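/- Fix a constant $\Lambda\ge 8$. For $0<\varepsilon<1$ put $s=\Lambda\varepsilon^{-1/2}$, and use the following terms. - A simple polygon is a compact region of the plane bounded by a simple closed polygonal curve; it is rectilinear if all its edges are horizontal or vertical. $\mathrm{per}$ denotes the total length of the edges, $\mathrm{hper}$ the total length of the horizontal edges. A chord of a simple polygon $P$ is a segment $ab\subset P$ with $a,b\in\partial P$. - A $\Lambda$-path is a $y$-monotone polygonal path in which every edge is vertical or has slope $\pm s$; it is either ascending or descending. - A fuzzy staircase is a simple polygon bounded by a path $pqr$, where $pq$ is horizontal and $qr$ has slope $\pm s$, and a path from $p$ to $r$ obtained from an $x$- and $y$-monotone rectilinear path by replacing vertical edges with $\Lambda$-paths with the same endpoints (possibly the vertical edge itself). - A tame histogram is a simple polygon bounded by a horizontal segment $pq$, with $p$ to the left of $q$, and a path $L$ from $p$ to $q$ consisting of ascending or descending $\Lambda$-paths and of horizontal edges directed to the right, such that (i) no chord of the polygon joins interior points of two distinct maximal ascending (resp. two distinct maximal descending) $\Lambda$-subpaths of $L$; and (ii) for every horizontal chord $ab$ with $a,b\in L$, the subpath $L_{ab}$ of $L$ between $a$ and $b$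 satisfies $\|L_{ab}\|\le 2\|ab\|$. Lemma. For every $\Lambda\ge 8$ there is a constant $C$ such that for every $0<\varepsilon<1$ and every simple rectilinear polygon $P$ there is a finite collection $\mathcal F$ of simple polygons with pairwise disjoint interiors and union $P$, each of which is a fuzzy staircase or a tame histogram (with respect to $\Lambda$ and $\varepsilon$), such that $$\sum_{F\in\mathcal F}\mathrm{per}(F)\le C\,\varepsilon^{-1/2}\,\mathrm{per}(P)\qquad\text{and}\qquad \sum_{F\in\mathcal F}\mathrm{hper}(F)\le C\,\mathrm{per}(P).$$ -/

import Mathlib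

/-- The Euclidean plane; `p 0` and `p 1` are the `x`- and `y`-coordinates of `p`. -/
abbrev Plane : Type := EuclideanSpace ℝ (Fin 2)

/-! ### Polygonal paths

A polygonal path is given by the list of its vertices. -/

/-- The directed edges of the polygonal path with vertex list `l`. -/
def pathEdges (l : List Plane) : List (Plane × Plane) := l.zip l.tail

/-- The directed edges of the closed polygonal curve with cyclic vertex list `l`
(the last vertex is joined to the first). -/
def cyclicEdges (l : List Plane) : List (Plane × Plane) := l.zip (l.rotate 1)

/-- The point set covered by a list of edges. -/
def trace (E : List (Plane × Plane)) : Set Plane :=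
  {x | ∃ e ∈ E, x ∈ segment ℝ e.1 e.2}

/-- The total Euclidean length (weight) of a list of edges. -/
noncomputable def weight (E : List (Plane × Plane)) : ℝ :=
  (E.map fun e => dist e.1 e.2).sum

/-- The total length of the horizontal edges in a list of edges. -/
noncomputable def horizontalWeight (E : List (Plane × Plane)) : ℝ :=
  (E.map fun e => if e.1 1 = e.2 1 then dist e.1 e.2 else 0).sum

/-- The half-open segment from `a` (included) to `b` (excluded). -/
def halfOpenSegment (a b : Plane) : Set Plane :=
  {x | ∃ t : ℝ, 0 ≤ t ∧ t < 1 ∧ x = a + t • (b - a)}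

/-- The closed polygonal curve with cyclic vertex list `l` is simple: every edge is
nondegenerate, and no point is visited twice (each edge being taken with its first endpoint and
without its last one, which is the first endpoint of the next edge). -/
def IsSimpleClosed (l : List Plane) : Prop :=
  l ≠ [] ∧ (∀ e ∈ cyclicEdges l, e.1 ≠ e.2) ∧
    (cyclicEdges l).Pairwise fun e f =>
      Disjoint (halfOpenSegment e.1 e.2) (halfOpenSegment f.1 f.2)

/-! ### Simple polygons -/

/-- A simple polygon: a compact region of the plane that is the closure of its interior and whose
topological boundary is a simple closed polygonal curve. (Such a region is the curve together with
the bounded component of its complement, so it is determined by the curve, and each simple closed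
polygonal curve bounds one.) A vertex is allowed to have interior angle `π`. -/
structure SimplePolygon where
  /-- the vertices in cyclic order along the boundary -/
  vertices : List Plane
  /-- the closed region -/
  region : Set Plane
  simple : IsSimpleClosed vertices
  isCompact_region : IsCompact region
  closure_interior_region : closure (interior region) = region
  frontier_region : frontier region = trace (cyclicEdges vertices)

namespace SimplePolygon

/-- The perimeter. -/
noncomputable def per (P : SimplePolygon) : ℝ := weight (cyclicEdges P.vertices)

/-- The horizontal perimeter: the total length of the horizontal edges. -/
noncomputable def hper (P : SimplePolygon) : ℝ := horizontalWeight (cyclicEdges P.vertices)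

/-- All edges are axis-parallel. -/
def IsRectilinear (P : SimplePolygon) : Prop :=
  ∀ e ∈ cyclicEdges P.vertices, e.1 0 = e.2 0 ∨ e.1 1 = e.2 1

/-- The segment `ab` is a chord of `P`: its endpoints are on the boundary, and it is contained in
the (closed) polygon. -/
def IsChord (P : SimplePolygon) (a b : Plane) : Prop :=
  a ∈ frontier P.region ∧ b ∈ frontier P.region ∧ segment ℝ a b ⊆ P.region

/-- `l` lists the vertices of `P` in cyclic order, from some vertex on, in one of the two
orientations of the boundary. -/
def HasBoundary (P : SimplePolygon) (l : List Plane) : Prop :=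
  l.IsRotated P.vertices ∨ l.reverse.IsRotated P.vertices

/-- The polygons in the list `F` form a subdivision of `P`: they cover exactly `P`, and their
interiors are pairwise disjoint. -/
def IsSubdivision (P : SimplePolygon) (F : List SimplePolygon) : Prop :=
  (⋃ Q ∈ F, Q.region) = P.region ∧
    F.Pairwise fun Q Q' => Disjoint (interior Q.region) (interior Q'.region)

end SimplePolygon

/-! ### `Λ`-paths

In this section `s` is the slope of steep edges, later `s = Λ ε^(-1/2)`. -/

/-- The segment `ab` has slope `s`. -/
def HasSlope (s : ℝ) (a b : Plane) : Prop :=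
  a 0 ≠ b 0 ∧ b 1 - a 1 = s * (b 0 - a 0)

/-- The segment `ab` is vertical or has slope `± s`. -/
def IsSteepEdge (s : ℝ) (a b : Plane) : Prop :=
  a 0 = b 0 ∨ HasSlope s a b ∨ HasSlope (-s) a b

/-- The edge from `a` to `b` is ascending. -/
def Ascends (a b : Plane) : Prop := a 1 < b 1

/-- The edge from `a` to `b` is descending. -/
def Descends (a b : Plane) : Prop := b 1 < a 1

/-- `l` is a `Λ`-path: a `y`-monotone path whose edges are all vertical or of slope `± s`.
(Such a path has no horizontal edge, so it is strictly ascending or strictly descending.) -/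
def IsLambdaPath (s : ℝ) (l : List Plane) : Prop :=
  2 ≤ l.length ∧ l.IsChain (IsSteepEdge s) ∧ (l.IsChain Ascends ∨ l.IsChain Descends)

/-! ### Fuzzy staircases -/

/-- `l` is a staircase path: a rectilinear path that is both `x`- and `y`-monotone. -/
def IsStaircase (l : List Plane) : Prop :=
  l.IsChain (fun a b => a 0 = b 0 ∨ a 1 = b 1) ∧
    (l.IsChain (fun a b => a 0 ≤ b 0) ∨ l.IsChain (fun a b => b 0 ≤ a 0)) ∧
    (l.IsChain (fun a b => a 1 ≤ b 1) ∨ l.IsChain (fun a b => b 1 ≤ a 1))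

/-- `IsLambdaReplacement s S L`: the path `L` is obtained from the rectilinear path `S` by
replacing each vertical edge with a `Λ`-path between its two endpoints (possibly the vertical edge
itself). -/
inductive IsLambdaReplacement (s : ℝ) : List Plane → List Plane → Prop
  | single (a : Plane) : IsLambdaReplacement s [a] [a]
  | horizontal (a b : Plane) (S L : List Plane) (hab : a 1 = b 1)
      (h : IsLambdaReplacement s (b :: S) (b :: L)) :
      IsLambdaReplacement s (a :: b :: S) (a :: b :: L)
  | vertical (a b : Plane) (M S L : List Plane) (hab : a 0 = b 0)
      (hM : IsLambdaPath s (a :: (M ++ [b])))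
      (h : IsLambdaReplacement s (b :: S) (b :: L)) :
      IsLambdaReplacement s (a :: b :: S) (a :: (M ++ b :: L))

/-- A fuzzy staircase: a simple polygon bounded by a path `pqr`, where `pq` is horizontal and `qr`
has slope `± s`, and a path `L` from `p` to `r` obtained from a staircase path `S` by replacing
vertical edges with `Λ`-paths. -/
def IsFuzzyStaircase (s : ℝ) (P : SimplePolygon) : Prop :=
  ∃ (p q r : Plane) (S L : List Plane),
    p 1 = q 1 ∧ (HasSlope s q r ∨ HasSlope (-s) q r) ∧
    IsStaircase S ∧ IsLambdaReplacement s S L ∧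
    L.head? = some p ∧ L.getLast? = some r ∧
    P.HasBoundary (L ++ [q])

/-! ### Tame histograms -/

/-- `M` is a maximal subpath of the path `L` among those with at least one edge and with all edges
satisfying `R`. -/
def IsMaximalRun (R : Plane → Plane → Prop) (L M : List Plane) : Prop :=
  ∃ X Z : List Plane, L = X ++ M ++ Z ∧ 2 ≤ M.length ∧ M.IsChain R ∧
    (∀ a ∈ X.getLast?, ∀ b ∈ M.head?, ¬ R a b) ∧
    (∀ a ∈ M.getLast?, ∀ b ∈ Z.head?, ¬ R a b)

/-- The points of the path `M` other than its two endpoints. -/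
def pathInterior (M : List Plane) : Set Plane :=
  {x | x ∈ trace (pathEdges M) ∧ (∀ a ∈ M.head?, x ≠ a) ∧ (∀ a ∈ M.getLast?, x ≠ a)}

/-- `N` is the subpath `L_{ab}` of `L` between the points `a` and `b` of `L`, where `a` is on the
edge of `L` that leaves the vertex `u`, and `b` is on that same edge or on a later one, namely the
one that enters the vertex `w`. -/
def IsSubpath (L : List Plane) (a b : Plane) (N : List Plane) : Prop :=
  ∃ (X M Z : List Plane) (u w : Plane),
    L = X ++ u :: (M ++ w :: Z) ∧ N = a :: (M ++ [b]) ∧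
    a ∈ segment ℝ u (M.head?.getD w) ∧ b ∈ segment ℝ (M.getLast?.getD u) w

/-- A tame histogram: a simple polygon bounded by a horizontal segment `pq` (with left endpoint
`p`) and a path `L` from `p` to `q` that consists of ascending or descending `Λ`-paths and of
horizontal edges directed to the right, such that
(i) no chord joins interior points of two distinct ascending (two distinct descending) `Λ`-paths
of `L`, and
(ii) for every horizontal chord `ab` with `a, b ∈ L`, the subpath of `L` between `a` and `b` has
length at most `2‖ab‖`. -/
def IsTameHistogram (s : ℝ) (P : SimplePolygon) : Prop :=
  ∃ (p q : Plane) (L : List Plane),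
    L.head? = some p ∧ L.getLast? = some q ∧ p 1 = q 1 ∧ p 0 < q 0 ∧
    P.HasBoundary L ∧
    L.IsChain (fun a b => IsSteepEdge s a b ∨ (a 1 = b 1 ∧ a 0 < b 0)) ∧
    (∀ R : Plane → Plane → Prop, R = Ascends ∨ R = Descends →
      ∀ M M' : List Plane, IsMaximalRun R L M → IsMaximalRun R L M' → M ≠ M' →
        ∀ a ∈ pathInterior M, ∀ b ∈ pathInterior M', ¬ P.IsChord a b) ∧
    (∀ (a b : Plane) (N : List Plane), IsSubpath L a b N → a 1 = b 1 → P.IsChord a b →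
      weight (pathEdges N) ≤ 2 * dist a b)

/-! The polygon is first cut along a grid into histograms, that is, columns of cells standing on a
common base. Each histogram is then tiled on its own, at a cost proportional to its own boundary
length.

Histograms. The coordinates of the vertices give a grid, and `P` becomes the finite set `S` of the
cells with centre in `P`. As the boundary of `P` is connected, a grid chord with both ends on the
boundary separates `S`; a parity count of crossings proves this (`exists_parity`,
`IsGridRegion.separated`). The rest is combinatorics (`histDecomp_aux`). From a piece with a base
one takes the histogram of the columns rising from that base inside the piece. Where the piece
continues beyond the side of a column, a maximal window is a chord; `Rooted.exists_split` cuts along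
it, and the window is the base of the piece behind it. The potential `3 * out Z Z - 2 * out (hist Z)
Z` does not grow under such a cut (`Rooted.out_split`), so the boundary lengths of all histograms
add up to at most three times the perimeter of `P`.

Rows. Turned so that its base is vertical, a histogram is a list of rows, a step function of the
height. Its boundary length bounds the total height `ht` plus the variation `pvar` of the row values
(`le_out_hist`).

Horizontal bases. Here tiles with vertical and horizontal edges suffice. The rows are read with
interchanged coordinates. They form a tame histogram if, above every level, each block has variation
at most its height (`TameRows`): the path over a chord is then at most twice the chord. `tamable`
works from the inside outwards and cuts off a bump at the level where the variation of a block
reaches its height. A bump has perimeter at most three times the variation that disappears with it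
(`Reduces.bump`).

Vertical bases. `env_pinned` constructs a steep path from the bottom to the top of the base, to the
left of the row ends, such that the part between path and rows is tiled by fuzzy staircases. The
path leaves with slope `s` and comes back with slope `-s`, unless rows are in the way; then it
follows the leftmost of them. In the gap between a line of slope `s` and the rows behind it, the
rows are replaced by monotone stairs running through their suffix minima (`Stairs.exists_stairs`,
`lower_gap`). A pocket behind a vertical edge of the stairs is again an envelope problem, with fewer
row values, and its steep path is the Λ-path which replaces that edge. A gap is `s` times as high as
it is wide, so that the perimeter costs a factor `s` and the horizontal perimeter does not. Between
the base and the steep path there remain two triangular tips and a tower, which is cut into slices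
of height one third of their width (`exists_slices`). As the slopes are at least 8, such a slice is
a tame histogram (`exists_slice`).

Bookkeeping. Up to isometries, each tile is the region between a segment and a monotone path
(`IsRightChain.polygon`). Almost everywhere its indicator function is a difference of two crossing
numbers (`IsRightChain.indicator`). That tiles fit together is thus a telescoping identity of
crossing numbers, and `isSubdivision_of_cnt` converts the final identity almost everywhere into a
subdivision. -/

open MeasureTheory

/-! ### Points, segments, paths -/

/-- The point with given coordinates. -/
noncomputable def pt (x y : ℝ) : Plane := !₂[x, y]

@[simp] lemma pt_zero (x y : ℝ) : pt x y 0 = x := by simp [pt]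
@[simp] lemma pt_one (x y : ℝ) : pt x y 1 = y := by simp [pt]

lemma plane_ext {p q : Plane} (h0 : p 0 = q 0) (h1 : p 1 = q 1) : p = q := by
  ext i; fin_cases i <;> assumption

@[simp] lemma pt_eta (p : Plane) : pt (p 0) (p 1) = p := plane_ext (by simp) (by simp)

lemma mem_segment_coord {a b x : Plane} :
    x ∈ segment ℝ a b ↔ ∃ t : ℝ, 0 ≤ t ∧ t ≤ 1 ∧ x 0 = a 0 + t * (b 0 - a 0) ∧
      x 1 = a 1 + t * (b 1 - a 1) := by
  rw [segment_eq_image']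
  constructor
  · rintro ⟨t, ⟨h0, h1⟩, rfl⟩
    exact ⟨t, h0, h1, by simp, by simp⟩
  · rintro ⟨t, h0, h1, hx, hy⟩
    refine ⟨t, ⟨h0, h1⟩, ?_⟩
    apply plane_ext <;> simp [*]

lemma mem_halfOpen_coord {a b x : Plane} :
    x ∈ halfOpenSegment a b ↔ ∃ t : ℝ, 0 ≤ t ∧ t < 1 ∧ x 0 = a 0 + t * (b 0 - a 0) ∧
      x 1 = a 1 + t * (b 1 - a 1) := by
  constructor
  · rintro ⟨t, h0, h1, rfl⟩
    exact ⟨t, h0, h1, by simp, by simp⟩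
  · rintro ⟨t, h0, h1, hx, hy⟩
    refine ⟨t, h0, h1, ?_⟩
    apply plane_ext <;> simp [*]

lemma halfOpen_subset_segment (a b : Plane) : halfOpenSegment a b ⊆ segment ℝ a b := by
  intro x hx
  obtain ⟨t, h0, h1, h⟩ := mem_halfOpen_coord.1 hx
  exact mem_segment_coord.2 ⟨t, h0, h1.le, h⟩

@[simp] lemma pathEdges_nil : pathEdges [] = [] := rfl
@[simp] lemma pathEdges_single (a : Plane) : pathEdges [a] = [] := rfl
@[simp] lemma pathEdges_cons_cons (a b : Plane) (l : List Plane) :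
    pathEdges (a :: b :: l) = (a, b) :: pathEdges (b :: l) := rfl

lemma pathEdges_append_cons (X Z : List Plane) (z : Plane) :
    pathEdges (X ++ z :: Z) = pathEdges (X ++ [z]) ++ pathEdges (z :: Z) := by
  induction X with
  | nil => simp
  | cons a X ih =>
    cases X with
    | nil => simp
    | cons b X => simpa using ih

lemma pathEdges_snoc (X : List Plane) (u v : Plane) :
    pathEdges (X ++ [u, v]) = pathEdges (X ++ [u]) ++ [(u, v)] := by
  rw [pathEdges_append_cons]; simp

lemma cyclicEdges_cons (a : Plane) (l : List Plane) :
    cyclicEdges (a :: l) = pathEdges (a :: (l ++ [a])) := by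
  unfold cyclicEdges pathEdges
  have key : ∀ (l : List Plane) (a c : Plane),
      (a :: l).zip (l ++ [c]) = (a :: (l ++ [c])).zip (l ++ [c]) := by
    intro l
    induction l with
    | nil => intro a c; simp
    | cons b l ih => intro a c; simp only [List.cons_append, List.zip_cons_cons]; rw [ih b c]
  simpa using key l a a

lemma cyclicEdges_chain (A B : Plane) (M : List Plane) :
    cyclicEdges (A :: (M ++ [B])) = pathEdges (A :: (M ++ [B])) ++ [(B, A)] := by
  rw [cyclicEdges_cons]
  have := pathEdges_snoc (A :: M) B A
  simpa using this

@[simp] lemma trace_nil : trace [] = ∅ := by simp [trace]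

@[simp] lemma trace_cons (e : Plane × Plane) (E : List (Plane × Plane)) :
    trace (e :: E) = segment ℝ e.1 e.2 ∪ trace E := by
  ext x; simp [trace]

lemma trace_append (E F : List (Plane × Plane)) : trace (E ++ F) = trace E ∪ trace F := by
  induction E with
  | nil => simp
  | cons e E ih => simp [ih, Set.union_assoc]

lemma isCompact_segment (a b : Plane) : IsCompact (segment ℝ a b) := by
  rw [segment_eq_image']
  exact isCompact_Icc.image (by fun_prop)

lemma isCompact_trace (E : List (Plane × Plane)) : IsCompact (trace E) := by
  induction E with
  | nil => simp
  | cons e E ih => rw [trace_cons]; exact (isCompact_segment _ _).union ih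

lemma head_mem_trace (a b : Plane) (l : List Plane) : a ∈ trace (pathEdges (a :: b :: l)) := by
  simp [left_mem_segment]

lemma mem_trace_of_mem {a b : Plane} {l : List Plane} {v : Plane} (h : v ∈ a :: b :: l) :
    v ∈ trace (pathEdges (a :: b :: l)) := by
  induction l generalizing a b with
  | nil =>
    simp only [pathEdges_cons_cons, trace_cons]
    simp only [List.mem_cons, List.not_mem_nil, or_false] at h
    rcases h with rfl | rfl
    · exact Or.inl (left_mem_segment _ _ _)
    · exact Or.inl (right_mem_segment _ _ _)
  | cons c l ih =>
    rw [pathEdges_cons_cons, trace_cons]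
    rcases List.mem_cons.1 h with rfl | h
    · exact Or.inl (left_mem_segment _ _ _)
    · exact Or.inr (ih h)

lemma mem_of_mem_pathEdges {l : List Plane} {e : Plane × Plane} (h : e ∈ pathEdges l) :
    e.1 ∈ l ∧ e.2 ∈ l := by
  have := List.of_mem_zip h
  exact ⟨this.1, List.mem_of_mem_tail this.2⟩

lemma mem_pathEdges_iff {l : List Plane} {u v : Plane} :
    (u, v) ∈ pathEdges l ↔ ∃ X Z, l = X ++ u :: v :: Z := by
  constructor
  · induction l with
    | nil => simp
    | cons a l ih =>
      cases l with
      | nil => simp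
      | cons b l =>
        rw [pathEdges_cons_cons, List.mem_cons]
        rintro (h | h)
        · obtain ⟨rfl, rfl⟩ := Prod.mk.inj h
          exact ⟨[], l, rfl⟩
        · obtain ⟨X, Z, hX⟩ := ih h
          exact ⟨a :: X, Z, by rw [hX]; rfl⟩
  · rintro ⟨X, Z, rfl⟩
    rw [pathEdges_append_cons]
    simp

lemma isChain_iff_pathEdges {R : Plane → Plane → Prop} {l : List Plane} :
    l.IsChain R ↔ ∀ e ∈ pathEdges l, R e.1 e.2 := by
  induction l with
  | nil => simp
  | cons a l ih =>
    cases l with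
    | nil => simp
    | cons b l => rw [List.isChain_cons_cons, ih]; simp

lemma pathEdges_reverse (l : List Plane) :
    pathEdges l.reverse = ((pathEdges l).map Prod.swap).reverse := by
  induction l with
  | nil => simp
  | cons a l ih =>
    cases l with
    | nil => simp
    | cons b l =>
      have h2 : (a :: b :: l).reverse = l.reverse ++ [b, a] := by simp
      rw [h2, pathEdges_snoc, pathEdges_cons_cons, List.map_cons, List.reverse_cons, ← ih]
      simp

lemma trace_reverse (l : List Plane) : trace (pathEdges l.reverse) = trace (pathEdges l) := by
  rw [pathEdges_reverse]
  ext x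
  simp only [trace, List.mem_reverse, List.mem_map, Set.mem_ofPred_eq]
  constructor
  · rintro ⟨e, ⟨f, hf, rfl⟩, hx⟩
    exact ⟨f, hf, by rwa [segment_symm]⟩
  · rintro ⟨f, hf, hx⟩
    exact ⟨f.swap, ⟨f, hf, rfl⟩, by rwa [segment_symm]⟩

/-! ### Weakly monotone paths -/

/-- The path is weakly `y`-monotone, in the direction given by the sign of `τ`. -/
def MonoY (τ : ℝ) (l : List Plane) : Prop := l.IsChain fun u v => τ * u 1 ≤ τ * v 1

/-- Two consecutive horizontal edges have the same direction. -/
def NoBack (l : List Plane) : Prop :=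
  ∀ a b c : Plane, [a, b, c] <:+: l → a 1 = b 1 → b 1 = c 1 → 0 < (b 0 - a 0) * (c 0 - b 0)

lemma NoBack.infix {l l' : List Plane} (h : NoBack l) (hl : l' <:+: l) : NoBack l' :=
  fun a b c habc => h a b c (habc.trans hl)

lemma NoBack.tail {a : Plane} {l : List Plane} (h : NoBack (a :: l)) : NoBack l :=
  h.infix (List.suffix_cons a l).isInfix

lemma noBack_reverse {l : List Plane} (h : NoBack l) : NoBack l.reverse := by
  intro a b c habc h1 h2
  have := h c b a (by
    have := List.reverse_infix.2 habc
    simpa using this) h2.symm h1.symm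
  nlinarith

lemma monoY_reverse {τ : ℝ} {l : List Plane} (h : MonoY τ l) : MonoY (-τ) l.reverse := by
  unfold MonoY at *
  rw [List.isChain_reverse]
  refine h.imp ?_
  intro a b hab
  simp only; linarith

lemma MonoY.tail {τ : ℝ} {a : Plane} {l : List Plane} (h : MonoY τ (a :: l)) : MonoY τ l :=
  List.IsChain.tail h

lemma mem_segment_mono {τ : ℝ} {u v q : Plane} (h : τ * u 1 ≤ τ * v 1)
    (hq : q ∈ segment ℝ u v) : τ * u 1 ≤ τ * q 1 ∧ τ * q 1 ≤ τ * v 1 := by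
  obtain ⟨t, h0, h1, -, hy⟩ := mem_segment_coord.1 hq
  rw [hy]
  constructor <;> nlinarith

lemma MonoY.trace_ge {τ : ℝ} {b : Plane} {l : List Plane} (h : MonoY τ (b :: l)) {q : Plane}
    (hq : q ∈ trace (pathEdges (b :: l))) : τ * b 1 ≤ τ * q 1 := by
  induction l generalizing b with
  | nil => simp at hq
  | cons c l ih =>
    rw [pathEdges_cons_cons, trace_cons] at hq
    have hbc := (List.isChain_cons_cons.1 h).1
    rcases hq with hq | hq
    · exact (mem_segment_mono hbc hq).1
    · exact hbc.trans (ih h.tail hq)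

lemma MonoY.trace_le {τ : ℝ} {b : Plane} {l : List Plane} (h : MonoY τ (l ++ [b])) {q : Plane}
    (hq : q ∈ trace (pathEdges (l ++ [b]))) : τ * q 1 ≤ τ * b 1 := by
  have h1 := monoY_reverse h
  have h2 : q ∈ trace (pathEdges (l ++ [b]).reverse) := by rwa [trace_reverse]
  rw [List.reverse_append, List.reverse_singleton, List.singleton_append] at h1 h2
  have := h1.trace_ge h2
  linarith

/-- The points of a monotone path on the level of its first point lie on the side given by the
direction of the first edge. -/
lemma level_side {τ σ : ℝ} {b : Plane} {l : List Plane} (hτ : τ ≠ 0)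
    (hm : MonoY τ (b :: l)) (hn : NoBack (b :: l))
    (hs : ∀ c ∈ l.head?, b 1 = c 1 → 0 < σ * (c 0 - b 0)) {q : Plane}
    (hq : q ∈ trace (pathEdges (b :: l))) (hq1 : q 1 = b 1) : σ * b 0 ≤ σ * q 0 := by
  induction l generalizing b with
  | nil => simp at hq
  | cons c l ih =>
    rw [pathEdges_cons_cons, trace_cons] at hq
    have hbc := (List.isChain_cons_cons.1 hm).1
    have hs0 := hs c (by simp)
    rcases hq with hq | hq
    · obtain ⟨t, h0, h1, hx, hy⟩ := mem_segment_coord.1 hq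
      by_cases hl : b 1 = c 1
      · have := hs0 hl
        rw [hx]; nlinarith
      · have ht : t = 0 := by
          have : t * (c 1 - b 1) = 0 := by linarith [hy, hq1]
          rcases mul_eq_zero.1 this with h | h
          · exact h
          · exact absurd (by linarith : b 1 = c 1) hl
        rw [hx, ht]; simp
    · have h3 := hm.tail.trace_ge hq
      have hl : b 1 = c 1 := by
        have : τ * b 1 = τ * c 1 := le_antisymm hbc (by rw [← hq1]; exact h3)
        exact mul_left_cancel₀ hτ this
      have hsc := hs0 hl
      have := ih hm.tail hn.tail (by
        intro d hd hcd
        cases l with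
        | nil => simp at hd
        | cons e l =>
          simp only [List.head?_cons, Option.mem_some_iff] at hd
          subst hd
          have h5 := hn b c e ⟨[], l, rfl⟩ hl hcd
          by_contra hneg
          push Not at hneg
          have : (σ * (c 0 - b 0)) * (σ * (e 0 - c 0)) ≤ 0 :=
            mul_nonpos_of_nonneg_of_nonpos hsc.le hneg
          have hσ : σ ≠ 0 := by rintro rfl; simp at hsc
          have : 0 < σ ^ 2 * ((c 0 - b 0) * (e 0 - c 0)) := by positivity
          nlinarith) hq (by rw [hq1, hl])
      linarith

/-- The points of a monotone path on a given level form a convex set. -/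
lemma level_convex {l : List Plane} (hm : MonoY 1 l) {p q r : Plane}
    (hq : q ∈ trace (pathEdges l)) (hr : r ∈ trace (pathEdges l)) (hqp : q 1 = p 1)
    (hrp : r 1 = p 1) (h1 : q 0 ≤ p 0) (h2 : p 0 ≤ r 0) : p ∈ trace (pathEdges l) := by
  have hseg : ∀ {a b q r : Plane}, q ∈ segment ℝ a b → r ∈ segment ℝ a b → q 1 = p 1 → r 1 = p 1 →
      q 0 ≤ p 0 → p 0 ≤ r 0 → p ∈ segment ℝ a b := by
    intro a b q r hq hr hqp hrp h1 h2
    have : p ∈ segment ℝ q r := by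
      rcases eq_or_lt_of_le (h1.trans h2) with h | h
      · have : p = q := plane_ext (by linarith) hqp.symm
        rw [this]; exact left_mem_segment _ _ _
      · refine mem_segment_coord.2 ⟨(p 0 - q 0) / (r 0 - q 0), ?_, ?_, ?_, ?_⟩
        · apply div_nonneg <;> linarith
        · rw [div_le_one (by linarith)]; linarith
        · field_simp [(sub_pos.2 h).ne']; ring
        · rw [hrp, hqp]; ring
    exact (convex_segment a b).segment_subset hq hr this
  induction l generalizing q r with
  | nil => simp at hq
  | cons a l ih =>
    cases l with
    | nil => simp at hq
    | cons b l =>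
      rw [pathEdges_cons_cons, trace_cons] at hq hr ⊢
      have hab := (List.isChain_cons_cons.1 hm).1
      have cross : ∀ {q r : Plane}, q ∈ segment ℝ a b → r ∈ trace (pathEdges (b :: l)) →
          q 1 = p 1 → r 1 = p 1 → b 1 = p 1 ∧ b ∈ trace (pathEdges (b :: l)) := by
        intro q r hq hr hqp hrp
        have e1 := (mem_segment_mono hab hq).2
        have e2 := hm.tail.trace_ge hr
        refine ⟨by linarith, ?_⟩
        cases l with
        | nil => simp at hr
        | cons c l => exact head_mem_trace _ _ _
      rcases hq with hq | hq <;> rcases hr with hr | hr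
      · exact Or.inl (hseg hq hr hqp hrp h1 h2)
      · obtain ⟨hb, hbt⟩ := cross hq hr hqp hrp
        rcases le_total (p 0) (b 0) with h | h
        · exact Or.inl (hseg hq (right_mem_segment _ _ _) hqp hb h1 h)
        · exact Or.inr (ih hm.tail hbt hr hb hrp h h2)
      · obtain ⟨hb, hbt⟩ := cross hr hq hrp hqp
        rcases le_total (p 0) (b 0) with h | h
        · exact Or.inr (ih hm.tail hq hbt hqp hb h1 h)
        · exact Or.inl (hseg (right_mem_segment _ _ _) hr hb hrp h h2)
      · exact Or.inr (ih hm.tail hq hr hqp hrp h1 h2)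

/-! ### Counting crossings -/

/-- The crossing number of an upward edge with the horizontal ray to the right of `p`. -/
noncomputable def hc (e : Plane × Plane) (p : Plane) : ℤ :=
  if e.1 1 ≤ p 1 ∧ p 1 < e.2 1 ∧
    (p 0 - e.1 0) * (e.2 1 - e.1 1) < (e.2 0 - e.1 0) * (p 1 - e.1 1) then 1 else 0

/-- The number of crossings of a list of upward edges with the ray to the right of `p`. -/
noncomputable def hcount (E : List (Plane × Plane)) (p : Plane) : ℤ := (E.map fun e => hc e p).sum

@[simp] lemma hcount_nil (p : Plane) : hcount [] p = 0 := rfl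
@[simp] lemma hcount_cons (e : Plane × Plane) (E : List (Plane × Plane)) (p : Plane) :
    hcount (e :: E) p = hc e p + hcount E p := by simp [hcount]
lemma hcount_append (E F : List (Plane × Plane)) (p : Plane) :
    hcount (E ++ F) p = hcount E p + hcount F p := by simp [hcount]

lemma hc_level {u v : Plane} (h : v 1 ≤ u 1) (p : Plane) : hc (u, v) p = 0 := by
  unfold hc
  rw [if_neg]
  rintro ⟨h1, h2, -⟩
  simp only at h1 h2
  linarith

/-- The levels of an edge are half-open, so a point on the level of `z` is counted by the upper part
only. The side inequality of either part is a positive multiple of that of the whole edge. -/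
lemma hc_split {u v z : Plane} (h : u 1 ≤ v 1) (hz : z ∈ segment ℝ u v) (p : Plane) :
    hc (u, v) p = hc (u, z) p + hc (z, v) p := by
  obtain ⟨t, h0, h1, hx, hy⟩ := mem_segment_coord.1 hz
  rcases eq_or_lt_of_le h with h | h
  · have hz1 : z 1 = u 1 := by rw [hy, h]; ring
    rw [hc_level h.symm.le, hc_level hz1.le, hc_level (by rw [hz1, h])]; rfl
  · have hd : 0 < v 1 - u 1 := by linarith
    by_cases hz0 : t = 0
    · have : z = u := plane_ext (by rw [hx, hz0]; ring) (by rw [hy, hz0]; ring)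
      subst this
      rw [hc_level le_rfl]; ring
    by_cases hz1 : t = 1
    · have : z = v := plane_ext (by rw [hx, hz1]; ring) (by rw [hy, hz1]; ring)
      subst this
      rw [hc_level (u := z) (v := z) le_rfl]; ring
    have ht0 : 0 < t := lt_of_le_of_ne h0 (Ne.symm hz0)
    have ht1 : t < 1 := lt_of_le_of_ne h1 hz1
    have k1 : u 1 < z 1 := by rw [hy]; nlinarith
    have k2 : z 1 < v 1 := by rw [hy]; nlinarith
    have e1 : (p 0 - u 0) * (z 1 - u 1) < (z 0 - u 0) * (p 1 - u 1) ↔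
        (p 0 - u 0) * (v 1 - u 1) < (v 0 - u 0) * (p 1 - u 1) := by
      have : (z 0 - u 0) * (p 1 - u 1) - (p 0 - u 0) * (z 1 - u 1) =
          t * ((v 0 - u 0) * (p 1 - u 1) - (p 0 - u 0) * (v 1 - u 1)) := by rw [hx, hy]; ring
      rw [← sub_pos, this, mul_pos_iff_of_pos_left ht0, sub_pos]
    have e2 : (p 0 - z 0) * (v 1 - z 1) < (v 0 - z 0) * (p 1 - z 1) ↔
        (p 0 - u 0) * (v 1 - u 1) < (v 0 - u 0) * (p 1 - u 1) := by
      have : (v 0 - z 0) * (p 1 - z 1) - (p 0 - z 0) * (v 1 - z 1) =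
          (1 - t) * ((v 0 - u 0) * (p 1 - u 1) - (p 0 - u 0) * (v 1 - u 1)) := by rw [hx, hy]; ring
      rw [← sub_pos, this, mul_pos_iff_of_pos_left (by linarith), sub_pos]
    unfold hc
    simp only [e1, e2]
    by_cases hL : (p 0 - u 0) * (v 1 - u 1) < (v 0 - u 0) * (p 1 - u 1)
    · simp only [hL, and_true]
      split_ifs <;> first | rfl | (exfalso; grind)
    · simp [hL]

/-- The crossing number of a monotone path: it is given by the edge on the level of the point. -/
lemma hcount_path {b : Plane} {l : List Plane} (hm : MonoY 1 (b :: l)) (p : Plane) :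
    (hcount (pathEdges (b :: l)) p = 0 ∧
      (p 1 < b 1 ∨ ((b :: l).getLast (by simp)) 1 ≤ p 1)) ∨
    (b 1 ≤ p 1 ∧ p 1 < ((b :: l).getLast (by simp)) 1 ∧
      ∃ e ∈ pathEdges (b :: l), e.1 1 ≤ p 1 ∧ p 1 < e.2 1 ∧
        hcount (pathEdges (b :: l)) p = hc e p) := by
  induction l generalizing b with
  | nil => left; simp [lt_or_ge]
  | cons c l ih =>
    have hbc := (List.isChain_cons_cons.1 hm).1
    simp only [one_mul] at hbc
    rw [pathEdges_cons_cons, hcount_cons]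
    have hlast : (b :: c :: l).getLast (by simp) = (c :: l).getLast (by simp) := by simp
    rw [hlast]
    have hcl : c 1 ≤ ((c :: l).getLast (by simp)) 1 := by
      cases l with
      | nil => simp
      | cons d l =>
        have := hm.tail.trace_ge (mem_trace_of_mem (List.getLast_mem (l := c :: d :: l) (by simp)))
        simpa using this
    rcases ih hm.tail with ⟨h0, h⟩ | ⟨h1, h2, e, he, h3, h4, h5⟩
    · rcases h with h | h
      · by_cases hb : b 1 ≤ p 1
        · right
          exact ⟨hb, h.trans_le hcl, (b, c), by simp, hb, h, by rw [h0, add_zero]⟩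
        · left
          push Not at hb
          refine ⟨?_, Or.inl hb⟩
          rw [h0, add_zero]
          unfold hc; rw [if_neg]; rintro ⟨k, -⟩; simp only at k; linarith
      · left
        refine ⟨?_, Or.inr h⟩
        rw [h0, add_zero]
        unfold hc; rw [if_neg]; rintro ⟨-, k, -⟩; simp only at k; linarith
    · right
      refine ⟨hbc.trans h1, h2, e, List.mem_cons_of_mem _ he, h3, h4, ?_⟩
      rw [h5]
      have : hc (b, c) p = 0 := by
        unfold hc; rw [if_neg]; rintro ⟨-, k, -⟩; simp only at k; linarith
      rw [this, zero_add]

/-! ### Rays and closures -/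

/-- The points weakly to the right of a point of `T` on the same level. -/
def rayRight (T : Set Plane) : Set Plane := {p | ∃ q ∈ T, q 1 = p 1 ∧ q 0 ≤ p 0}

/-- The points weakly to the left of a point of `T` on the same level. -/
def rayLeft (T : Set Plane) : Set Plane := {p | ∃ q ∈ T, q 1 = p 1 ∧ p 0 ≤ q 0}

lemma continuous_coord (i : Fin 2) : Continuous fun p : Plane => p i := by fun_prop

-- This is the sum of a compact set and a closed half-line.
open scoped Pointwise in
lemma isClosed_rayRight {T : Set Plane} (hT : IsCompact T) : IsClosed (rayRight T) := by
  have hR : IsClosed {p : Plane | p 1 = 0 ∧ 0 ≤ p 0} :=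
    (isClosed_eq (continuous_coord 1) continuous_const).inter
      (isClosed_le continuous_const (continuous_coord 0))
  have : rayRight T = T + {p : Plane | p 1 = 0 ∧ 0 ≤ p 0} := by
    ext p
    simp only [rayRight, Set.mem_add, Set.mem_ofPred_eq]
    constructor
    · rintro ⟨q, hq, h1, h0⟩
      exact ⟨q, hq, p - q, ⟨by simp [h1], by simpa using h0⟩, by simp⟩
    · rintro ⟨q, hq, r, ⟨h1, h0⟩, rfl⟩
      exact ⟨q, hq, by simp [h1], by simpa using h0⟩
  rw [this]
  exact IsClosed.add_left_of_isCompact hR hT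

open scoped Pointwise in
lemma isClosed_rayLeft {T : Set Plane} (hT : IsCompact T) : IsClosed (rayLeft T) := by
  have hR : IsClosed {p : Plane | p 1 = 0 ∧ p 0 ≤ 0} :=
    (isClosed_eq (continuous_coord 1) continuous_const).inter
      (isClosed_le (continuous_coord 0) continuous_const)
  have : rayLeft T = T + {p : Plane | p 1 = 0 ∧ p 0 ≤ 0} := by
    ext p
    simp only [rayLeft, Set.mem_add, Set.mem_ofPred_eq]
    constructor
    · rintro ⟨q, hq, h1, h0⟩
      exact ⟨q, hq, p - q, ⟨by simp [h1], by simpa using h0⟩, by simp⟩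
    · rintro ⟨q, hq, r, ⟨h1, h0⟩, rfl⟩
      exact ⟨q, hq, by simp [h1], by simpa using h0⟩
  rw [this]
  exact IsClosed.add_left_of_isCompact hR hT

lemma continuous_pt {f g : ℝ → ℝ} (hf : Continuous f) (hg : Continuous g) :
    Continuous fun t => pt (f t) (g t) := by
  unfold pt; fun_prop

lemma tendsto_shift (q : Plane) (a b : ℝ) :
    Filter.Tendsto (fun δ : ℝ => pt (q 0 + δ * a) (q 1 + δ * b)) (nhdsWithin 0 (Set.Ioi 0))
      (nhds q) := by
  have h : Continuous fun δ : ℝ => pt (q 0 + δ * a) (q 1 + δ * b) :=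
    continuous_pt (by fun_prop) (by fun_prop)
  have := h.tendsto 0
  simp only [zero_mul, add_zero, pt_eta] at this
  exact this.mono_left nhdsWithin_le_nhds

/-- That boundary points of the region between a segment and a path are limits of inner and of outer
points is verified along one short ray issuing from the point. -/
lemma mem_closure_of_shift {S : Set Plane} {q : Plane} (a b : ℝ)
    (h : ∀ᶠ δ : ℝ in nhdsWithin 0 (Set.Ioi 0), pt (q 0 + δ * a) (q 1 + δ * b) ∈ S) :
    q ∈ closure S :=
  mem_closure_of_tendsto (tendsto_shift q a b) h

lemma eventually_shift {O : Set Plane} (hO : IsOpen O) {q : Plane} (hq : q ∈ O) (a b : ℝ) :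
    ∀ᶠ δ : ℝ in nhdsWithin 0 (Set.Ioi 0), pt (q 0 + δ * a) (q 1 + δ * b) ∈ O :=
  (tendsto_shift q a b).eventually (hO.mem_nhds hq)

/-! ### Null sets -/

lemma affineSpan_pair_ne_top (a b : Plane) : affineSpan ℝ ({a, b} : Set Plane) ≠ ⊤ := by
  intro h
  have h1 := collinear_iff_finrank_le_one.1 (collinear_pair ℝ a b)
  rw [← direction_affineSpan, h, AffineSubspace.direction_top, finrank_top] at h1
  simp at h1

lemma volume_line (a b : Plane) : volume (affineSpan ℝ ({a, b} : Set Plane) : Set Plane) = 0 :=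
  Measure.addHaar_affineSubspace _ _ (affineSpan_pair_ne_top a b)

lemma volume_segment (a b : Plane) : volume (segment ℝ a b) = 0 := by
  refine measure_mono_null ?_ (volume_line a b)
  rw [← convexHull_pair]
  exact convexHull_subset_affineSpan _

lemma volume_trace (E : List (Plane × Plane)) : volume (trace E) = 0 := by
  induction E with
  | nil => simp
  | cons e E ih => rw [trace_cons]; exact measure_union_null (volume_segment _ _) ih

lemma volume_level_zero (c : ℝ) : volume {p : Plane | p 0 = c} = 0 := by
  refine measure_mono_null ?_ (volume_line (pt c 0) (pt c 1))
  intro p hp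
  have h : AffineMap.lineMap (pt c 0) (pt c 1) (p 1) = p := by
    apply plane_ext <;> simp [AffineMap.lineMap_apply]
    exact hp.symm
  rw [← h]
  exact AffineMap.lineMap_mem_affineSpan_pair _ _ _

lemma volume_level_one (c : ℝ) : volume {p : Plane | p 1 = c} = 0 := by
  refine measure_mono_null ?_ (volume_line (pt 0 c) (pt 1 c))
  intro p hp
  have h : AffineMap.lineMap (pt 0 c) (pt 1 c) (p 0) = p := by
    apply plane_ext <;> simp [AffineMap.lineMap_apply]
    exact hp.symm
  rw [← h]
  exact AffineMap.lineMap_mem_affineSpan_pair _ _ _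

lemma ae_not_mem_trace (E : List (Plane × Plane)) : ∀ᵐ p : Plane, p ∉ trace E :=
  measure_eq_zero_iff_ae_notMem.1 (volume_trace E)

/-! ### The polygon between a monotone path and the segment joining its endpoints -/

/-- The path `A, M, B` is `y`-monotone without backtracking and strictly to the right of the
segment `AB`. -/
structure IsRightChain (A : Plane) (M : List Plane) (B : Plane) : Prop where
  mono : MonoY 1 (A :: (M ++ [B]))
  nondeg : (A :: (M ++ [B])).IsChain (· ≠ ·)
  noBack : NoBack (A :: (M ++ [B]))
  ne : M ≠ []
  right : ∀ v ∈ M, (B 0 - A 0) * (v 1 - A 1) < (v 0 - A 0) * (B 1 - A 1)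
  lt : A 1 < B 1

/-- Edges of a nondegenerate monotone path without backtracking are disjoint. -/
lemma path_simple {l : List Plane} (hm : MonoY 1 l) (hd : l.IsChain (· ≠ ·)) (hn : NoBack l) :
    (pathEdges l).Pairwise fun e f =>
      Disjoint (halfOpenSegment e.1 e.2) (halfOpenSegment f.1 f.2) := by
  induction l with
  | nil => simp
  | cons a l ih =>
    cases l with
    | nil => simp
    | cons b l =>
      rw [pathEdges_cons_cons, List.pairwise_cons]
      refine ⟨?_, ih hm.tail (List.IsChain.tail hd) hn.tail⟩
      intro f hf
      rw [Set.disjoint_left]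
      intro x hx hxf
      have hab := (List.isChain_cons_cons.1 hm).1
      have hne := (List.isChain_cons_cons.1 hd).1
      have hxT : x ∈ trace (pathEdges (b :: l)) := ⟨f, hf, halfOpen_subset_segment _ _ hxf⟩
      have h1 := hm.tail.trace_ge hxT
      simp only [one_mul] at h1 hab
      obtain ⟨t, h0, ht, hx0, hx1⟩ := mem_halfOpen_coord.1 hx
      rcases eq_or_lt_of_le hab with h | h
      · have hx1' : x 1 = b 1 := by rw [hx1, h]; simp
        have hne0 : b 0 - a 0 ≠ 0 := by
          intro h'
          exact hne (plane_ext (by linarith) h)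
        -- After a level edge, the rest of the path on this level stays beyond `b`, since it must
        -- not turn back; the half-open edge has only points strictly before `b`.
        have := level_side (σ := b 0 - a 0) one_ne_zero hm.tail hn.tail (by
          intro c hc hbc
          cases l with
          | nil => simp at hc
          | cons d l =>
            simp only [List.head?_cons, Option.mem_some_iff] at hc
            subst hc
            exact hn a b d ⟨[], l, rfl⟩ h hbc) hxT hx1'
        rw [hx0] at this
        have h2 : 0 < (b 0 - a 0) ^ 2 := by positivity
        nlinarith
      · rw [hx1] at h1
        nlinarith

namespace IsRightChain

variable {A B : Plane} {M : List Plane}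

/-- The affine function vanishing on the line `AB` and positive on its right. -/
def side (A B p : Plane) : ℝ := (p 0 - A 0) * (B 1 - A 1) - (B 0 - A 0) * (p 1 - A 1)

lemma continuous_side : Continuous (side A B) := by unfold side; fun_prop

lemma side_right (h : IsRightChain A M B) {v : Plane} (hv : v ∈ M) : 0 < side A B v := by
  have := h.right v hv
  unfold side; linarith

lemma side_left_end : side A B A = 0 := by unfold side; ring
lemma side_right_end : side A B B = 0 := by unfold side; ring

lemma side_nonneg (h : IsRightChain A M B) {v : Plane} (hv : v ∈ A :: (M ++ [B])) :
    0 ≤ side A B v := by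
  simp only [List.mem_cons, List.mem_append, List.not_mem_nil, or_false] at hv
  rcases hv with rfl | hv | rfl
  · exact side_left_end.ge
  · exact (h.side_right hv).le
  · exact side_right_end.ge

lemma edge_mem (h : IsRightChain A M B) {e : Plane × Plane}
    (he : e ∈ pathEdges (A :: (M ++ [B]))) : (e.2 ∈ M ∨ e.1 ∈ M) ∧ e.1 ∈ A :: M := by
  obtain ⟨M', m, rfl⟩ : ∃ M' m, M = M' ++ [m] := ⟨_, _, (List.dropLast_append_getLast h.ne).symm⟩
  have h2 : A :: (M' ++ [m] ++ [B]) = (A :: M') ++ [m, B] := by simp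
  rw [h2, pathEdges_snoc, List.mem_append] at he
  rcases he with he | he
  · have := List.of_mem_zip he
    simp only [List.cons_append, List.tail_cons] at this
    exact ⟨Or.inl this.2, by simpa using this.1⟩
  · simp only [List.mem_singleton] at he
    subst he
    simp

lemma side_segment {u v q : Plane} {t : ℝ} (hx : q 0 = u 0 + t * (v 0 - u 0))
    (hy : q 1 = u 1 + t * (v 1 - u 1)) :
    side A B q = (1 - t) * side A B u + t * side A B v := by
  unfold side; rw [hx, hy]; ring

/-- The region: the points between the segment and the path. -/
def region (A : Plane) (M : List Plane) (B : Plane) : Set Plane :=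
  rayRight (segment ℝ A B) ∩ rayLeft (trace (pathEdges (A :: (M ++ [B]))))

/-- The interior points. -/
def inner (A : Plane) (M : List Plane) (B : Plane) : Set Plane :=
  {p | A 1 < p 1 ∧ p 1 < B 1 ∧ 0 < side A B p} ∩
    (rayRight (trace (pathEdges (A :: (M ++ [B])))))ᶜ

lemma isClosed_region : IsClosed (region A M B) :=
  (isClosed_rayRight (isCompact_segment _ _)).inter (isClosed_rayLeft (isCompact_trace _))

lemma isOpen_inner : IsOpen (inner A M B) := by
  refine IsOpen.inter ?_ (isClosed_rayRight (isCompact_trace _)).isOpen_compl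
  exact (isOpen_lt continuous_const (continuous_coord 1)).inter
    ((isOpen_lt (continuous_coord 1) continuous_const).inter
      (isOpen_lt continuous_const continuous_side))

/-- On each edge `side` is affine, nonnegative at both ends and positive at one of them, because
every edge has an end in `M`. It can therefore vanish only at the other end, which is then `A` or
`B`. -/
lemma trace_side (h : IsRightChain A M B) {q : Plane}
    (hq : q ∈ trace (pathEdges (A :: (M ++ [B])))) :
    0 ≤ side A B q ∧ (side A B q = 0 → q = A ∨ q = B) := by
  obtain ⟨e, he, hqe⟩ := hq
  obtain ⟨t, h0, h1, hx, hy⟩ := mem_segment_coord.1 hqe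
  have hs := side_segment (A := A) (B := B) hx hy
  have hm := mem_of_mem_pathEdges he
  have n1 := h.side_nonneg hm.1
  have n2 := h.side_nonneg hm.2
  have h1' : 0 ≤ 1 - t := by linarith
  refine ⟨by rw [hs]; positivity, ?_⟩
  intro hz
  have hend : ∀ v ∈ A :: (M ++ [B]), side A B v = 0 → v = A ∨ v = B := by
    intro v hv hv0
    simp only [List.mem_cons, List.mem_append, List.not_mem_nil, or_false] at hv
    rcases hv with rfl | hv | rfl
    · exact Or.inl rfl
    · exact absurd hv0 (h.side_right hv).ne'
    · exact Or.inr rfl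
  rcases (h.edge_mem he).1 with hM | hM
  · have hp := h.side_right hM
    have ht : t = 0 := by
      by_contra ht
      have : 0 < t := lt_of_le_of_ne h0 (Ne.symm ht)
      nlinarith [mul_pos this hp, mul_nonneg h1' n1]
    have : q = e.1 := plane_ext (by rw [hx, ht]; ring) (by rw [hy, ht]; ring)
    rw [this] at hz ⊢
    exact hend _ hm.1 hz
  · have hp := h.side_right hM
    have ht : 1 - t = 0 := by
      by_contra ht
      have : 0 < 1 - t := lt_of_le_of_ne h1' (Ne.symm ht)
      nlinarith [mul_pos this hp, mul_nonneg h0 n2]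
    have ht : t = 1 := by linarith
    have : q = e.2 := plane_ext (by rw [hx, ht]; ring) (by rw [hy, ht]; ring)
    rw [this] at hz ⊢
    exact hend _ hm.2 hz

lemma mem_rayRight_segment (h : A 1 < B 1) {p : Plane} :
    p ∈ rayRight (segment ℝ A B) ↔ A 1 ≤ p 1 ∧ p 1 ≤ B 1 ∧ 0 ≤ side A B p := by
  have hd : 0 < B 1 - A 1 := by linarith
  constructor
  · rintro ⟨q, hq, hq1, hq0⟩
    obtain ⟨t, h0, h1, hx, hy⟩ := mem_segment_coord.1 hq
    refine ⟨by rw [← hq1, hy]; nlinarith, by rw [← hq1, hy]; nlinarith, ?_⟩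
    unfold side
    rw [← hq1, hy]
    rw [hx] at hq0
    nlinarith
  · rintro ⟨h1, h2, h3⟩
    refine ⟨pt (A 0 + (p 1 - A 1) / (B 1 - A 1) * (B 0 - A 0)) (p 1), ?_, by simp, ?_⟩
    · refine mem_segment_coord.2 ⟨(p 1 - A 1) / (B 1 - A 1), ?_, ?_, by simp, ?_⟩
      · apply div_nonneg <;> linarith
      · rw [div_le_one hd]; linarith
      · rw [div_mul_cancel₀ _ hd.ne']; simp
    · unfold side at h3
      rw [pt_zero, div_mul_eq_mul_div, ← le_sub_iff_add_le', div_le_iff₀ hd]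
      linarith

lemma mem_segment_of_side (h : A 1 < B 1) {p : Plane} (h1 : A 1 ≤ p 1) (h2 : p 1 ≤ B 1)
    (h3 : side A B p = 0) : p ∈ segment ℝ A B := by
  have hd : 0 < B 1 - A 1 := by linarith
  refine mem_segment_coord.2 ⟨(p 1 - A 1) / (B 1 - A 1), ?_, ?_, ?_, ?_⟩
  · apply div_nonneg <;> linarith
  · rw [div_le_one hd]; linarith
  · unfold side at h3
    field_simp
    linarith
  · rw [div_mul_cancel₀ _ hd.ne']; simp

lemma trace_level (h : IsRightChain A M B) {q : Plane}
    (hq : q ∈ trace (pathEdges (A :: (M ++ [B])))) : A 1 ≤ q 1 ∧ q 1 ≤ B 1 := by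
  have h1 := h.mono.trace_ge hq
  have h2 := MonoY.trace_le (l := A :: M) (b := B) (by simpa using h.mono) (by simpa using hq)
  constructor <;> linarith

lemma mem_trace (h : IsRightChain A M B) {v : Plane} (hv : v ∈ A :: (M ++ [B])) :
    v ∈ trace (pathEdges (A :: (M ++ [B]))) := by
  obtain ⟨m, M', rfl⟩ := List.exists_cons_of_ne_nil h.ne
  exact mem_trace_of_mem hv

lemma exists_level {l : List Plane} {b : Plane} (hm : MonoY 1 (b :: l)) {c : ℝ} (h1 : b 1 ≤ c)
    (h2 : c < ((b :: l).getLast (by simp)) 1) : ∃ q ∈ trace (pathEdges (b :: l)), q 1 = c := by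
  rcases hcount_path hm (pt 0 c) with ⟨-, h⟩ | ⟨-, -, e, he, h3, h4, -⟩
  · simp only [pt_one] at h
    rcases h with h | h <;> linarith
  · simp only [pt_one] at h3 h4
    have hd : 0 < e.2 1 - e.1 1 := by linarith
    refine ⟨pt (e.1 0 + (c - e.1 1) / (e.2 1 - e.1 1) * (e.2 0 - e.1 0)) c, ⟨e, he, ?_⟩, by simp⟩
    refine mem_segment_coord.2 ⟨(c - e.1 1) / (e.2 1 - e.1 1), ?_, ?_, by simp, ?_⟩
    · apply div_nonneg <;> linarith
    · rw [div_le_one hd]; linarith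
    · rw [div_mul_cancel₀ _ hd.ne']; simp

lemma exists_trace_level (h : IsRightChain A M B) {c : ℝ} (h1 : A 1 ≤ c) (h2 : c ≤ B 1) :
    ∃ q ∈ trace (pathEdges (A :: (M ++ [B]))), q 1 = c := by
  rcases eq_or_lt_of_le h2 with rfl | h2
  · exact ⟨B, h.mem_trace (by simp), rfl⟩
  · exact exists_level h.mono h1 (by simpa using h2)

lemma inner_subset (h : IsRightChain A M B) : inner A M B ⊆ region A M B := by
  rintro p ⟨⟨h1, h2, h3⟩, h4⟩
  refine ⟨(mem_rayRight_segment h.lt).2 ⟨h1.le, h2.le, h3.le⟩, ?_⟩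
  obtain ⟨q, hq, hq1⟩ := h.exists_trace_level h1.le h2.le
  refine ⟨q, hq, hq1, ?_⟩
  by_contra hlt
  exact h4 ⟨q, hq, hq1, le_of_not_ge hlt⟩

/-- If some path point on the level of `p` were weakly to its left, `p` would be between two path
points and hence on the path, by `level_convex`. So off the boundary the closed conditions turn into
the open ones. -/
lemma region_subset (h : IsRightChain A M B) :
    region A M B ⊆ inner A M B ∪ trace (cyclicEdges (A :: (M ++ [B]))) := by
  rintro p ⟨hp1, q, hq, hq1, hq0⟩
  rw [cyclicEdges_chain, trace_append, trace_cons, trace_nil, Set.union_empty]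
  by_cases hT : p ∈ trace (pathEdges (A :: (M ++ [B])))
  · exact Or.inr (Or.inl hT)
  by_cases hS : p ∈ segment ℝ B A
  · exact Or.inr (Or.inr hS)
  left
  rw [segment_symm] at hS
  obtain ⟨h1, h2, h3⟩ := (mem_rayRight_segment h.lt).1 hp1
  have h3 : 0 < side A B p :=
    lt_of_le_of_ne h3 fun h0 => hS (mem_segment_of_side h.lt h1 h2 h0.symm)
  have hray : p ∉ rayRight (trace (pathEdges (A :: (M ++ [B])))) := by
    rintro ⟨r, hr, hr1, hr0⟩
    exact hT (level_convex h.mono hr hq hr1 hq1 hr0 hq0)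
  have hd : 0 < B 1 - A 1 := by linarith [h.lt]
  refine ⟨⟨lt_of_le_of_ne h1 ?_, lt_of_le_of_ne h2 ?_, h3⟩, hray⟩
  · intro h0
    refine hray ⟨A, h.mem_trace (by simp), h0, ?_⟩
    unfold side at h3
    rw [h0] at h3
    nlinarith
  · intro h0
    refine hray ⟨B, h.mem_trace (by simp), h0.symm, ?_⟩
    unfold side at h3
    rw [h0] at h3
    nlinarith

end IsRightChain

/-! ### The boundary of the region between segment and path -/

namespace IsRightChain

variable {A B : Plane} {M : List Plane}

lemma side_shift (q : Plane) (a b : ℝ) (h : 0 < side A B q) :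
    ∀ᶠ δ : ℝ in nhdsWithin 0 (Set.Ioi 0), 0 < side A B (pt (q 0 + δ * a) (q 1 + δ * b)) :=
  eventually_shift (isOpen_lt continuous_const continuous_side) h a b

/-- Monotonicity keeps the part before the edge weakly below `u` and the part after it weakly above
`v`. Near the level of the edge only one of the parts matters. -/
lemma level_eq {X Z : List Plane} {u v : Plane} (hm : MonoY 1 (X ++ u :: v :: Z))
    {r : Plane} (hr : r ∈ trace (pathEdges (X ++ u :: v :: Z))) :
    (r ∈ trace (pathEdges (X ++ [u])) ∧ r 1 ≤ u 1) ∨ r ∈ segment ℝ u v ∨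
      (r ∈ trace (pathEdges (v :: Z)) ∧ v 1 ≤ r 1) := by
  have e1 : MonoY 1 (X ++ [u]) := by
    have : X ++ u :: v :: Z = (X ++ [u]) ++ v :: Z := by simp
    rw [this] at hm
    exact List.IsChain.left_of_append hm
  have e2 : MonoY 1 (v :: Z) := by
    have : X ++ u :: v :: Z = (X ++ [u]) ++ v :: Z := by simp
    rw [this] at hm
    exact List.IsChain.right_of_append hm
  rw [pathEdges_append_cons, pathEdges_cons_cons, trace_append, trace_cons] at hr
  rcases hr with hr | hr | hr
  · have := e1.trace_le hr
    exact Or.inl ⟨hr, by linarith⟩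
  · exact Or.inr (Or.inl hr)
  · have := e2.trace_ge hr
    exact Or.inr (Or.inr ⟨hr, by linarith⟩)

/-- Points of a non-horizontal edge are limits of inner points and of points outside. -/
lemma steep_edge (h : IsRightChain A M B) {e : Plane × Plane}
    (he : e ∈ pathEdges (A :: (M ++ [B]))) (hl : e.1 1 < e.2 1) {q : Plane}
    (hq : q ∈ openSegment ℝ e.1 e.2) :
    q ∈ closure (inner A M B) ∧ q ∈ closure (region A M B)ᶜ := by
  obtain ⟨u, v⟩ := e
  simp only at hl hq
  have hqT : q ∈ trace (pathEdges (A :: (M ++ [B]))) :=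
    ⟨(u, v), he, openSegment_subset_segment ℝ _ _ hq⟩
  rw [openSegment_eq_image'] at hq
  obtain ⟨t, ⟨t0, t1⟩, hqdef⟩ := hq
  have hq0 : q 0 = u 0 + t * (v 0 - u 0) := by rw [← hqdef]; simp
  have hq1 : q 1 = u 1 + t * (v 1 - u 1) := by rw [← hqdef]; simp
  have k1 : u 1 < q 1 := by rw [hq1]; nlinarith
  have k2 : q 1 < v 1 := by rw [hq1]; nlinarith
  have hlev : ∀ r ∈ trace (pathEdges (A :: (M ++ [B]))), r 1 = q 1 → r 0 = q 0 := by
    intro r hr hr1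
    obtain ⟨X, Z, hXZ⟩ := mem_pathEdges_iff.1 he
    have hm := h.mono
    rw [hXZ] at hr hm
    rcases level_eq hm hr with ⟨-, hr'⟩ | hr' | ⟨-, hr'⟩
    · linarith
    · obtain ⟨t', -, -, hx, hy⟩ := mem_segment_coord.1 hr'
      have : t' = t := by
        have : (t' - t) * (v 1 - u 1) = 0 := by linarith
        rcases mul_eq_zero.1 this with h' | h' <;> linarith
      rw [hx, this, hq0]
    · linarith
  have hmem := mem_of_mem_pathEdges he
  have hAu := (h.trace_level (h.mem_trace hmem.1)).1
  have hvB := (h.trace_level (h.mem_trace hmem.2)).2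
  simp only at hAu hvB
  have hs : 0 < side A B q := by
    rcases eq_or_lt_of_le (h.trace_side hqT).1 with h0 | h0
    · rcases (h.trace_side hqT).2 h0.symm with h' | h'
      · rw [h'] at k1; linarith
      · rw [h'] at k2; linarith
    · exact h0
  constructor
  · refine mem_closure_of_shift (-1) 0 ?_
    filter_upwards [side_shift q (-1) 0 hs, self_mem_nhdsWithin] with δ h1 hδ
    refine ⟨⟨by simp; linarith, by simp; linarith, h1⟩, ?_⟩
    rintro ⟨r, hr, hr1, hr0⟩
    have := hlev r hr (by simpa using hr1)
    simp only [Set.mem_Ioi] at hδ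
    simp at hr0
    linarith
  · refine mem_closure_of_shift 1 0 ?_
    filter_upwards [self_mem_nhdsWithin] with δ hδ
    rintro ⟨-, r, hr, hr1, hr0⟩
    have := hlev r hr (by simpa using hr1)
    simp only [Set.mem_Ioi] at hδ
    simp at hr0
    linarith

/-- Points of a horizontal edge are limits of inner points and of points outside. -/
lemma level_edge (h : IsRightChain A M B) {e : Plane × Plane}
    (he : e ∈ pathEdges (A :: (M ++ [B]))) (hl : e.1 1 = e.2 1) {q : Plane}
    (hq : q ∈ openSegment ℝ e.1 e.2) :
    q ∈ closure (inner A M B) ∧ q ∈ closure (region A M B)ᶜ := by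
  obtain ⟨u, v⟩ := e
  have hne := isChain_iff_pathEdges.1 h.nondeg _ he
  simp only at hl hq hne
  have hqT : q ∈ trace (pathEdges (A :: (M ++ [B]))) :=
    ⟨(u, v), he, openSegment_subset_segment ℝ _ _ hq⟩
  rw [openSegment_eq_image'] at hq
  obtain ⟨t, ⟨t0, t1⟩, hqdef⟩ := hq
  have hq0 : q 0 = u 0 + t * (v 0 - u 0) := by rw [← hqdef]; simp
  have hq1 : q 1 = u 1 := by rw [← hqdef]; simp [hl]
  have hmem := mem_of_mem_pathEdges he
  have hs : 0 < side A B q := by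
    rw [side_segment hq0 (by rw [hq1, hl]; ring)]
    have n1 := h.side_nonneg hmem.1
    have n2 := h.side_nonneg hmem.2
    have t1' : 0 < 1 - t := by linarith
    rcases (h.edge_mem he).1 with h' | h'
    · have := h.side_right h'
      simp only at this n1 n2
      nlinarith [mul_pos t0 this, mul_nonneg t1'.le n1]
    · have := h.side_right h'
      simp only at this n1 n2
      nlinarith [mul_pos t1' this, mul_nonneg t0.le n2]
  have hQ := h.trace_level hqT
  obtain ⟨X, Z, hXZ⟩ := mem_pathEdges_iff.1 he
  have hm := h.mono
  have hn := h.noBack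
  rw [hXZ] at hm hn
  have hd : 0 < B 1 - A 1 := by linarith [h.lt]
  have e0 : X ++ u :: v :: Z = (X ++ [u]) ++ v :: Z := by simp
  have m1 : MonoY 1 (X ++ [u]) := by rw [e0] at hm; exact List.IsChain.left_of_append hm
  have m2 : MonoY 1 (v :: Z) := by rw [e0] at hm; exact List.IsChain.right_of_append hm
  have n1 : NoBack (X ++ [u]) := hn.infix ⟨[], v :: Z, by simp⟩
  have n2 : NoBack (v :: Z) := hn.infix ⟨X ++ [u], [], by simp⟩
  have hσ : v 0 - u 0 ≠ 0 := fun h' => hne (plane_ext (by linarith) hl)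
  -- the later part of the path
  have suf : ∀ r ∈ trace (pathEdges (v :: Z)), r 1 = v 1 →
      (v 0 - u 0) * v 0 ≤ (v 0 - u 0) * r 0 := by
    intro r hr hr1
    refine level_side one_ne_zero m2 n2 ?_ hr hr1
    intro c hc hvc
    cases Z with
    | nil => simp at hc
    | cons d Z =>
      simp only [List.head?_cons, Option.mem_some_iff] at hc
      subst hc
      exact hn u v d ⟨X, Z, by simp⟩ hl hvc
  have pre : ∀ r ∈ trace (pathEdges (X ++ [u])), r 1 = u 1 →
      (v 0 - u 0) * r 0 ≤ (v 0 - u 0) * u 0 := by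
    intro r hr hr1
    have hr' : r ∈ trace (pathEdges (u :: X.reverse)) := by
      rw [← trace_reverse] at hr; simpa using hr
    have := level_side (σ := -(v 0 - u 0)) (τ := -1) (by norm_num)
      (by simpa using monoY_reverse m1) (by simpa using noBack_reverse n1) (by
      intro c hc huc
      rcases List.eq_nil_or_concat X with rfl | ⟨X', d, rfl⟩
      · simp at hc
      · simp only [List.concat_eq_append, List.reverse_append, List.reverse_cons, List.reverse_nil, List.nil_append,
          List.singleton_append, List.head?_cons, Option.mem_some_iff] at hc
        subst hc
        have := hn d u v ⟨X', Z, by simp⟩ huc.symm hl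
        linarith) hr' hr1
    linarith
  have hBv : B 1 = v 1 → (v 0 - u 0) * v 0 ≤ (v 0 - u 0) * B 0 := by
    intro hB
    cases Z with
    | nil =>
      have : B = v := by
        have := congrArg (fun l => l.getLast?) hXZ
        simpa [List.getLast?_cons, List.getLast?_append] using this
      rw [this]
    | cons d Z =>
      refine suf B (mem_trace_of_mem ?_) hB
      have h3 := congrArg List.getLast? hXZ
      rw [e0, List.getLast?_append_of_ne_nil _ (by simp), ← List.cons_append,
        List.getLast?_append_of_ne_nil _ (by simp)] at h3
      exact List.mem_of_getLast? (by rw [← h3]; rfl)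
  have hAu : A 1 = u 1 → (v 0 - u 0) * A 0 ≤ (v 0 - u 0) * u 0 := by
    intro hA
    cases X with
    | nil =>
      have : A = u := by simpa using (List.cons_eq_cons.1 hXZ).1
      rw [this]
    | cons d X =>
      have : A = d := by simpa using (List.cons_eq_cons.1 hXZ).1
      subst this
      refine pre A ?_ hA
      cases X with
      | nil => exact head_mem_trace _ _ _
      | cons d X => exact head_mem_trace _ _ _
  have sufEv : ∀ δ : ℝ, 0 < δ → ∀ r ∈ trace (pathEdges (A :: (M ++ [B]))), r 1 = q 1 + δ * 1 →
      r ∈ trace (pathEdges (v :: Z)) := by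
    intro δ hδ r hr hr1
    rw [hXZ] at hr
    rcases level_eq hm hr with ⟨-, hr'⟩ | hr' | ⟨hr', -⟩
    · linarith
    · obtain ⟨t', -, -, -, hy⟩ := mem_segment_coord.1 hr'
      rw [← hl] at hy
      linarith
    · exact hr'
  have preEv : ∀ δ : ℝ, 0 < δ → ∀ r ∈ trace (pathEdges (A :: (M ++ [B]))), r 1 = q 1 + δ * (-1) →
      r ∈ trace (pathEdges (X ++ [u])) := by
    intro δ hδ r hr hr1
    rw [hXZ] at hr
    rcases level_eq hm hr with ⟨hr', -⟩ | hr' | ⟨-, hr'⟩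
    · exact hr'
    · obtain ⟨t', -, -, -, hy⟩ := mem_segment_coord.1 hr'
      rw [← hl] at hy
      linarith
    · linarith
  -- A rising path that turns left has the region below the level edge and the outside above it; if
  -- it turns right, it is the other way round. Just below the edge only the earlier part of the
  -- path is met, just above it only the later one, and both are on the proper side of `q` by `pre`
  -- and `suf`.
  rcases lt_or_gt_of_ne hσ with hneg | hpos
  · have c1 : q 0 < u 0 := by nlinarith
    have c2 : v 0 < q 0 := by nlinarith
    constructor
    · have hA : A 1 < q 1 := by
        refine lt_of_le_of_ne hQ.1 fun h0 => ?_
        have h3 := (mul_le_mul_left_of_neg hneg).1 (hAu (by rw [h0, hq1]))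
        unfold side at hs
        rw [← h0] at hs
        nlinarith
      have hO : q ∉ rayRight (trace (pathEdges (X ++ [u]))) := by
        rintro ⟨r, hr, hr1, hr0⟩
        have := (mul_le_mul_left_of_neg hneg).1 (pre r hr (by rw [hr1, hq1]))
        linarith
      refine mem_closure_of_shift 0 (-1) ?_
      filter_upwards [side_shift q 0 (-1) hs, self_mem_nhdsWithin,
        eventually_shift (isClosed_rayRight (isCompact_trace _)).isOpen_compl hO 0 (-1),
        eventually_shift (isOpen_lt continuous_const (continuous_coord 1)) hA 0 (-1)]
        with δ h1 hδ h2 h3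
      simp only [Set.mem_Ioi] at hδ
      refine ⟨⟨h3, by simp; linarith, h1⟩, ?_⟩
      rintro ⟨r, hr, hr1, hr0⟩
      exact h2 ⟨r, preEv δ hδ r hr (by simpa using hr1), hr1, hr0⟩
    · have hO : q ∉ rayLeft (trace (pathEdges (v :: Z))) := by
        rintro ⟨r, hr, hr1, hr0⟩
        have := (mul_le_mul_left_of_neg hneg).1 (suf r hr (by rw [hr1, hq1, hl]))
        linarith
      refine mem_closure_of_shift 0 1 ?_
      filter_upwards [self_mem_nhdsWithin,
        eventually_shift (isClosed_rayLeft (isCompact_trace _)).isOpen_compl hO 0 1] with δ hδ h2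
      simp only [Set.mem_Ioi] at hδ
      rintro ⟨-, r, hr, hr1, hr0⟩
      exact h2 ⟨r, sufEv δ hδ r hr (by simpa using hr1), hr1, hr0⟩
  · have c1 : u 0 < q 0 := by nlinarith
    have c2 : q 0 < v 0 := by nlinarith
    constructor
    · have hB : q 1 < B 1 := by
        refine lt_of_le_of_ne hQ.2 fun h0 => ?_
        have h3 := (mul_le_mul_iff_right₀ hpos).1 (hBv (by rw [← h0, hq1, hl]))
        unfold side at hs
        rw [h0] at hs
        nlinarith
      have hO : q ∉ rayRight (trace (pathEdges (v :: Z))) := by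
        rintro ⟨r, hr, hr1, hr0⟩
        have := (mul_le_mul_iff_right₀ hpos).1 (suf r hr (by rw [hr1, hq1, hl]))
        linarith
      refine mem_closure_of_shift 0 1 ?_
      filter_upwards [side_shift q 0 1 hs, self_mem_nhdsWithin,
        eventually_shift (isClosed_rayRight (isCompact_trace _)).isOpen_compl hO 0 1,
        eventually_shift (isOpen_lt (continuous_coord 1) continuous_const) hB 0 1]
        with δ h1 hδ h2 h3
      simp only [Set.mem_Ioi] at hδ
      refine ⟨⟨by simp; linarith, h3, h1⟩, ?_⟩
      rintro ⟨r, hr, hr1, hr0⟩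
      exact h2 ⟨r, sufEv δ hδ r hr (by simpa using hr1), hr1, hr0⟩
    · have hO : q ∉ rayLeft (trace (pathEdges (X ++ [u]))) := by
        rintro ⟨r, hr, hr1, hr0⟩
        have := (mul_le_mul_iff_right₀ hpos).1 (pre r hr (by rw [hr1, hq1]))
        linarith
      refine mem_closure_of_shift 0 (-1) ?_
      filter_upwards [self_mem_nhdsWithin,
        eventually_shift (isClosed_rayLeft (isCompact_trace _)).isOpen_compl hO 0 (-1)]
        with δ hδ h2
      simp only [Set.mem_Ioi] at hδ
      rintro ⟨-, r, hr, hr1, hr0⟩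
      exact h2 ⟨r, preEv δ hδ r hr (by simpa using hr1), hr1, hr0⟩

/-- Points of the segment are limits of inner points and of points outside. -/
lemma segment_edge (h : IsRightChain A M B) {q : Plane} (hq : q ∈ openSegment ℝ A B) :
    q ∈ closure (inner A M B) ∧ q ∈ closure (region A M B)ᶜ := by
  rw [openSegment_eq_image'] at hq
  obtain ⟨t, ⟨t0, t1⟩, hqdef⟩ := hq
  have hq0 : q 0 = A 0 + t * (B 0 - A 0) := by rw [← hqdef]; simp
  have hq1 : q 1 = A 1 + t * (B 1 - A 1) := by rw [← hqdef]; simp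
  have hd : 0 < B 1 - A 1 := by linarith [h.lt]
  have k1 : A 1 < q 1 := by rw [hq1]; nlinarith
  have k2 : q 1 < B 1 := by rw [hq1]; nlinarith
  have hs : side A B q = 0 := by unfold side; rw [hq0, hq1]; ring
  have hO : q ∉ rayRight (trace (pathEdges (A :: (M ++ [B])))) := by
    rintro ⟨r, hr, hr1, hr0⟩
    have h1 := h.trace_side hr
    have h2 : side A B r ≤ 0 := by
      rw [← hs]; unfold side; rw [hr1]; nlinarith
    rcases h1.2 (le_antisymm h2 h1.1) with h' | h'
    · rw [h'] at hr1; linarith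
    · rw [h'] at hr1; linarith
  have hshift : ∀ δ a : ℝ, side A B (pt (q 0 + δ * a) (q 1 + δ * 0)) = δ * a * (B 1 - A 1) := by
    intro δ a
    have : side A B (pt (q 0 + δ * a) (q 1 + δ * 0)) = side A B q + δ * a * (B 1 - A 1) := by
      unfold side; simp; ring
    rw [this, hs, zero_add]
  constructor
  · refine mem_closure_of_shift 1 0 ?_
    filter_upwards [self_mem_nhdsWithin,
      eventually_shift (isClosed_rayRight (isCompact_trace _)).isOpen_compl hO 1 0] with δ hδ h2
    simp only [Set.mem_Ioi] at hδ
    exact ⟨⟨by simp; linarith, by simp; linarith, by rw [hshift]; nlinarith⟩, h2⟩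
  · refine mem_closure_of_shift (-1) 0 ?_
    filter_upwards [self_mem_nhdsWithin] with δ hδ
    simp only [Set.mem_Ioi] at hδ
    rintro ⟨h1, -⟩
    have := ((mem_rayRight_segment h.lt).1 h1).2.2
    rw [hshift] at this
    nlinarith

lemma trace_subset (h : IsRightChain A M B) :
    trace (cyclicEdges (A :: (M ++ [B]))) ⊆
      closure (inner A M B) ∩ closure (region A M B)ᶜ := by
  have hcl : IsClosed (closure (inner A M B) ∩ closure (region A M B)ᶜ) :=
    isClosed_closure.inter isClosed_closure
  rw [cyclicEdges_chain, trace_append, trace_cons, trace_nil, Set.union_empty]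
  apply Set.union_subset
  · rintro q ⟨e, he, hq⟩
    rw [← closure_openSegment] at hq
    refine hcl.closure_subset_iff.2 ?_ hq
    intro r hr
    have hle := isChain_iff_pathEdges.1 h.mono _ he
    simp only [one_mul] at hle
    rcases eq_or_lt_of_le hle with hl | hl
    · exact h.level_edge he hl hr
    · exact h.steep_edge he hl hr
  · intro q hq
    rw [segment_symm, ← closure_openSegment] at hq
    refine hcl.closure_subset_iff.2 ?_ hq
    intro r hr
    exact h.segment_edge hr

lemma isSimpleClosed (h : IsRightChain A M B) : IsSimpleClosed (A :: (M ++ [B])) := by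
  have hd : 0 < B 1 - A 1 := by linarith [h.lt]
  refine ⟨by simp, ?_, ?_⟩
  · rw [cyclicEdges_chain]
    intro e he
    rw [List.mem_append, List.mem_singleton] at he
    rcases he with he | rfl
    · exact isChain_iff_pathEdges.1 h.nondeg _ he
    · intro h'
      simp only at h'
      rw [h'] at hd
      simp at hd
  · rw [cyclicEdges_chain, List.pairwise_append]
    refine ⟨path_simple h.mono h.nondeg h.noBack, by simp, ?_⟩
    intro e he f hf
    rw [List.mem_singleton] at hf
    subst hf
    rw [Set.disjoint_left]
    intro x hx hx'
    have hxT : x ∈ trace (pathEdges (A :: (M ++ [B]))) := ⟨e, he, halfOpen_subset_segment _ _ hx⟩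
    obtain ⟨t, t0, t1, hx0, hx1⟩ := mem_halfOpen_coord.1 hx'
    simp only at hx0 hx1
    have hs : side A B x = 0 := by unfold side; rw [hx0, hx1]; ring
    rcases (h.trace_side hxT).2 hs with h' | h'
    · rw [h'] at hx1
      nlinarith
    · obtain ⟨t', t0', t1', hx0', hx1'⟩ := mem_halfOpen_coord.1 hx
      have hm := mem_of_mem_pathEdges he
      have n1 := h.side_nonneg hm.1
      have n2 := h.side_nonneg hm.2
      have hs' := side_segment (A := A) (B := B) hx0' hx1'
      rw [hs] at hs'
      have hE := h.edge_mem he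
      -- Here `x = B` would lie on a half-open edge. Since `side` vanishes at `x`, the edge goes
      -- from `A` into `M` and `x` is its first vertex `A`, which is on another level.
      have hA : e.1 = A := by
        rcases List.mem_cons.1 hE.2 with h1 | h1
        · exact h1
        · have := h.side_right h1
          nlinarith [mul_pos (by linarith : 0 < 1 - t') this, mul_nonneg t0' n2]
      have hM : e.2 ∈ M := by
        rcases hE.1 with h1 | h1
        · exact h1
        · have := h.side_right h1
          nlinarith [mul_pos (by linarith : 0 < 1 - t') this, mul_nonneg t0' n2]
      have := h.side_right hM
      rw [hA, side_left_end] at hs'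
      have ht' : t' = 0 := by
        rcases mul_eq_zero.1 (by linarith : t' * side A B e.2 = 0) with h3 | h3
        · exact h3
        · linarith
      rw [h', hA, ht'] at hx1'
      linarith

/-- The polygon bounded by the path and the segment. -/
def polygon (h : IsRightChain A M B) : SimplePolygon where
  vertices := A :: (M ++ [B])
  region := region A M B
  simple := h.isSimpleClosed
  isCompact_region := by
    refine Metric.isCompact_of_isClosed_isBounded isClosed_region ?_
    have hb : Bornology.IsBounded (segment ℝ A B ∪ trace (pathEdges (A :: (M ++ [B])))) :=
      ((isCompact_segment A B).union (isCompact_trace _)).isBounded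
    obtain ⟨R, hR⟩ := hb.exists_norm_le
    refine (((isCompact_Icc (a := -R) (b := R)).prod (isCompact_Icc (a := -R) (b := R))).image
      (f := fun z : ℝ × ℝ => pt z.1 z.2) (by unfold pt; fun_prop)).isBounded.subset ?_
    rintro p ⟨⟨q, hq, hq1, hq0⟩, r, hr, hr1, hr0⟩
    have b0 := abs_le.1 ((PiLp.norm_apply_le q 0).trans (hR q (Or.inl hq)))
    have b1 := abs_le.1 ((PiLp.norm_apply_le q 1).trans (hR q (Or.inl hq)))
    have b2 := abs_le.1 ((PiLp.norm_apply_le r 0).trans (hR r (Or.inr hr)))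
    refine ⟨(p 0, p 1), ⟨⟨?_, ?_⟩, ?_, ?_⟩, by simp⟩ <;> simp only <;> linarith
  closure_interior_region := by
    apply subset_antisymm
    · exact closure_minimal interior_subset isClosed_region
    · intro p hp
      have hi : inner A M B ⊆ interior (region A M B) :=
        interior_maximal h.inner_subset isOpen_inner
      rcases h.region_subset hp with h' | h'
      · exact subset_closure (hi h')
      · exact closure_mono hi (h.trace_subset h').1
  frontier_region := by
    have hi : inner A M B ⊆ interior (region A M B) :=
      interior_maximal h.inner_subset isOpen_inner
    rw [isClosed_region.frontier_eq]
    apply subset_antisymm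
    · rintro p ⟨hp, hp'⟩
      rcases h.region_subset hp with h' | h'
      · exact absurd (hi h') hp'
      · exact h'
    · intro p hp
      have := h.trace_subset hp
      refine ⟨isClosed_region.closure_subset_iff.2 h.inner_subset this.1, ?_⟩
      have h2 := this.2
      rwa [closure_compl] at h2

/-- The ray to the right of `p` crosses the monotone path at most once, namely if `p` is to the left
of the path on its level; the same holds for the segment. The difference is therefore 1 between the
two and 0 elsewhere. Written in this way, the indicator functions of adjacent tiles add up, as the
crossings of a common path cancel. -/
lemma indicator (h : IsRightChain A M B) {p : Plane}
    (hp : p ∉ trace (cyclicEdges (A :: (M ++ [B])))) :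
    (region A M B).indicator (fun _ => (1 : ℤ)) p =
      hcount (pathEdges (A :: (M ++ [B]))) p - hc (A, B) p := by
  rw [cyclicEdges_chain, trace_append, trace_cons, trace_nil, Set.union_empty,
    Set.mem_union, not_or] at hp
  have hin : p ∈ region A M B → p ∈ inner A M B := by
    intro h'
    rcases h.region_subset h' with h' | h'
    · exact h'
    · rw [cyclicEdges_chain, trace_append, trace_cons, trace_nil, Set.union_empty] at h'
      exact absurd h' (by simpa using hp)
  have hd : 0 < B 1 - A 1 := by linarith [h.lt]
  have hAB : A 1 ≤ p 1 → p 1 < B 1 → hc (A, B) p = if side A B p < 0 then 1 else 0 := by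
    intro h1 h2
    unfold hc side
    simp only [h1, h2, true_and, sub_neg]
  rcases hcount_path h.mono p with ⟨h0, hl⟩ | ⟨hA, hB, e, he, h1, h2, h3⟩
  · have hl' : p 1 < A 1 ∨ B 1 ≤ p 1 := by simpa using hl
    have hc0 : hc (A, B) p = 0 := by
      unfold hc; rw [if_neg]; rintro ⟨k1, k2, -⟩; simp only at k1 k2
      rcases hl' with h' | h' <;> linarith
    rw [h0, hc0, Set.indicator_of_notMem]; · rfl
    intro h'
    obtain ⟨⟨k1, k2, -⟩, -⟩ := hin h'
    rcases hl' with h' | h' <;> linarith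
  · have hB : p 1 < B 1 := by simpa using hB
    rw [hAB hA hB, h3]
    have hde : 0 < e.2 1 - e.1 1 := by linarith
    obtain ⟨q, hq, hq1, hqc⟩ : ∃ q ∈ segment ℝ e.1 e.2, q 1 = p 1 ∧
        hc e p = if p 0 < q 0 then 1 else 0 := by
      refine ⟨pt (e.1 0 + (p 1 - e.1 1) / (e.2 1 - e.1 1) * (e.2 0 - e.1 0)) (p 1), ?_, by simp, ?_⟩
      · refine mem_segment_coord.2 ⟨(p 1 - e.1 1) / (e.2 1 - e.1 1), ?_, ?_, by simp, ?_⟩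
        · apply div_nonneg <;> linarith
        · rw [div_le_one hde]; linarith
        · rw [div_mul_cancel₀ _ hde.ne']; simp
      · unfold hc
        simp only [h1, h2, true_and, pt_zero]
        congr 1
        rw [div_mul_eq_mul_div, ← sub_lt_iff_lt_add', lt_div_iff₀ hde]
        rw [mul_comm (p 1 - e.1 1)]
    have hqT : q ∈ trace (pathEdges (A :: (M ++ [B]))) := ⟨e, he, hq⟩
    have hqs := (h.trace_side hqT).1
    rw [hqc]
    have hqp : side A B q = side A B p + (q 0 - p 0) * (B 1 - A 1) := by
      unfold side; rw [hq1]; ring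
    by_cases hr : p ∈ region A M B
    · obtain ⟨⟨-, -, k3⟩, k4⟩ := hin hr
      have k5 : p 0 < q 0 := by
        by_contra hlt
        exact k4 ⟨q, hqT, hq1, not_lt.1 hlt⟩
      rw [Set.indicator_of_mem hr, if_pos k5, if_neg (not_lt.2 k3.le)]; rfl
    · rw [Set.indicator_of_notMem hr]
      by_cases hs : side A B p < 0
      · have k5 : p 0 < q 0 := by
          by_contra hlt
          push Not at hlt
          nlinarith
        rw [if_pos hs, if_pos k5]; rfl
      · have k5 : ¬ p 0 < q 0 := by
          intro hlt
          exact hr ⟨(mem_rayRight_segment h.lt).2 ⟨hA, hB.le, not_lt.1 hs⟩, q, hqT, hq1, hlt.le⟩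
        rw [if_neg hs, if_neg k5]; rfl

end IsRightChain

/-! ### Images of polygons under isometries -/

lemma cyclicEdges_map (f : Plane → Plane) (l : List Plane) :
    cyclicEdges (l.map f) = (cyclicEdges l).map (Prod.map f f) := by
  unfold cyclicEdges
  rw [← List.map_rotate, List.zip_map]

lemma pathEdges_map (f : Plane → Plane) (l : List Plane) :
    pathEdges (l.map f) = (pathEdges l).map (Prod.map f f) := by
  unfold pathEdges
  rw [← List.map_tail, List.zip_map]

lemma image_segment_isometry (Φ : Plane ≃ₗᵢ[ℝ] Plane) (a b : Plane) :
    Φ '' segment ℝ a b = segment ℝ (Φ a) (Φ b) :=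
  image_segment ℝ Φ.toLinearEquiv.toLinearMap.toAffineMap a b

lemma image_halfOpenSegment (Φ : Plane ≃ₗᵢ[ℝ] Plane) (a b : Plane) :
    halfOpenSegment (Φ a) (Φ b) = Φ '' halfOpenSegment a b := by
  ext x
  constructor
  · rintro ⟨t, h0, h1, rfl⟩
    exact ⟨a + t • (b - a), ⟨t, h0, h1, rfl⟩, by simp⟩
  · rintro ⟨_, ⟨t, h0, h1, rfl⟩, rfl⟩
    exact ⟨t, h0, h1, by simp⟩

lemma trace_map (Φ : Plane ≃ₗᵢ[ℝ] Plane) (E : List (Plane × Plane)) :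
    trace (E.map (Prod.map Φ Φ)) = Φ '' trace E := by
  induction E with
  | nil => simp
  | cons e E ih =>
    rw [List.map_cons, trace_cons, trace_cons, Set.image_union, ih, image_segment_isometry]
    rfl

lemma weight_map (Φ : Plane ≃ₗᵢ[ℝ] Plane) (E : List (Plane × Plane)) :
    weight (E.map (Prod.map Φ Φ)) = weight E := by
  unfold weight
  rw [List.map_map]
  congr 1
  apply List.map_congr_left
  intro e _
  simp

namespace SimplePolygon

/-- The image of a polygon under a linear isometry. -/
noncomputable def map (Φ : Plane ≃ₗᵢ[ℝ] Plane) (Q : SimplePolygon) : SimplePolygon where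
  vertices := Q.vertices.map Φ
  region := Φ '' Q.region
  simple := by
    refine ⟨by simpa using Q.simple.1, ?_, ?_⟩
    · rw [cyclicEdges_map]
      intro e he
      obtain ⟨f, hf, rfl⟩ := List.mem_map.1 he
      intro h
      exact Q.simple.2.1 f hf (Φ.injective h)
    · rw [cyclicEdges_map, List.pairwise_map]
      refine Q.simple.2.2.imp ?_
      intro e f h
      simp only [Prod.map_fst, Prod.map_snd]
      rw [image_halfOpenSegment, image_halfOpenSegment]
      exact (Set.disjoint_image_iff Φ.injective).2 h
  isCompact_region := Q.isCompact_region.image Φ.continuous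
  closure_interior_region := by
    have h1 := Φ.toHomeomorph.image_interior Q.region
    have h2 := Φ.toHomeomorph.image_closure (interior Q.region)
    rw [Q.closure_interior_region, h1] at h2
    exact h2.symm
  frontier_region := by
    rw [cyclicEdges_map, trace_map, ← Q.frontier_region]
    exact (Φ.toHomeomorph.image_frontier Q.region).symm

lemma per_map (Φ : Plane ≃ₗᵢ[ℝ] Plane) (Q : SimplePolygon) : (Q.map Φ).per = Q.per := by
  unfold per map
  rw [cyclicEdges_map, weight_map]

lemma hper_map {Φ : Plane ≃ₗᵢ[ℝ] Plane} (h : ∀ u v : Plane, Φ u 1 = Φ v 1 ↔ u 1 = v 1)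
    (Q : SimplePolygon) : (Q.map Φ).hper = Q.hper := by
  unfold hper map horizontalWeight
  simp only
  rw [cyclicEdges_map, List.map_map]
  congr 1
  apply List.map_congr_left
  intro e _
  simp [h]

lemma mem_map_region {Φ : Plane ≃ₗᵢ[ℝ] Plane} {Q : SimplePolygon} {p : Plane} :
    Φ p ∈ (Q.map Φ).region ↔ p ∈ Q.region :=
  Φ.injective.mem_set_image

lemma HasBoundary.map {Q : SimplePolygon} {l : List Plane} (h : Q.HasBoundary l)
    (Φ : Plane ≃ₗᵢ[ℝ] Plane) : (Q.map Φ).HasBoundary (l.map Φ) := by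
  rcases h with h | h
  · exact Or.inl (h.map Φ)
  · right
    rw [← List.map_reverse]
    exact h.map Φ

lemma hasBoundary_reverse {Q : SimplePolygon} {l : List Plane} (h : Q.HasBoundary l) :
    Q.HasBoundary l.reverse := by
  rcases h with h | h
  · right; rwa [List.reverse_reverse]
  · exact Or.inl h

lemma isChord_map {Φ : Plane ≃ₗᵢ[ℝ] Plane} {Q : SimplePolygon} {a b : Plane} :
    (Q.map Φ).IsChord (Φ a) (Φ b) ↔ Q.IsChord a b := by
  have hf : frontier (Q.map Φ).region = Φ '' frontier Q.region :=
    (Φ.toHomeomorph.image_frontier Q.region).symm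
  unfold IsChord
  rw [hf, Φ.injective.mem_set_image, Φ.injective.mem_set_image, ← image_segment_isometry]
  simp only [map, Set.image_subset_image_iff Φ.injective]

end SimplePolygon

/-! ### Counting the tiles over a point -/

/-- The number of polygons of the list that contain the point. -/
noncomputable def cnt (F : List SimplePolygon) (p : Plane) : ℤ :=
  (F.map fun Q => Q.region.indicator (fun _ => (1 : ℤ)) p).sum

@[simp] lemma cnt_nil (p : Plane) : cnt [] p = 0 := rfl
@[simp] lemma cnt_cons (Q : SimplePolygon) (F : List SimplePolygon) (p : Plane) :
    cnt (Q :: F) p = Q.region.indicator (fun _ => (1 : ℤ)) p + cnt F p := by simp [cnt]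
@[simp] lemma cnt_append (F F' : List SimplePolygon) (p : Plane) :
    cnt (F ++ F') p = cnt F p + cnt F' p := by simp [cnt]

lemma cnt_map (Φ : Plane ≃ₗᵢ[ℝ] Plane) (F : List SimplePolygon) (p : Plane) :
    cnt (F.map (SimplePolygon.map Φ)) (Φ p) = cnt F p := by
  induction F with
  | nil => simp
  | cons Q F ih =>
    rw [List.map_cons, cnt_cons, cnt_cons, ih]
    congr 1
    by_cases h : p ∈ Q.region
    · rw [Set.indicator_of_mem h, Set.indicator_of_mem (SimplePolygon.mem_map_region.2 h)]
    · rw [Set.indicator_of_notMem h,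
        Set.indicator_of_notMem (mt SimplePolygon.mem_map_region.1 h)]

lemma cnt_nonneg (F : List SimplePolygon) (p : Plane) : 0 ≤ cnt F p := by
  induction F with
  | nil => simp
  | cons Q F ih =>
    rw [cnt_cons]
    exact add_nonneg (Set.indicator_nonneg (fun _ _ => zero_le_one) _) ih

lemma ae_isometry (Φ : Plane ≃ₗᵢ[ℝ] Plane) {P : Plane → Prop} (h : ∀ᵐ p, P p) :
    ∀ᵐ p, P (Φ p) :=
  Φ.measurePreserving.quasiMeasurePreserving.ae h

/-! ### Reflections -/

/-- The linear isometry given by an involution of the plane. -/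
noncomputable def involution (f : Plane →ₗ[ℝ] Plane) (h1 : ∀ p, f (f p) = p)
    (h2 : ∀ p, ‖f p‖ = ‖p‖) : Plane ≃ₗᵢ[ℝ] Plane where
  toLinearEquiv := LinearEquiv.ofInvolutive f h1
  norm_map' := h2

/-- Reflection in the `y`-axis. -/
noncomputable def flipX : Plane ≃ₗᵢ[ℝ] Plane :=
  involution
    { toFun := fun p => pt (-p 0) (p 1)
      map_add' := fun p q => plane_ext (by simp; ring) (by simp)
      map_smul' := fun c p => plane_ext (by simp) (by simp) }
    (fun p => plane_ext (by simp) (by simp))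
    (fun p => by simp [EuclideanSpace.norm_eq, Fin.sum_univ_two])

/-- Reflection in the `x`-axis. -/
noncomputable def flipY : Plane ≃ₗᵢ[ℝ] Plane :=
  involution
    { toFun := fun p => pt (p 0) (-p 1)
      map_add' := fun p q => plane_ext (by simp) (by simp; ring)
      map_smul' := fun c p => plane_ext (by simp) (by simp) }
    (fun p => plane_ext (by simp) (by simp))
    (fun p => by simp [EuclideanSpace.norm_eq, Fin.sum_univ_two])

/-- Reflection in the diagonal. -/
noncomputable def swapXY : Plane ≃ₗᵢ[ℝ] Plane :=
  involution
    { toFun := fun p => pt (p 1) (p 0)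
      map_add' := fun p q => plane_ext (by simp) (by simp)
      map_smul' := fun c p => plane_ext (by simp) (by simp) }
    (fun p => plane_ext (by simp) (by simp))
    (fun p => by simp [EuclideanSpace.norm_eq, Fin.sum_univ_two, add_comm])

lemma flipX_apply (p : Plane) : flipX p = pt (-p 0) (p 1) := rfl
lemma flipY_apply (p : Plane) : flipY p = pt (p 0) (-p 1) := rfl
lemma swapXY_apply (p : Plane) : swapXY p = pt (p 1) (p 0) := rfl
@[simp] lemma flipX_zero (p : Plane) : flipX p 0 = -p 0 := by simp [flipX_apply]
@[simp] lemma flipX_one (p : Plane) : flipX p 1 = p 1 := by simp [flipX_apply]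
@[simp] lemma flipY_zero (p : Plane) : flipY p 0 = p 0 := by simp [flipY_apply]
@[simp] lemma flipY_one (p : Plane) : flipY p 1 = -p 1 := by simp [flipY_apply]
@[simp] lemma swapXY_zero (p : Plane) : swapXY p 0 = p 1 := by simp [swapXY_apply]
@[simp] lemma swapXY_one (p : Plane) : swapXY p 1 = p 0 := by simp [swapXY_apply]
@[simp] lemma flipX_flipX (p : Plane) : flipX (flipX p) = p := plane_ext (by simp) (by simp)
@[simp] lemma flipY_flipY (p : Plane) : flipY (flipY p) = p := plane_ext (by simp) (by simp)
@[simp] lemma swapXY_swapXY (p : Plane) : swapXY (swapXY p) = p := plane_ext (by simp) (by simp)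

/-- The isometry changes at most the signs of the coordinates. -/
def IsFlip (Φ : Plane ≃ₗᵢ[ℝ] Plane) : Prop :=
  ((∀ p, Φ p 0 = p 0) ∨ (∀ p, Φ p 0 = -p 0)) ∧ ((∀ p, Φ p 1 = p 1) ∨ (∀ p, Φ p 1 = -p 1))

lemma isFlip_flipX : IsFlip flipX := ⟨Or.inr flipX_zero, Or.inl flipX_one⟩
lemma isFlip_flipY : IsFlip flipY := ⟨Or.inl flipY_zero, Or.inr flipY_one⟩

namespace IsFlip

variable {Φ : Plane ≃ₗᵢ[ℝ] Plane} {s : ℝ}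

lemma level (h : IsFlip Φ) (u v : Plane) : Φ u 1 = Φ v 1 ↔ u 1 = v 1 := by
  rcases h.2 with h1 | h1 <;> simp [h1]

lemma vertical (h : IsFlip Φ) (u v : Plane) : Φ u 0 = Φ v 0 ↔ u 0 = v 0 := by
  rcases h.1 with h1 | h1 <;> simp [h1]

lemma slope (h : IsFlip Φ) {u v : Plane} (hs : HasSlope s u v ∨ HasSlope (-s) u v) :
    HasSlope s (Φ u) (Φ v) ∨ HasSlope (-s) (Φ u) (Φ v) := by
  unfold HasSlope at *
  rw [Ne, h.vertical]
  obtain ⟨h0 | h0, h1 | h1⟩ := h <;> rcases hs with ⟨h2, h3⟩ | ⟨h2, h3⟩ <;> simp only [h0, h1] <;>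
    first
    | exact Or.inl ⟨h2, by linarith⟩
    | exact Or.inr ⟨h2, by linarith⟩

lemma steep (h : IsFlip Φ) {u v : Plane} (hs : IsSteepEdge s u v) :
    IsSteepEdge s (Φ u) (Φ v) := by
  rcases hs with hs | hs
  · exact Or.inl ((h.vertical u v).2 hs)
  · exact Or.inr (h.slope hs)

lemma lambdaPath (h : IsFlip Φ) {l : List Plane} (hl : IsLambdaPath s l) :
    IsLambdaPath s (l.map Φ) := by
  refine ⟨by simpa using hl.1, ?_, ?_⟩
  · rw [List.isChain_map]
    exact hl.2.1.imp fun _ _ => h.steep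
  · rw [List.isChain_map, List.isChain_map]
    rcases h.2 with h1 | h1 <;> rcases hl.2.2 with h2 | h2
    · exact Or.inl (h2.imp fun a b hab => by simpa [Ascends, h1] using hab)
    · exact Or.inr (h2.imp fun a b hab => by simpa [Descends, h1] using hab)
    · exact Or.inr (h2.imp fun a b hab => by simpa [Ascends, Descends, h1] using hab)
    · exact Or.inl (h2.imp fun a b hab => by simpa [Ascends, Descends, h1] using hab)

lemma lambdaReplacement (h : IsFlip Φ) {S L : List Plane} (hl : IsLambdaReplacement s S L) :
    IsLambdaReplacement s (S.map Φ) (L.map Φ) := by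
  induction hl with
  | single a => exact .single _
  | horizontal a b S L hab _ ih => exact .horizontal _ _ _ _ ((h.level _ _).2 hab) ih
  | vertical a b M S L hab hM _ ih =>
    have := IsLambdaReplacement.vertical (Φ a) (Φ b) (M.map Φ) (S.map Φ) (L.map Φ)
      ((h.vertical _ _).2 hab) (by simpa using h.lambdaPath hM) ih
    simpa using this

lemma staircase (h : IsFlip Φ) {S : List Plane} (hS : IsStaircase S) : IsStaircase (S.map Φ) := by
  obtain ⟨h1, h2, h3⟩ := hS
  refine ⟨?_, ?_, ?_⟩
  · rw [List.isChain_map]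
    exact h1.imp fun a b hab => by rwa [h.vertical, h.level]
  · rw [List.isChain_map, List.isChain_map]
    rcases h.1 with h0 | h0 <;> simp only [h0, neg_le_neg_iff]
    · exact h2
    · exact h2.symm
  · rw [List.isChain_map, List.isChain_map]
    rcases h.2 with h0 | h0 <;> simp only [h0, neg_le_neg_iff]
    · exact h3
    · exact h3.symm

lemma fuzzyStaircase (h : IsFlip Φ) {Q : SimplePolygon} (hQ : IsFuzzyStaircase s Q) :
    IsFuzzyStaircase s (Q.map Φ) := by
  obtain ⟨p, q, r, S, L, h1, h2, h3, h4, h5, h6, h7⟩ := hQ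
  refine ⟨Φ p, Φ q, Φ r, S.map Φ, L.map Φ, (h.level _ _).2 h1, h.slope h2, h.staircase h3,
    h.lambdaReplacement h4, ?_, ?_, ?_⟩
  · rw [List.head?_map, h5]; rfl
  · rw [List.getLast?_map, h6]; rfl
  · simpa using h7.map Φ

end IsFlip

lemma weight_reverse (l : List Plane) : weight (pathEdges l.reverse) = weight (pathEdges l) := by
  rw [pathEdges_reverse]
  unfold weight
  rw [← List.map_reverse, List.map_map, List.map_reverse, List.sum_reverse]
  congr 1
  apply List.map_congr_left
  intro e _
  simp [dist_comm]

/-- The path of a tame histogram goes from left to right, so a reflection in the vertical axis has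
to be combined with a reversal. Subpaths, maximal runs and path interiors are carried back to the
original path accordingly. -/
lemma isSubpath_reverse_flip {L N : List Plane} {a b : Plane} (Φ : Plane ≃ₗᵢ[ℝ] Plane)
    (h : IsSubpath (L.map Φ).reverse a b N) :
    IsSubpath L (Φ.symm b) (Φ.symm a) (N.map Φ.symm).reverse := by
  obtain ⟨X, M, Z, u, w, h1, h2, h3, h4⟩ := h
  have hs : ∀ {x y z : Plane}, x ∈ segment ℝ y z → Φ.symm x ∈ segment ℝ (Φ.symm z) (Φ.symm y) := by
    intro x y z hx
    rw [segment_symm, ← image_segment_isometry]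
    exact Set.mem_image_of_mem _ hx
  refine ⟨(Z.map Φ.symm).reverse, (M.map Φ.symm).reverse, (X.map Φ.symm).reverse, Φ.symm w,
    Φ.symm u, ?_, ?_, ?_, ?_⟩
  · have := congrArg (fun l => (l.map Φ.symm).reverse) h1
    simpa [List.map_reverse, Function.comp_def] using this
  · rw [h2]; simp
  · have := hs h4
    simpa [List.head?_reverse, Option.getD_map] using this
  · have := hs h3
    simpa [List.getLast?_reverse, Option.getD_map] using this

lemma isMaximalRun_reverse_flip {R R' : Plane → Plane → Prop} {L M : List Plane}
    {Φ : Plane ≃ₗᵢ[ℝ] Plane} (hR : ∀ a b, R (Φ a) (Φ b) ↔ R' b a)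
    (h : IsMaximalRun R (L.map Φ).reverse M) :
    IsMaximalRun R' L (M.map Φ.symm).reverse := by
  obtain ⟨X, Z, h1, h2, h3, h4, h5⟩ := h
  have hR' : ∀ a b, R' (Φ.symm a) (Φ.symm b) ↔ R b a := by
    intro a b
    rw [← hR]; simp
  refine ⟨(Z.map Φ.symm).reverse, (X.map Φ.symm).reverse, ?_, by simpa using h2, ?_, ?_, ?_⟩
  · have := congrArg (fun l => (l.map Φ.symm).reverse) h1
    simpa [List.map_reverse, Function.comp_def] using this
  · rw [List.isChain_reverse, List.isChain_map]
    exact h3.imp fun a b hab => (hR' _ _).2 hab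
  · intro a ha b hb
    simp only [List.getLast?_reverse, List.head?_reverse, List.head?_map, List.getLast?_map,
      Option.mem_map] at ha hb
    obtain ⟨a, ha, rfl⟩ := ha
    obtain ⟨b, hb, rfl⟩ := hb
    rw [hR']
    exact h5 b hb a ha
  · intro a ha b hb
    simp only [List.getLast?_reverse, List.head?_reverse, List.head?_map, List.getLast?_map,
      Option.mem_map] at ha hb
    obtain ⟨a, ha, rfl⟩ := ha
    obtain ⟨b, hb, rfl⟩ := hb
    rw [hR']
    exact h4 b hb a ha

lemma mem_pathInterior_reverse_flip {M : List Plane} {x : Plane} (Φ : Plane ≃ₗᵢ[ℝ] Plane)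
    (h : x ∈ pathInterior M) : Φ.symm x ∈ pathInterior (M.map Φ.symm).reverse := by
  obtain ⟨h1, h2, h3⟩ := h
  refine ⟨?_, ?_, ?_⟩
  · rw [trace_reverse, pathEdges_map, trace_map]
    exact Set.mem_image_of_mem _ h1
  · intro a ha
    rw [List.head?_reverse, List.getLast?_map, Option.mem_map] at ha
    obtain ⟨a, ha, rfl⟩ := ha
    exact fun h => h3 a ha (Φ.symm.injective h)
  · intro a ha
    rw [List.getLast?_reverse, List.head?_map, Option.mem_map] at ha
    obtain ⟨a, ha, rfl⟩ := ha
    exact fun h => h2 a ha (Φ.symm.injective h)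

lemma IsTameHistogram.flipX {s : ℝ} {Q : SimplePolygon} (h : IsTameHistogram s Q) :
    IsTameHistogram s (Q.map flipX) := by
  obtain ⟨p, q, L, h1, h2, h3, h4, h5, h6, h7, h8⟩ := h
  refine ⟨_root_.flipX q, _root_.flipX p, (L.map _root_.flipX).reverse, ?_, ?_, by simp [h3], by simpa using h4,
    SimplePolygon.hasBoundary_reverse (h5.map _), ?_, ?_, ?_⟩
  · rw [List.head?_reverse, List.getLast?_map, h2]; rfl
  · rw [List.getLast?_reverse, List.head?_map, h1]; rfl
  · rw [List.isChain_reverse, List.isChain_map]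
    refine h6.imp ?_
    rintro a b (hab | ⟨hab, hab'⟩)
    · left
      have := isFlip_flipX.steep hab
      unfold IsSteepEdge HasSlope at *
      rcases this with h | ⟨h, h'⟩ | ⟨h, h'⟩
      · exact Or.inl h.symm
      · exact Or.inr (Or.inl ⟨h.symm, by linarith⟩)
      · exact Or.inr (Or.inr ⟨h.symm, by linarith⟩)
    · right; simp [hab, hab']
  · intro R hR M M' hM hM' hne a ha b hb hc
    -- The reversal exchanges ascending and descending runs.
    obtain ⟨R', hR', hRR⟩ : ∃ R' : Plane → Plane → Prop, (R' = Ascends ∨ R' = Descends) ∧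
        ∀ a b, R (_root_.flipX a) (_root_.flipX b) ↔ R' b a := by
      rcases hR with rfl | rfl
      · exact ⟨Descends, Or.inr rfl, fun a b => by simp [Ascends, Descends]⟩
      · exact ⟨Ascends, Or.inl rfl, fun a b => by simp [Ascends, Descends]⟩
    refine h7 R' hR' _ _ (isMaximalRun_reverse_flip hRR hM) (isMaximalRun_reverse_flip hRR hM')
      ?_ _ (mem_pathInterior_reverse_flip _root_.flipX ha) _ (mem_pathInterior_reverse_flip _root_.flipX hb)
      ?_
    · intro h
      exact hne (List.map_injective_iff.2 (_root_.flipX).symm.injective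
        (List.reverse_injective h))
    · rw [← SimplePolygon.isChord_map (Φ := _root_.flipX)]
      simpa using hc
  · intro a b N hN hab hc
    have h9 := h8 _ _ _ (isSubpath_reverse_flip _ hN)
    have hsymm : ∀ z : Plane, (_root_.flipX).symm z 1 = z 1 := by
      intro z
      have := flipX_one ((_root_.flipX).symm z)
      rw [← this]; simp
    have h10 := h9 (by rw [hsymm, hsymm, hab]) (by
      rw [← SimplePolygon.isChord_map (Φ := _root_.flipX)]
      obtain ⟨k1, k2, k3⟩ := hc
      simp only [LinearIsometryEquiv.apply_symm_apply]
      exact ⟨k2, k1, by rwa [segment_symm]⟩)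
    rw [weight_reverse, pathEdges_map, weight_map] at h10
    simpa [dist_comm] using h10

/-- A fuzzy staircase or a tame histogram. -/
def IsTile (s : ℝ) (Q : SimplePolygon) : Prop := IsFuzzyStaircase s Q ∨ IsTameHistogram s Q

lemma IsTile.flipX {s : ℝ} {Q : SimplePolygon} (h : IsTile s Q) : IsTile s (Q.map flipX) :=
  h.imp isFlip_flipX.fuzzyStaircase IsTameHistogram.flipX

/-! ### Rows

A list of rows `(h, x)` describes a step function of `y`: the first row occupies the levels from `a`
to `a + h`, and so on. -/

/-- The total height. -/
def ht (R : List (ℝ × ℝ)) : ℝ := (R.map Prod.fst).sum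

@[simp] lemma ht_nil : ht [] = 0 := rfl
@[simp] lemma ht_cons (r : ℝ × ℝ) (R : List (ℝ × ℝ)) : ht (r :: R) = r.1 + ht R := by simp [ht]
@[simp] lemma ht_append (R R' : List (ℝ × ℝ)) : ht (R ++ R') = ht R + ht R' := by simp [ht]
@[simp] lemma ht_reverse (R : List (ℝ × ℝ)) : ht R.reverse = ht R := by
  rw [ht, ht, List.map_reverse, List.sum_reverse]

lemma ht_nonneg {R : List (ℝ × ℝ)} (h : ∀ r ∈ R, 0 < r.1) : 0 ≤ ht R :=
  List.sum_nonneg (by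
    intro x hx
    obtain ⟨r, hr, rfl⟩ := List.mem_map.1 hx
    exact (h r hr).le)

lemma ht_pos {R : List (ℝ × ℝ)} (h : ∀ r ∈ R, 0 < r.1) (hR : R ≠ []) : 0 < ht R := by
  cases R with
  | nil => exact absurd rfl hR
  | cons r R =>
    rw [ht_cons]
    exact add_pos_of_pos_of_nonneg (h r (by simp)) (ht_nonneg fun r' hr' => h r' (by simp [hr']))

/-- The indicator function of the points to the left of the rows. -/
noncomputable def rowCount : ℝ → List (ℝ × ℝ) → Plane → ℤ
  | _, [], _ => 0
  | a, r :: R, p => (if a ≤ p 1 ∧ p 1 < a + r.1 ∧ p 0 < r.2 then 1 else 0) + rowCount (a + r.1) R p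

@[simp] lemma rowCount_nil (a : ℝ) (p : Plane) : rowCount a [] p = 0 := rfl
lemma rowCount_cons (a : ℝ) (r : ℝ × ℝ) (R : List (ℝ × ℝ)) (p : Plane) :
    rowCount a (r :: R) p =
      (if a ≤ p 1 ∧ p 1 < a + r.1 ∧ p 0 < r.2 then 1 else 0) + rowCount (a + r.1) R p := rfl

lemma rowCount_append (a : ℝ) (R R' : List (ℝ × ℝ)) (p : Plane) :
    rowCount a (R ++ R') p = rowCount a R p + rowCount (a + ht R) R' p := by
  induction R generalizing a with
  | nil => simp
  | cons r R ih =>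
    rw [List.cons_append, rowCount_cons, rowCount_cons, ih, ht_cons]
    ring_nf

lemma rowCount_split {h1 h2 : ℝ} (k1 : 0 ≤ h1) (k2 : 0 ≤ h2) (a x : ℝ) (p : Plane) :
    rowCount a [(h1 + h2, x)] p = rowCount a [(h1, x), (h2, x)] p := by
  simp only [rowCount_cons, rowCount_nil, add_zero]
  split_ifs <;> grind

lemma rowCount_single {h : ℝ} (a x : ℝ) (p : Plane) :
    rowCount a [(h, x)] p = hc (pt x a, pt x (a + h)) p := by
  simp only [rowCount_cons, rowCount_nil, add_zero]
  unfold hc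
  simp only [pt_zero, pt_one, sub_self, zero_mul, add_sub_cancel_left]
  by_cases c1 : a ≤ p 1
  · by_cases c2 : p 1 < a + h
    · have : 0 < h := by linarith
      congr 1
      simp only [c1, c2, true_and]
      rw [mul_neg_iff]
      apply propext
      constructor
      · intro hx
        right
        constructor <;> linarith
      · rintro (⟨k1, k2⟩ | ⟨k1, k2⟩) <;> linarith
    · simp [c2]
  · simp [c1]

/-- The reflection exchanges the closed and the open end of each row, so the identity may fail on
the finitely many lines between rows. -/
lemma ae_rowCount_reverse (a : ℝ) (R : List (ℝ × ℝ)) :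
    ∀ᵐ p : Plane, rowCount (-(a + ht R)) R.reverse (flipY p) = rowCount a R p := by
  induction R generalizing a with
  | nil => simp
  | cons r R ih =>
    have h1 := measure_eq_zero_iff_ae_notMem.1 (volume_level_one a)
    have h2 := measure_eq_zero_iff_ae_notMem.1 (volume_level_one (a + r.1))
    filter_upwards [ih (a + r.1), h1, h2] with p hp h1 h2
    replace h1 : p 1 ≠ a := h1
    replace h2 : p 1 ≠ a + r.1 := h2
    rw [List.reverse_cons, rowCount_append, ht_reverse, ht_cons, ← add_assoc, hp, rowCount_cons a,
      add_comm]
    congr 1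
    rw [rowCount_cons, rowCount_nil, add_zero, flipY_zero, flipY_one]
    congr 1
    apply propext
    have e1 : -(a + r.1 + ht R) + ht R ≤ -p 1 ↔ p 1 < a + r.1 := by
      constructor
      · intro h; exact lt_of_le_of_ne (by linarith) h2
      · intro h; linarith
    have e2 : -p 1 < -(a + r.1 + ht R) + ht R + r.1 ↔ a ≤ p 1 := by
      constructor
      · intro h; linarith
      · intro h
        have := lt_of_le_of_ne h (Ne.symm h1)
        linarith
    rw [e1, e2]
    tauto

/-- The variation of the rows, starting from the value `x`. -/
noncomputable def tv : ℝ → List (ℝ × ℝ) → ℝ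
  | _, [] => 0
  | x, r :: R => |r.2 - x| + tv r.2 R

/-- The last row value. -/
def lastX : ℝ → List (ℝ × ℝ) → ℝ
  | x, [] => x
  | _, r :: R => lastX r.2 R

/-- The variation of the rows, pinned at both ends. -/
noncomputable def pvar (x : ℝ) (R : List (ℝ × ℝ)) (y : ℝ) : ℝ := tv x R + |y - lastX x R|

@[simp] lemma tv_nil (x : ℝ) : tv x [] = 0 := rfl
@[simp] lemma tv_cons (x : ℝ) (r : ℝ × ℝ) (R : List (ℝ × ℝ)) :
    tv x (r :: R) = |r.2 - x| + tv r.2 R := rfl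
@[simp] lemma lastX_nil (x : ℝ) : lastX x [] = x := rfl
@[simp] lemma lastX_cons (x : ℝ) (r : ℝ × ℝ) (R : List (ℝ × ℝ)) :
    lastX x (r :: R) = lastX r.2 R := rfl

lemma tv_append (x : ℝ) (R R' : List (ℝ × ℝ)) :
    tv x (R ++ R') = tv x R + tv (lastX x R) R' := by
  induction R generalizing x with
  | nil => simp
  | cons r R ih => simp [ih, add_assoc]

lemma lastX_append (x : ℝ) (R R' : List (ℝ × ℝ)) :
    lastX x (R ++ R') = lastX (lastX x R) R' := by
  induction R generalizing x with
  | nil => simp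
  | cons r R ih => simp [ih]

lemma tv_nonneg (x : ℝ) (R : List (ℝ × ℝ)) : 0 ≤ tv x R := by
  induction R generalizing x with
  | nil => simp
  | cons r R ih => rw [tv_cons]; exact add_nonneg (abs_nonneg _) (ih _)

lemma pvar_nonneg (x : ℝ) (R : List (ℝ × ℝ)) (y : ℝ) : 0 ≤ pvar x R y :=
  add_nonneg (tv_nonneg _ _) (abs_nonneg _)

@[simp] lemma pvar_nil (x y : ℝ) : pvar x [] y = |y - x| := by simp [pvar]
@[simp] lemma pvar_cons (x y : ℝ) (r : ℝ × ℝ) (R : List (ℝ × ℝ)) :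
    pvar x (r :: R) y = |r.2 - x| + pvar r.2 R y := by simp [pvar, add_assoc]

/-- Cutting at a row. -/
lemma pvar_append_cons (x y : ℝ) (r : ℝ × ℝ) (R R' : List (ℝ × ℝ)) :
    pvar x (R ++ r :: R') y = pvar x R r.2 + pvar r.2 R' y := by
  induction R generalizing x with
  | nil => simp
  | cons q R ih => simp [ih, add_assoc]

lemma pvar_reverse (x y : ℝ) (R : List (ℝ × ℝ)) : pvar y R.reverse x = pvar x R y := by
  induction R generalizing x with
  | nil => simp [abs_sub_comm]
  | cons r R ih =>
    rw [List.reverse_cons, pvar_append_cons, ih, pvar_cons, pvar_nil, abs_sub_comm]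
    ring

lemma tv_le_pvar (x y : ℝ) (R : List (ℝ × ℝ)) : tv x R ≤ pvar x R y :=
  le_add_of_nonneg_right (abs_nonneg _)

/-- The two halves of a gap are filled from opposite ends, each paying for the variation seen from
its own end. -/
lemma tv_add_tv_reverse_le (x y : ℝ) (R R' : List (ℝ × ℝ)) :
    tv x R + tv y R'.reverse ≤ pvar x (R ++ R') y := by
  have h1 : pvar x (R ++ R') y = tv x R + pvar (lastX x R) R' y := by
    unfold pvar
    rw [tv_append, lastX_append]; ring
  rw [h1, ← pvar_reverse]
  have := tv_le_pvar y (lastX x R) R'.reverse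
  linarith

/-! ### More on paths -/

/-- The edges of stairs: horizontal to the right, or steep and ascending. -/
def StairEdge (s : ℝ) (u v : Plane) : Prop :=
  (u 1 = v 1 ∧ u 0 < v 0) ∨ (u 1 < v 1 ∧ IsSteepEdge s u v)

/-- An ascending path of steep edges. -/
def SteepUp (s : ℝ) (u v : Plane) : Prop := u 1 < v 1 ∧ IsSteepEdge s u v

lemma StairEdge.le {s : ℝ} {u v : Plane} (h : StairEdge s u v) : u 1 ≤ v 1 := by
  rcases h with h | h
  · exact h.1.le
  · exact h.1.le

lemma StairEdge.lex {s : ℝ} {u v : Plane} (h : StairEdge s u v) :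
    u 1 < v 1 ∨ (u 1 = v 1 ∧ u 0 < v 0) := by
  rcases h with h | h
  · exact Or.inr h
  · exact Or.inl h.1

lemma stair_pairwise {s : ℝ} {l : List Plane} (h : l.IsChain (StairEdge s)) :
    l.Pairwise fun u v : Plane => u 1 < v 1 ∨ (u 1 = v 1 ∧ u 0 < v 0) := by
  have : IsTrans Plane (fun u v => u 1 < v 1 ∨ (u 1 = v 1 ∧ u 0 < v 0)) := ⟨by
    rintro a b c (h1 | ⟨h1, h1'⟩) (h2 | ⟨h2, h2'⟩)
    · exact Or.inl (h1.trans h2)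
    · exact Or.inl (h1.trans_le h2.le)
    · exact Or.inl (h1.trans_lt h2)
    · exact Or.inr ⟨h1.trans h2, h1'.trans h2'⟩⟩
  exact (h.imp fun _ _ => StairEdge.lex).pairwise

lemma noBack_stair {s : ℝ} {l : List Plane} (h : l.IsChain (StairEdge s)) : NoBack l := by
  rintro a b c ⟨X, Z, rfl⟩ h1 h2
  have e : X ++ [a, b, c] ++ Z = X ++ (a :: b :: c :: Z) := by simp
  rw [e] at h
  have h3 := List.IsChain.right_of_append h
  have k1 := (List.isChain_cons_cons.1 h3).1
  have k2 := (List.isChain_cons_cons.1 (List.isChain_cons_cons.1 h3).2).1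
  rcases k1 with k1 | k1
  · rcases k2 with k2 | k2
    · exact mul_pos (by linarith [k1.2]) (by linarith [k2.2])
    · exact absurd h2 k2.1.ne
  · exact absurd h1 k1.1.ne

lemma IsLambdaPath.reverse {s : ℝ} {l : List Plane} (h : IsLambdaPath s l) :
    IsLambdaPath s l.reverse := by
  refine ⟨by simpa using h.1, ?_, ?_⟩
  · rw [List.isChain_reverse]
    refine h.2.1.imp fun a b hab => ?_
    rcases hab with h | ⟨h, h'⟩ | ⟨h, h'⟩
    · exact Or.inl h.symm
    · exact Or.inr (Or.inl ⟨h.symm, by linarith⟩)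
    · exact Or.inr (Or.inr ⟨h.symm, by linarith⟩)
  · rw [List.isChain_reverse, List.isChain_reverse]
    rcases h.2.2 with h | h
    · exact Or.inr h
    · exact Or.inl h

lemma IsLambdaReplacement.append {s : ℝ} {S L : List Plane} (h : IsLambdaReplacement s S L)
    {c : Plane} {S' L' : List Plane} (hc : S.getLast? = some c)
    (h' : IsLambdaReplacement s (c :: S') (c :: L')) :
    IsLambdaReplacement s (S ++ S') (L ++ L') := by
  induction h with
  | single a =>
    simp only [List.getLast?_singleton, Option.some.injEq] at hc
    subst hc
    exact h'
  | horizontal a b S L hab _ ih => exact .horizontal _ _ _ _ hab (ih (by simpa using hc))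
  | vertical a b M S L hab hM _ ih =>
    have := IsLambdaReplacement.vertical a b M (S ++ S') (L ++ L') hab hM (ih (by simpa using hc))
    simpa using this

lemma IsLambdaReplacement.reverse {s : ℝ} {S L : List Plane} (h : IsLambdaReplacement s S L) :
    IsLambdaReplacement s S.reverse L.reverse := by
  induction h with
  | single a => exact .single a
  | horizontal a b S L hab _ ih =>
    have := ih.append (c := b) (S' := [a]) (L' := [a]) (by simp)
      (.horizontal _ _ _ _ hab.symm (.single a))
    simpa using this
  | vertical a b M S L hab hM _ ih =>
    have := ih.append (c := b) (S' := [a]) (L' := M.reverse ++ [a]) (by simp)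
      (.vertical b a M.reverse [] [] hab.symm (by simpa using hM.reverse) (.single a))
    simpa using this

/-! ### Lengths -/

lemma dist_le_coord (u v : Plane) : dist u v ≤ |v 0 - u 0| + |v 1 - u 1| := by
  rw [EuclideanSpace.dist_eq, Fin.sum_univ_two, Real.dist_eq, Real.dist_eq]
  apply Real.sqrt_le_iff.2
  refine ⟨by positivity, ?_⟩
  rw [abs_sub_comm (v 0), abs_sub_comm (v 1)]
  nlinarith [abs_nonneg (u 0 - v 0), abs_nonneg (u 1 - v 1)]

lemma dist_level {u v : Plane} (h : u 1 = v 1) : dist u v = |v 0 - u 0| := by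
  rw [EuclideanSpace.dist_eq, Fin.sum_univ_two, Real.dist_eq, Real.dist_eq, h, sub_self, abs_zero]
  simp [Real.sqrt_sq_eq_abs, abs_sub_comm]

lemma dist_vertical {u v : Plane} (h : u 0 = v 0) : dist u v = |v 1 - u 1| := by
  rw [EuclideanSpace.dist_eq, Fin.sum_univ_two, Real.dist_eq, Real.dist_eq, h, sub_self, abs_zero]
  simp [Real.sqrt_sq_eq_abs, abs_sub_comm]

@[simp] lemma weight_nil : weight [] = 0 := rfl
@[simp] lemma weight_cons (e : Plane × Plane) (E : List (Plane × Plane)) :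
    weight (e :: E) = dist e.1 e.2 + weight E := by simp [weight]
@[simp] lemma weight_append (E E' : List (Plane × Plane)) :
    weight (E ++ E') = weight E + weight E' := by simp [weight]
@[simp] lemma horizontalWeight_nil : horizontalWeight [] = 0 := rfl
@[simp] lemma horizontalWeight_cons (e : Plane × Plane) (E : List (Plane × Plane)) :
    horizontalWeight (e :: E) =
      (if e.1 1 = e.2 1 then dist e.1 e.2 else 0) + horizontalWeight E := by
  simp [horizontalWeight]
@[simp] lemma horizontalWeight_append (E E' : List (Plane × Plane)) :
    horizontalWeight (E ++ E') = horizontalWeight E + horizontalWeight E' := by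
  simp [horizontalWeight]

/-- The vertical variation of a list of edges. -/
noncomputable def vWeight (E : List (Plane × Plane)) : ℝ := (E.map fun e => |e.2 1 - e.1 1|).sum

@[simp] lemma vWeight_nil : vWeight [] = 0 := rfl
@[simp] lemma vWeight_cons (e : Plane × Plane) (E : List (Plane × Plane)) :
    vWeight (e :: E) = |e.2 1 - e.1 1| + vWeight E := by simp [vWeight]
@[simp] lemma vWeight_append (E E' : List (Plane × Plane)) :
    vWeight (E ++ E') = vWeight E + vWeight E' := by simp [vWeight]

lemma horizontalWeight_le_weight (E : List (Plane × Plane)) : horizontalWeight E ≤ weight E := by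
  induction E with
  | nil => simp
  | cons e E ih =>
    rw [horizontalWeight_cons, weight_cons]
    have := dist_nonneg (x := e.1) (y := e.2)
    split_ifs <;> linarith

lemma IsSteepEdge.abs_le {s : ℝ} (hs : 1 ≤ s) {u v : Plane} (h : IsSteepEdge s u v) :
    s * |v 0 - u 0| ≤ |v 1 - u 1| := by
  have h0 : 0 ≤ s := by linarith
  rcases h with h | ⟨-, h⟩ | ⟨-, h⟩
  · rw [h]; simp
  · rw [h, abs_mul, abs_of_nonneg h0]
  · rw [h, abs_mul, abs_neg, abs_of_nonneg h0]

/-- An edge is at most as long as the sum of its coordinate differences, and for a steep edge with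
`s ≥ 1` the horizontal difference is at most the vertical one. -/
lemma weight_le {s : ℝ} (hs : 1 ≤ s) {E : List (Plane × Plane)}
    (h : ∀ e ∈ E, e.1 1 = e.2 1 ∨ IsSteepEdge s e.1 e.2) :
    weight E ≤ horizontalWeight E + 2 * vWeight E := by
  induction E with
  | nil => simp
  | cons e E ih =>
    rw [weight_cons, horizontalWeight_cons, vWeight_cons]
    have := ih fun f hf => h f (by simp [hf])
    have h2 := dist_le_coord e.1 e.2
    split_ifs with hl
    · linarith [abs_nonneg (e.2 1 - e.1 1)]
    · rcases h e (by simp) with h' | h'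
      · exact absurd h' hl
      · have := h'.abs_le hs
        nlinarith [abs_nonneg (e.2 0 - e.1 0)]

lemma vWeight_mono {b : Plane} {l : List Plane} (h : MonoY 1 (b :: l)) :
    vWeight (pathEdges (b :: l)) = ((b :: l).getLast (by simp)) 1 - b 1 := by
  induction l generalizing b with
  | nil => simp
  | cons c l ih =>
    have hbc := (List.isChain_cons_cons.1 h).1
    rw [pathEdges_cons_cons, vWeight_cons, ih h.tail, abs_of_nonneg (by simp only; linarith)]
    simp

/-! ### Total perimeters -/

/-- The total perimeter of a list of polygons. -/
noncomputable def sumPer (F : List SimplePolygon) : ℝ := (F.map SimplePolygon.per).sum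
/-- The total horizontal perimeter of a list of polygons. -/
noncomputable def sumHper (F : List SimplePolygon) : ℝ := (F.map SimplePolygon.hper).sum

@[simp] lemma sumPer_nil : sumPer [] = 0 := rfl
@[simp] lemma sumHper_nil : sumHper [] = 0 := rfl
@[simp] lemma sumPer_cons (Q : SimplePolygon) (F : List SimplePolygon) :
    sumPer (Q :: F) = Q.per + sumPer F := by simp [sumPer]
@[simp] lemma sumHper_cons (Q : SimplePolygon) (F : List SimplePolygon) :
    sumHper (Q :: F) = Q.hper + sumHper F := by simp [sumHper]
@[simp] lemma sumPer_append (F F' : List SimplePolygon) :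
    sumPer (F ++ F') = sumPer F + sumPer F' := by simp [sumPer]
@[simp] lemma sumHper_append (F F' : List SimplePolygon) :
    sumHper (F ++ F') = sumHper F + sumHper F' := by simp [sumHper]

lemma sumPer_map (Φ : Plane ≃ₗᵢ[ℝ] Plane) (F : List SimplePolygon) :
    sumPer (F.map (SimplePolygon.map Φ)) = sumPer F := by
  unfold sumPer
  rw [List.map_map]
  congr 1
  exact List.map_congr_left fun Q _ => Q.per_map Φ

lemma sumHper_map {Φ : Plane ≃ₗᵢ[ℝ] Plane} (h : IsFlip Φ) (F : List SimplePolygon) :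
    sumHper (F.map (SimplePolygon.map Φ)) = sumHper F := by
  unfold sumHper
  rw [List.map_map]
  congr 1
  exact List.map_congr_left fun Q _ => Q.hper_map h.level

lemma SimplePolygon.hper_le_per (Q : SimplePolygon) : Q.hper ≤ Q.per :=
  horizontalWeight_le_weight _

lemma sumHper_le_sumPer (F : List SimplePolygon) : sumHper F ≤ sumPer F :=
  List.sum_le_sum fun Q _ => Q.hper_le_per

/-! ### Joining paths -/

lemma pathEdges_join {l T : List Plane} {z : Plane} (h : l.getLast? = some z) :
    pathEdges (l ++ T) = pathEdges l ++ pathEdges (z :: T) := by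
  obtain ⟨X, rfl⟩ := List.getLast?_eq_some_iff.1 h
  rw [List.append_assoc, List.singleton_append, pathEdges_append_cons]

lemma isChain_join {R : Plane → Plane → Prop} {l T : List Plane} {z : Plane}
    (h : l.getLast? = some z) (h1 : l.IsChain R) (h2 : (z :: T).IsChain R) :
    (l ++ T).IsChain R := by
  rw [isChain_iff_pathEdges] at *
  rw [pathEdges_join h]
  intro e he
  rcases List.mem_append.1 he with he | he
  · exact h1 e he
  · exact h2 e he

lemma getLast?_join {l T : List Plane} {z : Plane} (h : l.getLast? = some z) :
    (l ++ T).getLast? = (z :: T).getLast? := by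
  obtain ⟨X, rfl⟩ := List.getLast?_eq_some_iff.1 h
  rw [List.append_assoc, List.singleton_append, List.getLast?_append_of_ne_nil _ (by simp)]

lemma SteepUp.stairEdge {s : ℝ} {u v : Plane} (h : SteepUp s u v) : StairEdge s u v := Or.inr h

lemma le_of_steepUp {s : ℝ} {l : List Plane} {z : Plane} (h : l.IsChain (StairEdge s))
    (hz : l.getLast? = some z) {v : Plane} (hv : v ∈ l) : v 1 ≤ z 1 := by
  obtain ⟨X, rfl⟩ := List.getLast?_eq_some_iff.1 hz
  have := List.pairwise_append.1 (stair_pairwise h)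
  rcases List.mem_append.1 hv with hv | hv
  · rcases this.2.2 v hv z (by simp) with h | h
    · exact h.le
    · exact h.1.le
  · simp at hv; rw [hv]

lemma horizontalWeight_steepUp {s : ℝ} {l : List Plane} (h : l.IsChain (SteepUp s)) :
    horizontalWeight (pathEdges l) = 0 := by
  rw [isChain_iff_pathEdges] at h
  unfold horizontalWeight
  apply List.sum_eq_zero
  intro x hx
  obtain ⟨e, he, rfl⟩ := List.mem_map.1 hx
  rw [if_neg (h e he).1.ne]

/-! ### The lower envelope of steep paths -/

/-- There is a steep path `G` from `(xA, a)` to `(xB, a + ht R)` such that the part between `G` and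
the rows `R` is tiled by fuzzy staircases, with total perimeters bounded in terms of `W`. -/
def EnvW (s xA a : ℝ) (R : List (ℝ × ℝ)) (xB W : ℝ) : Prop :=
  ∃ (T : List Plane) (F : List SimplePolygon),
    (pt xA a :: T).getLast? = some (pt xB (a + ht R)) ∧ (pt xA a :: T).IsChain (SteepUp s) ∧
    (∀ Q ∈ F, IsFuzzyStaircase s Q) ∧
    (∀ᵐ p : Plane, cnt F p = rowCount a R p - hcount (pathEdges (pt xA a :: T)) p) ∧
    (∀ v ∈ pt xA a :: T, v = pt xA a ∨ v = pt xB (a + ht R) ∨ (∃ r ∈ R, r.2 ≤ v 0) ∨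
      (xA < v 0 ∧ xB < v 0)) ∧
    sumHper F ≤ 2 * W ∧ sumPer F ≤ (2 + 4 * s) * W

/-- The bounds hold in terms of the variation of the rows. -/
def Env (s xA a : ℝ) (R : List (ℝ × ℝ)) (xB : ℝ) : Prop := EnvW s xA a R xB (pvar xA R xB)

/-- The upper right corners of the rows are to the right of the line of slope `s` given by `κ`,
strictly except perhaps for the last one. -/
def Clear (s κ : ℝ) : ℝ → List (ℝ × ℝ) → Prop
  | _, [] => True
  | a, r :: R => κ ≤ s * r.2 - (a + r.1) ∧ (R ≠ [] → κ < s * r.2 - (a + r.1)) ∧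
      Clear s κ (a + r.1) R

lemma Clear.right {s κ a : ℝ} {R R' : List (ℝ × ℝ)} (h : Clear s κ a (R ++ R')) :
    Clear s κ (a + ht R) R' := by
  induction R generalizing a with
  | nil => simpa using h
  | cons r R ih =>
    have := ih h.2.2
    rwa [add_assoc, ← ht_cons] at this

lemma clear_of_forall {s κ a : ℝ} {R : List (ℝ × ℝ)}
    (h : ∀ X r Z, R = X ++ r :: Z → κ ≤ s * r.2 - (a + ht X + r.1) ∧
      (Z ≠ [] → κ < s * r.2 - (a + ht X + r.1))) : Clear s κ a R := by
  induction R generalizing a with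
  | nil => trivial
  | cons r R ih =>
    have h0 := h [] r R rfl
    simp only [ht_nil, add_zero] at h0
    refine ⟨h0.1, h0.2, ih ?_⟩
    intro X q Z hX
    have := h (r :: X) q Z (by rw [hX]; rfl)
    rwa [ht_cons, ← add_assoc] at this

/-- The rows `R`, from `(μ, a)` on, are replaced by a staircase path `S` with vertical edges
replaced by steep paths. -/
structure Stairs (s κ μ a : ℝ) (R : List (ℝ × ℝ)) (S L : List Plane) (F : List SimplePolygon) :
    Prop where
  repl : IsLambdaReplacement s (pt μ a :: S) (pt μ a :: L)
  rect : (pt μ a :: S).IsChain fun u v => (u 0 = v 0 ∨ u 1 = v 1) ∧ u 0 ≤ v 0 ∧ u 1 ≤ v 1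
  chain : (pt μ a :: L).IsChain (StairEdge s)
  last : (pt μ a :: L).getLast? = some (pt (lastX μ R) (a + ht R))
  clear : ∀ v ∈ L, v = pt (lastX μ R) (a + ht R) ∨ (v 1 < a + ht R ∧ κ < s * v 0 - v 1)
  fuzzy : ∀ Q ∈ F, IsFuzzyStaircase s Q
  count : ∀ᵐ p : Plane, cnt F p = rowCount a R p - hcount (pathEdges (pt μ a :: L)) p
  hper : sumHper F ≤ 2 * (tv μ R - (lastX μ R - μ))
  per : sumPer F ≤ (2 + 4 * s) * (tv μ R - (lastX μ R - μ))
  hw : horizontalWeight (pathEdges (pt μ a :: L)) = lastX μ R - μ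

namespace Stairs

variable {s κ μ a : ℝ} {R : List (ℝ × ℝ)} {S L : List Plane} {F : List SimplePolygon}

lemma nil : Stairs s κ μ a [] [] [] [] where
  repl := .single _
  rect := by simp
  chain := by simp
  last := by simp
  clear := by simp
  fuzzy := by simp
  count := by simp
  hper := by simp
  per := by simp
  hw := by simp

/-- A row whose value is the current abscissa is itself a vertical edge of the stairs and requires
no tile. -/
lemma row {h : ℝ} (hh : 0 < h) (H : Stairs s κ μ (a + h) R S L F) (hR : ∀ r ∈ R, 0 < r.1)
    (hκ : R ≠ [] → κ < s * μ - (a + h)) :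
    Stairs s κ μ a ((h, μ) :: R) (pt μ (a + h) :: S) (pt μ (a + h) :: L) F where
  repl := IsLambdaReplacement.vertical _ _ [] _ _ (by simp)
    ⟨by simp, by simp [IsSteepEdge], Or.inl (by simp [Ascends, hh])⟩ H.repl
  rect := List.isChain_cons_cons.2 ⟨by simp [hh.le], H.rect⟩
  chain := List.isChain_cons_cons.2 ⟨Or.inr (by simp [hh, IsSteepEdge]), H.chain⟩
  last := by
    have := H.last
    simp only [List.getLast?_cons_cons, lastX_cons, ht_cons, ← add_assoc]
    exact this
  clear := by
    intro v hv
    simp only [lastX_cons, ht_cons, ← add_assoc]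
    rcases List.mem_cons.1 hv with rfl | hv
    · by_cases hR0 : R = []
      · left; simp [hR0]
      · right
        have := ht_pos hR hR0
        simp only [pt_zero, pt_one]
        exact ⟨by linarith, hκ hR0⟩
    · exact H.clear v hv
  fuzzy := H.fuzzy
  count := by
    filter_upwards [H.count] with p hp
    rw [hp, pathEdges_cons_cons, hcount_cons, ← rowCount_single, rowCount_cons, rowCount_cons]
    simp
  hper := by simpa using H.hper
  per := by simpa using H.per
  hw := by
    rw [pathEdges_cons_cons, horizontalWeight_cons, H.hw, if_neg (by simp [hh.ne'])]
    simp

/-- A pocket of rows beyond the abscissa `μ`, closed by a row of value `μ`, is spanned by a single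
vertical edge of the staircase. The steep path of its envelope is the Λ-path which replaces this
edge, and the tiles of the envelope fill the pocket. The pinned variation of the pocket is exactly
what it adds to the variation in excess of the net progress. -/
lemma group {g : List (ℝ × ℝ)} {h : ℝ} (hg : ∀ r ∈ g, 0 < r.1) (hg' : ∀ r ∈ g, μ < r.2)
    (hg0 : g ≠ []) (E : Env s μ a g μ) (H : Stairs s κ μ (a + ht g) ((h, μ) :: R) S L F)
    (hR : ∀ r ∈ (h, μ) :: R, 0 < r.1) (hs : 0 < s) (hκ : κ < s * μ - (a + ht g)) :
    ∃ S' L' F', Stairs s κ μ a (g ++ (h, μ) :: R) S' L' F' := by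
  obtain ⟨T, F', h1, h2, h3, h4, h5, h6, h7⟩ := E
  have hpos := ht_pos hg hg0
  have hposR := ht_pos hR (by simp)
  have hT : T ≠ [] := by
    rintro rfl
    simp only [List.getLast?_singleton, Option.some.injEq] at h1
    have := congrArg (fun p : Plane => p 1) h1
    simp only [pt_one] at this
    linarith
  have h2' : (pt μ a :: T).IsChain (StairEdge s) := h2.imp fun _ _ => SteepUp.stairEdge
  have hTl : T.getLast? = some (pt μ (a + ht g)) := by
    obtain ⟨t, T, rfl⟩ := List.exists_cons_of_ne_nil hT
    simpa using h1
  obtain ⟨M, hM⟩ := List.getLast?_eq_some_iff.1 hTl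
  have hlast : lastX μ (g ++ (h, μ) :: R) = lastX μ ((h, μ) :: R) := by
    rw [lastX_append]; rfl
  have htv : tv μ (g ++ (h, μ) :: R) = pvar μ g μ + tv μ ((h, μ) :: R) := by
    rw [tv_append]; unfold pvar; simp [add_assoc]
  have hht : a + ht (g ++ (h, μ) :: R) = a + ht g + ht ((h, μ) :: R) := by
    rw [ht_append, add_assoc]
  refine ⟨pt μ (a + ht g) :: S, T ++ L, F' ++ F, ?_, ?_, ?_, ?_, ?_, ?_, ?_, ?_, ?_, ?_⟩
  · have := IsLambdaReplacement.vertical (s := s) (pt μ a) (pt μ (a + ht g)) M S L (by simp)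
      ⟨by simp, by
        rw [← hM]; exact h2.imp fun _ _ k => k.2, Or.inl (by
        rw [← hM]; exact h2.imp fun _ _ k => k.1)⟩ H.repl
    rw [hM]
    simpa using this
  · exact List.isChain_cons_cons.2 ⟨by simp [hpos.le], H.rect⟩
  · exact isChain_join (l := pt μ a :: T) h1 h2' H.chain
  · rw [← List.cons_append, getLast?_join h1, H.last, hlast, hht]
  · intro v hv
    rw [hlast, hht]
    rcases List.mem_append.1 hv with hv | hv
    · right
      have hv' : v ∈ pt μ a :: T := List.mem_cons_of_mem _ hv
      have k1 := le_of_steepUp h2' h1 hv'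
      simp only [pt_one] at k1
      -- The condition on vertices in `EnvW` keeps the steep path weakly to the right of `μ`, so it
      -- also clears the line.
      have k2 : μ ≤ v 0 := by
        rcases h5 v hv' with h | h | ⟨r, hr, h⟩ | h
        · rw [h]; simp
        · rw [h]; simp
        · exact (hg' r hr).le.trans h
        · exact h.1.le
      have k3 := mul_le_mul_of_nonneg_left k2 hs.le
      constructor <;> linarith
    · exact H.clear v hv
  · intro Q hQ
    rcases List.mem_append.1 hQ with hQ | hQ
    · exact h3 Q hQ
    · exact H.fuzzy Q hQ
  · filter_upwards [h4, H.count] with p hp hp'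
    rw [cnt_append, hp, hp', ← List.cons_append, pathEdges_join h1, hcount_append, rowCount_append]
    ring
  · rw [sumHper_append, htv, hlast]
    linarith [H.hper]
  · rw [sumPer_append, htv, hlast]
    have := H.per
    have e : (2 + 4 * s) * (pvar μ g μ + tv μ ((h, μ) :: R) - (lastX μ ((h, μ) :: R) - μ)) =
      (2 + 4 * s) * pvar μ g μ + (2 + 4 * s) * (tv μ ((h, μ) :: R) - (lastX μ ((h, μ) :: R) - μ)) := by
      ring
    rw [e]
    linarith
  · rw [← List.cons_append, pathEdges_join h1, horizontalWeight_append, H.hw,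
      horizontalWeight_steepUp h2, hlast, zero_add]

/-- The initial horizontal edge changes the variation and the net progress by the same amount, so
the bounds persist. -/
lemma jump {μ' : ℝ} (hμ : μ < μ') (hR0 : R ≠ []) (hR : ∀ r ∈ R, 0 < r.1)
    (hR' : ∀ r ∈ R, μ' ≤ r.2) (H : Stairs s κ μ' a R S L F) (hκ : κ < s * μ' - a) :
    Stairs s κ μ a R (pt μ' a :: S) (pt μ' a :: L) F := by
  have hl : lastX μ R = lastX μ' R := by
    obtain ⟨r, R', rfl⟩ := List.exists_cons_of_ne_nil hR0
    rfl
  have ht' : tv μ R = tv μ' R + (μ' - μ) := by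
    obtain ⟨r, R', rfl⟩ := List.exists_cons_of_ne_nil hR0
    have := hR' r (by simp)
    rw [tv_cons, tv_cons, abs_of_nonneg (by linarith), abs_of_nonneg (by linarith)]; ring
  have hpos := ht_pos hR hR0
  refine ⟨?_, ?_, ?_, ?_, ?_, H.fuzzy, ?_, ?_, ?_, ?_⟩
  · exact .horizontal _ _ _ _ (by simp) H.repl
  · exact List.isChain_cons_cons.2 ⟨by simp [hμ.le], H.rect⟩
  · exact List.isChain_cons_cons.2 ⟨Or.inl (by simp [hμ]), H.chain⟩
  · rw [List.getLast?_cons_cons, H.last, hl]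
  · intro v hv
    rw [hl]
    rcases List.mem_cons.1 hv with rfl | hv
    · right
      simp only [pt_zero, pt_one]
      exact ⟨by linarith, hκ⟩
    · exact H.clear v hv
  · filter_upwards [H.count] with p hp
    rw [hp, pathEdges_cons_cons, hcount_cons, hc_level (by simp), zero_add]
  · rw [ht', hl]; linarith [H.hper]
  · rw [ht', hl]
    have := H.per
    have e : tv μ' R + (μ' - μ) - (lastX μ' R - μ) = tv μ' R - (lastX μ' R - μ') := by ring
    rwa [e]
  · rw [pathEdges_cons_cons, horizontalWeight_cons, H.hw, hl, if_pos (by simp), dist_level (by simp)]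
    simp only [pt_zero]
    rw [abs_of_pos (by linarith)]; ring

end Stairs

/-! ### Stairs along rows to the right of a line -/

/-- The set of row values. -/
def values (R : List (ℝ × ℝ)) : Set ℝ := {x | ∃ r ∈ R, r.2 = x}

lemma finite_values (R : List (ℝ × ℝ)) : (values R).Finite := by
  refine ((R.map Prod.snd).finite_toSet).subset ?_
  rintro x ⟨r, hr, rfl⟩
  exact List.mem_map.2 ⟨r, hr, rfl⟩

lemma exists_first_row {μ : ℝ} {R : List (ℝ × ℝ)} (h : ∃ r ∈ R, r.2 = μ) (h' : ∀ r ∈ R, μ ≤ r.2) :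
    ∃ g t R', R = g ++ (t, μ) :: R' ∧ ∀ r ∈ g, μ < r.2 := by
  induction R with
  | nil => simp at h
  | cons q R ih =>
    by_cases hq : q.2 = μ
    · exact ⟨[], q.1, R, by rw [← hq]; rfl, by simp⟩
    · obtain ⟨g, t, R', hR, hg⟩ := ih (by
        obtain ⟨r, hr, hr'⟩ := h
        rcases List.mem_cons.1 hr with rfl | hr
        · exact absurd hr' hq
        · exact ⟨r, hr, hr'⟩) fun r hr => h' r (by simp [hr])
      refine ⟨q :: g, t, R', by rw [hR]; rfl, ?_⟩
      intro r hr
      rcases List.mem_cons.1 hr with rfl | hr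
      · exact lt_of_le_of_ne (h' r (by simp)) (Ne.symm hq)
      · exact hg r hr

lemma exists_min_value {R : List (ℝ × ℝ)} (h : R ≠ []) :
    ∃ μ, (∃ r ∈ R, r.2 = μ) ∧ ∀ r ∈ R, μ ≤ r.2 := by
  induction R with
  | nil => exact absurd rfl h
  | cons q R ih =>
    by_cases hR : R = []
    · exact ⟨q.2, ⟨q, by simp, rfl⟩, by simp [hR]⟩
    · obtain ⟨μ, ⟨r, hr, rfl⟩, hμ⟩ := ih hR
      rcases le_total q.2 r.2 with hq | hq
      · refine ⟨q.2, ⟨q, by simp, rfl⟩, ?_⟩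
        intro r' hr'
        rcases List.mem_cons.1 hr' with rfl | hr'
        · exact le_rfl
        · exact hq.trans (hμ r' hr')
      · refine ⟨r.2, ⟨r, by simp [hr], rfl⟩, ?_⟩
        intro r' hr'
        rcases List.mem_cons.1 hr' with rfl | hr'
        · exact hq
        · exact hμ r' hr'

/-- The first row of minimal value `μ'` has below it a pocket of larger values and above it fewer
rows of values at least `μ'`. The stairs jump to the abscissa `μ'`, pass the pocket and the row
vertically and continue recursively, so the abscissa runs through the suffix minima and never
decreases. The pocket omits the value `μ'`, which makes its set of values a proper subset of `V`. -/
lemma Stairs.exists_stairs {s κ : ℝ} (hs : 0 < s) {V : Set ℝ}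
    (hV : ∀ g μ a, g ≠ [] → (∀ r ∈ g, 0 < r.1) → (∀ r ∈ g, μ < r.2) → values g ⊂ V →
      Env s μ a g μ) (n : ℕ) :
    ∀ R : List (ℝ × ℝ), R.length ≤ n → ∀ μ a, (∀ r ∈ R, 0 < r.1) → (∀ r ∈ R, μ ≤ r.2) →
      Clear s κ a R → values R ⊆ V → ∃ S L F, Stairs s κ μ a R S L F := by
  induction n with
  | zero =>
    intro R hn μ a _ _ _ _
    obtain rfl := List.length_eq_zero_iff.1 (Nat.le_zero.1 hn)
    exact ⟨_, _, _, Stairs.nil⟩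
  | succ n ih =>
    intro R hn μ a h1 h2 h3 h4
    by_cases hR : R = []
    · subst hR; exact ⟨_, _, _, Stairs.nil⟩
    obtain ⟨μ', hμ', hmin⟩ := exists_min_value hR
    obtain ⟨g, t, R', rfl, hg⟩ := exists_first_row hμ' hmin
    have hc := h3.right
    have key : ∃ S L F, Stairs s κ μ' a (g ++ (t, μ') :: R') S L F := by
      have ht0 : 0 < t := h1 (t, μ') (by simp)
      obtain ⟨S, L, F, H⟩ := ih R' (by simp at hn; omega) μ' (a + ht g + t)
        (fun r hr => h1 r (by simp [hr])) (fun r hr => hmin r (by simp [hr])) hc.2.2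
        (fun x ⟨r, hr, hx⟩ => h4 ⟨r, by simp [hr], hx⟩)
      have H' := H.row ht0 (fun r hr => h1 r (by simp [hr])) hc.2.1
      by_cases hg0 : g = []
      · subst hg0
        simp only [ht_nil, add_zero, List.nil_append] at H' ⊢
        exact ⟨_, _, _, H'⟩
      · have hg1 : ∀ r ∈ g, 0 < r.1 := fun r hr => h1 r (by simp [hr])
        refine Stairs.group hg1 hg hg0 (hV g μ' a hg0 hg1 hg ?_) H' (fun r hr => h1 r (by simp [hr]))
          hs (by have := hc.1; simp only at this; linarith)
        refine ⟨fun x ⟨r, hr, hx⟩ => h4 ⟨r, by simp [hr], hx⟩, fun hsub => ?_⟩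
        obtain ⟨r, hr, hr'⟩ := hsub (h4 ⟨(t, μ'), by simp, rfl⟩)
        exact (hg r hr).ne' hr'
    obtain ⟨S, L, F, H⟩ := key
    obtain ⟨r0, hr0, hr0'⟩ := hμ'
    rcases eq_or_lt_of_le (hr0' ▸ h2 r0 hr0) with rfl | hlt
    · exact ⟨_, _, _, H⟩
    · refine ⟨_, _, _, H.jump hlt hR h1 hmin ?_⟩
      have := hc.1
      have h5 := ht_nonneg (R := g) fun r hr => h1 r (by simp [hr])
      have h6 : 0 < t := h1 (t, μ') (by simp)
      simp only at this
      linarith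

lemma Clear.lt {s κ a : ℝ} {R : List (ℝ × ℝ)} (h : Clear s κ a R) (h1 : ∀ r ∈ R, 0 < r.1) :
    ∀ r ∈ R, κ + a < s * r.2 := by
  induction R generalizing a with
  | nil => simp
  | cons q R ih =>
    have hq := h1 q (by simp)
    intro r hr
    rcases List.mem_cons.1 hr with rfl | hr
    · linarith [h.1]
    · linarith [ih h.2.2 (fun r hr => h1 r (by simp [hr])) r hr]

lemma Clear.last {s κ a μ : ℝ} {R : List (ℝ × ℝ)} (h : Clear s κ a R) (hR : R ≠ []) :
    κ + (a + ht R) ≤ s * lastX μ R := by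
  induction R generalizing a μ with
  | nil => exact absurd rfl hR
  | cons q R ih =>
    by_cases h0 : R = []
    · subst h0
      simp only [ht_cons, ht_nil, add_zero, lastX_cons, lastX_nil]
      linarith [h.1]
    · rw [ht_cons, lastX_cons]
      have := ih (μ := q.2) h.2.2 h0
      linarith

/-- Up along the path and down along the segment, the vertical variation is twice the height;
`weight_le` doubles it once more. -/
lemma per_le {s : ℝ} (hs : 1 ≤ s) {A B : Plane} {M : List Plane} (h : IsRightChain A M B)
    (hE : ∀ e ∈ pathEdges (A :: (M ++ [B])), e.1 1 = e.2 1 ∨ IsSteepEdge s e.1 e.2)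
    (hBA : IsSteepEdge s B A) :
    h.polygon.per ≤ h.polygon.hper + 4 * (B 1 - A 1) := by
  have h1 : weight (cyclicEdges (A :: (M ++ [B]))) ≤
      horizontalWeight (cyclicEdges (A :: (M ++ [B]))) +
        2 * vWeight (cyclicEdges (A :: (M ++ [B]))) := by
    apply weight_le hs
    intro e he
    rw [cyclicEdges_chain, List.mem_append, List.mem_singleton] at he
    rcases he with he | rfl
    · exact hE e he
    · exact Or.inr hBA
  have h2 : vWeight (cyclicEdges (A :: (M ++ [B]))) = 2 * (B 1 - A 1) := by
    rw [cyclicEdges_chain, vWeight_append, vWeight_mono h.mono, vWeight_cons, vWeight_nil,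
      abs_sub_comm, abs_of_nonneg (by have := h.lt; simp only; linarith)]
    simp; ring
  show weight (cyclicEdges (A :: (M ++ [B]))) ≤ horizontalWeight (cyclicEdges (A :: (M ++ [B]))) + _
  linarith

/-- The part between a line of slope `s` and rows to the right of it is tiled. -/
lemma lower_gap {s xA a : ℝ} {R : List (ℝ × ℝ)} {V : Set ℝ} (hs : 1 ≤ s) (hR0 : R ≠ [])
    (h1 : ∀ r ∈ R, 0 < r.1) (hc : Clear s (s * xA - a) a R)
    (hV : ∀ g μ a, g ≠ [] → (∀ r ∈ g, 0 < r.1) → (∀ r ∈ g, μ < r.2) → values g ⊂ V →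
      Env s μ a g μ) (hRV : values R ⊆ V) :
    ∃ F : List SimplePolygon, (∀ Q ∈ F, IsFuzzyStaircase s Q) ∧
      (∀ᵐ p : Plane, cnt F p =
        rowCount a R p - _root_.hc (pt xA a, pt (xA + ht R / s) (a + ht R)) p) ∧
      sumHper F ≤ 2 * tv xA R ∧ sumPer F ≤ (2 + 4 * s) * tv xA R := by
  have hs0 : 0 < s := by linarith
  obtain ⟨μ, hμ, hmin⟩ := exists_min_value hR0
  obtain ⟨S, L, F, H⟩ := Stairs.exists_stairs hs0 hV R.length R le_rfl μ a h1 hmin hc hRV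
  have hpos := ht_pos h1 hR0
  have hlt := hc.lt h1
  have hAμ : xA < μ := by
    obtain ⟨r, hr, rfl⟩ := hμ
    have := hlt r hr
    by_contra hcon
    have := mul_le_mul_of_nonneg_left (not_lt.1 hcon) hs0.le
    linarith
  have hE0 := hc.last (μ := μ) hR0
  have hstart : s * xA - a < s * μ - a := by nlinarith
  have hlX : lastX xA R = lastX μ R := by
    obtain ⟨r, R', rfl⟩ := List.exists_cons_of_ne_nil hR0
    rfl
  have htv : tv xA R = tv μ R + (μ - xA) := by
    obtain ⟨r, R', rfl⟩ := List.exists_cons_of_ne_nil hR0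
    have := hmin r (by simp)
    rw [tv_cons, tv_cons, abs_of_nonneg (by linarith), abs_of_nonneg (by linarith)]; ring
  set E : Plane := pt (lastX μ R) (a + ht R) with hE
  set O : Plane := pt (xA + ht R / s) (a + ht R) with hO
  set A : Plane := pt xA a with hA
  have hclear : ∀ v ∈ pt μ a :: L, v = E ∨ (v 1 < a + ht R ∧ s * xA - a < s * v 0 - v 1) := by
    intro v hv
    rcases List.mem_cons.1 hv with rfl | hv
    · right
      simp only [pt_zero, pt_one]
      exact ⟨by linarith, hstart⟩
    · exact H.clear v hv
  obtain ⟨M0, hM0⟩ := List.getLast?_eq_some_iff.1 H.last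
  have hM0ne : M0 ≠ [] := by
    rintro rfl
    have := (List.cons_eq_cons.1 hM0).1
    have := congrArg (fun p : Plane => p 1) this
    simp only [pt_one] at this
    linarith
  have hpw := stair_pairwise H.chain
  rw [hM0] at hpw
  have hM0c : ∀ v ∈ M0, v 1 < a + ht R ∧ s * xA - a < s * v 0 - v 1 := by
    intro v hv
    rcases hclear v (by rw [hM0]; simp [hv]) with h | h
    · have := (List.pairwise_append.1 hpw).2.2 v hv _ (List.mem_singleton.2 rfl)
      rw [h] at this
      rcases this with h | h
      · exact absurd h (lt_irrefl _)
      · exact absurd h.2 (lt_irrefl _)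
    · exact h
  have hside : ∀ v : Plane, s * xA - a < s * v 0 - v 1 →
      (O 0 - A 0) * (v 1 - A 1) < (v 0 - A 0) * (O 1 - A 1) := by
    intro v hv
    simp only [hO, hA, pt_zero, pt_one, add_sub_cancel_left]
    have e : ht R / s * (v 1 - a) = ht R * ((v 1 - a) / s) := by ring
    rw [e, mul_comm (v 0 - xA)]
    refine mul_lt_mul_of_pos_left ?_ hpos
    rw [div_lt_iff₀ hs0]
    linarith
  have hchain : (A :: pt μ a :: L).IsChain (StairEdge s) :=
    List.isChain_cons_cons.2 ⟨Or.inl (by simp [hA, hAμ]), H.chain⟩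
  have hslope : O 0 - A 0 = ht R / s := by simp [hO, hA]
  have hslope' : HasSlope s A O := by
    constructor
    · intro h
      have : 0 < ht R / s := div_pos hpos hs0
      rw [← hslope, h] at this
      simp at this
    · rw [hslope]
      simp only [hO, hA, pt_one]
      field_simp
      ring
  have hrect : IsStaircase (pt μ a :: S) :=
    ⟨H.rect.imp fun _ _ h => h.1, Or.inl (H.rect.imp fun _ _ h => h.2.1),
      Or.inl (H.rect.imp fun _ _ h => h.2.2)⟩
  have hsO : ht R = s * (O 0 - A 0) := by rw [hslope]; field_simp
  have hA0 : A 0 = xA := by simp [hA]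
  have hA1 : A 1 = a := by simp [hA]
  have hO1 : O 1 = a + ht R := by simp [hO]
  have hEO : O 0 ≤ lastX μ R := by
    have h2 : s * (O 0) ≤ s * lastX μ R := by rw [hA0] at hsO; linarith
    exact le_of_mul_le_mul_left h2 hs0
  have hsteep : IsSteepEdge s O A := Or.inr (Or.inl ⟨hslope'.1.symm, by linarith [hslope'.2]⟩)
  have hhw : horizontalWeight (pathEdges (A :: pt μ a :: L)) = lastX μ R - xA := by
    rw [pathEdges_cons_cons, horizontalWeight_cons, if_pos (by simp [hA]), H.hw,
      dist_level (by simp [hA])]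
    simp only [hA, pt_zero]
    rw [abs_of_pos (by linarith)]; ring
  have hedges : ∀ e ∈ pathEdges (A :: pt μ a :: L), e.1 1 = e.2 1 ∨ IsSteepEdge s e.1 e.2 :=
    fun e he => (isChain_iff_pathEdges.1 hchain e he).imp (fun h => h.1) fun h => h.2
  have hF2 := H.hper
  have hF3 := H.per
  have hx1 : xA ≤ O 0 := by rw [← hA0]; nlinarith
  -- If the last corner `E` is on the line, the horizontal side of the fuzzy staircase is the bottom
  -- edge, between `(μ, a)` and `A`. Otherwise it is the top edge from `E` to `O`; the bottom edge
  -- then belongs to the stairs, which are traversed downwards from `E` to `A`.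
  rcases eq_or_lt_of_le hEO with hEO | hEO
  · have hEO' : E = O := plane_ext (by rw [hEO]; simp [hE]) (by simp [hE, hO])
    rw [← hE, hEO'] at hM0
    have hC : IsRightChain A M0 O := by
      rw [hM0] at hchain
      refine ⟨hchain.imp fun u v h => by simpa using h.le, hchain.imp fun u v h => ?_,
        noBack_stair hchain, hM0ne, fun v hv => hside v (hM0c v hv).2, by rw [hA1, hO1]; linarith⟩
      rintro rfl
      rcases h.lex with h | h
      · exact lt_irrefl _ h
      · exact lt_irrefl _ h.2
    have hl : A :: (M0 ++ [O]) = A :: pt μ a :: L := by rw [hM0]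
    have hper := per_le hs hC (by rw [hl]; exact hedges) hsteep
    have hhper : hC.polygon.hper = lastX μ R - xA := by
      show horizontalWeight (cyclicEdges (A :: (M0 ++ [O]))) = _
      rw [cyclicEdges_chain, hl, horizontalWeight_append, hhw, horizontalWeight_cons,
        if_neg (by rw [hO1, hA1]; linarith)]
      simp
    refine ⟨hC.polygon :: F, ?_, ?_, ?_, ?_⟩
    · intro Q hQ
      rcases List.mem_cons.1 hQ with rfl | hQ
      · refine ⟨pt μ a, A, O, pt μ a :: S, pt μ a :: L, by simp [hA], Or.inl hslope', hrect, H.repl,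
          rfl, by rw [H.last, ← hE, hEO'], Or.inl ?_⟩
        show _ ~r (A :: (M0 ++ [O]))
        rw [hM0]
        exact List.isRotated_append (l := M0 ++ [O]) (l' := [A])
      · exact H.fuzzy Q hQ
    · filter_upwards [H.count, ae_not_mem_trace (cyclicEdges (A :: (M0 ++ [O])))] with p hp hp'
      rw [cnt_cons, hp]
      have := hC.indicator hp'
      rw [show hC.polygon.region = IsRightChain.region A M0 O from rfl, this, hl,
        pathEdges_cons_cons, hcount_cons, hc_level (by simp [hA])]
      ring
    · rw [sumHper_cons, hhper, htv]
      linarith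
    · rw [sumPer_cons, htv]
      -- The inclined side has slope `s`, so the height is `s` times the width. Together with
      -- `per_le` this yields the term `4 * s`.
      have e1 : O 1 - A 1 = s * (lastX μ R - xA) := by
        rw [hO1, hA1, ← hEO, ← hA0]; linarith
      rw [e1, hhper] at hper
      nlinarith
  · have hM0' : pt μ a :: L = M0 ++ [E] := hM0
    have hjoin : (A :: pt μ a :: L).getLast? = some E := by
      rw [hM0', ← List.cons_append]; exact List.getLast?_concat
    have hC : IsRightChain A (pt μ a :: L) O := by
      have hm : (A :: pt μ a :: L).IsChain fun u v => u 1 ≤ v 1 ∧ u ≠ v :=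
        hchain.imp fun u v h => ⟨h.le, by
          rintro rfl
          rcases h.lex with h | h
          · exact lt_irrefl _ h
          · exact lt_irrefl _ h.2⟩
      have hm' : (A :: ((pt μ a :: L) ++ [O])).IsChain fun u v => u 1 ≤ v 1 ∧ u ≠ v :=
        isChain_join hjoin hm (by
          simp only [List.isChain_cons_cons, List.isChain_singleton, and_true]
          refine ⟨by simp [hE, hO], fun h => ?_⟩
          rw [← h] at hEO
          simp [hE] at hEO)
      refine ⟨hm'.imp fun u v h => by simpa using h.1, hm'.imp fun u v h => h.2, ?_, by simp, ?_,
        by rw [hA1, hO1]; linarith⟩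
      · intro u v w huvw k1 k2
        rw [← List.cons_append, List.infix_concat_iff] at huvw
        rcases huvw with ⟨X, hX⟩ | huvw
        · exfalso
          rw [hM0'] at hX
          have := congrArg List.reverse hX
          simp only [List.reverse_append, List.reverse_cons, List.reverse_nil, List.nil_append,
            List.cons_append, List.cons.injEq] at this
          obtain ⟨-, rfl, h3⟩ := this
          have hu : u ∈ M0.reverse ++ [A] := by rw [← h3]; simp
          have : u 1 < a + ht R := by
            rcases List.mem_append.1 hu with hu | hu
            · exact (hM0c u (List.mem_reverse.1 hu)).1
            · rw [List.mem_singleton.1 hu, hA1]; linarith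
          rw [k1] at this
          simp [hE] at this
        · exact noBack_stair hchain u v w huvw k1 k2
      · intro v hv
        rcases hclear v hv with rfl | h
        · refine hside _ ?_
          simp only [hE, pt_zero, pt_one]
          have := mul_lt_mul_of_pos_left hEO hs0
          rw [hA0] at hsO
          linarith
        · exact hside v h.2
    have hl : pathEdges (A :: ((pt μ a :: L) ++ [O])) =
        pathEdges (A :: pt μ a :: L) ++ [(E, O)] := by
      rw [← List.cons_append, pathEdges_join hjoin]; simp
    have hper := per_le hs hC (by
      rw [hl]
      intro e he
      rcases List.mem_append.1 he with he | he
      · exact hedges e he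
      · rw [List.mem_singleton.1 he]; left; simp [hE, hO]) hsteep
    have hhper : hC.polygon.hper = lastX μ R - xA + (lastX μ R - O 0) := by
      show horizontalWeight (cyclicEdges (A :: ((pt μ a :: L) ++ [O]))) = _
      rw [cyclicEdges_chain, hl, horizontalWeight_append, horizontalWeight_append, hhw,
        horizontalWeight_cons, horizontalWeight_cons, if_pos (by simp [hE, hO]),
        if_neg (by rw [hO1, hA1]; linarith), dist_level (by simp [hE, hO]), abs_sub_comm,
        abs_of_pos (by simp only [hE, pt_zero]; linarith)]
      simp [hE]
    refine ⟨hC.polygon :: F, ?_, ?_, ?_, ?_⟩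
    · intro Q hQ
      rcases List.mem_cons.1 hQ with rfl | hQ
      · have hr : IsLambdaReplacement s (A :: pt μ a :: S) (A :: pt μ a :: L) :=
          .horizontal _ _ _ _ (by simp [hA]) H.repl
        have hrect' : (A :: pt μ a :: S).IsChain
            fun u v => (u 0 = v 0 ∨ u 1 = v 1) ∧ u 0 ≤ v 0 ∧ u 1 ≤ v 1 :=
          List.isChain_cons_cons.2 ⟨by simp [hA, hAμ.le], H.rect⟩
        refine ⟨E, O, A, (A :: pt μ a :: S).reverse, (A :: pt μ a :: L).reverse, by simp [hE, hO],
          Or.inl ⟨hslope'.1.symm, by linarith [hslope'.2]⟩, ⟨?_, Or.inr ?_, Or.inr ?_⟩, hr.reverse,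
          by rw [List.head?_reverse, hjoin], by rw [List.getLast?_reverse]; rfl, Or.inr ?_⟩
        · rw [List.isChain_reverse]
          exact hrect'.imp fun u v h => h.1.imp Eq.symm Eq.symm
        · rw [List.isChain_reverse]
          exact hrect'.imp fun u v h => h.2.1
        · rw [List.isChain_reverse]
          exact hrect'.imp fun u v h => h.2.2
        · show _ ~r (A :: ((pt μ a :: L) ++ [O]))
          rw [List.reverse_append, List.reverse_reverse]
          exact List.isRotated_append (l := [O]) (l' := A :: pt μ a :: L)
      · exact H.fuzzy Q hQ
    · filter_upwards [H.count, ae_not_mem_trace (cyclicEdges (A :: ((pt μ a :: L) ++ [O])))]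
        with p hp hp'
      rw [cnt_cons, hp]
      have := hC.indicator hp'
      rw [show hC.polygon.region = IsRightChain.region A (pt μ a :: L) O from rfl, this, hl,
        pathEdges_cons_cons, hcount_append, hcount_cons, hcount_cons, hc_level (by simp [hA]),
        hc_level (u := E) (v := O) (by simp [hE, hO])]
      simp
    · rw [sumHper_cons, hhper, htv]
      linarith
    · rw [sumPer_cons, htv]
      have e1 : O 1 - A 1 = s * (O 0 - xA) := by rw [hO1, hA1, ← hA0]; linarith
      rw [e1, hhper] at hper
      nlinarith

namespace EnvW

variable {s xA xB a W : ℝ} {R : List (ℝ × ℝ)}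

lemma nil (s x a : ℝ) : EnvW s x a [] x 0 :=
  ⟨[], [], by simp, by simp, by simp, by simp, by simp, by simp, by simp⟩

lemma single {h : ℝ} (hh : 0 ≤ h) (s x a : ℝ) : EnvW s x a [(h, x)] x 0 := by
  rcases eq_or_lt_of_le hh with rfl | hh
  · refine ⟨[], [], by simp, by simp, by simp, ?_, by simp, by simp, by simp⟩
    refine Filter.Eventually.of_forall fun p => ?_
    rw [rowCount_single, hc_level (by simp)]
    simp
  · refine ⟨[pt x (a + h)], [], by simp, by simp [SteepUp, IsSteepEdge, hh], by simp, ?_, ?_,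
      by simp, by simp⟩
    · refine Filter.Eventually.of_forall fun p => ?_
      rw [rowCount_single]; simp
    · intro v hv
      simp only [List.mem_cons, List.not_mem_nil, or_false] at hv
      rcases hv with rfl | rfl
      · exact Or.inl rfl
      · right; left; simp

lemma mono {W' : ℝ} (hs : 0 < s) (hW : W ≤ W') (h : EnvW s xA a R xB W) :
    EnvW s xA a R xB W' := by
  obtain ⟨T, F, h1, h2, h3, h4, h5, h6, h7⟩ := h
  refine ⟨T, F, h1, h2, h3, h4, h5, by linarith, h7.trans ?_⟩
  exact mul_le_mul_of_nonneg_left hW (by linarith)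

lemma congr {R' : List (ℝ × ℝ)} (h : EnvW s xA a R xB W) (h1 : ht R = ht R')
    (h2 : ∀ p, rowCount a R p = rowCount a R' p) (h3 : ∀ r ∈ R, ∃ r' ∈ R', r'.2 ≤ r.2) :
    EnvW s xA a R' xB W := by
  obtain ⟨T, F, k1, k2, k3, k4, k5, k6, k7⟩ := h
  rw [h1] at k1 k5
  refine ⟨T, F, k1, k2, k3, ?_, ?_, k6, k7⟩
  · filter_upwards [k4] with p hp
    rw [hp, h2]
  · intro v hv
    rcases k5 v hv with h | h | ⟨r, hr, h⟩ | h
    · exact Or.inl h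
    · exact Or.inr (Or.inl h)
    · obtain ⟨r', hr', h'⟩ := h3 r hr
      exact Or.inr (Or.inr (Or.inl ⟨r', hr', h'.trans h⟩))
    · exact Or.inr (Or.inr (Or.inr h))

/-- Paths, tiles and counts are concatenated. Only the condition on vertices needs care: the common
point ceases to be an end, so it must itself be to the right of some row value or of both new ends.
-/
lemma join {x W' : ℝ} {R' : List (ℝ × ℝ)} (h : EnvW s xA a R x W)
    (h' : EnvW s x (a + ht R) R' xB W')
    (hx : (∃ r ∈ R ++ R', r.2 ≤ x) ∨ (xA < x ∧ xB < x)) :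
    EnvW s xA a (R ++ R') xB (W + W') := by
  obtain ⟨T, F, h1, h2, h3, h4, h5, h6, h7⟩ := h
  obtain ⟨T', F', k1, k2, k3, k4, k5, k6, k7⟩ := h'
  have hmem : ∀ v : Plane, x ≤ v 0 → (∃ r ∈ R ++ R', r.2 ≤ v 0) ∨ (xA < v 0 ∧ xB < v 0) := by
    intro v hv
    rcases hx with ⟨r, hr, hr'⟩ | hx
    · exact Or.inl ⟨r, hr, hr'.trans hv⟩
    · exact Or.inr ⟨hx.1.trans_le hv, hx.2.trans_le hv⟩
  refine ⟨T ++ T', F ++ F', ?_, isChain_join (l := pt xA a :: T) h1 h2 k2, ?_, ?_, ?_, ?_, ?_⟩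
  · rw [← List.cons_append, getLast?_join h1, k1, ht_append, add_assoc]
  · intro Q hQ
    rcases List.mem_append.1 hQ with hQ | hQ
    · exact h3 Q hQ
    · exact k3 Q hQ
  · filter_upwards [h4, k4] with p hp hp'
    rw [cnt_append, hp, hp', ← List.cons_append, pathEdges_join h1, hcount_append, rowCount_append]
    ring
  · intro v hv
    rw [← List.cons_append, List.mem_append] at hv
    rw [ht_append, ← add_assoc]
    rcases hv with hv | hv
    · rcases h5 v hv with h | h | ⟨r, hr, h⟩ | h
      · exact Or.inl h
      · exact Or.inr (Or.inr (hmem v (by rw [h]; simp)))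
      · exact Or.inr (Or.inr (Or.inl ⟨r, by simp [hr], h⟩))
      · exact Or.inr (Or.inr (hmem v h.2.le))
    · rcases k5 v (List.mem_cons_of_mem _ hv) with h | h | ⟨r, hr, h⟩ | h
      · exact Or.inr (Or.inr (hmem v (by rw [h]; simp)))
      · exact Or.inr (Or.inl h)
      · exact Or.inr (Or.inr (Or.inl ⟨r, by simp [hr], h⟩))
      · exact Or.inr (Or.inr (hmem v h.1.le))
  · rw [sumHper_append]; linarith
  · rw [sumPer_append]; linarith

lemma _root_.ae_hcount_flipY (l : List Plane) :
    ∀ᵐ p : Plane, hcount (pathEdges (l.map flipY).reverse) p = hcount (pathEdges l) (flipY p) := by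
  rw [pathEdges_reverse, pathEdges_map]
  generalize pathEdges l = E
  induction E with
  | nil => simp
  | cons e E ih =>
    have h1 := measure_eq_zero_iff_ae_notMem.1 (volume_level_one (-e.1 1))
    have h2 := measure_eq_zero_iff_ae_notMem.1 (volume_level_one (-e.2 1))
    filter_upwards [ih, h1, h2] with p hp h1 h2
    replace h1 : p 1 ≠ -e.1 1 := h1
    replace h2 : p 1 ≠ -e.2 1 := h2
    rw [List.map_cons, List.map_cons, List.reverse_cons, hcount_append, hp, hcount_cons,
      hcount_cons, hcount_nil, add_zero, add_comm]
    congr 1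
    unfold hc
    simp only [Prod.fst_swap, Prod.snd_swap, Prod.map_fst, Prod.map_snd, flipY_zero, flipY_one]
    congr 1
    apply propext
    have e3 : (p 0 - e.2 0) * (-e.1 1 - -e.2 1) < (e.1 0 - e.2 0) * (p 1 - -e.2 1) ↔
        (p 0 - e.1 0) * (e.2 1 - e.1 1) < (e.2 0 - e.1 0) * (-p 1 - e.1 1) := by
      constructor <;> intro h <;> nlinarith
    rw [e3]
    constructor
    · rintro ⟨c1, c2, c3⟩
      exact ⟨by linarith, by have := lt_of_le_of_ne c1 (Ne.symm h2); linarith, c3⟩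
    · rintro ⟨c1, c2, c3⟩
      exact ⟨by linarith, lt_of_le_of_ne (by linarith) h1, c3⟩

/-- The reflection in the horizontal axis exchanges the ends of the path, and the rows are read from
the top. -/
lemma flip (h : EnvW s xB (-(a + ht R)) R.reverse xA W) : EnvW s xA a R xB W := by
  obtain ⟨T, F, h1, h2, h3, h4, h5, h6, h7⟩ := h
  rw [ht_reverse, neg_add_rev, neg_add_cancel_comm] at h1 h5
  obtain ⟨X, hX⟩ := List.getLast?_eq_some_iff.1 h1
  have hl : ((pt xB (-(a + ht R)) :: T).map flipY).reverse = pt xA a :: (X.map flipY).reverse := by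
    rw [neg_add_rev, hX]
    simp only [List.map_append, List.map_cons, List.map_nil, List.reverse_append,
      List.reverse_cons, List.reverse_nil, List.nil_append, List.cons_append, List.cons.injEq,
      and_true]
    exact plane_ext (by simp) (by simp)
  refine ⟨(X.map flipY).reverse, F.map (SimplePolygon.map flipY), ?_, ?_, ?_, ?_, ?_, ?_, ?_⟩
  · rw [← hl, List.getLast?_reverse, List.map_cons, List.head?_cons, flipY_apply]
    simp
  · rw [← hl, List.isChain_reverse, List.isChain_map]
    refine h2.imp fun u v h => ⟨by simpa using h.1, ?_⟩
    have := isFlip_flipY.steep h.2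
    rcases this with h | ⟨h, h'⟩ | ⟨h, h'⟩
    · exact Or.inl h.symm
    · exact Or.inr (Or.inl ⟨h.symm, by linarith⟩)
    · exact Or.inr (Or.inr ⟨h.symm, by linarith⟩)
  · intro Q hQ
    obtain ⟨Q', hQ', rfl⟩ := List.mem_map.1 hQ
    exact isFlip_flipY.fuzzyStaircase (h3 Q' hQ')
  · filter_upwards [ae_isometry flipY h4, ae_rowCount_reverse a R,
      ae_hcount_flipY (pt xB (-(a + ht R)) :: T)] with p hp hp1 hp2
    rw [← hl, hp2, ← hp1, ← hp]
    conv_lhs => rw [← flipY_flipY p]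
    rw [cnt_map]
  · intro v hv
    rw [← hl] at hv
    obtain ⟨u, hu, rfl⟩ := List.mem_map.1 (List.mem_reverse.1 hv)
    rw [neg_add_rev] at hu
    rcases h5 u hu with h | h | ⟨r, hr, h⟩ | h
    · right; left; rw [h, flipY_apply]; simp
    · left; rw [h, flipY_apply]; simp
    · exact Or.inr (Or.inr (Or.inl ⟨r, List.mem_reverse.1 hr, by simpa using h⟩))
    · exact Or.inr (Or.inr (Or.inr (by simpa using h.symm)))
  · rw [sumHper_map isFlip_flipY]; exact h6
  · rw [sumPer_map]; exact h7

end EnvW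

/-! ### Cutting rows -/

/-- `Lo` consists of the first rows of `R`, the last of them possibly cut. -/
def IsPre (Lo R : List (ℝ × ℝ)) : Prop :=
  ∀ X r Z, Lo = X ++ r :: Z → ∃ r' Z', R = X ++ r' :: Z' ∧ r'.2 = r.2 ∧ r.1 ≤ r'.1

lemma isPre_append (Lo Up : List (ℝ × ℝ)) : IsPre Lo (Lo ++ Up) := by
  rintro X r Z rfl
  exact ⟨r, Z ++ Up, by simp, rfl, le_rfl⟩

lemma isPre_cut {h1 h : ℝ} (hh : h1 ≤ h) (x : ℝ) (X Z : List (ℝ × ℝ)) :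
    IsPre (X ++ [(h1, x)]) (X ++ (h, x) :: Z) := by
  induction X with
  | nil =>
    intro X r Z' hX
    cases X with
    | nil =>
      simp only [List.nil_append, List.cons.injEq] at hX
      obtain ⟨rfl, -⟩ := hX
      exact ⟨(h, x), Z, rfl, rfl, hh⟩
    | cons q X => simp at hX
  | cons q X ih =>
    intro X' r Z' hX
    cases X' with
    | nil =>
      simp only [List.nil_append, List.cons_append, List.cons.injEq] at hX
      exact ⟨q, X ++ (h, x) :: Z, rfl, by rw [hX.1], by rw [hX.1]⟩
    | cons q' X' =>
      simp only [List.cons_append, List.cons.injEq] at hX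
      obtain ⟨r', Z'', h3, h4, h5⟩ := ih X' r Z' hX.2
      exact ⟨r', Z'', by rw [List.cons_append, h3, hX.1]; rfl, h4, h5⟩

/-- A level inside a row divides it into two rows of the same value; a level between two rows just
divides the list. -/
lemma exists_cut {R : List (ℝ × ℝ)} (hR : ∀ r ∈ R, 0 < r.1) {t : ℝ} (h0 : 0 ≤ t) (h1 : t ≤ ht R) :
    ∃ Lo Up : List (ℝ × ℝ), ht Lo = t ∧ (∀ r ∈ Lo, 0 < r.1) ∧ (∀ r ∈ Up, 0 < r.1) ∧
      (R = Lo ++ Up ∨ ∃ X h1 h2 x Z, R = X ++ (h1 + h2, x) :: Z ∧ Lo = X ++ [(h1, x)] ∧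
        Up = (h2, x) :: Z) := by
  induction R generalizing t with
  | nil => exact ⟨[], [], by simp at h1 ⊢; linarith, by simp, by simp, Or.inl rfl⟩
  | cons q R ih =>
    have hq : 0 < q.1 := hR q (by simp)
    have hR' : ∀ r ∈ R, 0 < r.1 := fun r hr => hR r (by simp [hr])
    rcases eq_or_lt_of_le h0 with rfl | h0
    · exact ⟨[], q :: R, rfl, by simp, hR, Or.inl rfl⟩
    rcases lt_or_ge t q.1 with hlt | hge
    · refine ⟨[(t, q.2)], (q.1 - t, q.2) :: R, by simp, by simpa using h0, ?_, Or.inr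
        ⟨[], t, q.1 - t, q.2, R, by simp, rfl, rfl⟩⟩
      intro r hr
      rcases List.mem_cons.1 hr with rfl | hr
      · simpa using hlt
      · exact hR' r hr
    · rw [ht_cons] at h1
      obtain ⟨Lo, Up, k1, k2, k3, k4⟩ := ih hR' (t := t - q.1) (by linarith) (by linarith)
      refine ⟨q :: Lo, Up, by rw [ht_cons, k1]; ring, ?_, k3, ?_⟩
      · intro r hr
        rcases List.mem_cons.1 hr with rfl | hr
        · exact hq
        · exact k2 r hr
      · rcases k4 with rfl | ⟨X, t1, t2, x, Z, rfl, rfl, rfl⟩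
        · exact Or.inl rfl
        · exact Or.inr ⟨q :: X, t1, t2, x, Z, rfl, rfl, rfl⟩

/-- The consequences of a cut. -/
lemma exists_cut' {R : List (ℝ × ℝ)} (hR : ∀ r ∈ R, 0 < r.1) {t : ℝ} (h0 : 0 ≤ t) (h1 : t ≤ ht R) :
    ∃ Lo Up : List (ℝ × ℝ), ht Lo = t ∧ (∀ r ∈ Lo, 0 < r.1) ∧ (∀ r ∈ Up, 0 < r.1) ∧
      IsPre Lo R ∧ IsPre Up.reverse R.reverse ∧ ht R = ht Lo + ht Up ∧
      (∀ a p, rowCount a R p = rowCount a (Lo ++ Up) p) ∧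
      (∀ x y, pvar x R y = pvar x (Lo ++ Up) y) ∧ values R = values (Lo ++ Up) := by
  obtain ⟨Lo, Up, k1, k2, k3, k4⟩ := exists_cut hR h0 h1
  refine ⟨Lo, Up, k1, k2, k3, ?_⟩
  rcases k4 with rfl | ⟨X, t1, t2, x, Z, rfl, rfl, rfl⟩
  · refine ⟨isPre_append _ _, ?_, by simp, by simp, by simp, rfl⟩
    rw [List.reverse_append]
    exact isPre_append _ _
  · have p1 : 0 < t1 := k2 (t1, x) (by simp)
    have p2 : 0 < t2 := k3 (t2, x) (by simp)
    refine ⟨isPre_cut (by linarith) _ _ _, ?_, by simp; ring, ?_, ?_, ?_⟩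
    · have := isPre_cut (h1 := t2) (h := t1 + t2) (by linarith) x Z.reverse X.reverse
      simpa using this
    · intro a p
      have e1 : X ++ (t1 + t2, x) :: Z = X ++ ([(t1 + t2, x)] ++ Z) := rfl
      have e2 : X ++ [(t1, x)] ++ (t2, x) :: Z = X ++ ([(t1, x), (t2, x)] ++ Z) := by simp
      rw [e1, e2, rowCount_append, rowCount_append, rowCount_append, rowCount_append,
        rowCount_split p1.le p2.le]
      simp
    · intro y z
      rw [pvar_append_cons, pvar_append_cons]
      have := pvar_append_cons y x (t1, x) X []
      simp only [pvar_nil, sub_self, abs_zero, add_zero] at this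
      rw [this]
    · ext y
      simp only [values, List.mem_append, List.mem_cons, List.not_mem_nil, or_false,
        Set.mem_ofPred_eq]
      constructor
      · rintro ⟨r, hr | rfl | hr, rfl⟩
        · exact ⟨r, Or.inl (Or.inl hr), rfl⟩
        · exact ⟨(t1, x), Or.inl (Or.inr rfl), rfl⟩
        · exact ⟨r, Or.inr (Or.inr hr), rfl⟩
      · rintro ⟨r, (hr | rfl) | rfl | hr, rfl⟩
        · exact ⟨r, Or.inl hr, rfl⟩
        · exact ⟨(t1 + t2, x), Or.inr (Or.inl rfl), rfl⟩
        · exact ⟨(t1 + t2, x), Or.inr (Or.inl rfl), rfl⟩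
        · exact ⟨r, Or.inr (Or.inr hr), rfl⟩

/-! ### Envelopes and the parallelogram of steep paths -/

section

/-- The row with value `x` and levels from `y0` to `y1` has a point other than `A` and `B` in the
parallelogram with opposite vertices `A = (xA, a)` and `B = (xB, b)` and sides of slope `± s`. -/
def Meets (s xA a xB b x y0 y1 : ℝ) : Prop :=
  ∃ y, y0 ≤ y ∧ y ≤ y1 ∧ s * x - y ≤ s * xA - a ∧ s * x + y ≤ s * xB + b ∧
    ¬ (x = xA ∧ y = a) ∧ ¬ (x = xB ∧ y = b)

lemma Meets.flip {s xA a xB b x y0 y1 : ℝ} (h : Meets s xB (-b) xA (-a) x (-y1) (-y0)) :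
    Meets s xA a xB b x y0 y1 := by
  obtain ⟨y, h1, h2, h3, h4, h5, h6⟩ := h
  refine ⟨-y, by linarith, by linarith, by linarith, by linarith, ?_, ?_⟩
  · rintro ⟨k1, k2⟩; exact h6 ⟨k1, by linarith⟩
  · rintro ⟨k1, k2⟩; exact h5 ⟨k1, by linarith⟩

/-- The hypothesis that the envelope exists for rows with fewer values. -/
def EnvBelow (s : ℝ) (V : Set ℝ) : Prop :=
  ∀ g μ a, g ≠ [] → (∀ r ∈ g, 0 < r.1) → (∀ r ∈ g, μ < r.2) → values g ⊂ V → Env s μ a g μ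

variable {s xA xB a b : ℝ} {V : Set ℝ}

lemma ht_split {R X Z : List (ℝ × ℝ)} {r : ℝ × ℝ} (h : R = X ++ r :: Z) :
    ht R = ht X + r.1 + ht Z := by rw [h]; simp; ring

lemma mem_split {R X Z : List (ℝ × ℝ)} {r : ℝ × ℝ} (h : R = X ++ r :: Z) : r ∈ R := by
  rw [h]; simp

lemma EnvW.lower {R : List (ℝ × ℝ)} (hs : 1 ≤ s) (hR0 : R ≠ []) (h1 : ∀ r ∈ R, 0 < r.1)
    (hc : Clear s (s * xA - a) a R) (hV : EnvBelow s V) (hRV : values R ⊆ V) {x : ℝ}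
    (hx : s * x = s * xA + ht R) : EnvW s xA a R x (tv xA R) := by
  have hs0 : 0 < s := by linarith
  have hpos := ht_pos h1 hR0
  obtain ⟨F, k1, k2, k3, k4⟩ := lower_gap hs hR0 h1 hc hV hRV
  have hx' : xA + ht R / s = x := by field_simp; linarith
  rw [hx'] at k2
  refine ⟨[pt x (a + ht R)], F, by simp, ?_, k1, ?_, ?_, k3, k4⟩
  · simp only [List.isChain_cons_cons, List.isChain_singleton, and_true]
    refine ⟨by simp [hpos], Or.inr (Or.inl ⟨?_, ?_⟩)⟩
    · simp only [pt_zero]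
      rintro rfl
      linarith
    · simp only [pt_zero, pt_one]; linarith
  · filter_upwards [k2] with p hp
    rw [hp]; simp
  · intro v hv
    simp only [List.mem_cons, List.not_mem_nil, or_false] at hv
    rcases hv with rfl | rfl
    · exact Or.inl rfl
    · exact Or.inr (Or.inl rfl)

/-- Half of a gap. -/
lemma gap_half {R Lo : List (ℝ × ℝ)} (hs : 1 ≤ s) (hLo0 : Lo ≠ []) (hLo : ∀ r ∈ Lo, 0 < r.1)
    (hpre : IsPre Lo R) (hb : a + ht Lo ≤ b)
    (hO : 2 * (a + ht Lo) = s * xB + b - (s * xA - a)) (hV : EnvBelow s V) (hRV : values Lo ⊆ V)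
    (hN : ∀ X r Z, R = X ++ r :: Z → ¬ Meets s xA a xB b r.2 (a + ht X) (a + ht X + r.1)) {x : ℝ}
    (hx : s * x = s * xA + ht Lo) : EnvW s xA a Lo x (tv xA Lo) := by
  refine EnvW.lower hs hLo0 hLo ?_ hV hRV hx
  apply clear_of_forall
  intro X r Z hX
  obtain ⟨r', Z', hR, h2, h3⟩ := hpre X r Z hX
  have hr := hLo r (mem_split hX)
  have hh := ht_split hX
  have hZp : ∀ q ∈ Z, 0 < q.1 := fun q hq => hLo q (by rw [hX]; simp [hq])
  have hZ := ht_nonneg hZp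
  have hX0 := ht_nonneg (R := X) fun q hq => hLo q (by rw [hX]; simp [hq])
  -- A corner on or behind the line of slope `s` through `A`, and below the right vertex of the
  -- parallelogram, would be in the parallelogram. The strict inequality, which excludes `B`, comes
  -- from the corner being strictly behind the line or from further rows above it.
  have key : s * r.2 - (a + ht X + r.1) ≤ s * xA - a →
      s * r.2 + (a + ht X + r.1) < s * xB + b → False := by
    intro k1 k2
    refine hN X r' Z' hR ⟨a + ht X + r.1, by linarith, by linarith, by rw [h2]; exact k1,
      by rw [h2]; exact k2.le, ?_, ?_⟩
    · rintro ⟨-, h⟩; linarith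
    · rintro ⟨h, h'⟩; rw [h2] at h; rw [h, h'] at k2; exact lt_irrefl _ k2
  constructor
  · by_contra hcon
    push Not at hcon
    exact key hcon.le (by linarith)
  · intro hZ0
    have := ht_pos hZp hZ0
    by_contra hcon
    push Not at hcon
    exact key hcon (by linarith)

/-- The envelope when no row meets the parallelogram. -/
lemma env_gap {R : List (ℝ × ℝ)} (hs : 1 ≤ s) (hR : ∀ r ∈ R, 0 < r.1)
    (hJ : s * |xA - xB| ≤ ht R) (hV : EnvBelow s V) (hRV : values R ⊆ V)
    (hN : ∀ X r Z, R = X ++ r :: Z →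
      ¬ Meets s xA a xB (a + ht R) r.2 (a + ht X) (a + ht X + r.1)) : Env s xA a R xB := by
  have hs0 : 0 < s := by linarith
  have hJ1 := mul_le_mul_of_nonneg_left (le_abs_self (xA - xB)) hs0.le
  have hJ2 := mul_le_mul_of_nonneg_left (neg_abs_le (xA - xB)) hs0.le
  -- The line of slope `s` through `A` and the line of slope `-s` through `B` meet at height `t`
  -- above `A`. The rows are cut at this level; the lower half is filled against the first line, the
  -- upper half, after reflection, against the second.
  set t := (ht R + s * (xB - xA)) / 2 with ht'
  obtain ⟨Lo, Up, k1, k2, k3, k4, k5, k6, k7, k8, k9⟩ :=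
    exists_cut' hR (t := t) (by rw [ht']; linarith) (by rw [ht']; linarith)
  set x := xA + ht Lo / s with hx
  have hx1 : s * x = s * xA + ht Lo := by rw [hx]; field_simp
  have hx2 : s * x = s * xB + ht Up := by rw [hx1]; linarith
  have hlow : Lo ≠ [] → EnvW s xA a Lo x (tv xA Lo) := by
    intro h0
    refine gap_half (R := R) (xB := xB) (b := a + ht R) hs h0 k2 k4 ?_ (by linarith) hV
      (fun y ⟨r, hr, hy⟩ => hRV (k9 ▸ ⟨r, by simp [hr], hy⟩)) hN hx1
    linarith [ht_nonneg k3]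
  have hup : Up ≠ [] → EnvW s x (a + ht Lo) Up xB (tv xB Up.reverse) := by
    intro h0
    apply EnvW.flip
    have e : -(a + ht Lo + ht Up) = -(a + ht R) := by rw [k6]; ring
    rw [e]
    refine gap_half (R := R.reverse) (xB := xA) (b := -a) hs (by simpa using h0) (by simpa using k3)
      k5 ?_ (by rw [ht_reverse]; linarith) hV
      (fun y ⟨r, hr, hy⟩ => hRV (k9 ▸ ⟨r, by simp [List.mem_reverse.1 hr], hy⟩)) ?_
      (by rw [ht_reverse]; exact hx2)
    · rw [ht_reverse]; linarith [ht_nonneg k2]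
    · intro X r Z hX hM
      have hX' : R = Z.reverse ++ r :: X.reverse := by
        have := congrArg List.reverse hX
        simpa using this
      refine hN _ _ _ hX' ?_
      have hh := ht_split hX'
      rw [ht_reverse, ht_reverse] at hh
      have e1 : -(a + ht R) + ht X = -(a + ht Z + r.1) := by rw [hh]; ring
      have e2 : -(a + ht R) + ht X + r.1 = -(a + ht Z) := by rw [hh]; ring
      rw [e1] at hM
      rw [show -(a + ht Z + r.1) + r.1 = -(a + ht Z) by ring] at hM
      rw [ht_reverse]
      exact hM.flip
  have hfin : EnvW s xA a (Lo ++ Up) xB (tv xA Lo + tv xB Up.reverse) := by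
    by_cases h1 : Lo = []
    · subst h1
      have hxA : x = xA := by simp [hx]
      by_cases h2 : Up = []
      · subst h2
        have : xA = xB := by
          rw [hxA] at hx2
          simp only [ht_nil, add_zero] at hx2
          exact mul_left_cancel₀ hs0.ne' hx2
        subst this
        simpa using EnvW.nil s xA a
      · have := hup h2
        rw [hxA] at this
        simpa using this
    · by_cases h2 : Up = []
      · subst h2
        have : x = xB := by
          simp only [ht_nil, add_zero] at hx2
          exact mul_left_cancel₀ hs0.ne' hx2
        have h3 := hlow h1
        rw [this] at h3
        simpa using h3
      · refine (hlow h1).join (hup h2) (Or.inr ⟨?_, ?_⟩)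
        · have := ht_pos k2 h1
          by_contra hcon
          have := mul_le_mul_of_nonneg_left (not_lt.1 hcon) hs0.le
          linarith
        · have := ht_pos k3 h2
          by_contra hcon
          have := mul_le_mul_of_nonneg_left (not_lt.1 hcon) hs0.le
          linarith
  refine (hfin.mono hs0 ?_).congr (by rw [k6, ht_append]) (fun p => (k7 a p).symm) ?_
  · rw [k8]
    exact tv_add_tv_reverse_le _ _ _ _
  · intro r hr
    have : r.2 ∈ values R := k9 ▸ ⟨r, hr, rfl⟩
    obtain ⟨r', hr', h⟩ := this
    exact ⟨r', hr', h.le⟩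

/-- The conditions for the existence of the envelope. -/
structure EnvCond (s xA a : ℝ) (R : List (ℝ × ℝ)) (xB : ℝ) : Prop where
  pos : ∀ r ∈ R, 0 < r.1
  left : ∀ X r Z, R = X ++ r :: Z → s * xA + a ≤ s * r.2 + (a + ht X)
  right : ∀ X r Z, R = X ++ r :: Z → s * xB - (a + ht R) ≤ s * r.2 - (a + ht X + r.1)
  abs : s * |xA - xB| ≤ ht R

/-- The envelope up to a row of minimal value meeting the parallelogram. -/
lemma env_left {X : List (ℝ × ℝ)} {x lo : ℝ} (hs : 1 ≤ s) (hX : ∀ r ∈ X, 0 < r.1)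
    (hl : ∀ X1 r Z1, X = X1 ++ r :: Z1 → s * xA + a ≤ s * r.2 + (a + ht X1))
    (hz : s * xA + a ≤ s * x + (a + ht X)) (hlo1 : a + ht X ≤ lo)
    (hlo2 : s * x - lo ≤ s * xA - a) (hlo3 : lo = a + ht X ∨ s * x - lo = s * xA - a)
    (h0 : s * x + lo ≤ s * xB + b) (hb : a + ht X < b)
    (hN : ∀ X1 r Z1, X = X1 ++ r :: Z1 → r.2 < x →
      ¬ Meets s xA a xB b r.2 (a + ht X1) (a + ht X1 + r.1))
    (ih : EnvCond s xA a X x → Env s xA a X x) (hV : EnvBelow s V) (hXV : values X ⊆ V)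
    (hxV : x ∈ V) :
    ∃ X', ((X' = X ∧ lo = a + ht X) ∨ (X' = X ++ [(lo - (a + ht X), x)] ∧ a + ht X < lo)) ∧
      EnvW s xA a X' x (pvar xA X x) := by
  have hs0 : 0 < s := by linarith
  -- A corner behind the line of slope `s` through `(x, lo)` would have a value less than `x` and be
  -- in the parallelogram, against the minimality expressed by `hN`.
  have K : ∀ X1 r Z1, X = X1 ++ r :: Z1 →
      s * x - lo ≤ s * r.2 - (a + ht X1 + r.1) ∧
        (a + ht X < lo → s * x - lo < s * r.2 - (a + ht X1 + r.1)) := by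
    intro X1 r Z1 hX1
    have hh := ht_split hX1
    have hr := hX r (mem_split hX1)
    have hX1' := ht_nonneg (R := X1) fun q hq => hX q (by rw [hX1]; simp [hq])
    have hZ1 := ht_nonneg (R := Z1) fun q hq => hX q (by rw [hX1]; simp [hq])
    have key : s * r.2 - (a + ht X1 + r.1) ≤ s * x - lo → r.2 < x → False := by
      intro k1 k2
      have k3 := mul_lt_mul_of_pos_left k2 hs0
      refine hN X1 r Z1 hX1 k2 ⟨a + ht X1 + r.1, by linarith, le_rfl, by linarith, by linarith,
        ?_, ?_⟩
      · rintro ⟨-, h⟩; linarith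
      · rintro ⟨-, h⟩; linarith
    constructor
    · by_contra hcon
      push Not at hcon
      exact key hcon.le (lt_of_mul_lt_mul_left (by linarith) hs0.le)
    · intro hlt
      by_contra hcon
      push Not at hcon
      exact key hcon (lt_of_mul_lt_mul_left (by linarith) hs0.le)
  -- Either the row is in use from its bottom on, and the rows below it form a shorter instance
  -- ending at `x`. Or the row enters the parallelogram at `lo` through the side of slope `s` from
  -- `A`; then the path goes straight to that point, and the lower piece of the row joins the rows
  -- that bound the gap.
  rcases eq_or_lt_of_le hlo1 with heq | hlt
  · refine ⟨X, Or.inl ⟨rfl, heq.symm⟩, ih ⟨hX, hl, ?_, ?_⟩⟩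
    · intro X1 r Z1 hX1
      have := (K X1 r Z1 hX1).1
      rw [← heq] at this
      exact this
    · rw [← abs_of_pos hs0, ← abs_mul, abs_le]
      constructor <;> linarith
  · refine ⟨X ++ [(lo - (a + ht X), x)], Or.inr ⟨rfl, hlt⟩, ?_⟩
    have hW : pvar xA X x = tv xA (X ++ [(lo - (a + ht X), x)]) := by
      rw [tv_append]; simp [pvar]
    have heq : s * x - lo = s * xA - a := hlo3.resolve_left hlt.ne'
    rw [hW]
    refine EnvW.lower hs (by simp) ?_ ?_ hV ?_ ?_
    · intro r hr
      rcases List.mem_append.1 hr with hr | hr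
      · exact hX r hr
      · rw [List.mem_singleton.1 hr]; simpa using hlt
    · apply clear_of_forall
      intro X1 r Z1 hX1
      rw [← heq]
      rcases List.eq_nil_or_concat Z1 with rfl | ⟨Z', q, rfl⟩
      · obtain ⟨rfl, h⟩ := List.append_inj' hX1 rfl
        obtain rfl : (lo - (a + ht X), x) = r := by simpa using h
        simp
      · have : X ++ [(lo - (a + ht X), x)] = (X1 ++ r :: Z') ++ [q] := by rw [hX1]; simp
        obtain ⟨hX1', -⟩ := List.append_inj' this rfl
        have := K X1 r Z' hX1'
        exact ⟨this.1, fun _ => this.2 hlt⟩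
    · rintro y ⟨r, hr, rfl⟩
      rcases List.mem_append.1 hr with hr | hr
      · exact hXV ⟨r, hr, rfl⟩
      · rw [List.mem_singleton.1 hr]; exact hxV
    · simp; linarith

/-- Induction on the number of rows. If no row meets the parallelogram, `env_gap` uses its right
boundary. Otherwise the path follows the leftmost row that meets it, as long as that row is inside,
and `env_left` connects both ends of this piece with `A` and `B`, for the upper end after a
reflection. Being leftmost ensures that no other row obstructs the two connections. -/
lemma env_of_below (hs : 1 ≤ s) (hV : EnvBelow s V) (n : ℕ) :
    ∀ (R : List (ℝ × ℝ)) (xA a xB : ℝ), R.length ≤ n → values R ⊆ V → EnvCond s xA a R xB →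
      Env s xA a R xB := by
  have hs0 : 0 < s := by linarith
  induction n with
  | zero =>
    intro R xA a xB hn _ hC
    obtain rfl := List.length_eq_zero_iff.1 (Nat.le_zero.1 hn)
    refine env_gap hs hC.pos hC.abs hV (V := V) (by rintro y ⟨r, hr, -⟩; simp at hr) ?_
    intro X r Z h
    simp at h
  | succ n ih =>
    intro R xA a xB hn hRV hC
    by_cases hN : ∀ X r Z, R = X ++ r :: Z →
      ¬ Meets s xA a xB (a + ht R) r.2 (a + ht X) (a + ht X + r.1)
    · exact env_gap hs hC.pos hC.abs hV hRV hN
    have hfin : {x | ∃ X r Z, R = X ++ r :: Z ∧ r.2 = x ∧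
        Meets s xA a xB (a + ht R) r.2 (a + ht X) (a + ht X + r.1)}.Finite := by
      refine (finite_values R).subset ?_
      rintro x ⟨X, r, Z, h, hx, -⟩
      exact ⟨r, mem_split h, hx⟩
    push Not at hN
    obtain ⟨X0, r0, Z0, h0, hM0⟩ := hN
    obtain ⟨x, ⟨X, r, Z, hR, hrx, hM⟩, hmin⟩ := Set.exists_min_image _ id hfin
      ⟨r0.2, X0, r0, Z0, h0, rfl, hM0⟩
    have hmin' : ∀ X1 q Z1, R = X1 ++ q :: Z1 → q.2 < x →
        ¬ Meets s xA a xB (a + ht R) q.2 (a + ht X1) (a + ht X1 + q.1) := by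
      intro X1 q Z1 hX1 hlt hM1
      exact absurd (hmin q.2 ⟨X1, q, Z1, hX1, rfl, hM1⟩) (not_le.2 hlt)
    clear hmin hM0 h0 X0 r0 Z0
    obtain ⟨h, x'⟩ := r
    simp only at hrx
    subst hrx
    have hh := ht_split hR
    simp only at hh hM
    have hxV : x' ∈ V := hRV ⟨(h, x'), mem_split hR, rfl⟩
    have hXp : ∀ r ∈ X, 0 < r.1 := fun r hr => hC.pos r (by rw [hR]; simp [hr])
    have hZp : ∀ r ∈ Z, 0 < r.1 := fun r hr => hC.pos r (by rw [hR]; simp [hr])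
    have hh0 : 0 < h := hC.pos (h, x') (mem_split hR)
    have hX0 := ht_nonneg hXp
    have hZ0 := ht_nonneg hZp
    obtain ⟨y, y1, y2, y3, y4, -, -⟩ := hM
    -- The row of value `x'` is in the parallelogram from `lo` to `hi`: its own ends are clipped by
    -- the right sides of the parallelogram, while the left sides are respected by the whole row
    -- owing to `hC.left` and `hC.right`.
    set lo := max (a + ht X) (s * x' - (s * xA - a)) with hlo
    set hi := min (a + ht X + h) (s * xB + (a + ht R) - s * x') with hhi
    have hloy : lo ≤ y := max_le y1 (by linarith)
    have hyhi : y ≤ hi := le_min y2 (by linarith)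
    have cl := hC.left X (h, x') Z hR
    have cr := hC.right X (h, x') Z hR
    simp only at cl cr
    obtain ⟨X', hX', EX⟩ := env_left (xB := xB) (b := a + ht R) (X := X) (x := x') (lo := lo) hs hXp
      (fun X1 r Z1 h1 => hC.left X1 r (Z1 ++ (h, x') :: Z) (by rw [hR, h1]; simp)) cl
      (le_max_left _ _) (by have := le_max_right (a + ht X) (s * x' - (s * xA - a)); linarith)
      (by
        rcases max_choice (a + ht X) (s * x' - (s * xA - a)) with h | h
        · exact Or.inl h
        · right; rw [hlo, h]; ring)
      (by linarith) (by linarith)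
      (fun X1 r Z1 h1 => hmin' X1 r (Z1 ++ (h, x') :: Z) (by rw [hR, h1]; simp))
      (ih X xA a x' (by rw [hR] at hn; simp at hn; omega)
        (fun y ⟨r, hr, hy⟩ => hRV ⟨r, by rw [hR]; simp [hr], hy⟩)) hV
      (fun y ⟨r, hr, hy⟩ => hRV ⟨r, by rw [hR]; simp [hr], hy⟩) hxV
    have hRr : R.reverse = Z.reverse ++ (h, x') :: X.reverse := by rw [hR]; simp
    obtain ⟨Z', hZ', EZ⟩ := env_left (xA := xB) (a := -(a + ht R)) (xB := xA) (b := -a)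
      (X := Z.reverse) (x := x') (lo := -hi) hs (by simpa using hZp)
      (fun X1 r Z1 h1 => by
        have h2 : Z = Z1.reverse ++ r :: X1.reverse := by
          have := congrArg List.reverse h1
          simpa using this
        have h3 := hC.right (X ++ (h, x') :: Z1.reverse) r X1.reverse (by rw [hR, h2]; simp)
        have h4 := ht_split h2
        simp only [ht_append, ht_cons, ht_reverse] at h3 h4
        linarith)
      (by rw [ht_reverse]; linarith)
      (by rw [ht_reverse]; have := min_le_left (a + ht X + h) (s * xB + (a + ht R) - s * x'); linarith)
      (by have := min_le_right (a + ht X + h) (s * xB + (a + ht R) - s * x'); linarith)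
      (by
        rw [ht_reverse]
        rcases min_choice (a + ht X + h) (s * xB + (a + ht R) - s * x') with h' | h'
        · left; rw [hhi, h', hh]; ring
        · right; rw [hhi, h']; ring)
      (by linarith) (by rw [ht_reverse]; linarith)
      (fun X1 r Z1 h1 hlt hM => by
        have h2 : Z = Z1.reverse ++ r :: X1.reverse := by
          have := congrArg List.reverse h1
          simpa using this
        refine hmin' (X ++ (h, x') :: Z1.reverse) r X1.reverse (by rw [hR, h2]; simp) hlt ?_
        have h4 := ht_split h2
        simp only [ht_append, ht_cons, ht_reverse] at h4 ⊢
        apply Meets.flip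
        have e1 : -(a + (ht X + (h + ht Z1)) + r.1) = -(a + ht R) + ht X1 := by
          rw [hh, h4]; ring
        have e2 : -(a + (ht X + (h + ht Z1))) = -(a + ht R) + ht X1 + r.1 := by
          rw [hh, h4]; ring
        rw [e1, e2]
        exact hM)
      (ih Z.reverse xB _ x' (by rw [hR] at hn; simp at hn ⊢; omega)
        (fun y ⟨r, hr, hy⟩ => hRV ⟨r, by rw [hR]; simp [List.mem_reverse.1 hr], hy⟩)) hV
      (fun y ⟨r, hr, hy⟩ => hRV ⟨r, by rw [hR]; simp [List.mem_reverse.1 hr], hy⟩) hxV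
    have hX'h : ht X' = lo - a := by
      rcases hX' with ⟨rfl, h⟩ | ⟨rfl, h⟩
      · linarith
      · simp; ring
    have hZ'h : ht Z' = a + ht R - hi := by
      rcases hZ' with ⟨rfl, h⟩ | ⟨rfl, h⟩
      · linarith
      · simp; ring
    have EZ' : EnvW s x' hi Z'.reverse xB (pvar xB Z.reverse x') := by
      apply EnvW.flip
      rw [ht_reverse, hZ'h, List.reverse_reverse, add_sub_cancel]
      exact EZ
    have Emid := EnvW.single (h := hi - lo) (by linarith) s x' lo
    have e1 : a + ht X' = lo := by rw [hX'h]; ring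
    have J1 : EnvW s xA a (X' ++ [(hi - lo, x')]) x' (pvar xA X x' + 0) :=
      EX.join (by rw [e1]; exact Emid) (Or.inl ⟨(hi - lo, x'), by simp, le_rfl⟩)
    have J2 : EnvW s xA a (X' ++ [(hi - lo, x')] ++ Z'.reverse) xB
        (pvar xA X x' + 0 + pvar xB Z.reverse x') :=
      J1.join (by
        rw [ht_append, hX'h]
        simpa using EZ') (Or.inl ⟨(hi - lo, x'), by simp, le_rfl⟩)
    -- The pinned variation splits at a row without loss, and running along the row is free.
    have hW : pvar xA X x' + 0 + pvar xB Z.reverse x' = pvar xA R xB := by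
      rw [pvar_reverse, hR, pvar_append_cons, add_zero]
    rw [hW] at J2
    refine J2.congr ?_ ?_ ?_
    · simp only [ht_append, ht_cons, ht_nil, ht_reverse]; linarith
    · intro p
      have l1 : rowCount a X' p = rowCount a X p + rowCount (a + ht X) [(lo - (a + ht X), x')] p := by
        rcases hX' with ⟨rfl, h⟩ | ⟨rfl, h⟩
        · rw [rowCount_single, hc_level (by simp only [pt_one]; linarith), add_zero]
        · rw [rowCount_append]
      have l2 : rowCount hi Z'.reverse p =
          rowCount hi [(a + ht X + h - hi, x')] p + rowCount (a + ht X + h) Z p := by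
        rcases hZ' with ⟨rfl, h'⟩ | ⟨rfl, h'⟩
        · rw [rowCount_single, hc_level (by simp only [pt_one]; rw [ht_reverse] at h'; linarith),
            zero_add, List.reverse_reverse]
          rw [ht_reverse] at h'
          congr 1; linarith
        · rw [ht_reverse, List.reverse_append, List.reverse_reverse, rowCount_append]
          simp only [List.reverse_cons, List.reverse_nil, List.nil_append, ht_cons, ht_nil]
          congr 2
          · congr 2; linarith
          · linarith
      have p1 : 0 ≤ lo - (a + ht X) := by have := le_max_left (a + ht X) (s * x' - (s * xA - a)); linarith
      have p2 : 0 ≤ a + ht X + h - hi := by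
        have := min_le_left (a + ht X + h) (s * xB + (a + ht R) - s * x'); linarith
      have l3 : rowCount (a + ht X) [(h, x')] p = rowCount (a + ht X) [(lo - (a + ht X), x')] p +
          rowCount lo [(hi - lo, x')] p + rowCount hi [(a + ht X + h - hi, x')] p := by
        have := rowCount_split (h1 := lo - (a + ht X)) (h2 := (hi - lo) + (a + ht X + h - hi)) p1
          (by linarith) (a + ht X) x' p
        rw [show lo - (a + ht X) + ((hi - lo) + (a + ht X + h - hi)) = h by ring] at this
        rw [this, rowCount_cons]
        have l4 := rowCount_split (h1 := hi - lo) (h2 := a + ht X + h - hi) (by linarith) p2 lo x' p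
        rw [show a + ht X + (lo - (a + ht X), x').1 = lo by simp, l4, rowCount_cons (r := (hi - lo, x'))]
        simp only [rowCount_cons, rowCount_nil, add_zero]
        rw [show lo + (hi - lo) = hi by ring, show a + ht X + (lo - (a + ht X)) = lo by ring]
        ring
      have hR' : R = X ++ ([(h, x')] ++ Z) := by rw [hR]; rfl
      rw [rowCount_append, rowCount_append, ht_append, ← add_assoc, e1, hR', rowCount_append,
        rowCount_append, l1, l3]
      rw [show lo + ht [(hi - lo, x')] = hi by simp, l2]
      rw [show a + ht X + ht [(h, x')] = a + ht X + h by simp]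
      ring
    · intro r hr
      simp only [List.mem_append, List.mem_singleton, List.mem_reverse] at hr
      rcases hr with (hr | rfl) | hr
      · rcases hX' with ⟨rfl, h⟩ | ⟨rfl, h⟩
        · exact ⟨r, by rw [hR]; simp [hr], le_rfl⟩
        · rcases List.mem_append.1 hr with hr | hr
          · exact ⟨r, by rw [hR]; simp [hr], le_rfl⟩
          · exact ⟨(_, x'), mem_split hR, by rw [List.mem_singleton.1 hr]⟩
      · exact ⟨(_, x'), mem_split hR, le_rfl⟩
      · rcases hZ' with ⟨rfl, h⟩ | ⟨rfl, h⟩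
        · exact ⟨r, by rw [hR]; simp [List.mem_reverse.1 hr], le_rfl⟩
        · rcases List.mem_append.1 hr with hr | hr
          · exact ⟨r, by rw [hR]; simp [List.mem_reverse.1 hr], le_rfl⟩
          · exact ⟨(_, x'), mem_split hR, by rw [List.mem_singleton.1 hr]⟩

/-- The lower envelope of steep paths exists. -/
theorem env_pinned (hs : 1 ≤ s) (n : ℕ) :
    ∀ (R : List (ℝ × ℝ)) (μ a : ℝ), (values R).ncard ≤ n → (∀ r ∈ R, 0 < r.1) →
      (∀ r ∈ R, μ < r.2) → Env s μ a R μ := by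
  have hs0 : 0 < s := by linarith
  induction n with
  | zero =>
    intro R μ a hn _ _
    have h0 := (Set.ncard_eq_zero (finite_values R)).1 (Nat.le_zero.1 hn)
    have : R = [] := by
      cases R with
      | nil => rfl
      | cons r R =>
        have : r.2 ∈ values (r :: R) := ⟨r, by simp, rfl⟩
        rw [h0] at this
        exact absurd this (Set.notMem_empty _)
    subst this
    simpa [Env] using EnvW.nil s μ a
  | succ n ih =>
    intro R μ a hn h1 h2
    -- This outer induction is on the number of distinct values: a pocket of the stairs omits a
    -- value, whereas cutting a row may add a row but never a value.
    refine env_of_below hs (V := values R) ?_ R.length R μ a μ le_rfl subset_rfl ⟨h1, ?_, ?_, ?_⟩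
    · intro g μ' a' _ hg1 hg2 hlt
      refine ih g μ' a' ?_ hg1 hg2
      have := Set.ncard_lt_ncard hlt (finite_values R)
      omega
    · intro X r Z hX
      have := ht_nonneg (R := X) fun q hq => h1 q (by rw [hX]; simp [hq])
      have := mul_lt_mul_of_pos_left (h2 r (mem_split hX)) hs0
      linarith
    · intro X r Z hX
      have := ht_nonneg (R := Z) fun q hq => h1 q (by rw [hX]; simp [hq])
      have := mul_lt_mul_of_pos_left (h2 r (mem_split hX)) hs0
      rw [ht_split hX]
      linarith
    · simpa using ht_nonneg h1

end

/-! ### Slices of the part between a vertical line and a steep path -/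

lemma dist_segment_right {u v a : Plane} {t : ℝ} (h1 : t ≤ 1)
    (hx : a 0 = u 0 + t * (v 0 - u 0)) (hy : a 1 = u 1 + t * (v 1 - u 1)) :
    dist a v = (1 - t) * dist u v := by
  have : a = u + t • (v - u) := plane_ext (by simp [hx]) (by simp [hy])
  rw [this, dist_eq_norm, dist_eq_norm, ← abs_of_nonneg (by linarith : 0 ≤ 1 - t),
    ← Real.norm_eq_abs, ← norm_smul]
  congr 1
  module

lemma dist_segment_left {u v a : Plane} {t : ℝ} (h0 : 0 ≤ t)
    (hx : a 0 = u 0 + t * (v 0 - u 0)) (hy : a 1 = u 1 + t * (v 1 - u 1)) :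
    dist u a = t * dist u v := by
  have : a = u + t • (v - u) := plane_ext (by simp [hx]) (by simp [hy])
  have e : u - (u + t • (v - u)) = t • (u - v) := by module
  rw [this, dist_eq_norm, dist_eq_norm, e, norm_smul, Real.norm_eq_abs, abs_of_nonneg h0]

/-- The edge is not much longer than its progress to the right. -/
def Forward (u v : Plane) : Prop := dist u v ≤ (v 0 - u 0) + 5 / 4 * (u 1 - v 1)

lemma Forward.right {u v a : Plane} (h : Forward u v) (ha : a ∈ segment ℝ u v) : Forward a v := by
  obtain ⟨t, h0, h1, hx, hy⟩ := mem_segment_coord.1 ha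
  unfold Forward at *
  rw [dist_segment_right h1 hx hy, hx, hy]
  nlinarith

lemma Forward.left {u v a : Plane} (h : Forward u v) (ha : a ∈ segment ℝ u v) : Forward u a := by
  obtain ⟨t, h0, h1, hx, hy⟩ := mem_segment_coord.1 ha
  unfold Forward at *
  rw [dist_segment_left h0 hx hy, hx, hy]
  nlinarith

lemma weight_forward {a b : Plane} {l : List Plane} (h : (a :: l).IsChain Forward)
    (hb : (a :: l).getLast? = some b) :
    weight (pathEdges (a :: l)) ≤ (b 0 - a 0) + 5 / 4 * (a 1 - b 1) := by
  induction l generalizing a with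
  | nil =>
    simp only [List.getLast?_singleton, Option.some.injEq] at hb
    subst hb; simp
  | cons c l ih =>
    rw [List.isChain_cons_cons] at h
    have := ih h.2 (by simpa using hb)
    rw [pathEdges_cons_cons, weight_cons]
    have h1 := h.1
    unfold Forward at h1
    simp only
    linarith

/-- Slopes of at least 8 give `|Δx| ≤ Δy / 8`. Replacing `|Δx|` by the signed progress costs at most
`2 * |Δx| ≤ Δy / 4`, whence the constant 5/4. The bound is linear in the end points and so
telescopes along paths, even those that move back in `x`. -/
lemma SteepUp.forward {s : ℝ} (hs : 8 ≤ s) {u v : Plane} (h : SteepUp s u v) : Forward v u := by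
  have h1 := h.2.abs_le (by linarith)
  have h2 := dist_le_coord v u
  have h3 := h.1
  rw [abs_of_pos (by linarith : 0 < v 1 - u 1)] at h1
  rw [abs_sub_comm (u 1), abs_of_pos (by linarith : 0 < v 1 - u 1), abs_sub_comm] at h2
  unfold Forward
  have h4 := abs_nonneg (v 0 - u 0)
  have h5 := le_abs_self (v 0 - u 0)
  nlinarith

lemma SteepUp.bound {s : ℝ} (hs : 8 ≤ s) {u v : Plane} (h : SteepUp s u v) :
    8 * |v 0 - u 0| ≤ v 1 - u 1 := by
  have h1 := h.2.abs_le (by linarith)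
  have h3 := h.1
  rw [abs_of_pos (by linarith : 0 < v 1 - u 1)] at h1
  nlinarith [abs_nonneg (v 0 - u 0)]

lemma steepUp_bound {s : ℝ} (hs : 8 ≤ s) {u : Plane} {T : List Plane}
    (h : (u :: T).IsChain (SteepUp s)) {v : Plane} (hv : v ∈ u :: T) :
    8 * |v 0 - u 0| ≤ v 1 - u 1 := by
  induction T generalizing u with
  | nil => simp at hv; rw [hv]; simp
  | cons c T ih =>
    rw [List.isChain_cons_cons] at h
    have h1 := h.1.bound hs
    rcases List.mem_cons.1 hv with rfl | hv
    · simp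
    · have h2 := ih h.2 hv
      have h3 := abs_sub_le (v 0) (c 0) (u 0)
      linarith

/-- A path of an ascending edge, a horizontal edge and a descending path has one ascending run. -/
lemma maximalRun_ascends {A B : Plane} {D M : List Plane} (hB : ∀ d ∈ D.head?, ¬ Ascends B d)
    (hD : D.IsChain Descends) (h : IsMaximalRun Ascends (A :: B :: D) M) : M = [A, B] := by
  obtain ⟨X, Z, h1, h2, h3, -, -⟩ := h
  obtain ⟨x, y, M, rfl⟩ : ∃ x y M', M = x :: y :: M' := by
    match M, h2 with
    | x :: y :: M', _ => exact ⟨x, y, M', rfl⟩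
  have hxy := (List.isChain_cons_cons.1 h3).1
  match X, h1 with
  | [], h1 =>
    simp only [List.nil_append, List.cons_append, List.cons.injEq] at h1
    obtain ⟨rfl, rfl, h6⟩ := h1
    cases M with
    | nil => rfl
    | cons t M =>
      exfalso
      refine hB t (by rw [h6]; rfl) ?_
      exact (List.isChain_cons_cons.1 (List.isChain_cons_cons.1 h3).2).1
  | [c], h1 =>
    exfalso
    simp only [List.nil_append, List.cons_append, List.cons.injEq] at h1
    obtain ⟨-, rfl, h6⟩ := h1
    exact hB y (by rw [h6]; rfl) hxy
  | c :: d :: X, h1 =>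
    exfalso
    simp only [List.cons_append, List.cons.injEq, List.append_assoc] at h1
    obtain ⟨-, -, h1⟩ := h1
    rw [h1] at hD
    have := (List.isChain_cons_cons.1 (List.IsChain.right_of_append hD)).1
    exact lt_asymm hxy this

lemma maximalRun_descends {A B : Plane} {D M : List Plane} (hAB : ¬ Descends A B)
    (hB : ∀ d ∈ D.head?, ¬ Descends B d)
    (hD : D.IsChain Descends) (h : IsMaximalRun Descends (A :: B :: D) M) : M = D := by
  obtain ⟨X, Z, h1, h2, h3, h4, h5⟩ := h
  obtain ⟨x, y, M, rfl⟩ : ∃ x y M', M = x :: y :: M' := by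
    match M, h2 with
    | x :: y :: M', _ => exact ⟨x, y, M', rfl⟩
  have hxy := (List.isChain_cons_cons.1 h3).1
  match X, h1, h4 with
  | [], h1, _ =>
    exfalso
    simp only [List.nil_append, List.cons_append, List.cons.injEq] at h1
    obtain ⟨rfl, rfl, h1⟩ := h1
    exact hAB hxy
  | [c], h1, _ =>
    exfalso
    simp only [List.nil_append, List.cons_append, List.cons.injEq] at h1
    obtain ⟨-, rfl, h6⟩ := h1
    exact hB y (by rw [h6]; rfl) hxy
  | c :: d :: X, h1, h4 =>
    simp only [List.cons_append, List.cons.injEq] at h1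
    obtain ⟨-, -, h1⟩ := h1
    have h1' : D = X ++ (x :: y :: M) ++ Z := by simpa using h1
    have hX : X = [] := by
      rcases List.eq_nil_or_concat X with rfl | ⟨X', e, rfl⟩
      · rfl
      · exfalso
        refine h4 e (by simp [List.getLast?_cons]) x (by simp) ?_
        rw [h1'] at hD
        have e1 : (X'.concat e) ++ (x :: y :: M) ++ Z = X' ++ (e :: x :: (y :: M ++ Z)) := by simp
        rw [e1] at hD
        exact (List.isChain_cons_cons.1 (List.IsChain.right_of_append hD)).1
    have hZ : Z = [] := by
      cases Z with
      | nil => rfl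
      | cons f Z =>
        exfalso
        obtain ⟨M', g, hg⟩ : ∃ M' g, x :: y :: M = M' ++ [g] :=
          ⟨_, _, (List.dropLast_append_getLast (by simp)).symm⟩
        refine h5 g (by rw [hg]; simp) f (by simp) ?_
        rw [h1', hg] at hD
        have e1 : X ++ (M' ++ [g]) ++ f :: Z = (X ++ M') ++ (g :: f :: Z) := by simp
        rw [e1] at hD
        exact (List.isChain_cons_cons.1 (List.IsChain.right_of_append hD)).1
    rw [h1', hX, hZ]; simp

/-- A low slice is a tame histogram. -/
lemma exists_slice {s m : ℝ} (hs : 8 ≤ s) {u z : Plane} {T : List Plane}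
    (hG : (u :: T).IsChain (SteepUp s)) (hz : (u :: T).getLast? = some z) (hT : T ≠ [])
    (hm : m < u 0) (hh : 3 * (z 1 - u 1) ≤ u 0 - m) :
    ∃ Q : SimplePolygon, IsTameHistogram s Q ∧
      (∀ᵐ p : Plane, Q.region.indicator (fun _ => (1 : ℤ)) p =
        hcount (pathEdges (u :: T)) p - hc (pt m (u 1), pt m (z 1)) p) ∧
      Q.hper ≤ 2 * (u 0 - m) + (z 1 - u 1) ∧ Q.per ≤ Q.hper + 4 * (z 1 - u 1) := by
  have hG' : (u :: T).IsChain (StairEdge s) := hG.imp fun _ _ => SteepUp.stairEdge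
  have hzm : z ∈ u :: T := List.mem_of_getLast? hz
  have hb := fun {v : Plane} (hv : v ∈ u :: T) => steepUp_bound hs hG hv
  have hle := fun {v : Plane} (hv : v ∈ u :: T) => le_of_steepUp hG' hz hv
  -- The width on each level has to be 9/4 of the height still above it: 1 for the vertical side and
  -- 5/4 for the steep one. At the bottom the factor is 3, and the steep path recedes by at most an
  -- eighth of the height climbed.
  have hvx : ∀ v ∈ u :: T, 9 / 4 * (z 1 - v 1) ≤ v 0 - m ∧ m < v 0 := by
    intro v hv
    have h1 := hb hv
    have h2 := hle hv
    have h3 := neg_abs_le (v 0 - u 0)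
    have h4 := abs_nonneg (v 0 - u 0)
    constructor <;> linarith
  obtain ⟨t, T', rfl⟩ := List.exists_cons_of_ne_nil hT
  have hut := (List.isChain_cons_cons.1 hG).1
  have huz : u 1 < z 1 := lt_of_lt_of_le hut.1 (hle (by simp))
  set A : Plane := pt m (u 1) with hA
  set B : Plane := pt m (z 1) with hB
  have hchain : (A :: u :: t :: T').IsChain (StairEdge s) :=
    List.isChain_cons_cons.2 ⟨Or.inl (by simp [hA, hm]), hG'⟩
  have hjoin : (A :: u :: t :: T').getLast? = some z := by
    rw [List.getLast?_cons_cons]; exact hz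
  have hzB : z 0 - m > 0 := by linarith [(hvx z hzm).2]
  have hC : IsRightChain A (u :: t :: T') B := by
    have hmm : (A :: u :: t :: T').IsChain fun u v => u 1 ≤ v 1 ∧ u ≠ v :=
      hchain.imp fun u v h => ⟨h.le, by
        rintro rfl
        rcases h.lex with h | h
        · exact lt_irrefl _ h
        · exact lt_irrefl _ h.2⟩
    have hm' : (A :: ((u :: t :: T') ++ [B])).IsChain fun u v => u 1 ≤ v 1 ∧ u ≠ v :=
      isChain_join hjoin hmm (by
        simp only [List.isChain_cons_cons, List.isChain_singleton, and_true]
        refine ⟨by simp [hB], fun h => ?_⟩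
        rw [h] at hzB
        simp [hB] at hzB)
    refine ⟨hm'.imp fun u v h => by simpa using h.1, hm'.imp fun u v h => h.2, ?_, by simp, ?_,
      by simpa [hA, hB] using huz⟩
    · intro x y w hxyw k1 k2
      rw [← List.cons_append, List.infix_concat_iff] at hxyw
      rcases hxyw with ⟨X, hX⟩ | hxyw
      · exfalso
        obtain ⟨M0, hM0⟩ := List.getLast?_eq_some_iff.1 hz
        rw [hM0] at hX
        have := congrArg List.reverse hX
        simp only [List.reverse_append, List.reverse_cons, List.reverse_nil, List.nil_append,
          List.cons_append, List.cons.injEq] at this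
        obtain ⟨-, rfl, h3⟩ := this
        obtain ⟨M1, q, rfl⟩ : ∃ M1 q, M0 = M1 ++ [q] := by
          rcases List.eq_nil_or_concat M0 with rfl | ⟨M1, q, rfl⟩
          · simp at hM0
          · exact ⟨M1, q, by simp⟩
        simp only [List.reverse_append, List.reverse_cons, List.reverse_nil, List.nil_append,
          List.cons_append, List.cons.injEq] at h3
        rw [hM0] at hG
        have e : M1 ++ [q] ++ [y] = M1 ++ [q, y] := by simp
        rw [e] at hG
        have := (List.isChain_cons_cons.1 (List.IsChain.right_of_append hG)).1.1
        rw [h3.1] at k1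
        exact absurd k1 this.ne
      · exact noBack_stair hchain x y w hxyw k1 k2
    · intro v hv
      have := (hvx v hv).2
      simp only [hA, hB, pt_zero, pt_one, sub_self, zero_mul]
      exact mul_pos (by linarith) (by linarith)
  have hl : pathEdges (A :: ((u :: t :: T') ++ [B])) =
      (A, u) :: pathEdges (u :: t :: T') ++ [(z, B)] := by
    rw [← List.cons_append, pathEdges_join hjoin]; simp
  have hper := per_le (s := s) (by linarith) hC (by
    rw [hl]
    intro e he
    rcases List.mem_append.1 he with he | he
    · rcases List.mem_cons.1 he with rfl | he
      · left; simp [hA]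
      · exact Or.inr (isChain_iff_pathEdges.1 hG e he).2
    · rw [List.mem_singleton.1 he]; left; simp [hB]) (Or.inl (by simp [hA, hB]))
  have hhper : hC.polygon.hper = (u 0 - m) + (z 0 - m) := by
    show horizontalWeight (cyclicEdges (A :: ((u :: t :: T') ++ [B]))) = _
    rw [cyclicEdges_chain, hl, horizontalWeight_append, horizontalWeight_append,
      horizontalWeight_cons, horizontalWeight_steepUp hG, horizontalWeight_cons,
      horizontalWeight_cons, if_pos (by simp [hA]), if_pos (by simp [hB]),
      if_neg (by simpa [hA, hB] using huz.ne'), dist_level (by simp [hA]),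
      dist_level (by simp [hB])]
    simp only [hA, hB, pt_zero, horizontalWeight_nil]
    rw [abs_of_pos (by linarith), abs_sub_comm, abs_of_pos (by linarith)]
    ring
  refine ⟨hC.polygon, ?_, ?_, ?_, ?_⟩
  · set D := (u :: t :: T').reverse with hD
    have hDh : D.head? = some z := by rw [hD, List.head?_reverse, hz]
    obtain ⟨D', hD'⟩ : ∃ D', D = z :: D' := by
      match D, hDh with
      | d :: D', h => exact ⟨D', by simpa using h⟩
    have hDdesc : D.IsChain Descends := by
      rw [hD, List.isChain_reverse]
      exact hG.imp fun _ _ h => h.1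
    have hDf : (B :: D).IsChain Forward := by
      rw [hD', List.isChain_cons_cons]
      constructor
      · unfold Forward
        rw [dist_level (by simp [hB]), abs_of_pos (by simpa [hB] using hzB)]
        simp [hB]
      · rw [← hD', hD, List.isChain_reverse]
        exact hG.imp fun _ _ h => h.forward hs
    have hJ : ∀ v ∈ B :: D, 9 / 4 * (z 1 - v 1) ≤ v 0 - m := by
      intro v hv
      rcases List.mem_cons.1 hv with rfl | hv
      · simp [hB]
      · exact (hvx v (List.mem_reverse.1 hv)).1
    refine ⟨A, u, A :: B :: D, rfl, ?_, by simp [hA], by simpa [hA] using hm, Or.inr ?_, ?_, ?_, ?_⟩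
    · rw [hD]; simp [List.getLast?_cons]
    · show _ ~r (A :: ((u :: t :: T') ++ [B]))
      have e : (A :: B :: D).reverse = (u :: t :: T') ++ [B] ++ [A] := by rw [hD]; simp
      rw [e]
      exact List.isRotated_append (l' := [A])
    · rw [hD', List.isChain_cons_cons, List.isChain_cons_cons, ← hD', hD, List.isChain_reverse]
      refine ⟨Or.inl (Or.inl (by simp [hA, hB])), Or.inr ⟨by simp [hB], by simpa [hB] using hzB⟩,
        hG.imp fun x y h => Or.inl ?_⟩
      rcases h.2 with h | ⟨h, h'⟩ | ⟨h, h'⟩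
      · exact Or.inl h.symm
      · exact Or.inr (Or.inl ⟨h.symm, by linarith⟩)
      · exact Or.inr (Or.inr ⟨h.symm, by linarith⟩)
    -- There is one ascending and one descending run, so no two distinct runs exist.
    · intro R hR M M' hM hM' hne
      exfalso
      apply hne
      rcases hR with rfl | rfl
      · have k : ∀ d ∈ D.head?, ¬ Ascends B d := by
          rw [hDh]; intro d hd; simp at hd; subst hd; simp [Ascends, hB]
        rw [maximalRun_ascends k hDdesc hM, maximalRun_ascends k hDdesc hM']
      · have k : ∀ d ∈ D.head?, ¬ Descends B d := by
          rw [hDh]; intro d hd; simp at hd; subst hd; simp [Descends, hB]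
        have k' : ¬ Descends A B := by simp [Descends, hA, hB, huz.le]
        rw [maximalRun_descends k' k hDdesc hM, maximalRun_descends k' k hDdesc hM']
    · rintro a b N ⟨X, M, Z, v, w, h1, rfl, h3, h4⟩ hab -
      have hlast : ∀ {v' a' : Plane} {M' : List Plane},
          (v' :: (M' ++ [w])).IsChain Forward → a' ∈ segment ℝ v' (M'.head?.getD w) →
          b ∈ segment ℝ (M'.getLast?.getD v') w → M' ≠ [] → (a' :: (M' ++ [b])).IsChain Forward := by
        intro v' a' M' k1 k2 k3 k4
        obtain ⟨x, M1, hM1⟩ := List.exists_cons_of_ne_nil k4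
        have q1 : (a' :: (M' ++ [w])).IsChain Forward := by
          subst hM1
          simp only [List.cons_append, List.isChain_cons_cons] at k1 ⊢
          exact ⟨k1.1.right (by simpa using k2), k1.2⟩
        obtain ⟨M2, y, hM2⟩ : ∃ M2 y, M' = M2 ++ [y] :=
          ⟨_, _, (List.dropLast_append_getLast k4).symm⟩
        rw [hM2] at q1 k3 ⊢
        simp only [List.getLast?_append, List.getLast?_singleton, Option.some_or,
          Option.getD_some] at k3
        have e1 : ∀ w : Plane, a' :: (M2 ++ [y] ++ [w]) = (a' :: M2) ++ (y :: [w]) := by simp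
        rw [e1] at q1 ⊢
        have e2 : ((a' :: M2) ++ [y]).IsChain Forward := by
          have : (a' :: M2) ++ [y, w] = (a' :: M2 ++ [y]) ++ [w] := by simp
          rw [this] at q1
          exact List.IsChain.left_of_append q1
        have := isChain_join (T := [b]) (z := y) (l := (a' :: M2) ++ [y]) (by exact List.getLast?_concat) e2 (by
          simp only [List.isChain_cons_cons, List.isChain_singleton, and_true]
          have := (List.isChain_cons_cons.1 (List.IsChain.right_of_append q1)).1
          exact this.left k3)
        simpa using this
      by_cases hM : M = []
      · subst hM
        simp only [List.nil_append, pathEdges_cons_cons, pathEdges_single, weight_cons, weight_nil]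
        linarith [dist_nonneg (x := a) (y := b)]
      have hlast? : ∀ x : Plane, (x :: (M ++ [b])).getLast? = some b := by
        intro x; rw [← List.cons_append]; exact List.getLast?_concat
      -- Only if `a` is on the vertical side does the width estimate enter. Otherwise all edges from
      -- `a` on are `Forward`, and since `a` and `b` are on one level, the subpath is no longer than
      -- the chord.
      cases X with
      | nil =>
        simp only [List.nil_append, List.cons.injEq] at h1
        obtain ⟨rfl, h1⟩ := h1
        obtain ⟨x, M1, rfl⟩ := List.exists_cons_of_ne_nil hM
        simp only [List.cons_append, List.cons.injEq] at h1
        obtain ⟨rfl, h1⟩ := h1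
        have ha0 : a 0 = m := by
          obtain ⟨t, -, -, hx, -⟩ := mem_segment_coord.1 h3
          rw [hx]; simp [hA, hB]
        have ha1 : a 1 ≤ z 1 := by
          obtain ⟨t, t0, t1, -, hy⟩ := mem_segment_coord.1 h3
          rw [hy]; simp [hA, hB]; nlinarith
        have hbB : (B :: (M1 ++ [b])).IsChain Forward ∧ 9 / 4 * (z 1 - b 1) ≤ b 0 - m := by
          have hsub : (B :: (M1 ++ [w])).IsChain Forward := by
            rw [h1] at hDf
            have e : B :: (M1 ++ w :: Z) = (B :: (M1 ++ [w])) ++ Z := by simp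
            rw [e] at hDf
            exact List.IsChain.left_of_append hDf
          have hw : w ∈ B :: D := by rw [h1]; simp
          have hl : (M1.getLast?.getD B) ∈ B :: D := by
            rw [h1]
            cases hM1 : M1.getLast? with
            | none => simp
            | some y => simp [List.mem_of_getLast? hM1]
          have h4' : b ∈ segment ℝ (M1.getLast?.getD B) w := by
            rw [List.getLast?_cons] at h4
            simpa using h4
          constructor
          · by_cases hM1 : M1 = []
            · subst hM1
              simp only [List.nil_append, List.isChain_cons_cons, List.isChain_singleton,
                and_true] at hsub ⊢
              exact hsub.left (by simpa using h4')
            · refine hlast hsub ?_ h4' hM1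
              exact left_mem_segment _ _ _
          · obtain ⟨t, t0, t1, hx, hy⟩ := mem_segment_coord.1 h4'
            have j1 := hJ _ hl
            have j2 := hJ _ hw
            rw [hx, hy]
            nlinarith
        have hw := weight_forward hbB.1 (by
          have := hlast? a
          rwa [List.cons_append, List.getLast?_cons_cons] at this)
        have hd : dist a B = z 1 - a 1 := by
          rw [dist_vertical (by simp [ha0, hB])]
          simp only [hB, pt_one]
          rw [abs_of_nonneg (by linarith)]
        have hab' : b 0 - m ≤ dist a b := by
          rw [dist_level hab, ha0]; exact le_abs_self _
        rw [List.cons_append, pathEdges_cons_cons, weight_cons]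
        simp only
        rw [hd]
        have hB0 : B 0 = m := by simp [hB]
        have hB1 : B 1 = z 1 := by simp [hB]
        rw [hB0, hB1, ← hab] at hw
        have := hbB.2
        rw [← hab] at this
        linarith
      | cons y X =>
        simp only [List.cons_append, List.cons.injEq] at h1
        obtain ⟨-, h1⟩ := h1
        have hsub : (v :: (M ++ [w])).IsChain Forward := by
          rw [h1] at hDf
          have e : X ++ v :: (M ++ w :: Z) = X ++ ((v :: (M ++ [w])) ++ Z) := by simp
          rw [e] at hDf
          exact List.IsChain.left_of_append (List.IsChain.right_of_append hDf)
        have hw := weight_forward (hlast hsub h3 h4 hM) (hlast? a)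
        have hab' : b 0 - a 0 ≤ dist a b := by
          rw [dist_level hab]; exact le_abs_self _
        rw [hab] at hw
        linarith [dist_nonneg (x := a) (y := b)]
  · filter_upwards [ae_not_mem_trace (cyclicEdges (A :: ((u :: t :: T') ++ [B])))] with p hp
    rw [show hC.polygon.region = IsRightChain.region A (u :: t :: T') B from rfl, hC.indicator hp,
      hl, hcount_append, hcount_cons, hcount_cons, hc_level (by simp [hA]),
      hc_level (u := z) (v := B) (by simp [hB])]
    simp
  · rw [hhper]
    have h1 := hb hzm
    have h2 := le_abs_self (z 0 - u 0)
    have h3 := abs_nonneg (z 0 - u 0)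
    linarith
  · simpa [hA, hB] using hper

/-! ### Towers -/

/-- This is a right triangle. Its hypotenuse and horizontal leg form the path `pqr` of a fuzzy
staircase, and its vertical leg is the whole staircase path. -/
lemma exists_tip {s m : ℝ} (hs : 1 ≤ s) {A B u : Plane} (hA : A 0 = m) (hB : B 0 = m)
    (hu : m < u 0)
    (h : (u 1 = B 1 ∧ u 1 - A 1 = s * (u 0 - m)) ∨ (u 1 = A 1 ∧ B 1 - u 1 = s * (u 0 - m))) :
    ∃ Q : SimplePolygon, IsFuzzyStaircase s Q ∧
      (∀ᵐ p : Plane, Q.region.indicator (fun _ => (1 : ℤ)) p =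
        hc (A, u) p + hc (u, B) p - hc (A, B) p) ∧
      Q.hper = u 0 - m ∧ Q.per ≤ (1 + 4 * s) * (u 0 - m) := by
  have hp : 0 < s * (u 0 - m) := mul_pos (by linarith) (by linarith)
  have hAB : B 1 - A 1 = s * (u 0 - m) := by rcases h with h | h <;> linarith
  have hC : IsRightChain A [u] B := by
    refine ⟨?_, ?_, ?_, by simp, ?_, by linarith⟩
    · simp only [MonoY, List.singleton_append, List.isChain_cons_cons, List.isChain_singleton,
        and_true]
      rcases h with h | h <;> constructor <;> linarith
    · simp only [List.singleton_append, List.isChain_cons_cons, List.isChain_singleton, and_true]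
      constructor
      · rintro rfl; linarith
      · rintro rfl; linarith
    · intro x y w hxyw k1 k2
      have := hxyw.eq_of_length (by simp)
      simp only [List.singleton_append, List.cons.injEq] at this
      obtain ⟨rfl, rfl, rfl, -⟩ := this
      linarith
    · intro v hv
      rw [List.mem_singleton.1 hv, hA, hB, sub_self, zero_mul]
      exact mul_pos (by linarith) (by linarith)
  have hper : hC.polygon.hper = u 0 - m := by
    show horizontalWeight (cyclicEdges (A :: ([u] ++ [B]))) = _
    rw [cyclicEdges_chain]
    simp only [List.singleton_append, pathEdges_cons_cons, pathEdges_single, List.cons_append,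
      List.nil_append, horizontalWeight_cons, horizontalWeight_nil]
    rw [if_neg (by linarith : ¬ B 1 = A 1)]
    rcases h with h | h
    · rw [if_neg (by linarith), if_pos h.1, dist_level h.1, hB, abs_of_neg (by linarith)]
      ring
    · rw [if_pos h.1.symm, if_neg (by linarith), dist_level h.1.symm, hA, abs_of_pos (by linarith)]
      ring
  refine ⟨hC.polygon, ?_, ?_, hper, ?_⟩
  · rcases h with h | h
    · refine ⟨B, u, A, [B, A], [B, A], h.1.symm, Or.inl ⟨by rw [hA]; exact hu.ne', ?_⟩, ?_,
        .vertical B A [] [] [] (by rw [hA, hB]) ⟨by simp, ?_, ?_⟩ (.single _), rfl, rfl, Or.inl ?_⟩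
      · rw [hA]; linarith
      · refine ⟨?_, Or.inl ?_, Or.inr ?_⟩
        · simp [hA, hB]
        · simp [hA, hB]
        · simp; linarith
      · simp [IsSteepEdge, hA, hB]
      · right; simp [Descends]; linarith
      · exact ⟨1, rfl⟩
    · refine ⟨A, u, B, [A, B], [A, B], h.1.symm, Or.inr ⟨by rw [hB]; exact hu.ne', ?_⟩, ?_,
        .vertical A B [] [] [] (by rw [hA, hB]) ⟨by simp, ?_, ?_⟩ (.single _), rfl, rfl, Or.inr ?_⟩
      · rw [hB]; linarith
      · refine ⟨?_, Or.inl ?_, Or.inl ?_⟩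
        · simp [hA, hB]
        · simp [hA, hB]
        · simp; linarith
      · simp [IsSteepEdge, hA, hB]
      · left; simp [Ascends]; linarith
      · exact ⟨2, rfl⟩
  · filter_upwards [ae_not_mem_trace (cyclicEdges (A :: ([u] ++ [B])))] with p hp
    rw [show hC.polygon.region = IsRightChain.region A [u] B from rfl, hC.indicator hp]
    simp [add_assoc]
  · have := per_le (s := s) hs hC (by
      simp only [List.singleton_append, pathEdges_cons_cons, pathEdges_single, List.mem_cons,
        List.not_mem_nil, or_false]
      rcases h with h | h
      · rintro e (rfl | rfl)
        · exact Or.inr (Or.inr (Or.inl ⟨by simp only; linarith, by simp only [hA]; linarith⟩))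
        · exact Or.inl h.1
      · rintro e (rfl | rfl)
        · exact Or.inl h.1.symm
        · exact Or.inr (Or.inr (Or.inr ⟨by simp only; linarith, by simp only [hB]; linarith⟩)))
      (Or.inl (by rw [hA, hB]))
    rw [hper, hAB] at this
    linarith

/-- A steep path is cut at a level. -/
lemma cut_steep {s : ℝ} {c : ℝ} : ∀ {T : List Plane} {u z : Plane}, (u :: T).IsChain (SteepUp s) →
    (u :: T).getLast? = some z → u 1 < c → c < z 1 →
    ∃ (T1 T2 : List Plane) (w : Plane), w 1 = c ∧ T1 ≠ [] ∧ T2 ≠ [] ∧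
      (u :: T1).IsChain (SteepUp s) ∧ (u :: T1).getLast? = some w ∧
      (w :: T2).IsChain (SteepUp s) ∧ (w :: T2).getLast? = some z ∧
      (∀ p, hcount (pathEdges (u :: T)) p =
        hcount (pathEdges (u :: T1)) p + hcount (pathEdges (w :: T2)) p) ∧
      ∀ K : Set Plane, Convex ℝ K → (∀ v ∈ u :: T, v ∈ K) → (∀ v ∈ u :: T1, v ∈ K) ∧
        ∀ v ∈ w :: T2, v ∈ K := by
  intro T
  induction T with
  | nil =>
    intro u z _ hz h1 h2
    simp only [List.getLast?_singleton, Option.some.injEq] at hz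
    subst hz
    linarith
  | cons t T ih =>
    intro u z hG hz h1 h2
    have hut := (List.isChain_cons_cons.1 hG).1
    have htT := (List.isChain_cons_cons.1 hG).2
    rw [List.getLast?_cons_cons] at hz
    rcases lt_trichotomy (t 1) c with hc | hc | hc
    · obtain ⟨T1, T2, w, e1, e2, e3, e4, e5, e6, e7, e8, e9⟩ := ih htT hz hc h2
      refine ⟨t :: T1, T2, w, e1, by simp, e3, List.isChain_cons_cons.2 ⟨hut, e4⟩, by
        rw [List.getLast?_cons_cons, e5], e6, e7, ?_, ?_⟩
      · intro p
        simp only [pathEdges_cons_cons, hcount_cons, e8]; ring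
      · intro K hK hv
        have := e9 K hK fun v h => hv v (List.mem_cons_of_mem _ h)
        refine ⟨?_, this.2⟩
        intro v h
        rcases List.mem_cons.1 h with rfl | h
        · exact hv _ (by simp)
        · exact this.1 v h
    · refine ⟨[t], T, t, hc, by simp, ?_, by simpa using hut, by simp, htT, hz, ?_, ?_⟩
      · rintro rfl
        simp only [List.getLast?_singleton, Option.some.injEq] at hz
        subst hz
        linarith
      · intro p; simp
      · intro K hK hv
        refine ⟨?_, fun v h => hv v (List.mem_cons_of_mem _ h)⟩
        intro v h
        apply hv
        simp only [List.mem_cons, List.not_mem_nil, or_false] at h ⊢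
        tauto
    · set τ := (c - u 1) / (t 1 - u 1) with hτ
      have hd : 0 < t 1 - u 1 := by linarith
      have hτ0 : 0 < τ := div_pos (by linarith) hd
      have hτ1 : τ < 1 := (div_lt_one hd).2 (by linarith)
      have hτd : τ * (t 1 - u 1) = c - u 1 := div_mul_cancel₀ _ hd.ne'
      set w : Plane := pt (u 0 + τ * (t 0 - u 0)) (u 1 + τ * (t 1 - u 1)) with hw
      have hw0 : w 0 = u 0 + τ * (t 0 - u 0) := by simp [hw]
      have hw1 : w 1 = c := by simp [hw, hτd]
      have hws : w ∈ segment ℝ u t :=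
        mem_segment_coord.2 ⟨τ, hτ0.le, hτ1.le, by simp [hw], by simp [hw]⟩
      have k1 : SteepUp s u w ∧ SteepUp s w t := by
        refine ⟨⟨by rw [hw1]; exact h1, ?_⟩, ⟨by rw [hw1]; exact hc, ?_⟩⟩
        all_goals
          rcases hut.2 with h | ⟨h, h'⟩ | ⟨h, h'⟩
          · left; rw [hw0, h]; ring
          · right; left
            constructor
            · rw [hw0]
              intro hh
              apply h
              have h3 : (t 0 - u 0) = 0 := by
                by_contra hne
                have : τ * (t 0 - u 0) = 0 ∨ (1 - τ) * (t 0 - u 0) = 0 := by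
                  first
                  | left; linarith
                  | right; linarith
                rcases this with h | h <;> rcases mul_eq_zero.1 h with h | h <;> first | linarith | exact hne h
              linarith
            · rw [hw1, hw0]
              have : s * (τ * (t 0 - u 0)) = τ * (t 1 - u 1) := by rw [h']; ring
              linarith
          · right; right
            constructor
            · rw [hw0]
              intro hh
              apply h
              have h3 : (t 0 - u 0) = 0 := by
                by_contra hne
                have : τ * (t 0 - u 0) = 0 ∨ (1 - τ) * (t 0 - u 0) = 0 := by
                  first
                  | left; linarith
                  | right; linarith
                rcases this with h | h <;> rcases mul_eq_zero.1 h with h | h <;> first | linarith | exact hne h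
              linarith
            · rw [hw1, hw0]
              have : -s * (τ * (t 0 - u 0)) = τ * (t 1 - u 1) := by rw [h']; ring
              linarith
      refine ⟨[w], t :: T, w, hw1, by simp, by simp, by simpa using k1.1, by simp,
        List.isChain_cons_cons.2 ⟨k1.2, htT⟩, by rwa [List.getLast?_cons_cons], ?_, ?_⟩
      · intro p
        simp only [pathEdges_cons_cons, hcount_cons, hc_split hut.1.le hws, pathEdges_single,
          hcount_nil]
        ring
      · intro K hK hv
        have hwK : w ∈ K := hK.segment_subset (hv _ (by simp)) (hv t (by simp)) hws
        constructor
        · intro v h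
          simp only [List.mem_cons, List.not_mem_nil, or_false] at h
          rcases h with rfl | rfl
          · exact hv _ (by simp)
          · exact hwK
        · intro v h
          rcases List.mem_cons.1 h with rfl | h
          · exact hwK
          · exact hv v (List.mem_cons_of_mem _ h)

/-- Slices are cut off from below, each of height one third of the width at its bottom. Except for
the last one, a slice then has horizontal perimeter at most 7 times its height, of which 6 stand for
twice the width and 1 for a possible widening; the perimeter adds 4 more. Only the last slice may be
flatter, and it pays `2 * W`. The lower bound `δ` on the width makes the procedure stop. -/
lemma exists_slices {s m δ W : ℝ} (hs : 8 ≤ s) (hδ : 0 < δ) (n : ℕ) :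
    ∀ (T : List Plane) (u z : Plane), (u :: T).IsChain (SteepUp s) → (u :: T).getLast? = some z →
      (∀ v ∈ u :: T, δ ≤ v 0 - m ∧ v 0 - m ≤ W) → 3 * (z 1 - u 1) ≤ n * δ →
      ∃ F : List SimplePolygon, (∀ Q ∈ F, IsTile s Q) ∧
        (∀ᵐ p : Plane, cnt F p = hcount (pathEdges (u :: T)) p - hc (pt m (u 1), pt m (z 1)) p) ∧
        sumHper F ≤ 7 * (z 1 - u 1) + 2 * W ∧ sumPer F ≤ 11 * (z 1 - u 1) + 2 * W := by
  induction n with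
  | zero =>
    intro T u z hG hz hv hn
    have hW : 0 ≤ W := by have := hv u (by simp); linarith
    cases T with
    | nil =>
      simp only [List.getLast?_singleton, Option.some.injEq] at hz
      subst hz
      refine ⟨[], by simp, ?_, by simpa using hW, by simpa using hW⟩
      filter_upwards with p
      rw [hc_level (by simp)]; simp
    | cons t T =>
      exfalso
      have h1 := (List.isChain_cons_cons.1 hG).1.1
      have h2 := le_of_steepUp (hG.imp fun _ _ => SteepUp.stairEdge) hz (v := t) (by simp)
      simp at hn
      linarith
  | succ n ih =>
    intro T u z hG hz hv hn
    have hu := hv u (by simp)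
    have hW : 0 ≤ W := by linarith
    by_cases hT : T = []
    · subst hT
      simp only [List.getLast?_singleton, Option.some.injEq] at hz
      subst hz
      refine ⟨[], by simp, ?_, by simpa using hW, by simpa using hW⟩
      filter_upwards with p
      rw [hc_level (by simp)]; simp
    by_cases hh : 3 * (z 1 - u 1) ≤ u 0 - m
    · obtain ⟨Q, h1, h2, h3, h4⟩ := exists_slice hs hG hz hT (by linarith) hh
      refine ⟨[Q], by simpa [IsTile] using Or.inr h1, by simpa using h2, ?_, ?_⟩
      · simp only [sumHper_cons, sumHper_nil]
        have := le_of_steepUp (hG.imp fun _ _ => SteepUp.stairEdge) hz (v := u) (by simp)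
        linarith
      · simp only [sumPer_cons, sumPer_nil]
        have := le_of_steepUp (hG.imp fun _ _ => SteepUp.stairEdge) hz (v := u) (by simp)
        linarith
    · push Not at hh
      obtain ⟨T1, T2, w, e1, e2, e3, e4, e5, e6, e7, e8, e9⟩ :=
        cut_steep (c := u 1 + (u 0 - m) / 3) hG hz (by linarith) (by linarith)
      have e10 := e9 {p | δ ≤ p 0 - m ∧ p 0 - m ≤ W} (by
        intro p hp q hq a b ha hb hab
        simp only [Set.mem_setOf_eq, PiLp.add_apply, PiLp.smul_apply, smul_eq_mul] at hp hq ⊢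
        obtain rfl : b = 1 - a := by linarith
        constructor <;> nlinarith) hv
      obtain ⟨Q, h1, h2, h3, h4⟩ := exists_slice hs e4 e5 e2 (m := m) (by linarith) (by linarith)
      obtain ⟨F, f1, f2, f3, f4⟩ := ih T2 w z e6 e7 e10.2 (by
        push_cast at hn
        linarith)
      refine ⟨Q :: F, ?_, ?_, ?_, ?_⟩
      · intro q hq
        rcases List.mem_cons.1 hq with rfl | hq
        · exact Or.inr h1
        · exact f1 q hq
      · filter_upwards [h2, f2] with p hp hp'
        have hsp := hc_split (u := pt m (u 1)) (v := pt m (z 1)) (z := pt m (w 1))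
          (by simp; linarith) (mem_segment_coord.2
          ⟨(w 1 - u 1) / (z 1 - u 1), div_nonneg (by linarith) (by linarith),
            (div_le_one (by linarith)).2 (by linarith), by simp, by
            simp only [pt_one]
            rw [div_mul_cancel₀ _ (by linarith)]; ring⟩) p
        rw [cnt_cons, hp, hp', e8, hsp]
        ring
      · rw [sumHper_cons]; linarith
      · rw [sumPer_cons]; linarith

/-- Rows with vertical base can be tiled. -/
theorem exists_tiles_vertical {s m a : ℝ} {R : List (ℝ × ℝ)} (hs : 8 ≤ s) (hR : ∀ r ∈ R, 0 < r.1)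
    (hm : ∀ r ∈ R, m < r.2) :
    ∃ F : List SimplePolygon, (∀ Q ∈ F, IsTile s Q) ∧
      (∀ᵐ p : Plane, cnt F p = rowCount a R p - hc (pt m a, pt m (a + ht R)) p) ∧
      sumHper F ≤ 8 * (pvar m R m + ht R) ∧ sumPer F ≤ 8 * s * (pvar m R m + ht R) := by
  obtain ⟨T, F, h1, h2, h3, h4, h5, h6, h7⟩ :=
    env_pinned (s := s) (by linarith) _ R m a le_rfl hR hm
  have hpv := pvar_nonneg m R m
  have hht := ht_nonneg hR
  have hsp : 8 * pvar m R m ≤ s * pvar m R m := mul_le_mul_of_nonneg_right hs hpv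
  have hsh : 8 * ht R ≤ s * ht R := mul_le_mul_of_nonneg_right hs hht
  set A := pt m a
  set B := pt m (a + ht R)
  -- The path is then a point or the base itself, and nothing is left between the two.
  by_cases hT : T = [] ∨ T = [B]
  · refine ⟨F, fun Q hQ => Or.inl (h3 Q hQ), ?_, by linarith, by linarith⟩
    filter_upwards [h4] with p hp
    rw [hp]
    rcases hT with rfl | rfl
    · simp only [List.getLast?_singleton, Option.some.injEq] at h1
      simp [← h1, hc_level]
    · simp
  · push Not at hT
    obtain ⟨hT0, hT1⟩ := hT
    obtain ⟨T', hT'⟩ : ∃ T', T = T' ++ [B] := by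
      obtain ⟨t, T, rfl⟩ := List.exists_cons_of_ne_nil hT0
      rw [List.getLast?_cons_cons] at h1
      exact List.getLast?_eq_some_iff.1 h1
    subst hT'
    obtain ⟨u, U, rfl⟩ : ∃ u U, T' = u :: U := List.exists_cons_of_ne_nil (by
      rintro rfl; exact hT1 rfl)
    obtain ⟨z, hz⟩ : ∃ z, (u :: U).getLast? = some z :=
      ⟨_, List.getLast?_eq_some_getLast (by simp)⟩
    have hAu : SteepUp s A u := (List.isChain_cons_cons.1 h2).1
    have hC : (u :: U).IsChain (SteepUp s) :=
      List.IsChain.left_of_append (List.isChain_cons_cons.1 h2).2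
    have hzB : SteepUp s z B := by
      obtain ⟨X, hX⟩ := List.getLast?_eq_some_iff.1 hz
      have : ((u :: U) ++ [B]).IsChain (SteepUp s) := (List.isChain_cons_cons.1 h2).2
      rw [hX, List.append_assoc] at this
      exact (List.isChain_cons_cons.1 (List.IsChain.right_of_append this)).1
    have hA1 : A 1 = a := by simp [A]
    have hA0 : A 0 = m := by simp [A]
    have hB1 : B 1 = a + ht R := by simp [B]
    have hB0 : B 0 = m := by simp [B]
    have hst := h2.imp (fun _ _ => SteepUp.stairEdge)
    have hzm : z ∈ u :: U := List.mem_of_getLast? hz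
    have hvl : ∀ v ∈ u :: U, a < v 1 ∧ v 1 < a + ht R := by
      intro v hv
      have k1 := stair_pairwise (hC.imp (fun _ _ => SteepUp.stairEdge))
      have k2 := le_of_steepUp (hC.imp (fun _ _ => SteepUp.stairEdge)) hz hv
      have k3 := steepUp_bound hs hC hv
      have k4 := hAu.1
      have k5 := hzB.1
      have := abs_nonneg (v 0 - u 0)
      constructor <;> linarith
    -- Here the condition on vertices in `EnvW` is needed: an inner vertex is to the right of a row
    -- value, which exceeds `m`, or strictly to the right of the ends.
    have hvm : ∀ v ∈ u :: U, m < v 0 := by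
      intro v hv
      have hl := hvl v hv
      rcases h5 v (List.mem_cons_of_mem _ (List.mem_append_left _ hv)) with h | h | ⟨r, hr, h⟩ | h
      · rw [h, hA1] at hl; linarith
      · rw [h, hB1] at hl; linarith
      · exact (hm r hr).trans_le h
      · exact h.1
    have hvW : ∀ v ∈ u :: U, 8 * (v 0 - m) ≤ ht R := by
      intro v hv
      have k := steepUp_bound hs h2 (List.mem_cons_of_mem _ (List.mem_append_left [B] hv))
      have := le_abs_self (v 0 - A 0)
      rw [hA0, hA1] at k
      rw [hA0] at this
      linarith [(hvl v hv).2]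
    obtain ⟨δ, hδ, hδ'⟩ : ∃ δ > 0, ∀ v ∈ u :: U, δ ≤ v 0 - m := by
      have : ∀ l : List Plane, (∀ v ∈ l, m < v 0) → ∃ δ > 0, ∀ v ∈ l, δ ≤ v 0 - m := by
        intro l
        induction l with
        | nil => intro; exact ⟨1, one_pos, by simp⟩
        | cons v l ih =>
          intro h
          obtain ⟨δ, h1, h2⟩ := ih fun v hv => h v (List.mem_cons_of_mem _ hv)
          refine ⟨min δ (v 0 - m), lt_min h1 (by have := h v (by simp); linarith), ?_⟩
          intro w hw
          rcases List.mem_cons.1 hw with rfl | hw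
          · exact min_le_right _ _
          · exact (min_le_left _ _).trans (h2 w hw)
      exact this _ hvm
    obtain ⟨n, hn⟩ := exists_nat_ge (3 * (z 1 - u 1) / δ)
    obtain ⟨F2, g1, g2, g3, g4⟩ := exists_slices (W := ht R / 8) hs hδ n U u z hC hz
      (fun v hv => ⟨hδ' v hv, by linarith [hvW v hv]⟩) ((div_le_iff₀ hδ).1 hn)
    -- The first edge rises from the line `x = m` to the right, so its slope must be `s`; likewise
    -- the last edge has slope `-s`. They are the inclined sides of the tips.
    have sA : u 1 - a = s * (u 0 - m) := by
      have := hvm u (by simp)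
      rcases hAu.2 with h | ⟨h, h'⟩ | ⟨h, h'⟩
      · rw [hA0] at h; linarith
      · rw [hA0, hA1] at h'; exact h'
      · exfalso
        have := hAu.1
        rw [hA0] at h'
        nlinarith
    have sB : a + ht R - z 1 = s * (z 0 - m) := by
      have := hvm z hzm
      rcases hzB.2 with h | ⟨h, h'⟩ | ⟨h, h'⟩
      · rw [hB0] at h; linarith
      · exfalso
        have := hzB.1
        rw [hB0] at h'
        nlinarith
      · rw [hB0, hB1] at h'; linarith
    obtain ⟨Q1, q1, q2, q3, q4⟩ := exists_tip (s := s) (by linarith) hA0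
      (B := pt m (u 1)) (by simp) (hvm u (by simp)) (Or.inl ⟨by simp, by rw [hA1]; exact sA⟩)
    obtain ⟨Q2, r1, r2, r3, r4⟩ := exists_tip (s := s) (by linarith) (A := pt m (z 1)) (B := B)
      (by simp) hB0 (hvm z hzm) (Or.inr ⟨by simp, by rw [hB1]; exact sB⟩)
    have hu1 := hvW u (by simp)
    have hz1 := hvW z hzm
    have hlu := hvl u (by simp)
    have hlz := hvl z hzm
    have huz : u 1 ≤ z 1 := le_of_steepUp (hC.imp (fun _ _ => SteepUp.stairEdge)) hz (by simp)
    refine ⟨F ++ (Q1 :: Q2 :: F2), ?_, ?_, ?_, ?_⟩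
    · intro Q hQ
      simp only [List.mem_append, List.mem_cons] at hQ
      rcases hQ with hQ | rfl | rfl | hQ
      · exact Or.inl (h3 Q hQ)
      · exact Or.inl q1
      · exact Or.inl r1
      · exact g1 Q hQ
    · filter_upwards [h4, g2, q2, r2] with p k1 k2 k3 k4
      have hsp : ∀ x y w : ℝ, x ≤ y → y ≤ w → hc (pt m x, pt m w) p =
          hc (pt m x, pt m y) p + hc (pt m y, pt m w) p := by
        intro x y w hxy hyw
        apply hc_split (by simp; linarith)
        rcases eq_or_lt_of_le (hxy.trans hyw) with h | h
        · have : x = y := le_antisymm hxy (by linarith)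
          rw [this]; exact left_mem_segment _ _ _
        · exact mem_segment_coord.2 ⟨(y - x) / (w - x), div_nonneg (by linarith) (by linarith),
            (div_le_one (by linarith)).2 (by linarith), by simp, by
            simp only [pt_one]
            rw [div_mul_cancel₀ _ (by linarith)]; ring⟩
      have e : pathEdges (A :: (u :: U ++ [B])) = (A, u) :: (pathEdges (u :: U) ++ [(z, B)]) := by
        rw [List.cons_append, pathEdges_cons_cons, ← List.cons_append, pathEdges_join hz]; simp
      rw [cnt_append, cnt_cons, cnt_cons, k1, k2, k3, k4, e, hcount_cons, hcount_append,
        hc_level (u := u) (v := pt m (u 1)) (by simp),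
        hc_level (u := pt m (z 1)) (v := z) (by simp)]
      simp only [hcount_cons, hcount_nil, A, B]
      rw [hsp a (u 1) (a + ht R) (by linarith) (by linarith),
        hsp (u 1) (z 1) (a + ht R) huz (by linarith)]
      ring
    · simp only [sumHper_append, sumHper_cons]
      linarith
    · simp only [sumPer_append, sumPer_cons]
      have e1 : s * (8 * (u 0 - m)) ≤ s * ht R := mul_le_mul_of_nonneg_left hu1 (by linarith)
      have e2 : s * (8 * (z 0 - m)) ≤ s * ht R := mul_le_mul_of_nonneg_left hz1 (by linarith)
      linarith

/-! ### Tame rows -/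

/-- The first row value. -/
def firstX : ℝ → List (ℝ × ℝ) → ℝ
  | x, [] => x
  | _, r :: _ => r.2

@[simp] lemma firstX_nil (x : ℝ) : firstX x [] = x := rfl
@[simp] lemma firstX_cons (x : ℝ) (r : ℝ × ℝ) (R : List (ℝ × ℝ)) : firstX x (r :: R) = r.2 := rfl

/-- Whenever a maximal block `Y` of rows has no value less than `c`, the variation of `Y` relative
to `c` is at most its height. -/
def TameRows (m : ℝ) (R : List (ℝ × ℝ)) : Prop :=
  ∀ (X Y Z : List (ℝ × ℝ)) (c : ℝ), R = X ++ Y ++ Z → m ≤ c → (∀ r ∈ Y, c ≤ r.2) →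
    lastX c X ≤ c → firstX c Z ≤ c → pvar c Y c ≤ ht Y

/-- A distinguished row is before, inside or after a given block. The proofs that tameness survives
an operation on one row distinguish these cases. -/
lemma append3_eq {α : Type*} {X Y Z A B : List α} {f : α} (h : X ++ Y ++ Z = A ++ f :: B) :
    (∃ X', X = A ++ f :: X' ∧ B = X' ++ Y ++ Z) ∨
    (∃ Y1 Y2, Y = Y1 ++ f :: Y2 ∧ A = X ++ Y1 ∧ B = Y2 ++ Z) ∨
    (∃ Z', Z = Z' ++ f :: B ∧ A = X ++ Y ++ Z') := by
  rcases List.append_eq_append_iff.1 h with ⟨a', h1, h2⟩ | ⟨c', h1, h2⟩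
  · exact Or.inr (Or.inr ⟨a', h2, h1⟩)
  · cases c' with
    | nil => exact Or.inr (Or.inr ⟨[], by simpa using h2.symm, by simpa using h1.symm⟩)
    | cons f' c' =>
      simp only [List.cons_append, List.cons.injEq] at h2
      obtain ⟨rfl, h2⟩ := h2
      rcases List.append_eq_append_iff.1 h1 with ⟨a', h3, h4⟩ | ⟨d', h3, h4⟩
      · exact Or.inr (Or.inl ⟨a', c', h4, h3, h2⟩)
      · cases d' with
        | nil =>
          exact Or.inr (Or.inl ⟨[], c', by simpa using h4.symm, by simpa using h3.symm, h2⟩)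
        | cons f' d' =>
          simp only [List.cons_append, List.cons.injEq] at h4
          obtain ⟨rfl, h4⟩ := h4
          exact Or.inl ⟨d', h3, by rw [h2, h4]⟩

namespace TameRows

variable {m : ℝ} {R A B : List (ℝ × ℝ)}

lemma nil : TameRows m [] := by
  intro X Y Z c h _ _ _ _
  obtain ⟨h, -⟩ := List.append_eq_nil_iff.1 h.symm
  obtain ⟨-, rfl⟩ := List.append_eq_nil_iff.1 h
  simp

lemma pvar_le (h : TameRows m R) (hR : ∀ r ∈ R, m ≤ r.2) : pvar m R m ≤ ht R :=
  h [] R [] m (by simp) le_rfl hR (by simp) (by simp)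

lemma flat {w c : ℝ} (hw : 0 ≤ w) (h : 2 * (c - m) ≤ w) : TameRows m [(w, c)] := by
  intro X Y Z d hd h1 h2 _ _
  have : X ++ Y ++ Z = [] ++ (w, c) :: [] := hd.symm
  rcases append3_eq this with ⟨X', -, h4⟩ | ⟨Y1, Y2, h4, h5, h6⟩ | ⟨Z', -, h4⟩
  · obtain ⟨h, -⟩ := List.append_eq_nil_iff.1 h4.symm
    obtain ⟨-, rfl⟩ := List.append_eq_nil_iff.1 h
    simp
  · obtain ⟨-, rfl⟩ := List.append_eq_nil_iff.1 h5.symm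
    obtain ⟨rfl, -⟩ := List.append_eq_nil_iff.1 h6.symm
    subst h4
    have := h2 (w, c) (by simp)
    simp only at this
    simp only [List.nil_append, pvar_cons, pvar_nil, ht_cons, ht_nil]
    rw [abs_of_nonneg (by linarith), abs_of_nonpos (by linarith)]
    linarith
  · obtain ⟨h, -⟩ := List.append_eq_nil_iff.1 h4.symm
    obtain ⟨-, rfl⟩ := List.append_eq_nil_iff.1 h
    simp

/-- A block all of whose values are at least some `c > m` avoids the row of value `m` and is within
`A` or within `B`. For `c = m` the block is divided by this row, and variations and heights add up.
-/
lemma append {t : ℝ} (ht0 : 0 ≤ t) (hA : TameRows m A) (hB : TameRows m B) :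
    TameRows m (A ++ (t, m) :: B) := by
  intro X Y Z c hc h1 h2 h3 h4
  rcases append3_eq hc.symm with ⟨X', rfl, h5⟩ | ⟨Y1, Y2, rfl, rfl, rfl⟩ | ⟨Z', rfl, h5⟩
  · refine hB X' Y Z c h5 h1 h2 ?_ h4
    cases X' with
    | nil => simp
    | cons r X' => simpa [lastX_append] using h3
  · obtain rfl : c = m := le_antisymm (h2 (t, m) (by simp)) h1
    have e1 := hA X Y1 [] c (by simp) le_rfl (fun r hr => h2 r (by simp [hr])) h3 (by simp)
    have e2 := hB [] Y2 Z c (by simp) le_rfl (fun r hr => h2 r (by simp [hr])) (by simp) h4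
    rw [pvar_append_cons, ht_append, ht_cons]
    simp only
    linarith
  · refine hA X Y Z' c h5 h1 h2 h3 ?_
    cases Z' with
    | nil => simp
    | cons r Z' => simpa using h4

/-- A lower reference value lengthens just the first and the last jump. -/
lemma _root_.pvar_shift {c : ℝ} (h : c ≤ m) (hR0 : R ≠ []) (hR : ∀ r ∈ R, m ≤ r.2) :
    pvar c R c = pvar m R m + 2 * (m - c) := by
  obtain ⟨r, R, rfl⟩ := List.exists_cons_of_ne_nil hR0
  have h1 := hR r (by simp)
  have key : ∀ (R : List (ℝ × ℝ)) (x : ℝ), m ≤ x → (∀ r ∈ R, m ≤ r.2) →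
      pvar x R c = pvar x R m + (m - c) := by
    intro R
    induction R with
    | nil =>
      intro x hx _
      simp only [pvar_nil]
      rw [abs_of_nonpos (by linarith), abs_of_nonpos (by linarith)]; ring
    | cons q R ih =>
      intro x _ hR
      simp only [pvar_cons]
      rw [ih _ (hR q (by simp)) fun r hr => hR r (by simp [hr])]; ring
  simp only [pvar_cons]
  rw [key R _ h1 fun r hr => hR r (by simp [hr]), abs_of_nonneg (by linarith),
    abs_of_nonneg (by linarith)]
  ring

/-- At a level below `m'` the only block is the whole list, and its variation is largest for the
lowest level `m`. -/
lemma lower {m' : ℝ} (h : TameRows m' R) (hR0 : R ≠ []) (hm : m ≤ m')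
    (hR : ∀ r ∈ R, m' ≤ r.2) (hp : pvar m' R m' + 2 * (m' - m) ≤ ht R) : TameRows m R := by
  intro X Y Z c hc h1 h2 h3 h4
  rcases le_or_gt m' c with hmc | hmc
  · exact h X Y Z c hc hmc h2 h3 h4
  · have hX : X = [] := by
      rcases List.eq_nil_or_concat X with rfl | ⟨X', e, rfl⟩
      · rfl
      · simp only [List.concat_eq_append, lastX_append, lastX_cons, lastX_nil] at h3
        have := hR e (by rw [hc]; simp)
        linarith
    have hZ : Z = [] := by
      cases Z with
      | nil => rfl
      | cons r Z =>
        have := hR r (by rw [hc]; simp)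
        simp only [firstX_cons] at h4
        linarith
    subst hX hZ
    simp only [List.nil_append, List.append_nil] at hc
    subst hc
    rw [pvar_shift hmc.le hR0 hR]
    linarith

/-- If the neighbour of `Y` is greater than `c`, the end row of `Y` on that side has the value `c`
and can itself serve as the neighbour: without it the variation is the same and the height is
smaller. This covers chords that begin or end along an edge of the path. -/
lemma strip (h : TameRows m R) (hR : ∀ r ∈ R, 0 < r.1) {X Y Z : List (ℝ × ℝ)} {c : ℝ}
    (hc : R = X ++ Y ++ Z) (hm : m ≤ c)
    (hY : ∀ r ∈ Y, c ≤ r.2) (h1 : lastX c X ≤ c ∨ firstX c Y ≤ c)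
    (h2 : firstX c Z ≤ c ∨ lastX c Y ≤ c) : pvar c Y c ≤ ht Y := by
  have key : ∀ X Y, R = X ++ Y ++ Z → (∀ r ∈ Y, c ≤ r.2) → lastX c X ≤ c →
      (firstX c Z ≤ c ∨ lastX c Y ≤ c) → pvar c Y c ≤ ht Y := by
    intro X Y hc hY h1 h2
    by_cases hZ : firstX c Z ≤ c
    · exact h X Y Z c hc hm hY h1 hZ
    · replace h2 := h2.resolve_left hZ
      rcases List.eq_nil_or_concat Y with rfl | ⟨Y', e, rfl⟩
      · simp
      · rw [List.concat_eq_append] at hc hY h2 ⊢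
        have he := hY e (by simp)
        rw [lastX_append, lastX_cons, lastX_nil] at h2
        have hec : e.2 = c := le_antisymm h2 he
        have := h X Y' (e :: Z) c (by simp [hc]) hm (fun r hr => hY r (by simp [hr])) h1
          (by simp [hec])
        have h0 := hR e (by rw [hc]; simp)
        rw [pvar_append_cons, hec, ht_append, ht_cons, ht_nil, pvar_nil, sub_self, abs_zero]
        linarith
  by_cases hX : lastX c X ≤ c
  · exact key X Y hc hY hX h2
  · replace h1 := h1.resolve_left hX
    cases Y with
    | nil => simp
    | cons r Y =>
      have hr := hY r (by simp)
      have hrc : r.2 = c := le_antisymm h1 hr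
      have := key (X ++ [r]) Y (by simp [hc]) (fun q hq => hY q (by simp [hq]))
        (by simp [lastX_append, hrc]) (by simpa [hrc] using h2)
      have h0 := hR r (by rw [hc]; simp)
      rw [pvar_cons, ht_cons, hrc, sub_self, abs_zero]
      linarith

lemma merge {h1 h2 v : ℝ} (h : TameRows m (A ++ (h1, v) :: (h2, v) :: B)) :
    TameRows m (A ++ (h1 + h2, v) :: B) := by
  intro X Y Z c hc hm hY hX hZ
  rcases append3_eq hc.symm with ⟨X', rfl, rfl⟩ | ⟨Y1, Y2, rfl, rfl, rfl⟩ | ⟨Z', rfl, rfl⟩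
  · refine h (A ++ (h1, v) :: (h2, v) :: X') Y Z c (by simp) hm hY ?_ hZ
    simpa [lastX_append] using hX
  · have hv := hY (h1 + h2, v) (by simp)
    have := h X (Y1 ++ (h1, v) :: (h2, v) :: Y2) Z c (by simp) hm (by
      intro r hr
      simp only [List.mem_append, List.mem_cons] at hr
      rcases hr with hr | rfl | rfl | hr
      · exact hY r (by simp [hr])
      · exact hv
      · exact hv
      · exact hY r (by simp [hr])) hX hZ
    simp only [pvar_append_cons, pvar_cons, sub_self, abs_zero, ht_append, ht_cons] at this ⊢
    linarith
  · refine h X Y (Z' ++ (h1, v) :: (h2, v) :: B) c (by simp) hm hY hX ?_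
    cases Z' with
    | nil => simpa using hZ
    | cons r Z' => simpa using hZ

/-- Consecutive rows with the same value are merged. -/
lemma exists_merged (n : ℕ) : ∀ R : List (ℝ × ℝ), R.length ≤ n → (∀ r ∈ R, 0 < r.1) →
    TameRows m R → ∃ R', TameRows m R' ∧ (∀ r ∈ R', 0 < r.1) ∧ values R' = values R ∧
      ht R' = ht R ∧ (∀ x y, pvar x R' y = pvar x R y) ∧
      (∀ a p, rowCount a R' p = rowCount a R p) ∧ R'.IsChain fun r q => r.2 ≠ q.2 := by
  induction n with
  | zero =>
    intro R hn h0 hR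
    obtain rfl := List.length_eq_zero_iff.1 (Nat.le_zero.1 hn)
    exact ⟨[], hR, by simp, rfl, rfl, fun _ _ => rfl, fun _ _ => rfl, by simp⟩
  | succ n ih =>
    intro R hn h0 hR
    by_cases hch : R.IsChain fun r q => r.2 ≠ q.2
    · exact ⟨R, hR, h0, rfl, rfl, fun _ _ => rfl, fun _ _ => rfl, hch⟩
    · obtain ⟨A, B, r, q, rfl, hrq⟩ : ∃ A B r q, R = A ++ r :: q :: B ∧ r.2 = q.2 := by
        by_contra hcon
        apply hch
        rw [List.isChain_iff_forall_rel_of_append_cons_cons]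
        intro r q A B hR heq
        exact hcon ⟨A, B, r, q, hR, heq⟩
      obtain ⟨h1, v⟩ := r
      obtain ⟨h2, v'⟩ := q
      simp only at hrq
      subst hrq
      have p1 := h0 (h1, v) (by simp)
      have p2 := h0 (h2, v) (by simp)
      simp only at p1 p2
      obtain ⟨R', e1, e2, e3, e4, e5, e6, e7⟩ := ih (A ++ (h1 + h2, v) :: B)
        (by simp at hn ⊢; omega) (by
          intro r hr
          simp only [List.mem_append, List.mem_cons] at hr
          rcases hr with hr | rfl | hr
          · exact h0 r (by simp [hr])
          · simp only; linarith
          · exact h0 r (by simp [hr])) hR.merge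
      refine ⟨R', e1, e2, ?_, ?_, ?_, ?_, e7⟩
      · rw [e3]
        ext x
        simp only [values, List.mem_append, List.mem_cons, Set.mem_setOf_eq]
        constructor
        · rintro ⟨r, hr | rfl | hr, rfl⟩
          · exact ⟨r, Or.inl hr, rfl⟩
          · exact ⟨(h1, v), by simp, rfl⟩
          · exact ⟨r, by simp [hr], rfl⟩
        · rintro ⟨r, hr | rfl | rfl | hr, rfl⟩
          · exact ⟨r, Or.inl hr, rfl⟩
          · exact ⟨_, Or.inr (Or.inl rfl), rfl⟩
          · exact ⟨_, Or.inr (Or.inl rfl), rfl⟩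
          · exact ⟨r, by simp [hr], rfl⟩
      · rw [e4]; simp only [ht_append, ht_cons]; ring
      · intro x y
        rw [e5]; simp [pvar_append_cons]
      · intro a p
        rw [e6, rowCount_append, rowCount_append]
        congr 1
        have := rowCount_split p1.le p2.le (a + ht A) v p
        simp only [rowCount_cons, rowCount_nil, add_zero] at this
        rw [rowCount_cons, rowCount_cons, rowCount_cons, this]
        simp only [add_assoc]

end TameRows

/-! ### The polygon of a list of rows -/

/-- The corners of the rows. -/
noncomputable def rowVerts : ℝ → List (ℝ × ℝ) → List Plane
  | _, [] => []
  | a, r :: R => pt r.2 a :: pt r.2 (a + r.1) :: rowVerts (a + r.1) R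

/-- The path along the rows `R` from `(x, a)` to `(m, a + ht R)`. -/
noncomputable def rowPath (m x a : ℝ) (R : List (ℝ × ℝ)) : List Plane :=
  pt x a :: (rowVerts a R ++ [pt m (a + ht R)])

lemma rowPath_nil (m x a : ℝ) : rowPath m x a [] = [pt x a, pt m a] := by simp [rowPath, rowVerts]

lemma rowPath_cons (m x a : ℝ) (r : ℝ × ℝ) (R : List (ℝ × ℝ)) :
    rowPath m x a (r :: R) = pt x a :: pt r.2 a :: rowPath m r.2 (a + r.1) R := by
  simp [rowPath, rowVerts, add_assoc]

lemma rowPath_ne_nil (m x a : ℝ) (R : List (ℝ × ℝ)) :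
    ∃ l, rowPath m x a R = pt x a :: l := ⟨_, rfl⟩

lemma pathEdges_rowPath_cons (m x a : ℝ) (r : ℝ × ℝ) (R : List (ℝ × ℝ)) :
    pathEdges (rowPath m x a (r :: R)) = (pt x a, pt r.2 a) :: (pt r.2 a, pt r.2 (a + r.1)) ::
      pathEdges (rowPath m r.2 (a + r.1) R) := by
  rw [rowPath_cons]
  unfold rowPath
  simp

lemma hcount_rowPath (m x a : ℝ) (R : List (ℝ × ℝ)) (p : Plane) :
    hcount (pathEdges (rowPath m x a R)) p = rowCount a R p := by
  induction R generalizing x a with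
  | nil => simp [rowPath_nil, hc_level]
  | cons r R ih =>
    rw [pathEdges_rowPath_cons, hcount_cons, hcount_cons, ih, hc_level (by simp),
      ← rowCount_single, rowCount_cons, rowCount_cons]
    simp

lemma weight_rowPath (m x a : ℝ) {R : List (ℝ × ℝ)} (hR : ∀ r ∈ R, 0 < r.1) :
    weight (pathEdges (rowPath m x a R)) = pvar x R m + ht R := by
  induction R generalizing x a with
  | nil => simp [rowPath_nil, dist_level]
  | cons r R ih =>
    have := hR r (by simp)
    rw [pathEdges_rowPath_cons, weight_cons, weight_cons, ih _ _ fun q hq => hR q (by simp [hq])]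
    simp only [pvar_cons, ht_cons]
    rw [dist_level (by simp), dist_vertical (by simp)]
    simp only [pt_zero, pt_one, add_sub_cancel_left]
    rw [abs_of_pos this]; ring

lemma monoY_rowPath (m x a : ℝ) {R : List (ℝ × ℝ)} (hR : ∀ r ∈ R, 0 < r.1) :
    MonoY 1 (rowPath m x a R) := by
  unfold MonoY
  rw [isChain_iff_pathEdges]
  induction R generalizing x a with
  | nil => simp [rowPath_nil]
  | cons r R ih =>
    have h0 := hR r (by simp)
    rw [pathEdges_rowPath_cons]
    intro e he
    rcases List.mem_cons.1 he with rfl | he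
    · simp
    · rcases List.mem_cons.1 he with rfl | he
      · simp [h0.le]
      · exact ih _ _ (fun q hq => hR q (by simp [hq])) e he

lemma level_edge_rowPath {m x a : ℝ} {R : List (ℝ × ℝ)} {u v : Plane}
    (h : (u, v) ∈ pathEdges (rowPath m x a R)) :
    (∃ R1 R2, R = R1 ++ R2 ∧ u = pt (lastX x R1) (a + ht R1) ∧
      v = pt (firstX m R2) (a + ht R1)) ∨
    ∃ r ∈ R, u 0 = v 0 ∧ v 1 = u 1 + r.1 := by
  induction R generalizing x a with
  | nil =>
    left
    simp only [rowPath_nil, pathEdges_cons_cons, pathEdges_single, List.mem_singleton,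
      Prod.mk.injEq] at h
    exact ⟨[], [], by simp, by simp [h.1], by simp [h.2]⟩
  | cons r R ih =>
    rw [pathEdges_rowPath_cons] at h
    rcases List.mem_cons.1 h with h | h
    · simp only [Prod.mk.injEq] at h
      exact Or.inl ⟨[], r :: R, by simp, by simp [h.1], by simp [h.2]⟩
    · rcases List.mem_cons.1 h with h | h
      · simp only [Prod.mk.injEq] at h
        exact Or.inr ⟨r, by simp, by simp [h.1, h.2]⟩
      · rcases ih h with ⟨R1, R2, rfl, h1, h2⟩ | ⟨q, hq, h'⟩
        · refine Or.inl ⟨r :: R1, R2, rfl, ?_, ?_⟩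
          · rw [h1]; simp [add_assoc]
          · rw [h2]; simp [add_assoc]
        · exact Or.inr ⟨q, by simp [hq], h'⟩

lemma alternate_rowPath {m x a : ℝ} {R : List (ℝ × ℝ)} {u v w : Plane}
    (h : [u, v, w] <:+: rowPath m x a R) : u 0 = v 0 ∨ v 0 = w 0 := by
  induction R generalizing x a with
  | nil =>
    have := h.length_le
    simp [rowPath_nil] at this
  | cons r R ih =>
    rw [rowPath_cons, List.infix_cons_iff] at h
    rcases h with h | h
    · right
      obtain ⟨t, ht⟩ := h
      obtain ⟨l, hl⟩ := rowPath_ne_nil m r.2 (a + r.1) R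
      rw [hl] at ht
      simp only [List.cons_append, List.cons.injEq] at ht
      rw [ht.2.1, ht.2.2.1]; simp
    · rw [List.infix_cons_iff] at h
      rcases h with h | h
      · left
        obtain ⟨t, ht⟩ := h
        obtain ⟨l, hl⟩ := rowPath_ne_nil m r.2 (a + r.1) R
        rw [hl] at ht
        simp only [List.cons_append, List.cons.injEq] at ht
        rw [ht.1, ht.2.1]; simp
      · exact ih h

lemma trace_rowPath {m x a : ℝ} {X Z : List (ℝ × ℝ)} {r : ℝ × ℝ}
    (hR : ∀ q ∈ X ++ r :: Z, 0 < q.1) {p : Plane}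
    (hp : p ∈ trace (pathEdges (rowPath m x a (X ++ r :: Z)))) (h1 : a + ht X < p 1)
    (h2 : p 1 < a + ht X + r.1) : p 0 = r.2 := by
  induction X generalizing x a with
  | nil =>
    simp only [List.nil_append, ht_nil, add_zero] at *
    rw [pathEdges_rowPath_cons, trace_cons, trace_cons] at hp
    rcases hp with hp | hp | hp
    · obtain ⟨t, -, -, -, h⟩ := mem_segment_coord.1 hp
      simp at h; linarith
    · obtain ⟨t, -, -, h, -⟩ := mem_segment_coord.1 hp
      simpa using h
    · have := MonoY.trace_ge (monoY_rowPath m r.2 (a + r.1) fun q hq => hR q (by simp [hq])) hp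
      simp at this; linarith
  | cons q X ih =>
    have hq := hR q (by simp)
    have hX : 0 ≤ ht X := ht_nonneg fun r hr => hR r (by simp [hr])
    rw [ht_cons] at h1 h2
    rw [List.cons_append, pathEdges_rowPath_cons, trace_cons, trace_cons] at hp
    rcases hp with hp | hp | hp
    · obtain ⟨t, -, -, -, h⟩ := mem_segment_coord.1 hp
      simp at h; linarith
    · obtain ⟨t, t0, t1, -, h⟩ := mem_segment_coord.1 hp
      simp at h; nlinarith
    · exact ih (fun q hq => hR q (by simp only [List.cons_append, List.mem_cons]; exact Or.inr hq))
        hp (by linarith) (by linarith)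

/-- Neighbouring rows differ, so no edge is degenerate. Level edges alternate with columns, so there
are never two consecutive level edges, and the condition against turning back is vacuous. -/
lemma isRightChain_rows {m a : ℝ} {R : List (ℝ × ℝ)} (hR0 : R ≠ []) (hR : ∀ r ∈ R, 0 < r.1)
    (hm : ∀ r ∈ R, m < r.2) (hne : R.IsChain fun r q => r.2 ≠ q.2) :
    IsRightChain (pt m a) (rowVerts a R) (pt m (a + ht R)) := by
  have hpos := ht_pos hR hR0
  have hnd : (rowPath m m a R).IsChain (· ≠ ·) := by
    rw [isChain_iff_pathEdges]
    rintro ⟨u, v⟩ he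
    rcases level_edge_rowPath he with ⟨R1, R2, rfl, rfl, rfl⟩ | ⟨r, hr, -, h⟩
    · intro h
      have := congrArg (fun p : Plane => p 0) h
      simp only [pt_zero] at this
      rcases List.eq_nil_or_concat R1 with rfl | ⟨R1, q, rfl⟩
      · obtain ⟨r, R2, rfl⟩ := List.exists_cons_of_ne_nil hR0
        have := hm r (by simp)
        simp only [lastX_nil, List.nil_append, firstX_cons] at *
        linarith
      · cases R2 with
        | nil =>
          have := hm q (by simp)
          simp only [List.concat_eq_append, lastX_append, lastX_cons, lastX_nil, firstX_nil] at *
          linarith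
        | cons r R2 =>
          simp only [List.concat_eq_append, lastX_append, lastX_cons, lastX_nil,
            firstX_cons] at *
          refine List.isChain_iff_forall_rel_of_append_cons_cons.1 hne (l₁ := R1) (l₂ := R2) ?_ this
          simp
    · have := hR r hr
      intro huv
      simp only at huv
      rw [huv] at h
      linarith
  refine ⟨monoY_rowPath m m a hR, hnd, ?_, ?_, ?_, by simpa using hpos⟩
  · intro u v w h k1 k2
    exfalso
    have hi : [u, v, w] <:+: rowPath m m a R := h
    obtain ⟨X, Z, h⟩ := h
    have h' : rowPath m m a R = X ++ (u :: v :: w :: Z) := by rw [rowPath, ← h]; simp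
    rw [h'] at hnd
    have h3 := List.isChain_cons_cons.1 (List.IsChain.right_of_append hnd)
    rcases alternate_rowPath hi with h4 | h4
    · exact h3.1 (plane_ext h4 k1)
    · exact (List.isChain_cons_cons.1 h3.2).1 (plane_ext h4 k2)
  · obtain ⟨r, R, rfl⟩ := List.exists_cons_of_ne_nil hR0
    simp [rowVerts]
  · have : ∀ (R : List (ℝ × ℝ)) (a : ℝ), (∀ r ∈ R, m < r.2) → ∀ v ∈ rowVerts a R, m < v 0 := by
      intro R
      induction R with
      | nil => simp [rowVerts]
      | cons r R ih =>
        intro a hm v hv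
        have h0 := hm r (by simp)
        simp only [rowVerts, List.mem_cons] at hv
        rcases hv with rfl | rfl | hv
        · simpa using h0
        · simpa using h0
        · exact ih _ (fun q hq => hm q (by simp [hq])) v hv
    intro v hv
    have := this R a hm v hv
    simp only [pt_zero, pt_one, sub_self, zero_mul]
    exact mul_pos (by linarith) (by linarith)

lemma segment_level {x x' y : ℝ} {b : Plane} (h : b ∈ segment ℝ (pt x y) (pt x' y)) :
    b 1 = y ∧ (x ≤ b 0 ∨ x' ≤ b 0) := by
  obtain ⟨t, t0, t1, hx, hy⟩ := mem_segment_coord.1 h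
  simp only [pt_zero, pt_one, sub_self, mul_zero, add_zero] at hx hy
  refine ⟨hy, ?_⟩
  rcases le_total x x' with h | h
  · left; nlinarith
  · right; nlinarith

lemma segment_column {x y y' : ℝ} {b : Plane} (hy : y ≤ y')
    (h : b ∈ segment ℝ (pt x y) (pt x y')) : b 0 = x ∧ y ≤ b 1 ∧ b 1 ≤ y' := by
  obtain ⟨t, t0, t1, hx, hy⟩ := mem_segment_coord.1 h
  simp only [pt_zero, pt_one, sub_self, mul_zero, add_zero] at hx hy
  refine ⟨hx, ?_, ?_⟩ <;> nlinarith

/-- A path along the rows passes complete rows `Y` and stops on a level edge or in a column. In both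
cases the horizontal moves add up to a variation pinned at the stopping abscissa, and the vertical
moves to the difference in height. The last conjunct says that one of the two rows adjacent to the
stop does not extend beyond it. -/
lemma subpath_end {m : ℝ} {R : List (ℝ × ℝ)} (hR : ∀ r ∈ R, 0 < r.1) :
    ∀ {x a : ℝ} {M Z : List Plane} {w b : Plane},
      rowPath m x a R = pt x a :: (M ++ w :: Z) → b ∈ segment ℝ (M.getLast?.getD (pt x a)) w →
      ∃ Y Z', R = Y ++ Z' ∧
        weight (pathEdges (pt x a :: (M ++ [b]))) = pvar x Y (b 0) + (b 1 - a) ∧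
        a + ht Y ≤ b 1 ∧ (firstX m Z' ≤ b 0 ∨ lastX x Y ≤ b 0) := by
  induction R with
  | nil =>
    intro x a M Z w b h hb
    rw [rowPath_nil] at h
    cases M with
    | nil =>
      simp only [List.nil_append, List.cons.injEq, true_and] at h
      obtain ⟨rfl, -⟩ := h
      have := segment_level (by simpa using hb)
      refine ⟨[], [], rfl, ?_, by simp [this.1], by simpa using this.2.symm⟩
      simp only [List.nil_append, pathEdges_cons_cons, pathEdges_single, weight_cons, weight_nil]
      rw [dist_level (by simp [this.1])]
      simp [this.1]
    | cons u M => simp at h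
  | cons r R ih =>
    intro x a M Z w b h hb
    have h0 := hR r (by simp)
    rw [rowPath_cons] at h
    simp only [List.cons.injEq, true_and] at h
    match M, h, hb with
    | [], h, hb =>
      simp only [List.nil_append, List.cons.injEq] at h
      obtain ⟨rfl, -⟩ := h
      have := segment_level (by simpa using hb)
      refine ⟨[], r :: R, rfl, ?_, by simp [this.1], by simpa using this.2.symm⟩
      simp only [List.nil_append, pathEdges_cons_cons, pathEdges_single, weight_cons, weight_nil]
      rw [dist_level (by simp [this.1])]
      simp [this.1]
    | [u], h, hb =>
      obtain ⟨l, hl⟩ := rowPath_ne_nil m r.2 (a + r.1) R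
      rw [hl] at h
      simp only [List.cons_append, List.nil_append, List.cons.injEq] at h
      obtain ⟨rfl, rfl, -⟩ := h
      have := segment_column (x := r.2) (y := a) (y' := a + r.1) (by linarith) (by simpa using hb)
      refine ⟨[], r :: R, rfl, ?_, by simpa using this.2.1, by simp [this.1]⟩
      simp only [List.nil_append, List.cons_append, pathEdges_cons_cons, pathEdges_single,
        weight_cons, weight_nil]
      rw [dist_level (by simp), dist_vertical (by simp [this.1])]
      simp only [pt_zero, pt_one, pvar_nil, this.1]
      rw [abs_of_nonneg (a := b 1 - a) (by linarith)]; ring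
    | u :: v :: M, h, hb =>
      obtain ⟨l, hl⟩ := rowPath_ne_nil m r.2 (a + r.1) R
      have h' := h
      rw [hl] at h'
      simp only [List.cons_append, List.cons.injEq] at h'
      obtain ⟨rfl, rfl, h3⟩ := h'
      obtain ⟨Y, Z', rfl, e2, e3, e4⟩ := ih (fun q hq => hR q (by simp [hq]))
        (x := r.2) (a := a + r.1) (M := M) (Z := Z) (w := w) (b := b) (by rw [hl, h3])
        (by simpa [List.getLast?_cons] using hb)
      refine ⟨r :: Y, Z', rfl, ?_, ?_, e4⟩
      · simp only [List.cons_append, pathEdges_cons_cons, weight_cons, pvar_cons] at e2 ⊢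
        rw [e2, dist_level (by simp), dist_vertical (by simp)]
        simp only [pt_zero, pt_one, add_sub_cancel_left]
        rw [abs_of_pos h0]; ring
      · rw [ht_cons]; linarith

/-- The start is now an arbitrary point of the row path, with the same abscissa as the end. Unless
both are on one edge, the chord spans complete rows `Y`, and the alternatives at both ends are those
required by `TameRows.strip`. -/
lemma subpath_rowPath {m : ℝ} {R : List (ℝ × ℝ)} (hR : ∀ r ∈ R, 0 < r.1) :
    ∀ {x y : ℝ} {X M Z : List Plane} {u w a b : Plane},
      rowPath m x y R = X ++ u :: (M ++ w :: Z) → a ∈ segment ℝ u (M.head?.getD w) →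
      b ∈ segment ℝ (M.getLast?.getD u) w → a 0 = b 0 → M = [] ∨
      ∃ X' Y Z', R = X' ++ Y ++ Z' ∧
        weight (pathEdges (a :: (M ++ [b]))) = pvar (a 0) Y (a 0) + (b 1 - a 1) ∧
        a 1 ≤ y + ht X' ∧ y + ht X' + ht Y ≤ b 1 ∧
        (lastX x X' ≤ a 0 ∨ firstX (a 0) Y ≤ a 0) ∧ (firstX m Z' ≤ a 0 ∨ lastX (a 0) Y ≤ a 0) := by
  induction R with
  | nil =>
    intro x y X M Z u w a b h _ _ _
    left
    have := congrArg List.length h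
    simp [rowPath_nil] at this
    exact List.eq_nil_of_length_eq_zero (by omega)
  | cons r R ih =>
    intro x y X M Z u w a b h ha hb hab
    have h0 := hR r (by simp)
    by_cases hM : M = []
    · exact Or.inl hM
    right
    obtain ⟨v, M', rfl⟩ := List.exists_cons_of_ne_nil hM
    have hR' : ∀ q ∈ R, 0 < q.1 := fun q hq => hR q (by simp [hq])
    match X, h with
    | [], h =>
      have h' := h
      rw [rowPath_cons] at h'
      simp only [List.nil_append, List.cons_append, List.cons.injEq] at h'
      obtain ⟨rfl, rfl, h3⟩ := h'
      have ha' := segment_level (by simpa using ha)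
      have hae : a = pt (a 0) y := plane_ext (by simp) (by simp [ha'.1])
      obtain ⟨Y, Z', e1, e2, e3, e4⟩ := subpath_end hR (m := m) (x := a 0) (a := y)
        (M := pt r.2 y :: M') (Z := Z) (w := w) (b := b) (by
          rw [rowPath_cons, h3]; rfl) (by simpa [List.getLast?_cons] using hb)
      refine ⟨[], Y, Z', by simpa using e1, ?_, by simp [ha'.1], by simpa using e3, ?_,
        by rwa [← hab] at e4⟩
      · rw [← hae, ← hab] at e2
        rw [ha'.1]
        exact e2
      · cases Y with
        | nil => simp
        | cons q Y =>
          simp only [List.cons_append, List.cons.injEq] at e1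
          obtain ⟨rfl, -⟩ := e1
          simpa using ha'.2
    | [t], h =>
      obtain ⟨l, hl⟩ := rowPath_ne_nil m r.2 (y + r.1) R
      have h' := h
      rw [rowPath_cons, hl] at h'
      simp only [List.nil_append, List.cons_append, List.cons.injEq] at h'
      obtain ⟨rfl, rfl, rfl, h3⟩ := h'
      have ha' := segment_column (x := r.2) (y := y) (y' := y + r.1) (by linarith) (by simpa using ha)
      obtain ⟨Y, Z', e1, e2, e3, e4⟩ := subpath_end hR' (m := m) (x := r.2) (a := y + r.1)
        (M := M') (Z := Z) (w := w) (b := b) (by rw [hl, h3])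
        (by simpa [List.getLast?_cons] using hb)
      refine ⟨[r], Y, Z', by simp [e1], ?_, by simpa using ha'.2.2, by simpa using e3, ?_, ?_⟩
      · simp only [List.cons_append, pathEdges_cons_cons, weight_cons]
        rw [e2, dist_vertical (by simp [ha'.1]), ← hab, ha'.1]
        simp only [pt_one]
        rw [abs_of_nonneg (by linarith)]; ring
      · left; simp [ha'.1]
      · rwa [← hab, ← ha'.1] at e4
    | t :: t' :: X, h =>
      rw [rowPath_cons] at h
      simp only [List.cons_append, List.cons.injEq] at h
      rcases ih hR' (x := r.2) (y := y + r.1) (X := X) (M := v :: M') (Z := Z) (u := u) (w := w)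
        (a := a) (b := b) (by simpa using h.2.2) ha hb hab with h4 | ⟨X', Y, Z', e1, e2, e3, e4, e5, e6⟩
      · simp at h4
      · refine ⟨r :: X', Y, Z', by simp [e1], e2, ?_, ?_, e5, e6⟩
        · rw [ht_cons]; linarith
        · rw [ht_cons]; linarith

lemma region_rows {m a : ℝ} {X Z : List (ℝ × ℝ)} {r : ℝ × ℝ} (hR : ∀ q ∈ X ++ r :: Z, 0 < q.1)
    {p : Plane} (hp : p ∈ IsRightChain.region (pt m a) (rowVerts a (X ++ r :: Z))
      (pt m (a + ht (X ++ r :: Z)))) (h1 : a + ht X < p 1) (h2 : p 1 < a + ht X + r.1) :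
    p 0 ≤ r.2 := by
  obtain ⟨-, q, hq, hq1, hq0⟩ := hp
  rw [← trace_rowPath hR hq (by rw [hq1]; exact h1) (by rw [hq1]; exact h2)]
  exact hq0

lemma segment_interior {u v p : Plane} (h : p ∈ segment ℝ u v) (h1 : p ≠ u) (h2 : p ≠ v) :
    ∃ t : ℝ, 0 < t ∧ t < 1 ∧ p 0 = u 0 + t * (v 0 - u 0) ∧ p 1 = u 1 + t * (v 1 - u 1) := by
  obtain ⟨t, t0, t1, hx, hy⟩ := mem_segment_coord.1 h
  refine ⟨t, lt_of_le_of_ne t0 ?_, lt_of_le_of_ne t1 ?_, hx, hy⟩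
  · rintro rfl
    exact h1 (plane_ext (by simpa using hx) (by simpa using hy))
  · rintro rfl
    exact h2 (plane_ext (by simpa using hx) (by simpa using hy))

lemma append_inj_of_ht {R1 R2 R1' R2' : List (ℝ × ℝ)} (h : R1 ++ R2 = R1' ++ R2')
    (hR : ∀ q ∈ R1 ++ R2, 0 < q.1) (hh : ht R1 = ht R1') : R1 = R1' ∧ R2 = R2' := by
  have key : ∀ {A B C D : List (ℝ × ℝ)} {E : List (ℝ × ℝ)}, B = A ++ E → C = E ++ D →
      (∀ q ∈ A ++ C, 0 < q.1) → ht A = ht B → A = B ∧ C = D := by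
    rintro A B C D E rfl rfl hR hh
    by_cases hE : E = []
    · subst hE; simp
    · have := ht_pos (R := E) (fun r hr => hR r (by simp [hr])) hE
      rw [ht_append] at hh
      linarith
  rcases List.append_eq_append_iff.1 h with ⟨E, h1, h2⟩ | ⟨E, h1, h2⟩
  · exact key h1 h2 hR hh
  · have := key h1 h2 (by rwa [← h]) hh.symm
    exact ⟨this.1.symm, this.2.symm⟩

/-- A chord does not join two level edges in the same direction. -/
lemma no_level_chord {m a τ : ℝ} {R1 R2 R1' R2' : List (ℝ × ℝ)} (h : R1 ++ R2 = R1' ++ R2')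
    (hR : ∀ q ∈ R1 ++ R2, 0 < q.1) (hτ : 0 < τ * (firstX m R2 - lastX m R1))
    (hτ' : 0 < τ * (firstX m R2' - lastX m R1')) {p q : Plane}
    (hp : p ∈ segment ℝ (pt (lastX m R1) (a + ht R1)) (pt (firstX m R2) (a + ht R1)))
    (hp1 : p ≠ pt (lastX m R1) (a + ht R1)) (hp2 : p ≠ pt (firstX m R2) (a + ht R1))
    (hq : q ∈ segment ℝ (pt (lastX m R1') (a + ht R1')) (pt (firstX m R2') (a + ht R1')))
    (hq1 : q ≠ pt (lastX m R1') (a + ht R1')) (hq2 : q ≠ pt (firstX m R2') (a + ht R1'))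
    (hpq : segment ℝ p q ⊆ IsRightChain.region (pt m a) (rowVerts a (R1 ++ R2))
      (pt m (a + ht (R1 ++ R2)))) : ¬ ht R1 < ht R1' := by
  intro hlt
  obtain ⟨t, t0, t1, px, py⟩ := segment_interior hp hp1 hp2
  obtain ⟨t', t0', t1', qx, qy⟩ := segment_interior hq hq1 hq2
  simp only [pt_zero, pt_one, sub_self, mul_zero, add_zero] at px py qx qy
  -- If the edges go to the left, the row just above the lower edge ends to the left of `p`, so the
  -- chord leaves the region right after `p`. If they go to the right, the row just below the upper
  -- edge ends to the left of `q`, and the chord leaves the region right before `q`.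
  rcases lt_trichotomy τ 0 with hs | rfl | hs
  · cases R2 with
    | nil =>
      have hR' : ∀ r ∈ R2', 0 < r.1 := fun r hr => hR r (by rw [h]; simp [hr])
      have := congrArg ht h
      simp only [ht_append, ht_nil] at this
      linarith [ht_nonneg hR']
    | cons r R2 =>
      have hr := hR r (by simp)
      simp only [firstX_cons] at hτ px
      have hd : r.2 - lastX m R1 < 0 := by
        by_contra hcon
        push Not at hcon
        exact absurd hτ (not_lt.2 (mul_nonpos_of_nonpos_of_nonneg hs.le hcon))
      have hpr : r.2 < p 0 := by nlinarith
      have hO : IsOpen {z : Plane | z 1 < a + ht R1 + r.1 ∧ r.2 < z 0} :=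
        (isOpen_lt (continuous_coord 1) continuous_const).inter
          (isOpen_lt continuous_const (continuous_coord 0))
      have ev := eventually_shift hO (q := p) ⟨by rw [py]; linarith, hpr⟩ (q 0 - p 0) (q 1 - p 1)
      have ev1 : ∀ᶠ δ : ℝ in nhdsWithin 0 (Set.Ioi 0), δ < 1 :=
        nhdsWithin_le_nhds (Iio_mem_nhds one_pos)
      obtain ⟨δ, ⟨k1, k2⟩, k3, k4⟩ := (ev.and (ev1.and self_mem_nhdsWithin)).exists
      have k4' : 0 < δ := k4
      have := region_rows hR (hpq (mem_segment_coord.2 ⟨δ, k4'.le, k3.le, pt_zero _ _, pt_one _ _⟩))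
        (by rw [pt_one, py, qy]; nlinarith) k1
      exact absurd this (not_le.2 k2)
  · simp at hτ
  · rcases List.eq_nil_or_concat R1' with rfl | ⟨X, r, rfl⟩
    · have hR' : ∀ r ∈ R1, 0 < r.1 := fun r hr => hR r (by simp [hr])
      simp only [ht_nil] at hlt
      linarith [ht_nonneg hR']
    · simp only [List.concat_eq_append] at *
      rw [h] at hR hpq
      have hr := hR r (by simp)
      simp only [lastX_append, lastX_cons, lastX_nil, ht_append, ht_cons, ht_nil, add_zero]
        at hτ' qx qy hlt
      have hd : 0 < firstX m R2' - r.2 := by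
        by_contra hcon
        push Not at hcon
        exact absurd hτ' (not_lt.2 (mul_nonpos_of_nonneg_of_nonpos hs.le hcon))
      have hqr : r.2 < q 0 := by nlinarith
      have hO : IsOpen {z : Plane | a + ht X < z 1 ∧ r.2 < z 0} :=
        (isOpen_lt continuous_const (continuous_coord 1)).inter
          (isOpen_lt continuous_const (continuous_coord 0))
      have ev := eventually_shift hO (q := q) ⟨by rw [qy]; linarith, hqr⟩ (p 0 - q 0) (p 1 - q 1)
      have ev1 : ∀ᶠ δ : ℝ in nhdsWithin 0 (Set.Ioi 0), δ < 1 :=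
        nhdsWithin_le_nhds (Iio_mem_nhds one_pos)
      obtain ⟨δ, ⟨k1, k2⟩, k3, k4⟩ := (ev.and (ev1.and self_mem_nhdsWithin)).exists
      have k4' : 0 < δ := k4
      rw [segment_symm] at hpq
      have e : X ++ [r] ++ R2' = X ++ r :: R2' := by simp
      rw [e] at hR hpq
      have := region_rows hR (hpq (mem_segment_coord.2 ⟨δ, k4'.le, k3.le, pt_zero _ _, pt_one _ _⟩))
        k1 (by rw [pt_one, py, qy]; nlinarith)
      exact absurd this (not_le.2 k2)

lemma isSubpath_map {L N : List Plane} {a b : Plane} (Φ : Plane ≃ₗᵢ[ℝ] Plane)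
    (h : IsSubpath (L.map Φ) a b N) : IsSubpath L (Φ.symm a) (Φ.symm b) (N.map Φ.symm) := by
  obtain ⟨X, M, Z, u, w, h1, rfl, h3, h4⟩ := h
  have hi : ∀ l : List Plane, (l.map Φ).map Φ.symm = l := by
    intro l; rw [List.map_map]; simp
  refine ⟨X.map Φ.symm, M.map Φ.symm, Z.map Φ.symm, Φ.symm u, Φ.symm w, ?_, by simp, ?_, ?_⟩
  · have := congrArg (List.map Φ.symm) h1
    rw [hi] at this
    rw [this]; simp
  · have := Set.mem_image_of_mem Φ.symm h3
    rw [image_segment_isometry] at this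
    convert this using 2
    cases M <;> simp
  · have := Set.mem_image_of_mem Φ.symm h4
    rw [image_segment_isometry] at this
    convert this using 2
    rw [List.getLast?_map]
    cases M.getLast? <;> simp

/-- A polygon which becomes a tame histogram when the coordinates are interchanged. -/
def IsBump (Q : SimplePolygon) : Prop :=
  ∀ s, IsTameHistogram s (Q.map swapXY) ∧ IsTameHistogram s ((Q.map swapXY).map flipY)

/-- The interchange of coordinates turns the level edges into the vertical edges of a histogram and
the columns into its edges to the right. Level edges and columns alternate, so each run is one edge
and `no_level_chord` excludes the forbidden chords. A horizontal chord corresponds to a constant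
abscissa `c` and spans rows of values at least `c`; by tameness their variation is at most their
height, so the path over the chord is at most twice as long as the chord. The factor `σ` allows for
an additional reflection. -/
lemma isTame_rows {m a s σ : ℝ} {R : List (ℝ × ℝ)} (hR0 : R ≠ []) (hR : ∀ r ∈ R, 0 < r.1)
    (hm : ∀ r ∈ R, m < r.2) (hne : R.IsChain fun r q => r.2 ≠ q.2) (hT : TameRows m R)
    {Q : SimplePolygon} {Φ : Plane ≃ₗᵢ[ℝ] Plane} (hσ : σ ≠ 0) (hΦ0 : ∀ p, Φ p 0 = p 1)
    (hΦ1 : ∀ p, Φ p 1 = σ * p 0) {Q' : SimplePolygon}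
    (hQv : Q.vertices = rowPath m m a R)
    (hQr : Q.region = IsRightChain.region (pt m a) (rowVerts a R) (pt m (a + ht R)))
    (hB : Q'.HasBoundary (Q.vertices.map Φ))
    (hch : ∀ x y, Q'.IsChord x y → Q.IsChord (Φ.symm x) (Φ.symm y)) :
    IsTameHistogram s Q' := by
  have hpos := ht_pos hR hR0
  have hs0 : ∀ p, Φ.symm p 1 = p 0 := fun p => by rw [← hΦ0 (Φ.symm p)]; simp
  have hs1 : ∀ p, p 1 = σ * Φ.symm p 0 := fun p => by rw [← hΦ1 (Φ.symm p)]; simp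
  have hlev : ∀ p q : Plane, Φ.symm p 0 = Φ.symm q 0 ↔ p 1 = q 1 := by
    intro p q
    rw [hs1 p, hs1 q]
    exact (mul_right_inj' hσ).symm
  have hi : ∀ l : List Plane, (l.map Φ).map Φ.symm = l := by
    intro l; rw [List.map_map]; simp
  have hlast : ((rowPath m m a R).map Φ).getLast? = some (Φ (pt m (a + ht R))) := by
    rw [List.getLast?_map, rowPath, ← List.cons_append, List.getLast?_concat]; rfl
  refine ⟨Φ (pt m a), Φ (pt m (a + ht R)), (rowPath m m a R).map Φ, rfl, hlast, by simp [hΦ1],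
    by simp [hΦ0, hpos], hQv ▸ hB, ?_, ?_, ?_⟩
  · rw [isChain_iff_pathEdges, pathEdges_map]
    intro e he
    obtain ⟨⟨u, v⟩, he', rfl⟩ := List.mem_map.1 he
    simp only [Prod.map_apply]
    rcases level_edge_rowPath he' with ⟨R1, R2, -, rfl, rfl⟩ | ⟨r, hr, h1, h2⟩
    · left; left; simp [hΦ0]
    · right
      have := hR r hr
      simp only [hΦ0, hΦ1, h1, h2, true_and]
      linarith
  · intro S hS
    obtain ⟨τ, hτ⟩ : ∃ τ : ℝ, ∀ x y, S x y → 0 < τ * (Φ.symm y 0 - Φ.symm x 0) := by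
      rcases hS with rfl | rfl
      · refine ⟨σ, fun x y h => ?_⟩
        have : x 1 < y 1 := h
        rw [mul_sub, ← hs1, ← hs1]; linarith
      · refine ⟨-σ, fun x y h => ?_⟩
        have : y 1 < x 1 := h
        have e : -σ * (Φ.symm y 0 - Φ.symm x 0) = σ * Φ.symm x 0 - σ * Φ.symm y 0 := by ring
        rw [e, ← hs1, ← hs1]; linarith
    have hrun : ∀ M, IsMaximalRun S ((rowPath m m a R).map Φ) M → ∃ R1 R2, R = R1 ++ R2 ∧
        M = [Φ (pt (lastX m R1) (a + ht R1)), Φ (pt (firstX m R2) (a + ht R1))] ∧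
        0 < τ * (firstX m R2 - lastX m R1) := by
      rintro M ⟨X, Z, h1, h2, h3, -, -⟩
      obtain ⟨x, y, M, rfl⟩ : ∃ x y M', M = x :: y :: M' := by
        match M, h2 with
        | x :: y :: M', _ => exact ⟨x, y, M', rfl⟩
      have hxy := hτ x y (List.isChain_cons_cons.1 h3).1
      have h1' := congrArg (List.map Φ.symm) h1
      rw [hi] at h1'
      have hM : M = [] := by
        cases M with
        | nil => rfl
        | cons z M =>
          exfalso
          have hyz := hτ y z (List.isChain_cons_cons.1 (List.isChain_cons_cons.1 h3).2).1
          have : [Φ.symm x, Φ.symm y, Φ.symm z] <:+: rowPath m m a R :=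
            ⟨X.map Φ.symm, (M ++ Z).map Φ.symm, by rw [h1']; simp⟩
          rcases alternate_rowPath this with h | h
          · rw [h, sub_self, mul_zero] at hxy; exact lt_irrefl _ hxy
          · rw [h, sub_self, mul_zero] at hyz; exact lt_irrefl _ hyz
      subst hM
      have he : (Φ.symm x, Φ.symm y) ∈ pathEdges (rowPath m m a R) :=
        mem_pathEdges_iff.2 ⟨X.map Φ.symm, Z.map Φ.symm, by rw [h1']; simp⟩
      rcases level_edge_rowPath he with ⟨R1, R2, h4, h5, h6⟩ | ⟨r, hr, h4, -⟩
      · refine ⟨R1, R2, h4, ?_, ?_⟩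
        · rw [← h5, ← h6]; simp
        · rw [h5, h6] at hxy; simpa using hxy
      · rw [h4, sub_self, mul_zero] at hxy; exact absurd hxy (lt_irrefl _)
    intro M M' hM hM' hne' p hp q hq hpq
    obtain ⟨R1, R2, h1, rfl, h3⟩ := hrun M hM
    obtain ⟨R1', R2', h1', rfl, h3'⟩ := hrun M' hM'
    have hmem : ∀ {u v x : Plane}, x ∈ pathInterior [Φ u, Φ v] →
        Φ.symm x ∈ segment ℝ u v ∧ Φ.symm x ≠ u ∧ Φ.symm x ≠ v := by
      rintro u v x ⟨k1, k2, k3⟩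
      have k2' := k2 (Φ u) (by simp)
      have k3' := k3 (Φ v) (by simp)
      refine ⟨?_, ?_, ?_⟩
      · simp only [pathEdges_cons_cons, pathEdges_single, trace_cons, trace_nil,
          Set.union_empty] at k1
        have := Set.mem_image_of_mem Φ.symm k1
        rw [image_segment_isometry] at this
        simpa using this
      · rintro rfl; simp at k2'
      · rintro rfl; simp at k3'
    obtain ⟨p1, p2, p3⟩ := hmem hp
    obtain ⟨q1, q2, q3⟩ := hmem hq
    have hseg := (hch p q hpq).2.2
    rw [hQr] at hseg
    have e := h1.symm.trans h1'
    subst h1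
    have k1 := no_level_chord e hR h3 h3' p1 p2 p3 q1 q2 q3 hseg
    have k2 := no_level_chord e.symm (by rwa [← e]) h3' h3 q1 q2 q3 p1 p2 p3
      (by rw [← e, segment_symm]; exact hseg)
    obtain ⟨rfl, rfl⟩ := append_inj_of_ht e hR (le_antisymm (not_lt.1 k2) (not_lt.1 k1))
    exact hne' rfl
  · intro x y N hN hxy hch'
    have hN' := isSubpath_map Φ hN
    have hseg := (hch x y hch').2.2
    rw [hQr] at hseg
    have hw : weight (pathEdges N) = weight (pathEdges (N.map Φ.symm)) := by
      rw [pathEdges_map, weight_map]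
    have hd : dist x y = dist (Φ.symm x) (Φ.symm y) := (Φ.symm.dist_map x y).symm
    rw [hw, hd]
    have hxy' := (hlev x y).2 hxy
    set p := Φ.symm x
    set q := Φ.symm y
    obtain ⟨X, M, Z, u, w, h1, h2, h3, h4⟩ := hN'
    rw [h2]
    rcases subpath_rowPath hR h1 h3 h4 hxy' with rfl | ⟨X', Y, Z', e1, e2, e3, e4, e5, e6⟩
    · simp only [List.nil_append, pathEdges_cons_cons, pathEdges_single, weight_cons, weight_nil]
      linarith [dist_nonneg (x := p) (y := q)]
    · have hdp : q 1 - p 1 ≤ dist p q := by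
        rw [dist_vertical hxy']; exact le_abs_self _
      have hmp : m ≤ p 0 := by
        obtain ⟨⟨z, hz, -, hz0⟩, -⟩ := hseg (left_mem_segment ℝ p q)
        obtain ⟨t, -, -, h, -⟩ := mem_segment_coord.1 hz
        simp at h
        linarith
      have hX : lastX m X' ≤ p 0 → lastX (p 0) X' ≤ p 0 := by
        cases X' <;> simp
      have hZ : firstX m Z' ≤ p 0 → firstX (p 0) Z' ≤ p 0 := by
        cases Z' <;> simp
      have := hT.strip hR e1 hmp (by
        intro r hr
        obtain ⟨Y1, Y2, rfl⟩ := List.append_of_mem hr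
        have e1' : R = (X' ++ Y1) ++ r :: (Y2 ++ Z') := by rw [e1]; simp
        have hr0 := hR r (by rw [e1']; simp)
        have hY1 : 0 ≤ ht Y1 := ht_nonneg fun q hq => hR q (by rw [e1']; simp [hq])
        have hY2 : 0 ≤ ht Y2 := ht_nonneg fun q hq => hR q (by rw [e1']; simp [hq])
        simp only [ht_append, ht_cons] at e4
        have hlt : 0 < q 1 - p 1 := by linarith
        rw [e1'] at hR hseg
        -- The chord passes each row of `Y` at half its height, and a point of the region cannot be
        -- to the right of the row end there.
        have := region_rows (p := pt (p 0) (a + ht (X' ++ Y1) + r.1 / 2)) hR (hseg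
          (mem_segment_coord.2 ⟨(a + ht (X' ++ Y1) + r.1 / 2 - p 1) / (q 1 - p 1),
            div_nonneg (by rw [ht_append]; linarith) hlt.le,
            (div_le_one hlt).2 (by rw [ht_append]; linarith), by rw [pt_zero, hxy']; ring, by
            rw [pt_one, div_mul_cancel₀ _ hlt.ne']; ring⟩))
          (by rw [pt_one]; linarith) (by rw [pt_one]; linarith)
        simpa using this) (e5.imp_left hX) (e6.imp_left hZ)
      rw [e2]
      linarith

/-- Tame rows form a polygon. -/
lemma exists_bump {m a : ℝ} {R : List (ℝ × ℝ)} (hR0 : R ≠ []) (hR : ∀ r ∈ R, 0 < r.1)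
    (hm : ∀ r ∈ R, m < r.2) (hT : TameRows m R) :
    ∃ Q : SimplePolygon, IsBump Q ∧
      (∀ᵐ p : Plane, Q.region.indicator (fun _ => (1 : ℤ)) p =
        rowCount a R p - hc (pt m a, pt m (a + ht R)) p) ∧
      Q.per = 2 * ht R + pvar m R m := by
  obtain ⟨R', h1, h2, h3, h4, h5, h6, h7⟩ := hT.exists_merged _ R le_rfl hR
  have hpos := ht_pos hR hR0
  have hR0' : R' ≠ [] := by rintro rfl; rw [← h4] at hpos; simp at hpos
  have hm' : ∀ r ∈ R', m < r.2 := by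
    intro r hr
    have : r.2 ∈ values R := by rw [← h3]; exact ⟨r, hr, rfl⟩
    obtain ⟨q, hq, hq'⟩ := this
    rw [← hq']; exact hm q hq
  have hC := isRightChain_rows (a := a) hR0' h2 hm' h7
  refine ⟨hC.polygon, fun s => ⟨?_, ?_⟩, ?_, ?_⟩
  · exact isTame_rows (Q := hC.polygon) (Φ := swapXY) (σ := 1) hR0' h2 hm' h7 h1 one_ne_zero
      (by simp) (by simp) rfl rfl (Or.inl (List.IsRotated.refl _))
      (fun x y h => by
        have e : ∀ z, swapXY (swapXY.symm z) = z := swapXY.apply_symm_apply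
        rw [← SimplePolygon.isChord_map (Φ := swapXY), e, e]; exact h)
  · exact isTame_rows (Q := hC.polygon) (Φ := swapXY.trans flipY) (σ := -1) hR0' h2 hm' h7 h1
      (by norm_num) (by simp) (by simp) rfl rfl
      (Or.inl (by
        have : List.map (swapXY.trans flipY) hC.polygon.vertices =
          List.map flipY (List.map swapXY hC.polygon.vertices) := by
          rw [List.map_map]; rfl
        rw [this]; exact List.IsRotated.refl _))
      (fun x y h => by
        have e : ∀ z, flipY (swapXY ((swapXY.trans flipY).symm z)) = z :=
          (swapXY.trans flipY).apply_symm_apply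
        rw [← SimplePolygon.isChord_map (Φ := swapXY), ← SimplePolygon.isChord_map (Φ := flipY), e,
          e]
        exact h)
  · filter_upwards [ae_not_mem_trace (cyclicEdges (rowPath m m a R'))] with p hp
    rw [show hC.polygon.region = IsRightChain.region (pt m a) (rowVerts a R') (pt m (a + ht R'))
      from rfl, hC.indicator hp, ← h4, ← h6, ← hcount_rowPath m m a R']
    rfl
  · show weight (cyclicEdges (pt m a :: (rowVerts a R' ++ [pt m (a + ht R')]))) = _
    rw [cyclicEdges_chain, weight_append]
    have := weight_rowPath m m a h2
    rw [rowPath] at this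
    rw [this, weight_cons, weight_nil, h4, h5, dist_vertical (by simp)]
    simp only [pt_one, sub_add_cancel_left, abs_neg]
    rw [abs_of_pos hpos]; ring

/-! ### Taming rows by cutting off bumps -/

/-- The rows `R'` are obtained from `R` by cutting off bumps. -/
def Reduces (m a : ℝ) (R R' : List (ℝ × ℝ)) : Prop :=
  ∃ F : List SimplePolygon, (∀ Q ∈ F, IsBump Q) ∧
    (∀ᵐ p : Plane, cnt F p = rowCount a R p - rowCount a R' p) ∧
    sumPer F + 3 * pvar m R' m ≤ 3 * pvar m R m ∧ ht R' = ht R ∧ ∀ r ∈ R', 0 < r.1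

namespace Reduces

variable {m a : ℝ} {R R' R'' : List (ℝ × ℝ)}

lemma refl (hR : ∀ r ∈ R, 0 < r.1) : Reduces m a R R := ⟨[], by simp, by simp, by simp, rfl, hR⟩

lemma trans (h : Reduces m a R R') (h' : Reduces m a R' R'') : Reduces m a R R'' := by
  obtain ⟨F, h1, h2, h3, h4, h5⟩ := h
  obtain ⟨F', h1', h2', h3', h4', h5'⟩ := h'
  refine ⟨F ++ F', ?_, ?_, ?_, h4'.trans h4, h5'⟩
  · intro Q hQ
    exact (List.mem_append.1 hQ).elim (h1 Q) (h1' Q)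
  · filter_upwards [h2, h2'] with p k k'
    rw [cnt_append, k, k']; ring
  · rw [sumPer_append]; linarith

lemma ne_nil (h : Reduces m a R R') (hR : ∀ r ∈ R, 0 < r.1) (hR0 : R ≠ []) : R' ≠ [] := by
  obtain ⟨F, h1, h2, h3, h4, h5⟩ := h
  have := ht_pos hR hR0
  rintro rfl
  rw [← h4] at this
  simp at this

lemma join {A A' B B' : List (ℝ × ℝ)} {t : ℝ} (ht0 : 0 < t) (hA : Reduces m a A A')
    (hB : Reduces m (a + ht A + t) B B') :
    Reduces m a (A ++ (t, m) :: B) (A' ++ (t, m) :: B') := by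
  obtain ⟨F, h1, h2, h3, h4, h5⟩ := hA
  obtain ⟨F', h1', h2', h3', h4', h5'⟩ := hB
  refine ⟨F ++ F', ?_, ?_, ?_, ?_, ?_⟩
  · intro Q hQ
    exact (List.mem_append.1 hQ).elim (h1 Q) (h1' Q)
  · filter_upwards [h2, h2'] with p k k'
    rw [cnt_append, k, k', rowCount_append, rowCount_append, rowCount_cons, rowCount_cons, h4]
    ring
  · rw [sumPer_append, pvar_append_cons, pvar_append_cons]; linarith
  · simp only [ht_append, ht_cons, h4, h4']
  · intro r hr
    simp only [List.mem_append, List.mem_cons] at hr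
    rcases hr with hr | rfl | hr
    · exact h5 r hr
    · exact ht0
    · exact h5' r hr

/-- By `pvar_shift`, both sides of the potential grow by `6 * (m' - m)`. -/
lemma lower {m' : ℝ} (h : Reduces m' a R R') (hm : m ≤ m') (hR0 : R ≠ []) (hR0' : R' ≠ [])
    (hR : ∀ r ∈ R, m' ≤ r.2) (hR' : ∀ r ∈ R', m' ≤ r.2) : Reduces m a R R' := by
  obtain ⟨F, h1, h2, h3, h4⟩ := h
  refine ⟨F, h1, h2, ?_, h4⟩
  rw [pvar_shift hm hR0 hR, pvar_shift hm hR0' hR']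
  linarith

/-- The bump above the level `c` has perimeter `2 * ht R + pvar c R c ≤ 3 * pvar c R c`, and `pvar c
R c` is exactly the loss of variation when the rows are flattened to `c`. This explains the factor 3
in `Reduces`. -/
lemma bump {c : ℝ} (hmc : m ≤ c) (hR0 : R ≠ []) (hR : ∀ r ∈ R, 0 < r.1) (hc : ∀ r ∈ R, c < r.2)
    (hT : TameRows c R) (hp : ht R ≤ pvar c R c) : Reduces m a R [(ht R, c)] := by
  obtain ⟨Q, h1, h2, h3⟩ := exists_bump (a := a) hR0 hR hc hT
  refine ⟨[Q], by simpa using h1, ?_, ?_, by simp, by simpa using ht_pos hR hR0⟩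
  · filter_upwards [h2] with p hp
    rw [cnt_cons, cnt_nil, hp, rowCount_single, add_zero]
  · rw [pvar_shift hmc hR0 fun r hr => (hc r hr).le]
    simp only [sumPer_cons, sumPer_nil, pvar_cons, pvar_nil, h3]
    rw [abs_of_nonneg (by linarith), abs_of_nonpos (by linarith)]
    linarith

/-- A single row that extends too far is shortened by `w / 2` at a time; the piece cut off has
variation `w`, equal to its height. -/
lemma flat {w : ℝ} (hw : 0 < w) (n : ℕ) : ∀ c, m < c → 2 * (c - m) ≤ (n + 1) * w →
    ∃ c', m < c' ∧ 2 * (c' - m) ≤ w ∧ Reduces m a [(w, c)] [(w, c')] := by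
  induction n with
  | zero =>
    intro c hc hn
    exact ⟨c, hc, by simpa using hn, refl (by simpa using hw)⟩
  | succ n ih =>
    intro c hc hn
    by_cases h : 2 * (c - m) ≤ w
    · exact ⟨c, hc, h, refl (by simpa using hw)⟩
    · push Not at h
      obtain ⟨c', h1, h2, h3⟩ := ih (c - w / 2) (by linarith) (by push_cast at hn; linarith)
      refine ⟨c', h1, h2, trans ?_ h3⟩
      have := bump (m := m) (a := a) (R := [(w, c)]) (c := c - w / 2) (by linarith) (by simp)
        (by simpa using hw) (by simpa using hw) (TameRows.flat hw.le (by linarith)) (by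
          simp only [ht_cons, ht_nil, pvar_cons, pvar_nil]
          rw [abs_of_nonneg (by linarith), abs_of_nonpos (by linarith)]
          linarith)
      simpa using this

end Reduces

/-- All rows can be made tame by cutting off bumps. -/
def Tamable (n : ℕ) : Prop :=
  ∀ (R : List (ℝ × ℝ)) (m a : ℝ), R.length ≤ n → R ≠ [] → (∀ r ∈ R, 0 < r.1) →
    (∀ r ∈ R, m < r.2) → ∃ R', Reduces m a R R' ∧ (∀ r ∈ R', m < r.2) ∧ TameRows m R'

/-- The rows of value exactly `m` divide the list into parts strictly above `m`, each of which is
tamed separately. -/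
lemma Tamable.weak {n : ℕ} (h : Tamable n) (k : ℕ) : ∀ (R : List (ℝ × ℝ)) (m a : ℝ),
    R.length ≤ k → R.length ≤ n → (∀ r ∈ R, 0 < r.1) → (∀ r ∈ R, m ≤ r.2) →
    ∃ R', Reduces m a R R' ∧ (∀ r ∈ R', m ≤ r.2) ∧ TameRows m R' := by
  induction k with
  | zero =>
    intro R m a hk _ _ _
    obtain rfl := List.length_eq_zero_iff.1 (Nat.le_zero.1 hk)
    exact ⟨[], Reduces.refl (by simp), by simp, TameRows.nil⟩
  | succ k ih =>
    intro R m a hk hn h0 hm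
    by_cases hR0 : R = []
    · subst hR0
      exact ⟨[], Reduces.refl (by simp), by simp, TameRows.nil⟩
    by_cases hflat : ∃ r ∈ R, r.2 = m
    · obtain ⟨g, t, B, rfl, hg⟩ := exists_first_row hflat hm
      simp only [List.length_append, List.length_cons] at hk hn
      have ht0 : 0 < t := h0 (t, m) (by simp)
      obtain ⟨B', b1, b2, b3⟩ := ih B m (a + ht g + t) (by omega) (by omega)
        (fun r hr => h0 r (by simp [hr])) (fun r hr => hm r (by simp [hr]))
      obtain ⟨g', g1, g2, g3⟩ := ih g m a (by omega) (by omega)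
        (fun r hr => h0 r (by simp [hr])) (fun r hr => hm r (by simp [hr]))
      refine ⟨g' ++ (t, m) :: B', g1.join ht0 b1, ?_, g3.append ht0.le b3⟩
      intro r hr
      simp only [List.mem_append, List.mem_cons] at hr
      rcases hr with hr | rfl | hr
      · exact g2 r hr
      · exact le_rfl
      · exact b2 r hr
    · obtain ⟨R', h1, h2, h3⟩ := h R m a hn hR0 h0 fun r hr =>
        lt_of_le_of_ne (hm r hr) fun h => hflat ⟨r, hr, h.symm⟩
      exact ⟨R', h1, fun r hr => (h2 r hr).le, h3⟩

/-- The rows on both sides of the first row of minimal value `m'` are tamed relative to `m'` and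
joined again. Afterwards tameness can fail only at levels between `m` and `m'`, where the block is
the whole list. In that case one bump is cut off and a single flat row remains. -/
lemma tamable (n : ℕ) : Tamable n := by
  induction n with
  | zero =>
    intro R m a hn hR0
    exact absurd (List.length_eq_zero_iff.1 (Nat.le_zero.1 hn)) hR0
  | succ n ih =>
    intro R m a hn hR0 h0 hm
    obtain ⟨m', ⟨r0, hr0, hr0'⟩, hmin⟩ := exists_min_value hR0
    have hmm : m < m' := hr0' ▸ hm r0 hr0
    obtain ⟨g, t, B, rfl, hg⟩ := exists_first_row ⟨r0, hr0, hr0'⟩ hmin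
    simp only [List.length_append, List.length_cons] at hn
    have ht0 : 0 < t := h0 (t, m') (by simp)
    obtain ⟨B', b1, b2, b3⟩ := ih.weak n B m' (a + ht g + t) (by omega) (by omega)
      (fun r hr => h0 r (by simp [hr])) (fun r hr => hmin r (by simp [hr]))
    obtain ⟨g', g1, g2, g3⟩ := ih.weak n g m' a (by omega) (by omega)
      (fun r hr => h0 r (by simp [hr])) (fun r hr => hmin r (by simp [hr]))
    have hred := g1.join ht0 b1
    have hT := g3.append ht0.le b3
    have hp : pvar m' (g' ++ (t, m') :: B') m' < ht (g' ++ (t, m') :: B') := by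
      rw [pvar_append_cons, ht_append, ht_cons]
      simp only
      linarith [g3.pvar_le g2, b3.pvar_le b2]
    have hL0 : g' ++ (t, m') :: B' ≠ [] := by simp
    have hLm : ∀ r ∈ g' ++ (t, m') :: B', m' ≤ r.2 := by
      intro r hr
      simp only [List.mem_append, List.mem_cons] at hr
      rcases hr with hr | rfl | hr
      · exact g2 r hr
      · exact le_rfl
      · exact b2 r hr
    have hLh : ∀ r ∈ g' ++ (t, m') :: B', 0 < r.1 := by
      obtain ⟨F, -, -, -, -, h5⟩ := hred
      exact h5
    have hred' := hred.lower hmm.le hR0 hL0 hmin hLm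
    set L := g' ++ (t, m') :: B'
    by_cases hkeep : pvar m' L m' + 2 * (m' - m) ≤ ht L
    · exact ⟨L, hred', fun r hr => hmm.trans_le (hLm r hr), hT.lower hL0 hmm.le hLm hkeep⟩
    · push Not at hkeep
      -- At this level the variation of `L` equals its height, so the rows above it are still tame
      -- and yet `Reduces.bump` is applicable.
      obtain ⟨c, hc⟩ : ∃ c, c = m' - (ht L - pvar m' L m') / 2 := ⟨_, rfl⟩
      have hcm : m < c := by linarith
      have hcm' : c < m' := by linarith
      have hLc : ∀ r ∈ L, c < r.2 := fun r hr => hcm'.trans_le (hLm r hr)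
      have hb := Reduces.bump (m := m) (a := a) hcm.le hL0 hLh hLc
        (hT.lower hL0 hcm'.le hLm (by linarith)) (by
          rw [pvar_shift hcm'.le hL0 hLm]; linarith)
      have hw := ht_pos hLh hL0
      obtain ⟨k, hk⟩ := exists_nat_ge (2 * (c - m) / ht L)
      have hk' := (div_le_iff₀ hw).1 hk
      obtain ⟨c', h1, h2, h3⟩ := Reduces.flat (a := a) hw k c hcm (by linarith)
      exact ⟨[(ht L, c')], (hred'.trans hb).trans h3, by simpa using h1,
        TameRows.flat hw.le h2⟩

/-- Rows can be tiled by bumps. -/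
theorem exists_bumps {m a : ℝ} {R : List (ℝ × ℝ)} (hR : ∀ r ∈ R, 0 < r.1)
    (hm : ∀ r ∈ R, m < r.2) :
    ∃ F : List SimplePolygon, (∀ Q ∈ F, IsBump Q) ∧
      (∀ᵐ p : Plane, cnt F p = rowCount a R p - hc (pt m a, pt m (a + ht R)) p) ∧
      sumPer F ≤ 3 * (pvar m R m + ht R) := by
  by_cases hR0 : R = []
  · subst hR0
    exact ⟨[], by simp, by simp [hc_level], by simp⟩
  · obtain ⟨R', hred, h2, h3⟩ := tamable _ R m a le_rfl hR0 hR hm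
    have hR0' := hred.ne_nil hR hR0
    obtain ⟨F, f1, f2, f3, f4, f5⟩ := hred
    obtain ⟨Q, q1, q2, q3⟩ := exists_bump (a := a) hR0' f5 h2 h3
    refine ⟨Q :: F, ?_, ?_, ?_⟩
    · intro q hq
      rcases List.mem_cons.1 hq with rfl | hq
      · exact q1
      · exact f1 q hq
    · filter_upwards [f2, q2] with p k1 k2
      rw [cnt_cons, k1, k2, f4]; ring
    · rw [sumPer_cons, q3, f4]
      have := ht_nonneg hR
      have := pvar_nonneg m R' m
      linarith

section

/-! ### Sets of cells -/

/-- The cells of a grid. -/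
abbrev Cell : Type := ℤ × ℤ

/-- The four directions. -/
def dirs : Finset Cell := {(1, 0), (-1, 0), (0, 1), (0, -1)}

/-- Two perpendicular directions. -/
def IsFrame (t d : Cell) : Prop := t ∈ dirs ∧ d ∈ dirs ∧ t ≠ d ∧ t ≠ -d

/-- The cell with coordinates `k` and `r`. -/
def cell (b t d : Cell) (k r : ℤ) : Cell := b + k • t + r • d

section

variable {b t d : Cell}

lemma neg_mem_dirs {e : Cell} (h : e ∈ dirs) : -e ∈ dirs := by
  revert h; unfold dirs; simp only [Finset.mem_insert, Finset.mem_singleton]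
  rintro (rfl | rfl | rfl | rfl) <;> simp

lemma ne_neg_of_mem_dirs {e : Cell} (h : e ∈ dirs) : e ≠ -e := by
  revert h; unfold dirs; simp only [Finset.mem_insert, Finset.mem_singleton]
  rintro (rfl | rfl | rfl | rfl) <;> decide

lemma IsFrame.cases (h : IsFrame t d) : ((t = (1, 0) ∨ t = (-1, 0)) ∧ (d = (0, 1) ∨ d = (0, -1))) ∨
    ((t = (0, 1) ∨ t = (0, -1)) ∧ (d = (1, 0) ∨ d = (-1, 0))) := by
  obtain ⟨h1, h2, h3, h4⟩ := h
  simp only [dirs, Finset.mem_insert, Finset.mem_singleton] at h1 h2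
  rcases h1 with rfl | rfl | rfl | rfl <;> rcases h2 with rfl | rfl | rfl | rfl <;> simp_all

lemma IsFrame.inj (h : IsFrame t d) {k r k' r' : ℤ} (hk : cell b t d k r = cell b t d k' r') :
    k = k' ∧ r = r' := by
  have h1 := congrArg Prod.fst hk
  have h2 := congrArg Prod.snd hk
  rcases h.cases with ⟨rfl | rfl, rfl | rfl⟩ | ⟨rfl | rfl, rfl | rfl⟩ <;>
    simp [cell] at h1 h2 <;> constructor <;> omega

lemma IsFrame.dir (h : IsFrame t d) {e : Cell} (he : e ∈ dirs) :
    e = t ∨ e = -t ∨ e = d ∨ e = -d := by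
  simp only [dirs, Finset.mem_insert, Finset.mem_singleton] at he
  rcases h.cases with ⟨rfl | rfl, rfl | rfl⟩ | ⟨rfl | rfl, rfl | rfl⟩ <;>
    rcases he with rfl | rfl | rfl | rfl <;> simp

lemma IsFrame.turn (h : IsFrame t d) {ε : ℤ} (hε : ε = 1 ∨ ε = -1) : IsFrame d (ε • t) := by
  obtain ⟨h1, h2, h3, h4⟩ := h
  rcases hε with rfl | rfl
  · refine ⟨h2, by simpa using h1, by simpa using h3.symm, ?_⟩
    simp only [one_smul]
    rintro rfl; simp at h4
  · refine ⟨h2, by simpa using neg_mem_dirs h1, ?_, by simpa using h3.symm⟩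
    simp only [neg_smul, one_smul]
    rintro rfl; simp at h4

lemma cell_add_t (k r : ℤ) : cell b t d k r + t = cell b t d (k + 1) r := by
  unfold cell; module
lemma cell_sub_t (k r : ℤ) : cell b t d k r + -t = cell b t d (k - 1) r := by
  unfold cell; module
lemma cell_add_d (k r : ℤ) : cell b t d k r + d = cell b t d k (r + 1) := by
  unfold cell; module
lemma cell_sub_d (k r : ℤ) : cell b t d k r + -d = cell b t d k (r - 1) := by
  unfold cell; module
lemma cell_add_smul (k r ε : ℤ) : cell b t d k r + ε • t = cell b t d (k + ε) r := by
  unfold cell; module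
lemma cell_sub_smul (k r ε : ℤ) : cell b t d k r + -(ε • t) = cell b t d (k - ε) r := by
  unfold cell; module
lemma cell_turn (k r ε i j : ℤ) :
    cell (cell b t d k r) d (ε • t) i j = cell b t d (k + j * ε) (r + i) := by
  unfold cell; module

end

/-- The four cells around the corner of `b` in direction `-t - d` belong to `S`. -/
def Full (S : Finset Cell) (t d b : Cell) : Prop := b ∈ S ∧ b + -t ∈ S ∧ b + -d ∈ S ∧ b + -t + -d ∈ S

/-- The cells of the columns above the base, as far as they belong to `Z`. -/
def InHist (Z : Finset Cell) (b t d : Cell) (n : ℤ) (c : Cell) : Prop :=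
  ∃ k r : ℤ, 0 ≤ k ∧ k < n ∧ 0 ≤ r ∧ c = cell b t d k r ∧
    ∀ j, 0 ≤ j → j ≤ r → cell b t d k j ∈ Z

/-- The base edges. -/
def BaseEdge (b t d : Cell) (n : ℤ) (c e : Cell) : Prop :=
  e = -d ∧ ∃ i : ℤ, 0 ≤ i ∧ i < n ∧ c = cell b t d i 0

/-- Every chord of `S` which ends at the boundary separates `S`. -/
def Separated (S : Finset Cell) : Prop :=
  ∀ (b t d : Cell) (n : ℤ), IsFrame t d → 0 < n →
    (∀ i, 0 ≤ i → i < n → cell b t d i 0 ∈ S ∧ cell b t d i (-1) ∈ S) →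
    ¬ Full S t d b → ¬ Full S t d (cell b t d n 0) →
    ∃ p : Cell → ZMod 2, ∀ c ∈ S, ∀ e ∈ dirs, c + e ∈ S →
      (p c ≠ p (c + e) ↔ BaseEdge b t d n c e ∨ BaseEdge b t d n (c + e) (-e))

/-- `Z` is a part of `S` which is bounded by a base and by sides of columns above the base. -/
structure Rooted (S Z : Finset Cell) (b t d : Cell) (n : ℤ) : Prop where
  sub : Z ⊆ S
  frame : IsFrame t d
  pos : 0 < n
  base : ∀ k, 0 ≤ k → k < n → cell b t d k 0 ∈ Z
  below : ∀ k, 0 ≤ k → k < n → cell b t d k (-1) ∉ Z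
  inv : ∀ c ∈ Z, ∀ e ∈ dirs, c + e ∈ S → c + e ∉ Z →
    BaseEdge b t d n c e ∨ (InHist Z b t d n c ∧ (e = t ∨ e = -t))
  corner0 : ¬ Full S t d b
  corner1 : ¬ Full S t d (cell b t d n 0)

namespace InHist

variable {Z Z' : Finset Cell} {b t d : Cell} {n : ℤ}

lemma mem {c : Cell} (h : InHist Z b t d n c) : c ∈ Z := by
  obtain ⟨k, r, h1, h2, h3, rfl, h4⟩ := h
  exact h4 r h3 le_rfl

lemma iff (hF : IsFrame t d) {k r : ℤ} : InHist Z b t d n (cell b t d k r) ↔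
    0 ≤ k ∧ k < n ∧ 0 ≤ r ∧ ∀ j, 0 ≤ j → j ≤ r → cell b t d k j ∈ Z := by
  constructor
  · rintro ⟨k', r', h1, h2, h3, h4, h5⟩
    obtain ⟨rfl, rfl⟩ := hF.inj h4
    exact ⟨h1, h2, h3, h5⟩
  · rintro ⟨h1, h2, h3, h5⟩
    exact ⟨k, r, h1, h2, h3, rfl, h5⟩

lemma down {k r : ℤ} (hF : IsFrame t d) (h : InHist Z b t d n (cell b t d k r)) {j : ℤ}
    (h0 : 0 ≤ j) (hj : j ≤ r) : InHist Z b t d n (cell b t d k j) := by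
  rw [iff hF] at h ⊢
  exact ⟨h.1, h.2.1, h0, fun i hi hi' => h.2.2.2 i hi (hi'.trans hj)⟩

lemma up {k r : ℤ} (hF : IsFrame t d) (h : InHist Z b t d n (cell b t d k r))
    (hr : cell b t d k (r + 1) ∈ Z) : InHist Z b t d n (cell b t d k (r + 1)) := by
  rw [iff hF] at h ⊢
  refine ⟨h.1, h.2.1, by linarith [h.2.2.1], fun i hi hi' => ?_⟩
  rcases eq_or_lt_of_le hi' with rfl | hlt
  · exact hr
  · exact h.2.2.2 i hi (by omega)

end InHist

namespace Rooted

variable {S Z : Finset Cell} {b t d : Cell} {n : ℤ}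

lemma base_hist (h : Rooted S Z b t d n) {k : ℤ} (h0 : 0 ≤ k) (h1 : k < n) :
    InHist Z b t d n (cell b t d k 0) := by
  rw [InHist.iff h.frame]
  refine ⟨h0, h1, le_rfl, fun j hj hj' => ?_⟩
  obtain rfl : j = 0 := by omega
  exact h.base k h0 h1

/-- A neighbour of the histogram is to the left or to the right of it. -/
lemma side (h : Rooted S Z b t d n) {c e : Cell} (hc : InHist Z b t d n c) (he : e ∈ dirs)
    (h1 : c + e ∈ Z) (h2 : ¬ InHist Z b t d n (c + e)) : e = t ∨ e = -t := by
  obtain ⟨k, r, k0, k1, r0, rfl, hj⟩ := id hc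
  rcases h.frame.dir he with rfl | rfl | rfl | rfl
  · exact Or.inl rfl
  · exact Or.inr rfl
  · rw [cell_add_d] at h1 h2
    exact absurd (hc.up h.frame h1) h2
  · rw [cell_sub_d] at h1 h2
    rcases eq_or_lt_of_le r0 with rfl | hr
    · exact absurd h1 (h.below k k0 k1)
    · exact absurd (hc.down h.frame (by omega) (by omega)) h2

/-- The histogram and its neighbour at height `r`. -/
lemma exists_run (h : Rooted S Z b t d n) {k r ε : ℤ} (hε : ε = 1 ∨ ε = -1)
    (h1 : InHist Z b t d n (cell b t d k r)) (h2 : cell b t d (k + ε) r ∈ Z)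
    (h3 : ¬ InHist Z b t d n (cell b t d (k + ε) r)) :
    ∃ r1 r2, r1 ≤ r2 ∧ (∀ i, r1 ≤ i → i ≤ r2 → InHist Z b t d n (cell b t d k i) ∧
      cell b t d (k + ε) i ∈ Z ∧ ¬ InHist Z b t d n (cell b t d (k + ε) i)) ∧
      ¬ Full S d (ε • t) (cell b t d (k + ε) r1) ∧
      ¬ Full S d (ε • t) (cell b t d (k + ε) (r2 + 1)) := by
  have hF := h.frame
  set A : ℤ → Prop := fun i => InHist Z b t d n (cell b t d k i) ∧
      cell b t d (k + ε) i ∈ Z ∧ ¬ InHist Z b t d n (cell b t d (k + ε) i) with hA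
  have hAr : A r := ⟨h1, h2, h3⟩
  have hA0 : ∀ i, A i → 0 ≤ i := fun i hi => ((InHist.iff hF).1 hi.1).2.2.1
  have hfin : ∃ m : ℕ, ¬ A (r + m) := by
    by_contra hcon
    push Not at hcon
    refine Set.infinite_of_injective_forall_mem (f := fun m : ℕ => cell b t d k (r + m)) ?_
      (fun m => (hcon m).1.mem) Z.finite_toSet
    intro i j hij
    have := (hF.inj hij).2
    omega
  have hfin' : ∃ m : ℕ, ¬ A (r - m) := ⟨(r + 1).toNat, fun hcon => by
    have := hA0 _ hcon
    have := hA0 _ hAr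
    omega⟩
  classical
  obtain ⟨m, hm, hm'⟩ : ∃ m : ℕ, ¬ A (r + m) ∧ ∀ j < m, A (r + j) :=
    ⟨Nat.find hfin, Nat.find_spec hfin, fun j hj => not_not.1 (Nat.find_min hfin hj)⟩
  obtain ⟨l, hl, hl'⟩ : ∃ m : ℕ, ¬ A (r - m) ∧ ∀ j < m, A (r - j) :=
    ⟨Nat.find hfin', Nat.find_spec hfin', fun j hj => not_not.1 (Nat.find_min hfin' hj)⟩
  have hm0 : 0 < m := Nat.pos_of_ne_zero (by rintro rfl; simp at hm; exact hm hAr)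
  have hl0 : 0 < l := Nat.pos_of_ne_zero (by rintro rfl; simp at hl; exact hl hAr)
  have hrun : ∀ i, r - l + 1 ≤ i → i ≤ r + m - 1 → A i := by
    intro i hi hi'
    rcases le_total r i with hri | hri
    · have := hm' (i - r).toNat (by omega)
      rwa [Int.toNat_of_nonneg (by omega), add_sub_cancel] at this
    · have := hl' (r - i).toNat (by omega)
      rwa [Int.toNat_of_nonneg (by omega), sub_sub_cancel] at this
  have hkt : ∀ i, cell b t d (k + ε) i + -(ε • t) = cell b t d k i := by
    intro i; rw [cell_sub_smul]; simp
  have hne : ε • t ≠ d ∧ ε • t ≠ -d := by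
    rcases hε with rfl | rfl
    · simpa using hF.2.2
    · obtain ⟨-, -, h3, h4⟩ := hF
      constructor
      · simp only [neg_smul, one_smul]; exact fun hh => h4 (by rw [← hh, neg_neg])
      · simpa using h3
  have hdt : d ≠ t ∧ d ≠ -t ∧ -d ≠ t ∧ -d ≠ -t := by
    obtain ⟨-, -, h3, h4⟩ := hF
    exact ⟨h3.symm, fun hh => h4 (by rw [hh, neg_neg]), h4.symm, fun hh => h3 (neg_injective hh).symm⟩
  refine ⟨r - l + 1, r + m - 1, by omega, hrun, ?_, ?_⟩
  · rintro ⟨f1, f2, f3, f4⟩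
    rw [add_right_comm, hkt] at f4
    rw [cell_sub_d] at f2 f4
    have e1 : r - l + 1 - 1 = r - l := by ring
    rw [e1] at f2 f4
    obtain ⟨a1, a2, a3⟩ := hrun (r - l + 1) le_rfl (by omega)
    have h0 := hA0 _ (hrun (r - l + 1) le_rfl (by omega))
    -- At the lower end a full corner is excluded as follows. On the level of the base, the column
    -- is the outermost one on this side, and the corner is an end of the base, which is not full.
    -- Higher up, the two cells underneath would satisfy `A` too, the one in the histogram by
    -- `down`, its neighbour by `inv`, and the run would extend further down.
    rcases eq_or_lt_of_le h0 with h0 | h0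
    · rw [← h0] at f1 a1 a2 a3
      have hk := (InHist.iff hF).1 a1
      have hk' : ¬ (0 ≤ k + ε ∧ k + ε < n) := fun hh => a3 (h.base_hist hh.1 hh.2)
      have e2 : r - l = -1 := by omega
      rw [e2] at f2 f4
      rw [← h0] at f3
      rw [hkt] at f3
      rcases hε with rfl | rfl
      · obtain rfl : n = k + 1 := by omega
        apply h.corner1
        refine ⟨f1, ?_, ?_, ?_⟩
        · rw [cell_sub_t]; simpa using f3
        · rw [cell_sub_d]; simpa using f2
        · rw [cell_sub_t, cell_sub_d]; simpa using f4
      · obtain rfl : k = 0 := by omega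
        apply h.corner0
        have e3 : b = cell b t d 0 0 := by unfold cell; simp
        rw [e3]
        refine ⟨f3, ?_, ?_, ?_⟩
        · rw [cell_sub_t]; simpa using f1
        · rw [cell_sub_d]; simpa using f4
        · rw [cell_sub_t, cell_sub_d]; simpa using f2
    · apply hl
      have q1 := a1.down hF (j := r - l) (by omega) (by omega)
      have q2 : cell b t d (k + ε) (r - l) ∈ Z := by
        by_contra hcon
        rcases h.inv _ a2 (-d) (neg_mem_dirs hF.2.1) (by rw [cell_sub_d, e1]; exact f2)
          (by rw [cell_sub_d, e1]; exact hcon) with ⟨-, i, -, -, hi⟩ | ⟨hh, -⟩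
        · have := (hF.inj hi).2; omega
        · exact a3 hh
      refine ⟨q1, q2, fun q3 => a3 ?_⟩
      have := q3.up hF (by rwa [show r - (l : ℤ) + 1 = r - l + 1 by ring])
      exact this
  · rintro ⟨f1, f2, f3, f4⟩
    rw [add_right_comm, hkt] at f4
    rw [hkt] at f3
    rw [cell_sub_d] at f2 f4
    have e1 : r + m - 1 + 1 = r + m := by ring
    rw [e1] at f1 f3
    obtain ⟨a1, a2, a3⟩ := hrun (r + m - 1) (by omega) le_rfl
    have q0 := hA0 _ (hrun (r + m - 1) (by omega) le_rfl)
    -- At the upper end, both cells above would be in `Z`, because an edge in direction `d` that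
    -- leaves `Z` inside `S` is neither a base edge nor the side of a column. The run would then
    -- extend further up.
    apply hm
    have q1 : cell b t d k (r + m) ∈ Z := by
      by_contra hcon
      rcases h.inv _ a1.mem d hF.2.1 (by rw [cell_add_d, e1]; exact f3)
        (by rw [cell_add_d, e1]; exact hcon) with ⟨hh, -⟩ | ⟨-, hh⟩
      · exact ne_neg_of_mem_dirs hF.2.1 hh
      · rcases hh with hh | hh
        · exact hdt.1 hh
        · exact hdt.2.1 hh
    have q2 : cell b t d (k + ε) (r + m) ∈ Z := by
      by_contra hcon
      rcases h.inv _ a2 d hF.2.1 (by rw [cell_add_d, e1]; exact f1)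
        (by rw [cell_add_d, e1]; exact hcon) with ⟨hh, -⟩ | ⟨hh, -⟩
      · exact ne_neg_of_mem_dirs hF.2.1 hh
      · exact a3 hh
    refine ⟨?_, q2, fun q3 => a3 (q3.down hF q0 (by omega))⟩
    have := a1.up hF (by rwa [e1])
    rwa [e1] at this

end Rooted

end

section

/-! ### The boundary length -/

/-- The length of the common edge of the cells `c` and `c + e`. -/
structure IsLength (ℓ : Cell → Cell → ℝ) : Prop where
  nonneg : ∀ c e, 0 ≤ ℓ c e
  neg : ∀ c e, ℓ c (-e) = ℓ c e
  shift : ∀ c, ∀ e ∈ dirs, ℓ (c + e) e = ℓ c e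

/-- The total length of the edges leading from `A` to the complement of `Z`. -/
noncomputable def out (ℓ : Cell → Cell → ℝ) (A Z : Finset Cell) : ℝ :=
  ∑ x ∈ A ×ˢ dirs with x.1 + x.2 ∉ Z, ℓ x.1 x.2

/-- The total length of the edges leading from `A` to `Z`. -/
noncomputable def inn (ℓ : Cell → Cell → ℝ) (A Z : Finset Cell) : ℝ :=
  ∑ x ∈ A ×ˢ dirs with x.1 + x.2 ∈ Z, ℓ x.1 x.2

section

variable {ℓ : Cell → Cell → ℝ} {A Z Z1 Z2 : Finset Cell}

/-- An edge from `A` to `Z2` leaves `Z1` but does not leave `Z`. -/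
lemma out_diff (h1 : Z1 ∪ Z2 = Z) (h2 : Disjoint Z1 Z2) : out ℓ A Z1 = out ℓ A Z + inn ℓ A Z2 := by
  unfold out inn
  rw [Finset.sum_filter, Finset.sum_filter, Finset.sum_filter, ← Finset.sum_add_distrib]
  apply Finset.sum_congr rfl
  intro x _
  subst h1
  have : x.1 + x.2 ∈ Z1 → x.1 + x.2 ∉ Z2 := fun k => Finset.disjoint_left.1 h2 k
  by_cases k1 : x.1 + x.2 ∈ Z1 <;> by_cases k2 : x.1 + x.2 ∈ Z2 <;> simp_all

lemma out_union (h2 : Disjoint Z1 Z2) : out ℓ (Z1 ∪ Z2) Z = out ℓ Z1 Z + out ℓ Z2 Z := by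
  unfold out
  rw [Finset.union_product, Finset.filter_union, Finset.sum_union]
  apply Finset.disjoint_filter_filter
  rw [Finset.disjoint_left] at *
  intro x hx hx'
  exact h2 (Finset.mem_product.1 hx).1 (Finset.mem_product.1 hx').1

lemma out_mono (hℓ : IsLength ℓ) {B Y : Finset Cell}
    (h : ∀ c ∈ A, ∀ e ∈ dirs, c + e ∉ Z → c ∈ B ∧ c + e ∉ Y) : out ℓ A Z ≤ out ℓ B Y := by
  apply Finset.sum_le_sum_of_subset_of_nonneg
  · intro x hx
    simp only [Finset.mem_filter, Finset.mem_product] at hx ⊢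
    have := h x.1 hx.1.1 x.2 hx.1.2 hx.2
    exact ⟨⟨this.1, hx.1.2⟩, this.2⟩
  · intro x _ _; exact hℓ.nonneg _ _

lemma le_sum_pairs (hℓ : IsLength ℓ) {T : Finset (Cell × Cell)} {n : ℤ} {f : ℤ → Cell × Cell}
    (hf : Function.Injective f) (h : ∀ i, 0 ≤ i → i < n → f i ∈ T) :
    ∑ i ∈ Finset.Ico 0 n, ℓ (f i).1 (f i).2 ≤ ∑ x ∈ T, ℓ x.1 x.2 := by
  rw [← Finset.sum_image (s := Finset.Ico 0 n) (g := f) (f := fun x => ℓ x.1 x.2)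
    fun i _ j _ hij => hf hij]
  apply Finset.sum_le_sum_of_subset_of_nonneg
  · intro x hx
    obtain ⟨i, hi, rfl⟩ := Finset.mem_image.1 hx
    exact h i (Finset.mem_Ico.1 hi).1 (Finset.mem_Ico.1 hi).2
  · intro x _ _; exact hℓ.nonneg _ _

lemma sum_pairs_le (hℓ : IsLength ℓ) {T : Finset (Cell × Cell)} {n : ℤ} {f : ℤ → Cell × Cell}
    (hf : Function.Injective f) (h : ∀ x ∈ T, ∃ i, 0 ≤ i ∧ i < n ∧ x = f i) :
    ∑ x ∈ T, ℓ x.1 x.2 ≤ ∑ i ∈ Finset.Ico 0 n, ℓ (f i).1 (f i).2 := by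
  rw [← Finset.sum_image (s := Finset.Ico 0 n) (g := f) (f := fun x => ℓ x.1 x.2)
    fun i _ j _ hij => hf hij]
  apply Finset.sum_le_sum_of_subset_of_nonneg
  · intro x hx
    obtain ⟨i, h0, h1, rfl⟩ := h x hx
    exact Finset.mem_image_of_mem _ (Finset.mem_Ico.2 ⟨h0, h1⟩)
  · intro x _ _; exact hℓ.nonneg _ _

end

open Classical in
/-- The histogram above the base. -/
noncomputable def hist (Z : Finset Cell) (b t d : Cell) (n : ℤ) : Finset Cell :=
  Z.filter (InHist Z b t d n)

namespace Rooted

variable {S Z : Finset Cell} {b t d : Cell} {n : ℤ}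

lemma mem_hist {c : Cell} : c ∈ hist Z b t d n ↔ InHist Z b t d n c := by
  classical
  unfold hist
  rw [Finset.mem_filter]
  exact ⟨fun h => h.2, fun h => ⟨h.mem, h⟩⟩

/-- The heights of the columns. -/
lemma exists_depth (h : Rooted S Z b t d n) : ∃ dep : ℤ → ℤ, ∀ k, 0 ≤ k → k < n → 0 < dep k ∧
    (∀ j, 0 ≤ j → j < dep k → cell b t d k j ∈ Z) ∧ cell b t d k (dep k) ∉ Z := by
  have : ∀ k : ℤ, ∃ r : ℤ, 0 ≤ k → k < n → 0 < r ∧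
      (∀ j, 0 ≤ j → j < r → cell b t d k j ∈ Z) ∧ cell b t d k r ∉ Z := by
    intro k
    by_cases hk : 0 ≤ k ∧ k < n
    · have hfin : ∃ m : ℕ, cell b t d k m ∉ Z := by
        by_contra hcon
        push Not at hcon
        refine Set.infinite_of_injective_forall_mem (f := fun m : ℕ => cell b t d k m) ?_
          hcon Z.finite_toSet
        intro i j hij
        have := (h.frame.inj hij).2
        omega
      classical
      refine ⟨Nat.find hfin, fun h0 h1 => ⟨?_, ?_, Nat.find_spec hfin⟩⟩
      · rcases Nat.eq_zero_or_pos (Nat.find hfin) with hz | hz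
        · have := Nat.find_spec hfin
          rw [hz] at this
          exact absurd (h.base k h0 h1) this
        · exact_mod_cast hz
      · intro j hj hj'
        have := Nat.find_min hfin (m := j.toNat) (by omega)
        rw [Int.toNat_of_nonneg hj] at this
        exact not_not.1 this
    · exact ⟨0, fun h0 h1 => absurd ⟨h0, h1⟩ hk⟩
  choose dep hdep using this
  exact ⟨dep, hdep⟩

/-- A part of `S` is split at the side of its histogram. -/
lemma exists_split (h : Rooted S Z b t d n) (hS : Separated S) {c e : Cell}
    (hc : InHist Z b t d n c) (he : e ∈ dirs) (h1 : c + e ∈ Z) (h2 : ¬ InHist Z b t d n (c + e)) :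
    ∃ (Z1 Z2 : Finset Cell) (b' t' d' : Cell) (n' : ℤ), Z1 ∪ Z2 = Z ∧ Disjoint Z1 Z2 ∧
      Rooted S Z1 b t d n ∧ Rooted S Z2 b' t' d' n' ∧ hist Z1 b t d n = hist Z b t d n ∧
      (∀ x ∈ Z1, ∀ f ∈ dirs, x + f ∈ Z2 → BaseEdge b' t' d' n' (x + f) (-f)) ∧
      ∀ i, 0 ≤ i → i < n' → cell b' t' d' i (-1) ∈ hist Z b t d n := by
  have hF := h.frame
  obtain ⟨ε, hε, rfl⟩ : ∃ ε : ℤ, (ε = 1 ∨ ε = -1) ∧ e = ε • t := by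
    rcases h.side hc he h1 h2 with rfl | rfl
    · exact ⟨1, Or.inl rfl, by simp⟩
    · exact ⟨-1, Or.inr rfl, by simp⟩
  obtain ⟨k, r, k0, k1, r0, rfl, -⟩ := id hc
  rw [cell_add_smul] at h1 h2
  obtain ⟨r1, r2, hr, hrun, hf1, hf2⟩ := h.exists_run hε hc h1 h2
  set b' := cell b t d (k + ε) r1 with hb'
  have hF' := hF.turn hε
  have hn' : 0 < r2 - r1 + 1 := by omega
  have hnear : ∀ i, cell b' d (ε • t) i 0 = cell b t d (k + ε) (r1 + i) := by
    intro i; rw [hb', cell_turn]; simp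
  have hfar : ∀ i, cell b' d (ε • t) i (-1) = cell b t d k (r1 + i) := by
    intro i; rw [hb', cell_turn]; simp
  -- The maximal run ends at boundary corners, so it is a separating chord. It becomes a base in
  -- direction `d`, and the new columns grow in direction `ε • t`, away from the old histogram.
  obtain ⟨p, hp⟩ := hS b' d (ε • t) (r2 - r1 + 1) hF' hn' (by
    intro i hi hi'
    rw [hnear, hfar]
    obtain ⟨a1, a2, -⟩ := hrun (r1 + i) (by omega) (by omega)
    exact ⟨h.sub a2, h.sub a1.mem⟩) hf1 (by
    rw [hnear, show r1 + (r2 - r1 + 1) = r2 + 1 by ring]; exact hf2)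
  have hεt : ∀ {x : Cell}, BaseEdge b' d (ε • t) (r2 - r1 + 1) x (-(ε • t)) ↔
      ∃ i, 0 ≤ i ∧ i < r2 - r1 + 1 ∧ x = cell b t d (k + ε) (r1 + i) := by
    intro x
    constructor
    · rintro ⟨-, i, i0, i1, rfl⟩; exact ⟨i, i0, i1, hnear i⟩
    · rintro ⟨i, i0, i1, rfl⟩; exact ⟨rfl, i, i0, i1, (hnear i).symm⟩
  have hbase : ∀ {x f : Cell}, BaseEdge b' d (ε • t) (r2 - r1 + 1) x f →
      x ∈ Z ∧ ¬ InHist Z b t d n x ∧ InHist Z b t d n (x + f) := by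
    rintro x f ⟨rfl, i, i0, i1, rfl⟩
    rw [hnear, cell_sub_smul]
    obtain ⟨a1, a2, a3⟩ := hrun (r1 + i) (by omega) (by omega)
    exact ⟨a2, a3, by simpa using a1⟩
  have hd : d ≠ ε • t ∧ d ≠ -(ε • t) := ⟨hF'.2.2.1, hF'.2.2.2⟩
  have hsame : ∀ {x f : Cell}, x ∈ Z → f ∈ dirs → x + f ∈ Z →
      ¬ BaseEdge b' d (ε • t) (r2 - r1 + 1) x f →
      ¬ BaseEdge b' d (ε • t) (r2 - r1 + 1) (x + f) (-f) → p x = p (x + f) := by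
    intro x f hx hf hxf k1 k2
    by_contra hcon
    exact ((hp x (h.sub hx) f hf (h.sub hxf)).1 hcon).elim k1 k2
  have hwin : ∀ i, r1 ≤ i → i ≤ r2 → p (cell b t d (k + ε) i) = p b' := by
    intro i hi
    induction i, hi using Int.leInduction with
    | base => intro _; rfl
    | succ i hi ih =>
      intro hi'
      rw [← ih (by omega), ← cell_add_d]
      symm
      refine hsame (hrun i hi (by omega)).2.1 hF.2.1 (by
        rw [cell_add_d]; exact (hrun (i + 1) (by omega) hi').2.1) ?_ ?_
      · rintro ⟨hh, -⟩; exact hd.2 hh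
      · rintro ⟨hh, -⟩; exact hd.1 (neg_injective hh)
  have hk0 : ∀ j, 0 ≤ j → j < n → p (cell b t d j 0) = p (cell b t d 0 0) := by
    intro j hj
    induction j, hj using Int.leInduction with
    | base => intro _; rfl
    | succ j hj ih =>
      intro hj'
      rw [← ih (by omega), ← cell_add_t]
      symm
      have q1 := h.base_hist hj (by omega)
      have q2 := h.base_hist (k := j + 1) (by omega) hj'
      refine hsame q1.mem hF.1 (by rw [cell_add_t]; exact q2.mem) ?_ ?_
      · intro hh; exact (hbase hh).2.1 q1
      · intro hh
        have := (hbase hh).2.1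
        rw [cell_add_t] at this
        exact this q2
  have hcol : ∀ {x : Cell}, InHist Z b t d n x → p x = p (cell b t d 0 0) := by
    rintro x ⟨j, i, j0, j1, i0, rfl, hi⟩
    rw [← hk0 j j0 j1]
    induction i, i0 using Int.leInduction with
    | base => rfl
    | succ i i0 ih =>
      rw [← ih fun l hl hl' => hi l hl (by omega), ← cell_add_d]
      symm
      refine hsame (hi i i0 (by omega)) hF.2.1 (by
        rw [cell_add_d]; exact hi (i + 1) (by omega) le_rfl) ?_ ?_
      · rintro ⟨hh, -⟩; exact hd.2 hh
      · rintro ⟨hh, -⟩; exact hd.1 (neg_injective hh)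
  -- Each cell of the histogram is connected with the base inside the histogram, where no edge of
  -- the window is crossed. The histogram thus has one colour, and the window cells have the other.
  have hH : ∀ {x : Cell}, InHist Z b t d n x → p x ≠ p b' := by
    intro x hx
    obtain ⟨a1, a2, a3⟩ := hrun r1 le_rfl hr
    rw [hcol hx, ← hcol a1]
    have e1 : cell b t d k r1 + ε • t = b' := by rw [cell_add_smul]
    rw [← e1]
    refine (hp _ (h.sub a1.mem) _ hF'.2.1 (h.sub (by rw [e1]; exact a2))).2 (Or.inr ?_)
    rw [hεt, e1]
    exact ⟨0, le_rfl, hn', by simp [hb']⟩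
  have hmem1 : ∀ {x}, x ∈ Z.filter (fun x => p x ≠ p b') ↔ x ∈ Z ∧ p x ≠ p b' :=
    Finset.mem_filter
  have hmem2 : ∀ {x}, x ∈ Z.filter (fun x => p x = p b') ↔ x ∈ Z ∧ p x = p b' :=
    Finset.mem_filter
  have hcross : ∀ x ∈ Z.filter (fun x => p x ≠ p b'), ∀ f ∈ dirs,
      x + f ∈ Z.filter (fun x => p x = p b') →
      BaseEdge b' d (ε • t) (r2 - r1 + 1) (x + f) (-f) := by
    intro x hx f hf hxf
    rw [hmem1] at hx
    rw [hmem2] at hxf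
    have hne : p x ≠ p (x + f) := by rw [hxf.2]; exact hx.2
    rcases (hp x (h.sub hx.1) f hf (h.sub hxf.1)).1 hne with hh | hh
    · exfalso
      exact hH (hbase hh).2.2 hxf.2
    · exact hh
  have hhist : ∀ x, InHist (Z.filter fun x => p x ≠ p b') b t d n x ↔ InHist Z b t d n x := by
    intro x
    constructor
    · rintro ⟨j, i, q1, q2, q3, q4, q5⟩
      exact ⟨j, i, q1, q2, q3, q4, fun l hl hl' => (hmem1.1 (q5 l hl hl')).1⟩
    · intro hx
      obtain ⟨j, i, q1, q2, q3, rfl, q5⟩ := id hx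
      exact ⟨j, i, q1, q2, q3, rfl, fun l hl hl' => hmem1.2 ⟨q5 l hl hl', hH (hx.down hF hl hl')⟩⟩
  refine ⟨Z.filter fun x => p x ≠ p b', Z.filter fun x => p x = p b', b', d, ε • t, r2 - r1 + 1,
    ?_, ?_, ⟨?_, hF, h.pos, ?_, ?_, ?_, h.corner0, h.corner1⟩,
    ⟨?_, hF', hn', ?_, ?_, ?_, hf1, ?_⟩, ?_, hcross, ?_⟩
  · ext x; simp only [Finset.mem_union, hmem1, hmem2]; tauto
  · rw [Finset.disjoint_left]; intro x hx hx'; exact (hmem1.1 hx).2 (hmem2.1 hx').2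
  · exact (Finset.filter_subset _ _).trans h.sub
  · intro j j0 j1
    have := h.base_hist j0 j1
    exact hmem1.2 ⟨this.mem, hH this⟩
  · intro j j0 j1 hj; exact h.below j j0 j1 (hmem1.1 hj).1
  -- The edges of `Z1` lost to `Z2` are sides of columns of the histogram of `Z1`; for their sake
  -- `inv` admits such edges.
  · intro x hx f hf hxS hxf
    by_cases hxZ : x + f ∈ Z
    · right
      have h2' : x + f ∈ Z.filter fun x => p x = p b' :=
        hmem2.2 ⟨hxZ, by by_contra hcon; exact hxf (hmem1.2 ⟨hxZ, hcon⟩)⟩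
      have := hcross x hx f hf h2'
      have q := (hbase this).2.2
      rw [add_neg_cancel_right] at q
      refine ⟨(hhist x).2 q, ?_⟩
      exact h.side q hf hxZ fun hcon => hH hcon (hmem2.1 h2').2
    · exact (h.inv x (hmem1.1 hx).1 f hf hxS hxZ).imp_right fun hh => ⟨(hhist x).2 hh.1, hh.2⟩
  · exact (Finset.filter_subset _ _).trans h.sub
  · intro i i0 i1
    rw [hnear]
    exact hmem2.2 ⟨(hrun _ (by omega) (by omega)).2.1, hwin _ (by omega) (by omega)⟩
  · intro i i0 i1
    rw [hfar]
    intro hcon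
    exact hH (hrun _ (by omega) (by omega)).1 (hmem2.1 hcon).2
  · intro x hx f hf hxS hxf
    left
    have hx' := hmem2.1 hx
    by_cases hxZ : x + f ∈ Z
    · have h1' : x + f ∈ Z.filter fun x => p x ≠ p b' :=
        hmem1.2 ⟨hxZ, fun hcon => hxf (hmem2.2 ⟨hxZ, hcon⟩)⟩
      have := hcross _ h1' (-f) (neg_mem_dirs hf) (by rwa [add_neg_cancel_right])
      rwa [add_neg_cancel_right, neg_neg] at this
    · exfalso
      rcases h.inv x hx'.1 f hf hxS hxZ with ⟨-, j, j0, j1, rfl⟩ | ⟨hh, -⟩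
      · exact hH (h.base_hist j0 j1) hx'.2
      · exact hH hh hx'.2
  · rw [hnear, show r1 + (r2 - r1 + 1) = r2 + 1 by ring]; exact hf2
  · ext x; rw [mem_hist, mem_hist, hhist]
  · intro i i0 i1
    rw [hfar, mem_hist]
    exact (hrun _ (by omega) (by omega)).1

end Rooted

end

/-! ### Partition of a set of cells into histograms -/

/-- A histogram: columns above a base. -/
def IsHist (h : Finset Cell) : Prop :=
  ∃ (b t d : Cell) (n : ℤ) (dep : ℤ → ℤ), IsFrame t d ∧ 0 < n ∧
    (∀ k, 0 ≤ k → k < n → 0 < dep k) ∧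
    ∀ c, c ∈ h ↔ ∃ k r : ℤ, 0 ≤ k ∧ k < n ∧ 0 ≤ r ∧ r < dep k ∧ c = cell b t d k r

/-- `Z` has a partition into histograms of total perimeter at most `B`. -/
def HistDecomp (ℓ : Cell → Cell → ℝ) (Z : Finset Cell) (B : ℝ) : Prop :=
  ∃ L : List (Finset Cell), (∀ h ∈ L, IsHist h) ∧
    (∀ c, (L.map fun h => if c ∈ h then (1 : ℤ) else 0).sum = if c ∈ Z then 1 else 0) ∧
    (L.map fun h => out ℓ h h).sum ≤ B

lemma HistDecomp.union {ℓ : Cell → Cell → ℝ} {Z1 Z2 : Finset Cell} {B1 B2 B : ℝ}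
    (h1 : HistDecomp ℓ Z1 B1) (h2 : HistDecomp ℓ Z2 B2) (h : Disjoint Z1 Z2) (hB : B1 + B2 ≤ B) :
    HistDecomp ℓ (Z1 ∪ Z2) B := by
  obtain ⟨L1, a1, a2, a3⟩ := h1
  obtain ⟨L2, b1, b2, b3⟩ := h2
  refine ⟨L1 ++ L2, ?_, ?_, ?_⟩
  · intro x hx
    exact (List.mem_append.1 hx).elim (a1 x) (b1 x)
  · intro c
    rw [List.map_append, List.sum_append, a2, b2]
    have : c ∈ Z1 → c ∉ Z2 := fun k => Finset.disjoint_left.1 h k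
    by_cases k1 : c ∈ Z1 <;> by_cases k2 : c ∈ Z2 <;> simp_all
  · rw [List.map_append, List.sum_append]; linarith

/-- `Z` is a union of components of `S`. -/
def IsClosedIn (S Z : Finset Cell) : Prop :=
  Z ⊆ S ∧ ∀ c ∈ Z, ∀ e ∈ dirs, c + e ∈ S → c + e ∈ Z

namespace Rooted

variable {S Z Z1 Z2 : Finset Cell} {b t d b' t' d' : Cell} {n n' : ℤ} {ℓ : Cell → Cell → ℝ}

lemma isHist (h : Rooted S Z b t d n) : IsHist (hist Z b t d n) := by
  obtain ⟨dep, hdep⟩ := h.exists_depth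
  refine ⟨b, t, d, n, dep, h.frame, h.pos, fun k h0 h1 => (hdep k h0 h1).1, fun c => ?_⟩
  rw [mem_hist]
  constructor
  · rintro ⟨k, r, k0, k1, r0, rfl, hr⟩
    refine ⟨k, r, k0, k1, r0, ?_, rfl⟩
    by_contra hcon
    push Not at hcon
    exact (hdep k k0 k1).2.2 (hr _ (hdep k k0 k1).1.le hcon)
  · rintro ⟨k, r, k0, k1, r0, hr, rfl⟩
    exact ⟨k, r, k0, k1, r0, rfl, fun j hj hj' => (hdep k k0 k1).2.1 j hj (by omega)⟩

/-- The base and the tops of the columns. -/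
lemma two_mul_base_le (h : Rooted S Z b t d n) (hℓ : IsLength ℓ) :
    2 * ∑ i ∈ Finset.Ico 0 n, ℓ (cell b t d i 0) d ≤ out ℓ (hist Z b t d n) Z := by
  obtain ⟨dep, hdep⟩ := h.exists_depth
  set T := (hist Z b t d n ×ˢ dirs).filter fun x => x.1 + x.2 ∉ Z with hT
  have hbase : ∑ i ∈ Finset.Ico 0 n, ℓ (cell b t d i 0) d ≤
      ∑ x ∈ T with x.2 = -d, ℓ x.1 x.2 := by
    have := le_sum_pairs (ℓ := ℓ) hℓ (T := T.filter fun x => x.2 = -d) (n := n)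
      (f := fun i => (cell b t d i 0, -d)) (fun i j hij =>
        (h.frame.inj (Prod.mk.injEq _ _ _ _ ▸ hij).1).1) (by
        intro i i0 i1
        simp only [hT, Finset.mem_filter, Finset.mem_product, and_true]
        refine ⟨⟨mem_hist.2 (h.base_hist i0 i1), neg_mem_dirs h.frame.2.1⟩, ?_⟩
        rw [cell_sub_d]
        exact h.below i i0 i1)
    simpa only [hℓ.neg] using this
  have htop : ∑ i ∈ Finset.Ico 0 n, ℓ (cell b t d i 0) d ≤
      ∑ x ∈ T with ¬ x.2 = -d, ℓ x.1 x.2 := by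
    have := le_sum_pairs (ℓ := ℓ) hℓ (T := T.filter fun x => ¬ x.2 = -d) (n := n)
      (f := fun i => (cell b t d i (dep i - 1), d)) (fun i j hij =>
        (h.frame.inj (Prod.mk.injEq _ _ _ _ ▸ hij).1).1) (by
        intro i i0 i1
        obtain ⟨q1, q2, q3⟩ := hdep i i0 i1
        simp only [hT, Finset.mem_filter, Finset.mem_product]
        refine ⟨⟨⟨mem_hist.2 ((InHist.iff h.frame).2 ⟨i0, i1, by omega, fun j hj hj' =>
          q2 j hj (by omega)⟩), h.frame.2.1⟩, ?_⟩, ne_neg_of_mem_dirs h.frame.2.1⟩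
        rw [cell_add_d, sub_add_cancel]
        exact q3)
    refine le_trans (le_of_eq ?_) this
    apply Finset.sum_congr rfl
    intro i _
    have key : ∀ r : ℤ, 0 ≤ r → ℓ (cell b t d i r) d = ℓ (cell b t d i 0) d := by
      intro r hr
      induction r, hr using Int.leInduction with
      | base => rfl
      | succ r hr ih => rw [← cell_add_d, hℓ.shift _ _ h.frame.2.1, ih]
    rename_i hi
    obtain ⟨q1, -⟩ := hdep i (Finset.mem_Ico.1 hi).1 (Finset.mem_Ico.1 hi).2
    exact (key _ (by omega)).symm
  have e : out ℓ (hist Z b t d n) Z = ∑ x ∈ T, ℓ x.1 x.2 := rfl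
  rw [e, ← Finset.sum_filter_add_sum_filter_not T (fun x => x.2 = -d)]
  linarith

/-- Let `W` be the length of the window. The cut adds at most `W` to the boundary of each of the two
parts, hence at most `6 * W` to the terms with factor 3. In return, the boundary of the old
histogram grows by at least `W`, and that of the new histogram is at least `2 * W`, from its base
and the tops of its columns. Taken twice, these make `6 * W`. -/
lemma out_split (hℓ : IsLength ℓ) (hu : Z1 ∪ Z2 = Z) (hd : Disjoint Z1 Z2)
    (h2 : Rooted S Z2 b' t' d' n') (hh : hist Z1 b t d n = hist Z b t d n)
    (hc : ∀ x ∈ Z1, ∀ f ∈ dirs, x + f ∈ Z2 → BaseEdge b' t' d' n' (x + f) (-f))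
    (hb : ∀ i, 0 ≤ i → i < n' → cell b' t' d' i (-1) ∈ hist Z b t d n) :
    3 * out ℓ Z1 Z1 - 2 * out ℓ (hist Z1 b t d n) Z1 +
      (3 * out ℓ Z2 Z2 - 2 * out ℓ (hist Z2 b' t' d' n') Z2) ≤
      3 * out ℓ Z Z - 2 * out ℓ (hist Z b t d n) Z := by
  have hw := h2.two_mul_base_le hℓ
  set W := ∑ i ∈ Finset.Ico 0 n', ℓ (cell b' t' d' i 0) d'
  have hF := h2.frame
  have hup : ∀ i, cell b' t' d' i (-1) + d' = cell b' t' d' i 0 := by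
    intro i; rw [cell_add_d]; simp
  have hW : W = ∑ i ∈ Finset.Ico 0 n', ℓ (cell b' t' d' i (-1)) d' := by
    apply Finset.sum_congr rfl
    intro i _
    rw [← hup, hℓ.shift _ _ hF.2.1]
  have i12 : inn ℓ Z1 Z2 ≤ W := by
    rw [hW]
    refine sum_pairs_le hℓ (f := fun i => (cell b' t' d' i (-1), d')) (fun i j hij =>
        (hF.inj (Prod.mk.injEq _ _ _ _ ▸ hij).1).1) ?_
    rintro ⟨x, f⟩ hx
    simp only [Finset.mem_filter, Finset.mem_product] at hx
    obtain ⟨hf, i, i0, i1, hi⟩ := hc x hx.1.1 f hx.1.2 hx.2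
    obtain rfl := neg_injective hf
    refine ⟨i, i0, i1, ?_⟩
    rw [← hup] at hi
    rw [add_right_cancel hi]
  have i21 : inn ℓ Z2 Z1 ≤ W := by
    have := sum_pairs_le hℓ (T := (Z2 ×ˢ dirs).filter fun x => x.1 + x.2 ∈ Z1) (n := n')
      (f := fun i => (cell b' t' d' i 0, -d')) (fun i j hij =>
        (hF.inj (Prod.mk.injEq _ _ _ _ ▸ hij).1).1) (by
      rintro ⟨x, f⟩ hx
      simp only [Finset.mem_filter, Finset.mem_product] at hx
      obtain ⟨hf, i, i0, i1, hi⟩ := hc _ hx.2 (-f) (neg_mem_dirs hx.1.2) (by simpa using hx.1.1)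
      rw [add_neg_cancel_right] at hi
      rw [neg_neg] at hf
      exact ⟨i, i0, i1, by rw [hi, hf]⟩)
    simp only [hℓ.neg] at this
    exact this
  have iH : W ≤ inn ℓ (hist Z b t d n) Z2 := by
    rw [hW]
    refine le_sum_pairs hℓ (f := fun i => (cell b' t' d' i (-1), d')) (fun i j hij =>
        (hF.inj (Prod.mk.injEq _ _ _ _ ▸ hij).1).1) ?_
    intro i i0 i1
    simp only [Finset.mem_filter, Finset.mem_product]
    exact ⟨⟨hb i i0 i1, hF.2.1⟩, by rw [hup]; exact h2.base i i0 i1⟩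
  have e1 := out_diff (ℓ := ℓ) (A := Z1) hu hd
  have e2 := out_diff (ℓ := ℓ) (A := Z2) (Z1 := Z2) (Z2 := Z1) (by rw [Finset.union_comm, hu]) hd.symm
  have e3 := out_diff (ℓ := ℓ) (A := hist Z b t d n) hu hd
  have e4 := out_union (ℓ := ℓ) (Z := Z) hd
  rw [hu] at e4
  rw [hh, e1, e2, e3, e4]
  linarith

end Rooted

/-- Induction on the number of cells. If the histogram of a rooted piece has a neighbour in the
piece outside itself, `exists_split` yields two smaller rooted pieces. Otherwise the histogram is a
union of components of the piece and is split off; the rest is closed in `S`, since all edges of `S`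
leaving a rooted piece start in its histogram. A nonempty closed set is rooted at the lower side of
a lowest cell, and there one may discard the negative term of the potential. -/
lemma histDecomp_aux {S : Finset Cell} (hS : Separated S) {ℓ : Cell → Cell → ℝ} (hℓ : IsLength ℓ)
    (N : ℕ) : ∀ Z : Finset Cell, Z.card ≤ N →
      (IsClosedIn S Z → HistDecomp ℓ Z (3 * out ℓ Z Z)) ∧
      ∀ b t d n, Rooted S Z b t d n →
        HistDecomp ℓ Z (3 * out ℓ Z Z - 2 * out ℓ (hist Z b t d n) Z) := by
  induction N with
  | zero =>
    intro Z hZ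
    obtain rfl := Finset.card_eq_zero.1 (Nat.le_zero.1 hZ)
    refine ⟨fun _ => ⟨[], by simp, by simp, by simp [out]⟩, fun b t d n h => ?_⟩
    exact absurd (h.base 0 le_rfl h.pos) (Finset.notMem_empty _)
  | succ N ih =>
    intro Z hZ
    have key : ∀ b t d n, Rooted S Z b t d n →
        HistDecomp ℓ Z (3 * out ℓ Z Z - 2 * out ℓ (hist Z b t d n) Z) := by
      intro b t d n h
      by_cases hside : ∃ c e, InHist Z b t d n c ∧ e ∈ dirs ∧ c + e ∈ Z ∧ ¬ InHist Z b t d n (c + e)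
      · obtain ⟨c, e, hc, he, h1, h2⟩ := hside
        obtain ⟨Z1, Z2, b', t', d', n', hu, hd, r1, r2, hh, hcr, hb⟩ := h.exists_split hS hc he h1 h2
        have hcard : Z1.card + Z2.card = Z.card := by rw [← hu, Finset.card_union_of_disjoint hd]
        have c1 : 0 < Z1.card := Finset.card_pos.2 ⟨_, r1.base 0 le_rfl r1.pos⟩
        have c2 : 0 < Z2.card := Finset.card_pos.2 ⟨_, r2.base 0 le_rfl r2.pos⟩
        rw [← hu]
        rw [← hu] at hh
        refine HistDecomp.union ((ih Z1 (by omega)).2 _ _ _ _ r1)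
          ((ih Z2 (by omega)).2 _ _ _ _ r2) hd ?_
        exact Rooted.out_split hℓ rfl hd r2 hh hcr (by rw [hu]; exact hb)
      · push Not at hside
        set H := hist Z b t d n with hH
        have hHZ : H ⊆ Z := fun x hx => (Rooted.mem_hist.1 hx).mem
        have hclosed : ∀ c ∈ H, ∀ e ∈ dirs, c + e ∈ Z → c + e ∈ H := fun c hc e he h1 =>
          Rooted.mem_hist.2 (hside c e (Rooted.mem_hist.1 hc) he h1)
        have hHc : 0 < H.card :=
          Finset.card_pos.2 ⟨_, Rooted.mem_hist.2 (h.base_hist le_rfl h.pos)⟩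
        have hcard := Finset.card_sdiff_add_card_eq_card hHZ
        have hrest : IsClosedIn S (Z \ H) := by
          refine ⟨Finset.sdiff_subset.trans h.sub, fun c hc e he hcS => ?_⟩
          rw [Finset.mem_sdiff] at hc ⊢
          by_cases hcZ : c + e ∈ Z
          · refine ⟨hcZ, fun hcH => hc.2 ?_⟩
            have := hclosed _ hcH (-e) (neg_mem_dirs he) (by rw [add_neg_cancel_right]; exact hc.1)
            rwa [add_neg_cancel_right] at this
          · exfalso
            rcases h.inv c hc.1 e he hcS hcZ with ⟨-, i, i0, i1, rfl⟩ | ⟨hh, -⟩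
            · exact hc.2 (Rooted.mem_hist.2 (h.base_hist i0 i1))
            · exact hc.2 (Rooted.mem_hist.2 hh)
        have hdis : Disjoint H (Z \ H) := Finset.disjoint_sdiff
        have d1 : HistDecomp ℓ H (out ℓ H H) :=
          ⟨[H], by simpa using h.isHist, by simp, by simp⟩
        have hun : H ∪ (Z \ H) = Z := Finset.union_sdiff_of_subset hHZ
        have d2 := d1.union (B := 3 * out ℓ Z Z - 2 * out ℓ H Z)
          ((ih (Z \ H) (by omega)).1 hrest) hdis (by
            have o1 : out ℓ H H ≤ out ℓ H Z := out_mono hℓ fun c hc e he hce =>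
              ⟨hc, fun hcz => hce (hclosed c hc e he hcz)⟩
            have o2 : out ℓ (Z \ H) (Z \ H) ≤ out ℓ (Z \ H) Z := out_mono hℓ fun c hc e he hce =>
              ⟨hc, fun hcz => hce (hrest.2 c hc e he (h.sub hcz))⟩
            have o3 := out_union (ℓ := ℓ) (Z := Z) hdis
            rw [hun] at o3
            linarith)
        rwa [hun] at d2
    refine ⟨fun hcl => ?_, key⟩
    by_cases hZ0 : Z = ∅
    · subst hZ0
      exact ⟨[], by simp, by simp, by simp [out]⟩
    · obtain ⟨c, hc, hmin⟩ := Finset.exists_min_image Z (fun c => c.2)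
        (Finset.nonempty_iff_ne_empty.2 hZ0)
      have hd : (0, 1) ∈ dirs := by simp [dirs]
      have hb : c + -(0, 1) ∉ Z := by
        intro hcon
        have := hmin _ hcon
        simp at this
      have hbS : c + -(0, 1) ∉ S := fun hcon => hb (hcl.2 c hc _ (neg_mem_dirs hd) hcon)
      have hr : Rooted S Z c (1, 0) (0, 1) 1 := by
        refine ⟨hcl.1, ⟨by simp [dirs], hd, by decide, by decide⟩, one_pos, ?_, ?_, ?_, ?_, ?_⟩
        · intro k k0 k1
          obtain rfl : k = 0 := by omega
          simpa [cell] using hc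
        · intro k k0 k1
          obtain rfl : k = 0 := by omega
          simpa [cell] using hb
        · intro x hx e he h1 h2
          exact absurd (hcl.2 x hx e he h1) h2
        · intro hF
          exact hbS hF.2.2.1
        · intro hF
          apply hbS
          have := hF.2.2.2
          rw [cell_sub_t] at this
          simpa [cell] using this
      obtain ⟨L, l1, l2, l3⟩ := key _ _ _ _ hr
      refine ⟨L, l1, l2, l3.trans ?_⟩
      have : 0 ≤ out ℓ (hist Z c (1, 0) (0, 1) 1) Z :=
        Finset.sum_nonneg fun x _ => hℓ.nonneg _ _
      linarith

/-- A set of cells which is separated by its chords has a short partition into histograms. -/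
theorem exists_histDecomp {S : Finset Cell} (hS : Separated S) {ℓ : Cell → Cell → ℝ}
    (hℓ : IsLength ℓ) : HistDecomp ℓ S (3 * out ℓ S S) :=
  (histDecomp_aux hS hℓ _ S le_rfl).1 ⟨subset_rfl, fun _ _ _ _ h => h⟩

section

/-! ### Histograms in the plane -/

/-- The lengths of the edges of a grid. -/
def gridLength (X Y : ℤ → ℝ) (c e : Cell) : ℝ :=
  if e.1 = 0 then X (c.1 + 1) - X c.1 else Y (c.2 + 1) - Y c.2

lemma isLength_grid {X Y : ℤ → ℝ} (hX : StrictMono X) (hY : StrictMono Y) :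
    IsLength (gridLength X Y) where
  nonneg c e := by
    unfold gridLength
    split_ifs
    · exact sub_nonneg.2 (hX (lt_add_one _)).le
    · exact sub_nonneg.2 (hY (lt_add_one _)).le
  neg c e := by unfold gridLength; simp
  shift c e he := by
    simp only [dirs, Finset.mem_insert, Finset.mem_singleton] at he
    rcases he with rfl | rfl | rfl | rfl <;> simp [gridLength]

/-- The indicator function of a cell of a grid. -/
noncomputable def cellCount (X Y : ℤ → ℝ) (c : Cell) (p : Plane) : ℤ :=
  if (X c.1 ≤ p 0 ∧ p 0 < X (c.1 + 1)) ∧ Y c.2 ≤ p 1 ∧ p 1 < Y (c.2 + 1) then 1 else 0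

/-- The rows of a histogram. -/
noncomputable def histRows (ξ η : ℤ → ℝ) (δ : ℤ → ℤ) (N : ℕ) : List (ℝ × ℝ) :=
  (List.range N).map fun k : ℕ => (η (k + 1) - η k, ξ (δ k))

section

variable {ξ η : ℤ → ℝ} {δ : ℤ → ℤ}

lemma histRows_succ (N : ℕ) :
    histRows ξ η δ (N + 1) = histRows ξ η δ N ++ [(η (N + 1) - η N, ξ (δ N))] := by
  unfold histRows; rw [List.range_succ, List.map_append]; rfl

lemma ht_histRows (N : ℕ) : ht (histRows ξ η δ N) = η N - η 0 := by
  induction N with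
  | zero => simp [histRows]
  | succ N ih => rw [histRows_succ, ht_append, ih]; simp

lemma tv_histRows (h0 : δ (-1) = 0) (N : ℕ) :
    tv (ξ 0) (histRows ξ η δ N) = ∑ j ∈ Finset.range N, |ξ (δ j) - ξ (δ (j - 1))| ∧
      lastX (ξ 0) (histRows ξ η δ N) = ξ (δ (N - 1)) := by
  induction N with
  | zero => simp [histRows, h0]
  | succ N ih =>
    rw [histRows_succ, tv_append, lastX_append, ih.1, ih.2, Finset.sum_range_succ]
    simp

lemma pvar_histRows (h0 : δ (-1) = 0) {N : ℕ} (hN : δ N = 0) :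
    pvar (ξ 0) (histRows ξ η δ N) (ξ 0) =
      ∑ j ∈ Finset.range (N + 1), |ξ (δ j) - ξ (δ (j - 1))| := by
  unfold pvar
  rw [(tv_histRows h0 N).1, (tv_histRows h0 N).2, Finset.sum_range_succ, hN]

lemma sum_steps (ξ : ℤ → ℝ) {i j : ℤ} (h : i ≤ j) :
    ∑ r ∈ Finset.Ico i j, (ξ (r + 1) - ξ r) = ξ j - ξ i := by
  induction j, h using Int.leInduction with
  | base => simp
  | succ j h ih =>
    have e : Finset.Ico i (j + 1) = insert j (Finset.Ico i j) := by
      ext x; simp only [Finset.mem_insert, Finset.mem_Ico]; omega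
    rw [e, Finset.sum_insert (by simp), ih]; ring

lemma abs_sub_eq_sum (hξ : StrictMono ξ) (i j : ℤ) : |ξ i - ξ j| =
    ∑ r ∈ Finset.Ico i j, (ξ (r + 1) - ξ r) + ∑ r ∈ Finset.Ico j i, (ξ (r + 1) - ξ r) := by
  rcases le_total i j with h | h
  · rw [sum_steps ξ h, Finset.Ico_eq_empty (by omega), Finset.sum_empty, add_zero,
      abs_of_nonpos (sub_nonpos.2 (hξ.monotone h))]; ring
  · rw [sum_steps ξ h, Finset.Ico_eq_empty (by omega), Finset.sum_empty, zero_add,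
      abs_of_nonneg (sub_nonneg.2 (hξ.monotone h))]

/-- In each row, the indicator function of the points to the left of `ξ r` grows by one cell when
`r` increases by one, starting from the base line `ξ 0`. -/
lemma rowCount_histRows (hξ : StrictMono ξ) (hη : StrictMono η) (N : ℕ)
    (hδ : ∀ k : ℤ, 0 ≤ k → k < N → 0 ≤ δ k) (p : Plane) :
    rowCount (η 0) (histRows ξ η δ N) p - hc (pt (ξ 0) (η 0), pt (ξ 0) (η N)) p =
      ∑ k ∈ Finset.Ico (0 : ℤ) N, ∑ r ∈ Finset.Ico 0 (δ k), cellCount ξ η (r, k) p := by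
  have hrow : ∀ k r : ℤ, 0 ≤ r →
      (if η k ≤ p 1 ∧ p 1 < η (k + 1) ∧ p 0 < ξ r then (1 : ℤ) else 0) =
      (if η k ≤ p 1 ∧ p 1 < η (k + 1) ∧ p 0 < ξ 0 then 1 else 0) +
        ∑ j ∈ Finset.Ico 0 r, cellCount ξ η (j, k) p := by
    intro k r hr
    induction r, hr using Int.leInduction with
    | base => simp
    | succ r hr ih =>
      have e : Finset.Ico 0 (r + 1) = insert r (Finset.Ico 0 r) := by
        ext x; simp only [Finset.mem_insert, Finset.mem_Ico]; omega
      rw [e, Finset.sum_insert (by simp), add_left_comm, ← ih]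
      have := hξ (lt_add_one r)
      unfold cellCount
      simp only
      split_ifs <;> grind
  induction N with
  | zero => simp [histRows, hc_level]
  | succ N ih =>
    have e : Finset.Ico (0 : ℤ) ((N + 1 : ℕ) : ℤ) = insert (N : ℤ) (Finset.Ico 0 (N : ℤ)) := by
      ext x; simp only [Finset.mem_insert, Finset.mem_Ico]; push_cast; omega
    have e0 : η 0 + (η N - η 0) = η N := by ring
    have hb := rowCount_single (h := η N - η 0) (η 0) (ξ 0) p
    have hb' := rowCount_single (h := η (N + 1) - η 0) (η 0) (ξ 0) p
    simp only [add_sub_cancel] at hb hb'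
    rw [e, Finset.sum_insert (by simp), ← ih fun k h0 h1 => hδ k h0 (by push_cast; omega),
      histRows_succ, rowCount_append, ht_histRows, e0, rowCount_cons, rowCount_nil]
    have h1 := hrow N (δ N) (hδ N (by omega) (by push_cast; omega))
    have h2 : η 0 ≤ η N := hη.monotone (by omega)
    have h3 : η N < η (N + 1) := hη (lt_add_one _)
    push_cast
    rw [← hb, ← hb']
    simp only [add_sub_cancel, add_zero, rowCount_cons, rowCount_nil]
    rw [h1]
    have : (if η 0 ≤ p 1 ∧ p 1 < η (N + 1) ∧ p 0 < ξ 0 then (1 : ℤ) else 0) =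
      (if η 0 ≤ p 1 ∧ p 1 < η N ∧ p 0 < ξ 0 then 1 else 0) +
        if η N ≤ p 1 ∧ p 1 < η (N + 1) ∧ p 0 < ξ 0 then 1 else 0 := by
      split_ifs <;> grind
    rw [this]; ring

end

/-- The base can be traversed in either direction, so `t` may be taken positive. The depth 0 at `-1`
and at `N` makes the outer sides of the extreme columns appear as jumps between neighbouring
columns. -/
lemma IsHist.exists_pos {h : Finset Cell} (hh : IsHist h) :
    ∃ (b t d : Cell) (N : ℕ) (δ : ℤ → ℤ), IsFrame t d ∧ (t = (1, 0) ∨ t = (0, 1)) ∧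
      (∀ k : ℤ, 0 ≤ k → k < N → 0 < δ k) ∧ δ (-1) = 0 ∧ δ N = 0 ∧
      ∀ c, c ∈ h ↔ ∃ k r : ℤ, 0 ≤ k ∧ k < N ∧ 0 ≤ r ∧ r < δ k ∧ c = cell b t d k r := by
  obtain ⟨b, t, d, n, dep, hF, hn, hd, hc⟩ := hh
  have hnN : ((n.toNat : ℕ) : ℤ) = n := Int.toNat_of_nonneg hn.le
  by_cases ht : t = (1, 0) ∨ t = (0, 1)
  · refine ⟨b, t, d, n.toNat, fun k => if 0 ≤ k ∧ k < n then dep k else 0, hF, ht, ?_, by simp,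
      by simp [hnN], ?_⟩
    · intro k k0 k1
      rw [hnN] at k1
      simp only [k0, k1, and_self, if_true]
      exact hd k k0 k1
    · intro c
      rw [hc, hnN]
      constructor
      · rintro ⟨k, r, k0, k1, h⟩
        exact ⟨k, r, k0, k1, by simpa [k0, k1] using h⟩
      · rintro ⟨k, r, k0, k1, h⟩
        exact ⟨k, r, k0, k1, by simpa [k0, k1] using h⟩
  · have hc' : ∀ k r, cell (cell b t d (n - 1) 0) (-t) d k r = cell b t d (n - 1 - k) r := by
      intro k r; unfold cell; module
    refine ⟨cell b t d (n - 1) 0, -t, d, n.toNat,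
      fun k => if 0 ≤ k ∧ k < n then dep (n - 1 - k) else 0,
      ⟨neg_mem_dirs hF.1, hF.2.1, fun h => hF.2.2.2 (by rw [← h, neg_neg]),
        fun h => hF.2.2.1 (neg_injective h)⟩, ?_, ?_, by simp, by simp [hnN], ?_⟩
    · have := hF.1
      simp only [dirs, Finset.mem_insert, Finset.mem_singleton] at this
      rcases this with rfl | rfl | rfl | rfl <;> simp at ht ⊢
    · intro k k0 k1
      rw [hnN] at k1
      simp only [k0, k1, and_self, if_true]
      exact hd _ (by omega) (by omega)
    · intro c
      rw [hc, hnN]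
      constructor
      · rintro ⟨k, r, k0, k1, r0, r1, rfl⟩
        refine ⟨n - 1 - k, r, by omega, by omega, r0, ?_, ?_⟩
        · beta_reduce; rw [if_pos ⟨by omega, by omega⟩, sub_sub_cancel]; exact r1
        · rw [hc', sub_sub_cancel]
      · rintro ⟨k, r, k0, k1, r0, r1, rfl⟩
        beta_reduce at r1
        rw [if_pos ⟨k0, k1⟩] at r1
        exact ⟨n - 1 - k, r, by omega, by omega, r0, r1, hc' k r⟩

section

variable {b t d : Cell} {N : ℕ} {δ : ℤ → ℤ} {h : Finset Cell}

/-- A sum over the cells of a histogram. -/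
lemma sum_hist {β : Type*} [AddCommMonoid β] (hF : IsFrame t d)
    (hc : ∀ c, c ∈ h ↔ ∃ k r : ℤ, 0 ≤ k ∧ k < N ∧ 0 ≤ r ∧ r < δ k ∧ c = cell b t d k r)
    (f : Cell → β) : ∑ c ∈ h, f c =
      ∑ k ∈ Finset.Ico (0 : ℤ) N, ∑ r ∈ Finset.Ico 0 (δ k), f (cell b t d k r) := by
  rw [Finset.sum_sigma']
  symm
  refine Finset.sum_bij (fun x _ => cell b t d x.1 x.2) ?_ ?_ ?_ ?_
  · rintro ⟨k, r⟩ hx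
    simp only [Finset.mem_sigma, Finset.mem_Ico] at hx
    exact (hc _).2 ⟨k, r, hx.1.1, hx.1.2, hx.2.1, hx.2.2, rfl⟩
  · rintro ⟨k, r⟩ _ ⟨k', r'⟩ _ hx
    obtain ⟨rfl, rfl⟩ := hF.inj hx
    rfl
  · intro c hcm
    obtain ⟨k, r, k0, k1, r0, r1, rfl⟩ := (hc c).1 hcm
    exact ⟨⟨k, r⟩, by simp [k0, k1, r0, r1], rfl⟩
  · intro x _; rfl

/-- The tops of the columns account for the height, and each jump between neighbouring depths is an
exposed side of the deeper column. Of the four directions only `d`, `t` and `-t` are used. -/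
lemma le_out_hist {X Y ξ η : ℤ → ℝ} (hX : StrictMono X) (hY : StrictMono Y) (hξ : StrictMono ξ)
    (hF : IsFrame t d) (hδ : ∀ k : ℤ, 0 ≤ k → k < N → 0 < δ k) (h0 : δ (-1) = 0) (hN : δ N = 0)
    (hc : ∀ c, c ∈ h ↔ ∃ k r : ℤ, 0 ≤ k ∧ k < N ∧ 0 ≤ r ∧ r < δ k ∧ c = cell b t d k r)
    (hξ' : ∀ k r, gridLength X Y (cell b t d k r) t = ξ (r + 1) - ξ r)
    (hη' : ∀ k r, gridLength X Y (cell b t d k r) d = η (k + 1) - η k) :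
    pvar (ξ 0) (histRows ξ η δ N) (ξ 0) + ht (histRows ξ η δ N) ≤ out (gridLength X Y) h h := by
  have hℓ := isLength_grid hX hY
  have hmem : ∀ {k r}, cell b t d k r ∈ h ↔ 0 ≤ k ∧ k < N ∧ 0 ≤ r ∧ r < δ k := by
    intro k r
    rw [hc]
    constructor
    · rintro ⟨k', r', q1, q2, q3, q4, q5⟩
      obtain ⟨rfl, rfl⟩ := hF.inj q5
      exact ⟨q1, q2, q3, q4⟩
    · rintro ⟨q1, q2, q3, q4⟩; exact ⟨k, r, q1, q2, q3, q4, rfl⟩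
  set O : Cell → ℝ := fun e => ∑ c ∈ h with c + e ∉ h, gridLength X Y c e with hO
  have hout : out (gridLength X Y) h h = ∑ e ∈ dirs, O e := by
    unfold out
    simp only [hO, Finset.sum_filter]
    rw [Finset.sum_product_right]
  have hO0 : ∀ e, 0 ≤ O e := fun e => Finset.sum_nonneg fun c _ => hℓ.nonneg _ _
  have h3 : O d + (O t + O (-t)) ≤ ∑ e ∈ dirs, O e := by
    have hd : d ∉ ({t, -t} : Finset Cell) := by
      simp only [Finset.mem_insert, Finset.mem_singleton]
      rintro (hh | hh)
      · exact hF.2.2.1 hh.symm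
      · exact hF.2.2.2 (by rw [hh, neg_neg])
    have ht : t ∉ ({-t} : Finset Cell) := by simpa using ne_neg_of_mem_dirs hF.1
    calc O d + (O t + O (-t)) = ∑ e ∈ {d, t, -t}, O e := by
          rw [Finset.sum_insert hd, Finset.sum_insert ht, Finset.sum_singleton]
      _ ≤ _ := Finset.sum_le_sum_of_subset_of_nonneg (by
          intro e he
          simp only [Finset.mem_insert, Finset.mem_singleton] at he
          rcases he with rfl | rfl | rfl
          · exact hF.2.1
          · exact hF.1
          · exact neg_mem_dirs hF.1) fun e _ _ => hO0 e
  have key : ∀ {α : Type} [DecidableEq α] (U : Finset α) (f : α → Cell) (e : Cell),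
      Set.InjOn f U → (∀ u ∈ U, f u ∈ h ∧ f u + e ∉ h) →
      ∑ u ∈ U, gridLength X Y (f u) e ≤ O e := by
    intro α _ U f e hf hU
    rw [← Finset.sum_image (f := fun c => gridLength X Y c e) hf]
    apply Finset.sum_le_sum_of_subset_of_nonneg
    · intro c hcm
      obtain ⟨u, hu, rfl⟩ := Finset.mem_image.1 hcm
      exact Finset.mem_filter.2 (hU u hu)
    · intro c _ _; exact hℓ.nonneg _ _
  have htop : ht (histRows ξ η δ N) ≤ O d := by
    rw [ht_histRows, ← sum_steps η (by omega : (0 : ℤ) ≤ N)]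
    have := key (Finset.Ico (0 : ℤ) N) (fun k => cell b t d k (δ k - 1)) d
      (fun i _ j _ hij => (hF.inj hij).1) (by
        intro k hk
        rw [Finset.mem_Ico] at hk
        have := hδ k hk.1 hk.2
        rw [cell_add_d, hmem, hmem]
        omega)
    simpa only [hη'] using this
  -- The pair `g j` consists of a column and its neighbour in direction `ε • t`; summed are the
  -- sides of those cells of the first which project beyond the second.
  have hside : ∀ (ε : ℤ), (ε = 1 ∨ ε = -1) → ∀ g : ℤ → ℤ × ℤ,
      (∀ j, (g j).2 = (g j).1 + ε) → Function.Injective (fun j => (g j).1) →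
      (∀ j, 0 ≤ j → j ≤ N → -1 ≤ (g j).1 ∧ (g j).1 ≤ N ∧ -1 ≤ (g j).2 ∧ (g j).2 ≤ N) →
      ∑ j ∈ Finset.range (N + 1), ∑ r ∈ Finset.Ico (δ (g j).2) (δ (g j).1), (ξ (r + 1) - ξ r) ≤
        O (ε • t) := by
    intro ε hε g hg hgi hgb
    have hδ0 : ∀ k : ℤ, -1 ≤ k → k ≤ N → 0 ≤ δ k ∧ (δ k ≠ 0 → 0 ≤ k ∧ k < N) := by
      intro k k0 k1
      rcases eq_or_lt_of_le k0 with rfl | k0'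
      · simp [h0]
      rcases eq_or_lt_of_le k1 with rfl | k1'
      · simp [hN]
      exact ⟨(hδ k (by omega) k1').le, fun _ => ⟨by omega, k1'⟩⟩
    rw [Finset.sum_sigma']
    have := key ((Finset.range (N + 1)).sigma fun j => Finset.Ico (δ (g j).2) (δ (g j).1))
      (fun x => cell b t d (g x.1).1 x.2) (ε • t) (by
        rintro ⟨j, r⟩ _ ⟨j', r'⟩ _ hx
        obtain ⟨q1, rfl⟩ := hF.inj hx
        have : (j : ℤ) = j' := hgi q1
        have : j = j' := by exact_mod_cast this
        subst this; rfl) (by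
        rintro ⟨j, r⟩ hx
        simp only [Finset.mem_sigma, Finset.mem_range, Finset.mem_Ico] at hx
        obtain ⟨q1, q2, q3, q4⟩ := hgb j (by omega) (by omega)
        have d1 := hδ0 _ q1 q2
        have d2 := hδ0 _ q3 q4
        show cell b t d (g j).1 r ∈ h ∧ cell b t d (g j).1 r + ε • t ∉ h
        rw [cell_add_smul, hmem, hmem, ← hg]
        have := d1.2 (by omega)
        omega)
    refine le_trans (le_of_eq ?_) this
    apply Finset.sum_congr rfl
    intro x _
    rcases hε with rfl | rfl
    · rw [one_smul, hξ']
    · rw [neg_smul, one_smul, hℓ.neg, hξ']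
  have s1 := hside 1 (Or.inl rfl) (fun j => (j - 1, j)) (fun j => by simp)
    (fun i j hij => by simpa using hij) (fun j j0 j1 => by simp only; omega)
  have s2 := hside (-1) (Or.inr rfl) (fun j => (j, j - 1)) (fun j => by simp; ring)
    (fun i j hij => by simpa using hij) (fun j j0 j1 => by simp only; omega)
  rw [one_smul] at s1
  rw [neg_smul, one_smul] at s2
  rw [pvar_histRows h0 hN, hout]
  simp only [abs_sub_eq_sum hξ, Finset.sum_add_distrib]
  simp only at s1 s2
  linarith

end

end

lemma mem_histRows {ξ η : ℤ → ℝ} (hξ : StrictMono ξ) (hη : StrictMono η) {δ : ℤ → ℤ} {N : ℕ}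
    (hδ : ∀ k : ℤ, 0 ≤ k → k < N → 0 < δ k) : ∀ r ∈ histRows ξ η δ N, 0 < r.1 ∧ ξ 0 < r.2 := by
  intro r hr
  obtain ⟨k, hk, rfl⟩ := List.mem_map.1 hr
  exact ⟨sub_pos.2 (hη (lt_add_one _)), hξ (hδ k (by omega) (by exact_mod_cast List.mem_range.1 hk))⟩

lemma cnt_map_involution {Φ : Plane ≃ₗᵢ[ℝ] Plane} (hΦ : ∀ p, Φ (Φ p) = p)
    (F : List SimplePolygon) (p : Plane) :
    cnt (F.map (SimplePolygon.map Φ)) p = cnt F (Φ p) := by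
  conv_lhs => rw [← hΦ p]
  exact cnt_map Φ F (Φ p)

lemma ae_off_grid (X Y : ℤ → ℝ) : ∀ᵐ p : Plane, (∀ i, p 0 ≠ X i) ∧ ∀ i, p 1 ≠ Y i := by
  rw [Filter.eventually_and, ae_all_iff, ae_all_iff]
  refine ⟨fun i => ?_, fun i => ?_⟩
  · simpa [ae_iff] using volume_level_zero (X i)
  · simpa [ae_iff] using volume_level_one (Y i)

/-- A histogram of cells is tiled with total perimeters controlled by its boundary length. -/
theorem IsHist.exists_tiles {h : Finset Cell} (hh : IsHist h) {X Y : ℤ → ℝ} {s : ℝ} (hs : 8 ≤ s)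
    (hX : StrictMono X) (hY : StrictMono Y) :
    ∃ F : List SimplePolygon, (∀ Q ∈ F, IsTile s Q) ∧
      (∀ᵐ p : Plane, cnt F p = ∑ c ∈ h, cellCount X Y c p) ∧
      sumHper F ≤ 8 * out (gridLength X Y) h h ∧
      sumPer F ≤ 8 * s * out (gridLength X Y) h h := by
  obtain ⟨b, t, d, N, δ, hF, ht, hδ, h0, hN, hc⟩ := hh.exists_pos
  -- A histogram with horizontal base is read with interchanged coordinates and tiled by bumps. For
  -- a vertical base, `htile` uses the tiling by steep paths.
  have hbump : ∀ {ξ η : ℤ → ℝ}, StrictMono ξ → StrictMono η →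
      (∀ k r, gridLength X Y (cell b t d k r) t = ξ (r + 1) - ξ r) →
      (∀ k r, gridLength X Y (cell b t d k r) d = η (k + 1) - η k) →
      ∃ F : List SimplePolygon, (∀ Q ∈ F, IsBump Q) ∧ (∀ᵐ p : Plane, cnt F p =
        ∑ k ∈ Finset.Ico (0 : ℤ) N, ∑ r ∈ Finset.Ico 0 (δ k), cellCount ξ η (r, k) p) ∧
        sumPer F ≤ 3 * out (gridLength X Y) h h := by
    intro ξ η hξ hη hξ' hη'
    have hr := mem_histRows hξ hη hδ
    obtain ⟨F, hFb, hFc, hFp⟩ := exists_bumps (a := η 0) (fun r hrm => (hr r hrm).1)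
      fun r hrm => (hr r hrm).2
    refine ⟨F, hFb, ?_, hFp.trans ?_⟩
    · filter_upwards [hFc] with p hp
      rw [hp, ht_histRows, add_sub_cancel,
        rowCount_histRows hξ hη N (fun k k0 k1 => (hδ k k0 k1).le)]
    · exact mul_le_mul_of_nonneg_left (le_out_hist hX hY hξ hF hδ h0 hN hc hξ' hη') (by norm_num)
  have htile : ∀ {ξ η : ℤ → ℝ}, StrictMono ξ → StrictMono η →
      (∀ k r, gridLength X Y (cell b t d k r) t = ξ (r + 1) - ξ r) →
      (∀ k r, gridLength X Y (cell b t d k r) d = η (k + 1) - η k) →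
      ∃ F : List SimplePolygon, (∀ Q ∈ F, IsTile s Q) ∧ (∀ᵐ p : Plane, cnt F p =
        ∑ k ∈ Finset.Ico (0 : ℤ) N, ∑ r ∈ Finset.Ico 0 (δ k), cellCount ξ η (r, k) p) ∧
        sumHper F ≤ 8 * out (gridLength X Y) h h ∧
        sumPer F ≤ 8 * s * out (gridLength X Y) h h := by
    intro ξ η hξ hη hξ' hη'
    have hr := mem_histRows hξ hη hδ
    have hle := le_out_hist hX hY hξ hF hδ h0 hN hc hξ' hη'
    obtain ⟨F, hFb, hFc, hFh, hFp⟩ := exists_tiles_vertical (a := η 0) hs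
      (fun r hrm => (hr r hrm).1) fun r hrm => (hr r hrm).2
    refine ⟨F, hFb, ?_, hFh.trans ?_, hFp.trans ?_⟩
    · filter_upwards [hFc] with p hp
      rw [hp, ht_histRows, add_sub_cancel,
        rowCount_histRows hξ hη N (fun k k0 k1 => (hδ k k0 k1).le)]
    · linarith
    · exact mul_le_mul_of_nonneg_left hle (by linarith)
  have hout : 0 ≤ out (gridLength X Y) h h :=
    Finset.sum_nonneg fun _ _ => (isLength_grid hX hY).nonneg _ _
  have hb : ∀ F G : List SimplePolygon, sumPer F ≤ 3 * out (gridLength X Y) h h →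
      sumPer G = sumPer F → sumHper G ≤ 8 * out (gridLength X Y) h h ∧
        sumPer G ≤ 8 * s * out (gridLength X Y) h h := by
    intro F G h1 h2
    have h3 := sumHper_le_sumPer G
    have h4 : 8 * 8 * out (gridLength X Y) h h ≤ 8 * s * out (gridLength X Y) h h :=
      mul_le_mul_of_nonneg_right (by linarith) hout
    constructor <;> linarith
  have hdd := hF.2.1
  simp only [dirs, Finset.mem_insert, Finset.mem_singleton] at hdd
  have hshift : ∀ {Z : ℤ → ℝ}, StrictMono Z → ∀ i, StrictMono fun k => Z (i + k) :=
    fun hZ i k l hkl => hZ (by omega)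
  -- Columns growing in a negative direction are reflected. The cell with index `i` reaches from `Z
  -- i` to `Z (i + 1)`, and its far end is on the base, hence the shift by one. Reflected half-open
  -- cells agree with the original ones only off the grid lines.
  have hrefl : ∀ {Z : ℤ → ℝ}, StrictMono Z → ∀ i, StrictMono fun k => -Z (i + 1 - k) :=
    fun hZ i k l hkl => neg_lt_neg (hZ (by omega))
  rcases ht with rfl | rfl
  · rcases hdd with rfl | rfl | rfl | rfl
    · exact absurd rfl hF.2.2.1
    · exact absurd rfl hF.2.2.2
    · obtain ⟨F, hFb, hFc, hFp⟩ := hbump (hshift hY b.2) (hshift hX b.1)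
        (fun k r => by simp [gridLength, cell, add_assoc])
        (fun k r => by simp [gridLength, cell, add_assoc])
      refine ⟨F.map (SimplePolygon.map swapXY), ?_, ?_, hb F _ hFp (sumPer_map _ _)⟩
      · simp only [List.mem_map]
        rintro _ ⟨Q, hQ, rfl⟩
        exact Or.inr (hFb Q hQ s).1
      · filter_upwards [ae_isometry swapXY hFc] with p hp
        rw [cnt_map_involution swapXY_swapXY, hp, sum_hist hF hc]
        refine Finset.sum_congr rfl fun k _ => Finset.sum_congr rfl fun r _ => ?_
        simp [cellCount, cell, add_assoc, and_comm]
    · obtain ⟨F, hFb, hFc, hFp⟩ := hbump (hrefl hY b.2) (hshift hX b.1)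
        (fun k r => by simp [gridLength, cell]; ring_nf)
        (fun k r => by simp [gridLength, cell, add_assoc])
      refine ⟨(F.map (SimplePolygon.map swapXY)).map (SimplePolygon.map flipY), ?_, ?_,
        hb F _ hFp (by rw [sumPer_map, sumPer_map])⟩
      · simp only [List.mem_map]
        rintro _ ⟨_, ⟨Q, hQ, rfl⟩, rfl⟩
        exact Or.inr (hFb Q hQ s).2
      · filter_upwards [ae_isometry flipY (ae_isometry swapXY hFc), ae_off_grid X Y] with p hp hg
        rw [cnt_map_involution flipY_flipY, cnt_map_involution swapXY_swapXY, hp, sum_hist hF hc]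
        refine Finset.sum_congr rfl fun k _ => Finset.sum_congr rfl fun r _ => ?_
        have h1 := hg.2 (b.2 + 1 - r)
        have h2 := hg.2 (b.2 - r)
        have e1 : b.2 + 1 - (r + 1) = b.2 - r := by ring
        have e2 : b.2 + -r + 1 = b.2 + 1 - r := by ring
        simp only [cellCount, cell, swapXY_zero, swapXY_one, flipY_zero, flipY_one, Prod.fst_add,
          Prod.snd_add, Prod.smul_fst, Prod.smul_snd, smul_eq_mul, mul_zero, mul_one, add_zero,
          mul_neg, e1, e2, neg_le_neg_iff, neg_lt_neg_iff, add_assoc, ← sub_eq_add_neg]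
        congr 1
        grind
  · rcases hdd with rfl | rfl | rfl | rfl
    · obtain ⟨F, hFb, hFc, hFp⟩ := htile (hshift hX b.1) (hshift hY b.2)
        (fun k r => by simp [gridLength, cell, add_assoc])
        (fun k r => by simp [gridLength, cell, add_assoc])
      refine ⟨F, hFb, ?_, hFp⟩
      filter_upwards [hFc] with p hp
      rw [hp, sum_hist hF hc]
      refine Finset.sum_congr rfl fun k _ => Finset.sum_congr rfl fun r _ => ?_
      simp [cellCount, cell, add_assoc]
    · obtain ⟨F, hFb, hFc, hFh, hFp⟩ := htile (hrefl hX b.1) (hshift hY b.2)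
        (fun k r => by simp [gridLength, cell]; ring_nf)
        (fun k r => by simp [gridLength, cell, add_assoc])
      refine ⟨F.map (SimplePolygon.map flipX), ?_, ?_, ?_, ?_⟩
      · simp only [List.mem_map]
        rintro _ ⟨Q, hQ, rfl⟩
        exact (hFb Q hQ).flipX
      · filter_upwards [ae_isometry flipX hFc, ae_off_grid X Y] with p hp hg
        rw [cnt_map_involution flipX_flipX, hp, sum_hist hF hc]
        refine Finset.sum_congr rfl fun k _ => Finset.sum_congr rfl fun r _ => ?_
        have h1 := hg.1 (b.1 + 1 - r)
        have h2 := hg.1 (b.1 - r)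
        have e1 : b.1 + 1 - (r + 1) = b.1 - r := by ring
        have e3 : b.1 + (-r + 1) = b.1 + 1 - r := by ring
        simp only [cellCount, cell, flipX_zero, flipX_one, Prod.fst_add,
          Prod.snd_add, Prod.smul_fst, Prod.smul_snd, smul_eq_mul, mul_zero, mul_one, add_zero,
          mul_neg, e1, e3, neg_le_neg_iff, neg_lt_neg_iff, add_assoc, ← sub_eq_add_neg]
        congr 1
        grind
      · rw [sumHper_map isFlip_flipX]; exact hFh
      · rw [sumPer_map]; exact hFp
    · exact absurd rfl hF.2.2.1
    · exact absurd rfl hF.2.2.2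

/-! ### Regions bounded by edges of a grid -/

/-- Starting from the integers, the values are inserted one by one, with the later indices shifted.
-/
lemma exists_grid (A : Finset ℝ) : ∃ X : ℤ → ℝ, StrictMono X ∧
    (∀ x, ∃ i, X i ≤ x ∧ x < X (i + 1)) ∧ ∀ a ∈ A, ∃ i, a = X i := by
  induction A using Finset.induction_on with
  | empty =>
    refine ⟨fun i => i, Int.cast_strictMono, fun x => ⟨⌊x⌋, Int.floor_le x, ?_⟩, by simp⟩
    push_cast
    exact Int.lt_floor_add_one x
  | insert a A _ ih =>
    obtain ⟨X, hX, hcov, hA⟩ := ih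
    obtain ⟨i, h1, h2⟩ := hcov a
    rcases eq_or_lt_of_le h1 with h1 | h1
    · refine ⟨X, hX, hcov, ?_⟩
      intro b hb
      rcases Finset.mem_insert.1 hb with rfl | hb
      · exact ⟨i, h1.symm⟩
      · exact hA b hb
    · set X' : ℤ → ℝ := fun k => if k ≤ i then X k else if k = i + 1 then a else X (k - 1) with hX'
      have e1 : ∀ k, k ≤ i → X' k = X k := fun k hk => by simp [hX', hk]
      have e2 : X' (i + 1) = a := by simp [hX']
      have e3 : ∀ k, i + 1 ≤ k → X' (k + 1) = X k := fun k hk => by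
        simp only [hX']; rw [if_neg (by omega), if_neg (by omega), add_sub_cancel_right]
      refine ⟨X', strictMono_int_of_lt_succ fun k => ?_, fun x => ?_, fun b hb => ?_⟩
      · rcases lt_trichotomy k i with h | rfl | h
        · rw [e1 k h.le, e1 _ h]; exact hX (lt_add_one k)
        · rw [e1 k le_rfl, e2]; exact h1
        · rcases eq_or_lt_of_le (show i + 1 ≤ k from h) with rfl | h'
          · rw [e2, e3 _ le_rfl]; exact h2
          · have := e3 (k - 1) (by omega)
            rw [sub_add_cancel] at this
            rw [this, e3 k h]; exact hX (by omega)
      · obtain ⟨k, k1, k2⟩ := hcov x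
        rcases lt_trichotomy k i with h | rfl | h
        · exact ⟨k, by rwa [e1 k h.le], by rwa [e1 _ h]⟩
        · rcases lt_or_ge x a with hx | hx
          · exact ⟨k, by rwa [e1 k le_rfl], by rwa [e2]⟩
          · exact ⟨k + 1, by rwa [e2], by rwa [e3 _ le_rfl]⟩
        · exact ⟨k + 1, by rwa [e3 k h], by rw [e3 (k + 1) (by omega)]; exact k2⟩
      · rcases Finset.mem_insert.1 hb with rfl | hb
        · exact ⟨i + 1, e2.symm⟩
        · obtain ⟨k, rfl⟩ := hA b hb
          rcases le_or_gt k i with h | h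
          · exact ⟨k, (e1 k h).symm⟩
          · exact ⟨k + 1, (e3 k h).symm⟩

/-- The edges `E` lie on the lines of a grid and bound the closed region `R`. -/
structure IsGridRegion (X Y : ℤ → ℝ) (R : Set Plane) (E : List (Plane × Plane)) : Prop where
  strictMono_fst : StrictMono X
  strictMono_snd : StrictMono Y
  cover_fst : ∀ x, ∃ i, X i ≤ x ∧ x < X (i + 1)
  cover_snd : ∀ y, ∃ j, Y j ≤ y ∧ y < Y (j + 1)
  isClosed : IsClosed R
  frontier_eq : frontier R = trace E
  edge : ∀ e ∈ E, (∃ i j j', e = (pt (X i) (Y j), pt (X i) (Y j'))) ∨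
    ∃ i i' j, e = (pt (X i) (Y j), pt (X i') (Y j))

/-- The centre of a cell. -/
noncomputable def ctr (X Y : ℤ → ℝ) (c : Cell) : Plane :=
  pt ((X c.1 + X (c.1 + 1)) / 2) ((Y c.2 + Y (c.2 + 1)) / 2)

/-- The interior of the rectangle formed by the cells with indices in `[i, i') × [j, j')`. -/
def box (X Y : ℤ → ℝ) (i i' j j' : ℤ) : Set Plane :=
  {p | (X i < p 0 ∧ p 0 < X i') ∧ Y j < p 1 ∧ p 1 < Y j'}

/-- The interior of a cell. -/
def cellBox (X Y : ℤ → ℝ) (c : Cell) : Set Plane := box X Y c.1 (c.1 + 1) c.2 (c.2 + 1)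

lemma isOpen_box (X Y : ℤ → ℝ) (i i' j j' : ℤ) : IsOpen (box X Y i i' j j') :=
  have h : ∀ k : Fin 2, Continuous fun p : Plane => p k := fun k => by fun_prop
  ((isOpen_lt continuous_const (h 0)).inter (isOpen_lt (h 0) continuous_const)).inter
    ((isOpen_lt continuous_const (h 1)).inter (isOpen_lt (h 1) continuous_const))

lemma mem_segment_vertical {x y y' : ℝ} {p : Plane} :
    p ∈ segment ℝ (pt x y) (pt x y') ↔ p 0 = x ∧ p 1 ∈ Set.uIcc y y' := by
  rw [mem_segment_coord, ← segment_eq_uIcc, segment_eq_image']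
  simp only [pt_zero, pt_one, sub_self, mul_zero, add_zero, Set.mem_image, Set.mem_Icc, smul_eq_mul]
  constructor
  · rintro ⟨t, h0, h1, h2, h3⟩; exact ⟨h2, t, ⟨h0, h1⟩, h3.symm⟩
  · rintro ⟨h2, t, ⟨h0, h1⟩, h3⟩; exact ⟨t, h0, h1, h2, h3.symm⟩

lemma mem_segment_horizontal {x x' y : ℝ} {p : Plane} :
    p ∈ segment ℝ (pt x y) (pt x' y) ↔ p 1 = y ∧ p 0 ∈ Set.uIcc x x' := by
  rw [mem_segment_coord, ← segment_eq_uIcc, segment_eq_image']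
  simp only [pt_zero, pt_one, sub_self, mul_zero, add_zero, Set.mem_image, Set.mem_Icc, smul_eq_mul]
  constructor
  · rintro ⟨t, h0, h1, h2, h3⟩; exact ⟨h3, t, ⟨h0, h1⟩, h2.symm⟩
  · rintro ⟨h2, t, ⟨h0, h1⟩, h3⟩; exact ⟨t, h0, h1, h3.symm, h2⟩

/-- A strictly monotone sequence has no value strictly between two consecutive ones. -/
lemma StrictMono.lt_iff_of_between {X : ℤ → ℝ} (hX : StrictMono X) {i k : ℤ} {x : ℝ}
    (h1 : X i < x) (h2 : x < X (i + 1)) : (X k < x ↔ k ≤ i) ∧ (x < X k ↔ i < k) := by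
  rcases le_or_gt k i with h | h
  · have := (hX.monotone h).trans_lt h1
    exact ⟨iff_of_true this h, iff_of_false this.not_gt h.not_gt⟩
  · have := h2.trans_le (hX.monotone (show i + 1 ≤ k from h))
    exact ⟨iff_of_false this.not_gt h.not_ge, iff_of_true this h⟩

lemma closedBox_subset_closure {a a' b b' : ℝ} (ha : a < a') (hb : b < b') {z : Plane}
    (h1 : a ≤ z 0) (h2 : z 0 ≤ a') (h3 : b ≤ z 1) (h4 : z 1 ≤ b') :
    z ∈ closure {p : Plane | (a < p 0 ∧ p 0 < a') ∧ b < p 1 ∧ p 1 < b'} := by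
  have : z ∈ closure (openSegment ℝ z (pt ((a + a') / 2) ((b + b') / 2))) := by
    rw [closure_openSegment]; exact left_mem_segment _ _ _
  refine closure_mono ?_ this
  rw [openSegment_eq_image']
  rintro _ ⟨t, ⟨h0, h1⟩, rfl⟩
  simp only [Set.mem_setOf_eq, PiLp.add_apply, PiLp.smul_apply, PiLp.sub_apply, pt_zero, pt_one,
    smul_eq_mul]
  refine ⟨⟨?_, ?_⟩, ?_, ?_⟩ <;> nlinarith

namespace IsGridRegion

variable {X Y : ℤ → ℝ} {R : Set Plane} {E : List (Plane × Plane)}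

lemma ctr_lt (G : IsGridRegion X Y R E) (c : Cell) (k : ℤ) : ctr X Y c 0 < X k ↔ c.1 < k := by
  have := G.strictMono_fst (lt_add_one c.1)
  exact (G.strictMono_fst.lt_iff_of_between (by simp [ctr]; linarith) (by simp [ctr]; linarith)).2

lemma lt_ctr (G : IsGridRegion X Y R E) (c : Cell) (k : ℤ) : Y k < ctr X Y c 1 ↔ k ≤ c.2 := by
  have := G.strictMono_snd (lt_add_one c.2)
  exact (G.strictMono_snd.lt_iff_of_between (by simp [ctr]; linarith) (by simp [ctr]; linarith)).1

lemma ctr_mem (G : IsGridRegion X Y R E) (c : Cell) : ctr X Y c ∈ cellBox X Y c := by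
  have h1 := G.strictMono_fst (lt_add_one c.1)
  have h2 := G.strictMono_snd (lt_add_one c.2)
  simp only [cellBox, box, ctr, Set.mem_setOf_eq, pt_zero, pt_one]
  refine ⟨⟨?_, ?_⟩, ?_, ?_⟩ <;> linarith

lemma exists_cellBox (G : IsGridRegion X Y R E) {p : Plane}
    (h : (∀ i, p 0 ≠ X i) ∧ ∀ j, p 1 ≠ Y j) : ∃ c, p ∈ cellBox X Y c := by
  obtain ⟨i, i1, i2⟩ := G.cover_fst (p 0)
  obtain ⟨j, j1, j2⟩ := G.cover_snd (p 1)
  exact ⟨(i, j), ⟨lt_of_le_of_ne i1 (h.1 i).symm, i2⟩, lt_of_le_of_ne j1 (h.2 j).symm, j2⟩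

lemma notMem_trace (G : IsGridRegion X Y R E) {c : Cell} {p : Plane} (h : p ∈ cellBox X Y c) :
    p ∉ trace E := by
  rintro ⟨e, he, hp⟩
  obtain ⟨⟨h1, h2⟩, h3, h4⟩ := h
  rcases G.edge e he with ⟨i, j, j', rfl⟩ | ⟨i, i', j, rfl⟩
  · have e1 := (mem_segment_vertical.1 hp).1
    have := G.strictMono_fst.lt_iff_of_between (k := i) h1 h2
    rw [e1] at this
    simp only [lt_self_iff_false, false_iff] at this
    omega
  · have e1 := (mem_segment_horizontal.1 hp).1
    have := G.strictMono_snd.lt_iff_of_between (k := j) h3 h4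
    rw [e1] at this
    simp only [lt_self_iff_false, false_iff] at this
    omega

/-- A segment avoiding the frontier is a connected subset of the union of the disjoint open sets
`interior R` and `Rᶜ`. -/
lemma mem_iff_of_segment (G : IsGridRegion X Y R E) {p q : Plane}
    (h : ∀ r ∈ segment ℝ p q, r ∉ trace E) : p ∈ R ↔ q ∈ R := by
  have hp : IsPreconnected (segment ℝ p q) := (convex_segment p q).isPreconnected
  have hsub : segment ℝ p q ⊆ interior R ∪ Rᶜ := by
    intro r hr
    by_cases hrR : r ∈ R
    · left
      by_contra hri
      refine h r hr ?_
      rw [← G.frontier_eq, G.isClosed.frontier_eq]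
      exact ⟨hrR, hri⟩
    · exact Or.inr hrR
  rcases hp.subset_or_subset isOpen_interior G.isClosed.isOpen_compl
    (disjoint_compl_right.mono_left interior_subset) hsub with h1 | h1
  · exact iff_of_true (interior_subset (h1 (left_mem_segment _ _ _)))
      (interior_subset (h1 (right_mem_segment _ _ _)))
  · exact iff_of_false (h1 (left_mem_segment _ _ _)) (h1 (right_mem_segment _ _ _))

end IsGridRegion

lemma convex_box (X Y : ℤ → ℝ) (i i' j j' : ℤ) {p q r : Plane} (hp : p ∈ box X Y i i' j j')
    (hq : q ∈ box X Y i i' j j') (hr : r ∈ segment ℝ p q) : r ∈ box X Y i i' j j' := by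
  obtain ⟨t, h0, h1, e0, e1⟩ := mem_segment_coord.1 hr
  obtain ⟨⟨a1, a2⟩, a3, a4⟩ := hp
  obtain ⟨⟨b1, b2⟩, b3, b4⟩ := hq
  have key : ∀ {a x y : ℝ}, a < x → a < y → a < x + t * (y - x) := by
    intro a x y hx hy
    rcases le_total x y with h | h <;> nlinarith
  have key' : ∀ {a x y : ℝ}, x < a → y < a → x + t * (y - x) < a := by
    intro a x y hx hy
    rcases le_total x y with h | h <;> nlinarith
  simp only [box, Set.mem_setOf_eq, e0, e1]
  exact ⟨⟨key a1 b1, key' a2 b2⟩, key a3 b3, key' a4 b4⟩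

namespace IsGridRegion

variable {X Y : ℤ → ℝ} {R : Set Plane} {E : List (Plane × Plane)}

lemma mem_iff_ctr (G : IsGridRegion X Y R E) {c : Cell} {p : Plane} (h : p ∈ cellBox X Y c) :
    p ∈ R ↔ ctr X Y c ∈ R :=
  G.mem_iff_of_segment fun _ hr => G.notMem_trace (convex_box _ _ _ _ _ _ h (G.ctr_mem c) hr)

/-- The closed rectangle of a cell. -/
def closedCell (X Y : ℤ → ℝ) (c : Cell) : Set Plane :=
  {z | (X c.1 ≤ z 0 ∧ z 0 ≤ X (c.1 + 1)) ∧ Y c.2 ≤ z 1 ∧ z 1 ≤ Y (c.2 + 1)}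

lemma mem_closure_cellBox (G : IsGridRegion X Y R E) {c : Cell} {z : Plane}
    (h : z ∈ closedCell X Y c) : z ∈ closure (cellBox X Y c) :=
  closedBox_subset_closure (G.strictMono_fst (lt_add_one _)) (G.strictMono_snd (lt_add_one _))
    h.1.1 h.1.2 h.2.1 h.2.2

/-- A point common to a cell in the region and a cell outside is on the boundary. -/
lemma mem_trace_of_closedCell (G : IsGridRegion X Y R E) {c c' : Cell} {z : Plane}
    (h : z ∈ closedCell X Y c) (h' : z ∈ closedCell X Y c') (hc : ctr X Y c ∈ R)
    (hc' : ctr X Y c' ∉ R) : z ∈ trace E := by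
  rw [← G.frontier_eq, frontier_eq_closure_inter_closure]
  exact ⟨closure_mono (fun p hp => (G.mem_iff_ctr hp).2 hc) (G.mem_closure_cellBox h),
    closure_mono (fun p hp hpR => hc' ((G.mem_iff_ctr hp).1 hpR)) (G.mem_closure_cellBox h')⟩

/-- Off the grid lines the open set is in the region, hence by density everywhere, so it is disjoint
from the frontier. This shows that no boundary edge passes between two neighbouring cells of the
region. -/
lemma notMem_trace_of_open (G : IsGridRegion X Y R E) {U : Set Plane} (hU : IsOpen U)
    (h : ∀ p ∈ U, ∀ c, p ∈ cellBox X Y c → ctr X Y c ∈ R) : ∀ p ∈ U, p ∉ trace E := by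
  intro p hp
  have h1 : U ⊆ R := by
    refine ((Measure.dense_of_ae (ae_off_grid X Y)).open_subset_closure_inter hU).trans ?_
    refine (closure_mono ?_).trans G.isClosed.closure_eq.subset
    rintro q ⟨hq, hqg⟩
    obtain ⟨c, hc⟩ := G.exists_cellBox hqg
    exact (G.mem_iff_ctr hc).2 (h q hq c hc)
  rw [← G.frontier_eq]
  intro hpf
  exact hpf.2 (interior_maximal h1 hU hp)

lemma box_index (G : IsGridRegion X Y R E) {i i' j j' : ℤ} {p : Plane} {c : Cell}
    (hp : p ∈ box X Y i i' j j') (hc : p ∈ cellBox X Y c) :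
    (i ≤ c.1 ∧ c.1 < i') ∧ j ≤ c.2 ∧ c.2 < j' := by
  obtain ⟨⟨a1, a2⟩, a3, a4⟩ := hp
  obtain ⟨⟨b1, b2⟩, b3, b4⟩ := hc
  exact ⟨⟨(G.strictMono_fst.lt_iff_of_between b1 b2).1.1 a1,
    (G.strictMono_fst.lt_iff_of_between b1 b2).2.1 a2⟩,
    (G.strictMono_snd.lt_iff_of_between b3 b4).1.1 a3,
    (G.strictMono_snd.lt_iff_of_between b3 b4).2.1 a4⟩

lemma eq_of_cellBox (G : IsGridRegion X Y R E) {p : Plane} {c c' : Cell}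
    (hc : p ∈ cellBox X Y c) (hc' : p ∈ cellBox X Y c') : c = c' := by
  have := G.box_index hc hc'
  exact Prod.ext (by omega) (by omega)

lemma cellBox_subset_box (G : IsGridRegion X Y R E) {i i' j j' : ℤ} {c : Cell}
    (h : (i ≤ c.1 ∧ c.1 < i') ∧ j ≤ c.2 ∧ c.2 < j') : cellBox X Y c ⊆ box X Y i i' j j' := by
  rintro p ⟨⟨b1, b2⟩, b3, b4⟩
  exact ⟨⟨(G.strictMono_fst.lt_iff_of_between b1 b2).1.2 h.1.1,
    (G.strictMono_fst.lt_iff_of_between b1 b2).2.2 h.1.2⟩,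
    (G.strictMono_snd.lt_iff_of_between b3 b4).1.2 h.2.1,
    (G.strictMono_snd.lt_iff_of_between b3 b4).2.2 h.2.2⟩

/-- The boundary does not separate neighbouring cells in the region. -/
lemma segment_ctr (G : IsGridRegion X Y R E) {c c' : Cell} (hc : ctr X Y c ∈ R)
    (hc' : ctr X Y c' ∈ R) (h : c' = c + (1, 0) ∨ c' = c + (0, 1)) :
    ∀ r ∈ segment ℝ (ctr X Y c) (ctr X Y c'), r ∉ trace E := by
  have h1 : ∀ d : Cell, (c.1 ≤ d.1 ∧ d.1 < c'.1 + 1) ∧ c.2 ≤ d.2 ∧ d.2 < c'.2 + 1 ↔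
      d = c ∨ d = c' := by
    intro d
    rw [Prod.ext_iff, Prod.ext_iff]
    rcases h with rfl | rfl <;> simp only [Prod.fst_add, Prod.snd_add] <;> omega
  intro r hr
  refine G.notMem_trace_of_open (isOpen_box X Y c.1 (c'.1 + 1) c.2 (c'.2 + 1)) ?_ r
    (convex_box _ _ _ _ _ _ (G.cellBox_subset_box ((h1 c).2 (Or.inl rfl)) (G.ctr_mem c))
      (G.cellBox_subset_box ((h1 c').2 (Or.inr rfl)) (G.ctr_mem c')) hr)
  intro p hp d hd
  rcases (h1 d).1 (G.box_index hp hd) with rfl | rfl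
  · exact hc
  · exact hc'

end IsGridRegion

/-! ### Parity of crossings -/

/-- The segment `vw` is axis-parallel. -/
def AxisParallel (v w : Plane) : Prop := v 0 = w 0 ∨ v 1 = w 1

/-- The parity of the crossings of the horizontal ray from `q` to the right with the axis-parallel
segment `vw`. -/
noncomputable def crossing (v w q : Plane) : ZMod 2 :=
  if q 0 < v 0 then (if v 1 < q 1 then 1 else 0) + (if w 1 < q 1 then 1 else 0) else 0

/-- The indicator function of the quadrant to the lower left of `z`. -/
noncomputable def quadrant (z q : Plane) : ZMod 2 := if q 0 < z 0 ∧ ¬ z 1 < q 1 then 1 else 0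

lemma crossing_eq_zero {v w : Plane} (h : v 1 = w 1) (q : Plane) : crossing v w q = 0 := by
  unfold crossing; rw [h]; split_ifs <;> decide

lemma axis_cases {v w : Plane} (h : AxisParallel v w) :
    (∃ x y y', v = pt x y ∧ w = pt x y') ∨ ∃ x x' y, v = pt x y ∧ w = pt x' y := by
  rcases h with h | h
  · exact Or.inl ⟨v 0, v 1, w 1, (pt_eta v).symm, by rw [h, pt_eta]⟩
  · exact Or.inr ⟨v 0, w 0, v 1, (pt_eta v).symm, by rw [h, pt_eta]⟩

/-- A horizontal motion that avoids a vertical edge passes its abscissa, if at all, outside its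
levels, where the two terms of the crossing number cancel. -/
lemma crossing_congr {v w q q' : Plane} (h : AxisParallel v w) (hq : q 1 = q' 1)
    (hd : ∀ r ∈ segment ℝ q q', r ∉ segment ℝ v w) : crossing v w q = crossing v w q' := by
  rcases axis_cases h with ⟨x, y, y', rfl, rfl⟩ | ⟨x, x', y, rfl, rfl⟩
  · have h1 : x ∈ Set.uIcc (q 0) (q' 0) → q 1 ∉ Set.uIcc y y' := by
      intro hx hy
      refine hd (pt x (q 1)) ?_ (mem_segment_vertical.2 ⟨by simp, by simpa using hy⟩)
      have := (mem_segment_horizontal (x := q 0) (x' := q' 0) (y := q 1) (p := pt x (q 1))).2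
        ⟨by simp, by simpa using hx⟩
      rwa [pt_eta, hq, pt_eta, ← hq] at this
    simp only [Set.mem_uIcc] at h1
    unfold crossing
    simp only [pt_zero, pt_one, ← hq]
    split_ifs <;> first | rfl | (exfalso; grind) | decide
  · rw [crossing_eq_zero (by simp), crossing_eq_zero (by simp)]

/-- For a vertical edge the sum vanishes identically modulo 2. For a level edge it is the indicator
function of the strip on and below the edge, and a vertical motion leaves or enters this strip only
through the edge. -/
lemma crossing_quadrant_congr {v w q q' : Plane} (h : AxisParallel v w) (hq : q 0 = q' 0)
    (hd : ∀ r ∈ segment ℝ q q', r ∉ segment ℝ v w) :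
    crossing v w q + quadrant v q + quadrant w q =
      crossing v w q' + quadrant v q' + quadrant w q' := by
  rcases axis_cases h with ⟨x, y, y', rfl, rfl⟩ | ⟨x, x', y, rfl, rfl⟩
  · have : ∀ p, crossing (pt x y) (pt x y') p + quadrant (pt x y) p + quadrant (pt x y') p = 0 := by
      intro p
      simp only [crossing, quadrant, pt_zero, pt_one]
      split_ifs <;> first | (exfalso; grind) | decide
    rw [this, this]
  · have h1 : y ∈ Set.uIcc (q 1) (q' 1) → q 0 ∉ Set.uIcc x x' := by
      intro hx hy
      refine hd (pt (q 0) y) ?_ (mem_segment_horizontal.2 ⟨by simp, by simpa using hy⟩)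
      have := (mem_segment_vertical (x := q 0) (y := q 1) (y' := q' 1) (p := pt (q 0) y)).2
        ⟨by simp, by simpa using hx⟩
      rwa [pt_eta, hq, pt_eta, ← hq] at this
    rw [crossing_eq_zero (by simp), crossing_eq_zero (by simp)]
    simp only [Set.mem_uIcc] at h1
    simp only [quadrant, pt_zero, pt_one, ← hq]
    split_ifs <;> first | rfl | (exfalso; grind) | decide

/-- Two points joined by an axis-parallel segment in `T`. -/
def AxisJoined (T : Set Plane) (v w : Plane) : Prop := AxisParallel v w ∧ segment ℝ v w ⊆ T

/-- A path in `T` from `u` to `w` gives a two-colouring of the complement of `T` that changes across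
a curve completing the path to a closed one. -/
lemma exists_parity {T : Set Plane} {u w : Plane} (h : Relation.ReflTransGen (AxisJoined T) u w) :
    ∃ χ : Plane → ZMod 2,
      (∀ q q' : Plane, q 1 = q' 1 → (∀ r ∈ segment ℝ q q', r ∉ T) → χ q = χ q') ∧
      ∀ q q' : Plane, q 0 = q' 0 → (∀ r ∈ segment ℝ q q', r ∉ T) →
        χ q + quadrant u q + quadrant w q = χ q' + quadrant u q' + quadrant w q' := by
  induction h with
  | refl =>
    exact ⟨0, fun _ _ _ _ => rfl, fun q q' _ _ => by simp [CharTwo.add_self_eq_zero]⟩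
  | @tail v w _ hvw ih =>
    obtain ⟨χ, h1, h2⟩ := ih
    refine ⟨fun q => χ q + crossing v w q, ?_, ?_⟩
    · intro q q' hq hT
      exact congrArg₂ _ (h1 q q' hq hT)
        (crossing_congr hvw.1 hq fun r hr hr' => hT r hr (hvw.2 hr'))
    · intro q q' hq hT
      have e1 := h2 q q' hq hT
      have e2 := crossing_quadrant_congr hvw.1 hq fun r hr hr' => hT r hr (hvw.2 hr')
      -- The quadrant of the intermediate vertex `v` occurs twice and cancels modulo 2.
      have e3 : ∀ p, χ p + crossing v w p + quadrant u p + quadrant w p =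
          χ p + quadrant u p + quadrant v p +
            (crossing v w p + quadrant v p + quadrant w p) := by
        intro p
        have := CharTwo.add_self_eq_zero (quadrant v p)
        linear_combination -this
      beta_reduce
      rw [e3, e3, e1, e2]

lemma AxisJoined.symm {T : Set Plane} {v w : Plane} (h : AxisJoined T v w) : AxisJoined T w v :=
  ⟨h.1.imp Eq.symm Eq.symm, by rw [segment_symm]; exact h.2⟩

lemma segment_axisParallel {a b x : Plane} (h : AxisParallel a b) (hx : x ∈ segment ℝ a b) :
    AxisParallel a x ∧ segment ℝ a x ⊆ segment ℝ a b := by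
  refine ⟨?_, (convex_segment a b).segment_subset (left_mem_segment _ _ _) hx⟩
  obtain ⟨t, -, -, e0, e1⟩ := mem_segment_coord.1 hx
  refine h.imp (fun h => ?_) fun h => ?_
  · rw [e0, h]; ring
  · rw [e1, h]; ring

/-- The trace of a closed rectilinear curve is connected by axis-parallel segments. -/
lemma reflTransGen_trace {l : List Plane} (h : ∀ e ∈ cyclicEdges l, AxisParallel e.1 e.2)
    {u w : Plane} (hu : u ∈ trace (cyclicEdges l)) (hw : w ∈ trace (cyclicEdges l)) :
    Relation.ReflTransGen (AxisJoined (trace (cyclicEdges l))) u w := by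
  cases l with
  | nil => obtain ⟨e, he, -⟩ := hu; simp [cyclicEdges] at he
  | cons a l =>
    have key : ∀ (L : List Plane) (v : Plane),
        (∀ e ∈ pathEdges (v :: L), e ∈ cyclicEdges (a :: l)) → ∀ e ∈ pathEdges (v :: L),
        Relation.ReflTransGen (AxisJoined (trace (cyclicEdges (a :: l)))) v e.1 := by
      intro L
      induction L with
      | nil => intro v _ e he; simp at he
      | cons b L ih =>
        intro v hv e he
        rw [pathEdges_cons_cons] at hv he
        rcases List.mem_cons.1 he with rfl | he
        · exact .refl
        · have hm := hv (v, b) (by simp)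
          exact .head ⟨h _ hm, fun x hx => ⟨_, hm, hx⟩⟩
            (ih b (fun e he => hv e (List.mem_cons_of_mem _ he)) e he)
    have h1 : ∀ x ∈ trace (cyclicEdges (a :: l)),
        Relation.ReflTransGen (AxisJoined (trace (cyclicEdges (a :: l)))) a x := by
      rintro x ⟨e, he, hx⟩
      have := segment_axisParallel (h e he) hx
      refine .tail (key (l ++ [a]) a (fun e he => by rwa [cyclicEdges_cons]) e
        (by rwa [← cyclicEdges_cons])) ⟨this.1, this.2.trans fun y hy => ⟨e, he, hy⟩⟩
    have : Std.Symm (AxisJoined (trace (cyclicEdges (a :: l)))) := ⟨fun _ _ h => h.symm⟩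
    exact (Relation.ReflTransGen.stdSymm.symm _ _ (h1 u hu)).trans (h1 w hw)

namespace IsGridRegion

variable {X Y : ℤ → ℝ} {R : Set Plane} {E : List (Plane × Plane)}

lemma quadrant_ctr (G : IsGridRegion X Y R E) (i j : ℤ) (c : Cell) :
    quadrant (pt (X i) (Y j)) (ctr X Y c) = if c.1 < i ∧ c.2 < j then 1 else 0 := by
  simp only [quadrant, pt_zero, pt_one, G.ctr_lt, G.lt_ctr, not_le]

lemma crossing_ctr (G : IsGridRegion X Y R E) (i i' j j' : ℤ) (c : Cell) :
    crossing (pt (X i) (Y j)) (pt (X i') (Y j')) (ctr X Y c) =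
      if c.1 < i then (if j ≤ c.2 then 1 else 0) + (if j' ≤ c.2 then 1 else 0) else 0 := by
  simp only [crossing, pt_zero, pt_one, G.ctr_lt, G.lt_ctr]

/-- A grid segment whose end points are joined in the boundary separates the region. -/
lemma exists_coloring (G : IsGridRegion X Y R E) {i i' j j' : ℤ} (ha : i = i' ∨ j = j')
    (hT : Relation.ReflTransGen (AxisJoined (trace E)) (pt (X i) (Y j)) (pt (X i') (Y j'))) :
    ∃ p : Cell → ZMod 2, ∀ c, ctr X Y c ∈ R →
      (ctr X Y (c + (1, 0)) ∈ R → (p c ≠ p (c + (1, 0)) ↔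
        i = i' ∧ c.1 + 1 = i ∧ (j ≤ c.2 ∧ c.2 < j' ∨ j' ≤ c.2 ∧ c.2 < j))) ∧
      (ctr X Y (c + (0, 1)) ∈ R → (p c ≠ p (c + (0, 1)) ↔
        j = j' ∧ c.2 + 1 = j ∧ (i ≤ c.1 ∧ c.1 < i' ∨ i' ≤ c.1 ∧ c.1 < i))) := by
  obtain ⟨χ, h1, h2⟩ := exists_parity hT
  -- The boundary path and the chord form a closed curve. Between neighbouring cells of the region
  -- there is no boundary, so the parity of its crossings changes across the chord only. A vertical
  -- chord is seen by the added crossing number, a horizontal one by the quadrants of its ends.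
  refine ⟨fun c => χ (ctr X Y c) + crossing (pt (X i) (Y j)) (pt (X i') (Y j')) (ctr X Y c),
    fun c hc => ⟨fun hc' => ?_, fun hc' => ?_⟩⟩
  · have e := h1 _ _ (by simp [ctr]) (G.segment_ctr hc hc' (Or.inl rfl))
    beta_reduce
    rw [e, G.crossing_ctr, G.crossing_ctr, Ne, add_right_inj]
    simp only [Prod.fst_add, Prod.snd_add, add_zero]
    constructor
    · intro hne
      by_contra hcon
      apply hne
      split_ifs <;> first | (exfalso; omega) | decide
    · rintro ⟨rfl, rfl, h⟩
      split_ifs <;> first | (exfalso; omega) | decide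
  · have e := h2 _ _ (by simp [ctr]) (G.segment_ctr hc hc' (Or.inr rfl))
    rw [G.quadrant_ctr, G.quadrant_ctr, G.quadrant_ctr, G.quadrant_ctr] at e
    beta_reduce
    rw [G.crossing_ctr, G.crossing_ctr]
    generalize χ (ctr X Y c) = x at *
    generalize χ (ctr X Y (c + (0, 1))) = y at *
    simp only [Prod.fst_add, Prod.snd_add, add_zero] at e ⊢
    have e' : x = y + (if c.1 < i ∧ c.2 < j then 1 else 0) +
        (if c.1 < i' ∧ c.2 < j' then 1 else 0) + (if c.1 < i ∧ c.2 + 1 < j then 1 else 0) +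
        (if c.1 < i' ∧ c.2 + 1 < j' then 1 else 0) := by
      have key : ∀ x y a b a' b' : ZMod 2, x + a + b = y + a' + b' → x = y + a + b + a' + b' := by
        decide
      exact key _ _ _ _ _ _ e
    rw [e', add_assoc, add_assoc, add_assoc, add_assoc, Ne, add_right_inj]
    constructor
    · intro hne
      by_contra hcon
      apply hne
      split_ifs <;> first | (exfalso; omega) | decide
    · rintro ⟨rfl, rfl, h⟩
      split_ifs <;> first | (exfalso; omega) | decide

end IsGridRegion

/-! ### Chords of the polygon separate its cells -/

namespace IsGridRegion

variable {X Y : ℤ → ℝ} {R : Set Plane} {E : List (Plane × Plane)}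

/-- The indices of the vertex of the cell `b` on its sides `-t` and `-d`. -/
def corner (b t d : Cell) : ℤ × ℤ :=
  (if (t + d).1 = 1 then b.1 else b.1 + 1, if (t + d).2 = 1 then b.2 else b.2 + 1)

/-- The vertex belongs to the four closed cells around it, at least one of which is in the region
and at least one outside. -/
lemma corner_mem_trace (G : IsGridRegion X Y R E) {S : Finset Cell}
    (hS : ∀ c, c ∈ S ↔ ctr X Y c ∈ R) {b t d : Cell} (hF : IsFrame t d)
    (hb : b ∈ S ∨ b + -t ∈ S) (hfull : ¬ Full S t d b) :
    pt (X (corner b t d).1) (Y (corner b t d).2) ∈ trace E := by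
  have hcl : ∀ c, c = b ∨ c = b + -t ∨ c = b + -d ∨ c = b + -t + -d →
      pt (X (corner b t d).1) (Y (corner b t d).2) ∈ closedCell X Y c := by
    intro c hc
    have hx : (corner b t d).1 = c.1 ∨ (corner b t d).1 = c.1 + 1 := by
      rcases hF.cases with ⟨rfl | rfl, rfl | rfl⟩ | ⟨rfl | rfl, rfl | rfl⟩ <;>
        rcases hc with rfl | rfl | rfl | rfl <;> simp [corner]
    have hy : (corner b t d).2 = c.2 ∨ (corner b t d).2 = c.2 + 1 := by
      rcases hF.cases with ⟨rfl | rfl, rfl | rfl⟩ | ⟨rfl | rfl, rfl | rfl⟩ <;>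
        rcases hc with rfl | rfl | rfl | rfl <;> simp [corner]
    have h1 := (G.strictMono_fst (lt_add_one c.1)).le
    have h2 := (G.strictMono_snd (lt_add_one c.2)).le
    simp only [closedCell, Set.mem_setOf_eq, pt_zero, pt_one]
    rcases hx with hx | hx <;> rcases hy with hy | hy <;> rw [hx, hy] <;> simp [h1, h2]
  obtain ⟨c, hc, hcS⟩ : ∃ c, (c = b ∨ c = b + -t ∨ c = b + -d ∨ c = b + -t + -d) ∧ c ∉ S := by
    by_contra hcon
    push Not at hcon
    exact hfull ⟨hcon _ (by simp), hcon _ (by simp), hcon _ (by simp), hcon _ (by simp)⟩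
  rw [hS] at hcS
  rcases hb with hb | hb
  · exact G.mem_trace_of_closedCell (hcl b (by simp)) (hcl c hc) ((hS _).1 hb) hcS
  · exact G.mem_trace_of_closedCell (hcl _ (by simp)) (hcl c hc) ((hS _).1 hb) hcS

/-- Scalar products with `t` and `d` eliminate the quantifier, so that each orientation becomes
linear arithmetic. -/
lemma baseEdge_iff {b t d c e : Cell} {n : ℤ} (hF : IsFrame t d) :
    BaseEdge b t d n c e ↔ e = -d ∧ (0 ≤ t.1 * (c.1 - b.1) + t.2 * (c.2 - b.2) ∧
      t.1 * (c.1 - b.1) + t.2 * (c.2 - b.2) < n) ∧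
      d.1 * (c.1 - b.1) + d.2 * (c.2 - b.2) = 0 := by
  unfold BaseEdge
  refine and_congr_right fun _ => ⟨?_, fun ⟨⟨h1, h2⟩, h3⟩ => ⟨_, h1, h2, ?_⟩⟩
  · rintro ⟨i, h1, h2, rfl⟩
    rcases hF.cases with ⟨rfl | rfl, rfl | rfl⟩ | ⟨rfl | rfl, rfl | rfl⟩ <;>
      simp [cell, h1, h2]
  · rcases hF.cases with ⟨rfl | rfl, rfl | rfl⟩ | ⟨rfl | rfl, rfl | rfl⟩ <;>
      simp [cell, Prod.ext_iff] at h3 ⊢ <;> omega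

/-- Corners that are not full are boundary points, and any two boundary points are joined within the
boundary by axis-parallel segments; `exists_coloring` then applies. The colours are compared in the
two positive directions, and the other two follow by exchanging the cells. -/
lemma separated (G : IsGridRegion X Y R E) {S : Finset Cell}
    (hS : ∀ c, c ∈ S ↔ ctr X Y c ∈ R)
    (hE : ∀ u ∈ trace E, ∀ w ∈ trace E, Relation.ReflTransGen (AxisJoined (trace E)) u w) :
    Separated S := by
  intro b t d n hF hn hrow h0 h1
  have c0 := G.corner_mem_trace hS hF (Or.inl (by simpa [cell] using (hrow 0 le_rfl hn).1)) h0
  have c1 := G.corner_mem_trace hS hF (Or.inr (by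
    rw [cell_sub_t]; exact (hrow (n - 1) (by omega) (by omega)).1)) h1
  obtain ⟨p, hp⟩ := G.exists_coloring (by
    rcases hF.cases with ⟨rfl | rfl, rfl | rfl⟩ | ⟨rfl | rfl, rfl | rfl⟩ <;> simp [corner, cell])
    (hE _ c0 _ c1)
  have key : ∀ c ∈ S, ∀ e : Cell, (e = (1, 0) ∨ e = (0, 1)) → c + e ∈ S →
      (p c ≠ p (c + e) ↔ BaseEdge b t d n c e ∨ BaseEdge b t d n (c + e) (-e)) := by
    intro c hc e he hce
    obtain ⟨p1, p2⟩ := hp c ((hS c).1 hc)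
    have hx : ∀ {x y : Cell}, x = y ↔ x.1 = y.1 ∧ x.2 = y.2 := Prod.ext_iff
    rcases he with rfl | rfl
    · rw [p1 ((hS _).1 hce)]
      rcases hF.cases with ⟨rfl | rfl, rfl | rfl⟩ | ⟨rfl | rfl, rfl | rfl⟩ <;>
        simp [baseEdge_iff hF, corner, cell, hx] <;> omega
    · rw [p2 ((hS _).1 hce)]
      rcases hF.cases with ⟨rfl | rfl, rfl | rfl⟩ | ⟨rfl | rfl, rfl | rfl⟩ <;>
        simp [baseEdge_iff hF, corner, cell, hx] <;> omega
  refine ⟨p, fun c hc e he hce => ?_⟩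
  have hneg : (e = (1, 0) ∨ e = (0, 1)) ∨ (-e = (1, 0) ∨ -e = (0, 1)) := by
    simp only [dirs, Finset.mem_insert, Finset.mem_singleton] at he
    rcases he with rfl | rfl | rfl | rfl <;> simp
  rcases hneg with h | h
  · exact key c hc e h hce
  · have := key (c + e) hce (-e) h (by simpa using hc)
    rw [add_neg_cancel_right, neg_neg] at this
    rw [ne_comm, this, or_comm]

end IsGridRegion

/-! ### The boundary length of the cells and the perimeter -/

lemma StrictMono.between_of_mem_uIcc {Z : ℤ → ℝ} (hZ : StrictMono Z) {j j' k : ℤ} {y : ℝ}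
    (h1 : Z k < y) (h2 : y < Z (k + 1)) (h : y ∈ Set.uIcc (Z j) (Z j')) :
    j ≤ k ∧ k < j' ∨ j' ≤ k ∧ k < j := by
  have b1 := hZ.lt_iff_of_between (k := j) h1 h2
  have b2 := hZ.lt_iff_of_between (k := j') h1 h2
  rw [Set.mem_uIcc, ← not_lt, ← not_lt, ← not_lt, ← not_lt, b1.1, b1.2, b2.1, b2.2] at h
  omega

lemma sum_steps_le {α : Type*} {Z : ℤ → ℝ} (hZ : StrictMono Z) (U : Finset α) (f : α → ℤ)
    (g : α → ℝ) {j j' : ℤ} (hf : Set.InjOn f U)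
    (hU : ∀ x ∈ U, j ≤ f x ∧ f x < j' ∨ j' ≤ f x ∧ f x < j)
    (hg : ∀ x ∈ U, g x = Z (f x + 1) - Z (f x)) : ∑ x ∈ U, g x ≤ |Z j - Z j'| := by
  rw [abs_sub_eq_sum hZ, ← Finset.sum_union (by
    rw [Finset.disjoint_left]; simp only [Finset.mem_Ico]; omega), Finset.sum_congr rfl hg,
    ← Finset.sum_image (f := fun r => Z (r + 1) - Z r) hf]
  refine Finset.sum_le_sum_of_subset_of_nonneg ?_ fun r _ _ => sub_nonneg.2 (hZ (lt_add_one r)).le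
  intro r hr
  obtain ⟨x, hx, rfl⟩ := Finset.mem_image.1 hr
  simpa [or_comm] using hU x hx

/-- Each element is charged to the first member of the list that covers it. -/
lemma sum_le_sum_cover {α β : Type*} (U : Finset α) (g : α → ℝ) (hg : ∀ x ∈ U, 0 ≤ g x)
    (w : β → ℝ) (A : β → α → Prop) : ∀ L : List β, (∀ x ∈ U, ∃ b ∈ L, A b x) →
      (∀ b ∈ L, ∀ V ⊆ U, (∀ x ∈ V, A b x) → ∑ x ∈ V, g x ≤ w b) →
      ∑ x ∈ U, g x ≤ (L.map w).sum := by
  classical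
  intro L
  induction L generalizing U with
  | nil =>
    intro h _
    rw [Finset.eq_empty_of_forall_notMem (s := U) fun x hx => by simpa using h x hx]
    simp
  | cons b L ih =>
    intro h hw
    rw [List.map_cons, List.sum_cons, ← Finset.sum_filter_add_sum_filter_not U (A b)]
    refine add_le_add (hw b (by simp) _ (Finset.filter_subset _ _) fun x hx =>
      (Finset.mem_filter.1 hx).2) ?_
    refine ih (U.filter fun x => ¬ A b x) (fun x hx => hg x (Finset.mem_filter.1 hx).1) ?_ ?_
    · intro x hx
      obtain ⟨hx, hxb⟩ := Finset.mem_filter.1 hx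
      obtain ⟨b', hb', hA⟩ := h x hx
      rcases List.mem_cons.1 hb' with rfl | hb'
      · exact absurd hA hxb
      · exact ⟨b', hb', hA⟩
    · intro b' hb' V hV hA
      exact hw b' (List.mem_cons_of_mem _ hb') V (hV.trans (Finset.filter_subset _ _)) hA

namespace IsGridRegion

variable {X Y : ℤ → ℝ} {R : Set Plane} {E : List (Plane × Plane)}

/-- The boundary edge `e'` covers the side of the cell `x.1` in direction `x.2`. -/
def Covers (X Y : ℤ → ℝ) (e' : Plane × Plane) (x : Cell × Cell) : Prop :=
  (x.2.1 ≠ 0 ∧ ∃ i j j', e' = (pt (X i) (Y j), pt (X i) (Y j')) ∧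
      i = (if x.2.1 = 1 then x.1.1 + 1 else x.1.1) ∧
      (j ≤ x.1.2 ∧ x.1.2 < j' ∨ j' ≤ x.1.2 ∧ x.1.2 < j)) ∨
    (x.2.1 = 0 ∧ ∃ i i' j, e' = (pt (X i) (Y j), pt (X i') (Y j)) ∧
      j = (if x.2.2 = 1 then x.1.2 + 1 else x.1.2) ∧
      (i ≤ x.1.1 ∧ x.1.1 < i' ∨ i' ≤ x.1.1 ∧ x.1.1 < i))

/-- The midpoint of the common side belongs to a closed cell in the region and to one outside, so it
is on a boundary edge. As the midpoint is strictly between two grid lines, this edge runs along the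
side and contains all of it. -/
lemma exists_covers (G : IsGridRegion X Y R E) {c e : Cell} (he : e ∈ dirs)
    (hc : ctr X Y c ∈ R) (hce : ctr X Y (c + e) ∉ R) : ∃ e' ∈ E, Covers X Y e' (c, e) := by
  have hX := G.strictMono_fst
  have hY := G.strictMono_snd
  have l1 := hX (lt_add_one c.1)
  have l2 := hY (lt_add_one c.2)
  set x := (X c.1 + X (c.1 + 1)) / 2 with hx
  set y := (Y c.2 + Y (c.2 + 1)) / 2 with hy
  have x1 : X c.1 < x := by rw [hx]; linarith
  have x2 : x < X (c.1 + 1) := by rw [hx]; linarith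
  have y1 : Y c.2 < y := by rw [hy]; linarith
  have y2 : y < Y (c.2 + 1) := by rw [hy]; linarith
  have bx := fun k => hX.lt_iff_of_between (k := k) x1 x2
  have by' := fun k => hY.lt_iff_of_between (k := k) y1 y2
  have vert : ∀ i, i = (if e.1 = 1 then c.1 + 1 else c.1) → e.1 ≠ 0 →
      pt (X i) y ∈ trace E → ∃ e' ∈ E, Covers X Y e' (c, e) := by
    rintro i hi he0 ⟨e', he', hm⟩
    refine ⟨e', he', Or.inl ⟨he0, ?_⟩⟩
    rcases G.edge e' he' with ⟨i', j, j', rfl⟩ | ⟨i', i'', j, rfl⟩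
    · obtain ⟨m0, m1⟩ := mem_segment_vertical.1 hm
      rw [pt_zero] at m0
      obtain rfl := hX.injective m0
      exact ⟨_, j, j', rfl, hi, hY.between_of_mem_uIcc y1 y2 (by simpa using m1)⟩
    · have := (mem_segment_horizontal.1 hm).1
      rw [pt_one] at this
      have b1 := by' j
      rw [this] at b1
      simp only [lt_self_iff_false, false_iff] at b1
      omega
  have hor : ∀ j, j = (if e.2 = 1 then c.2 + 1 else c.2) → e.1 = 0 →
      pt x (Y j) ∈ trace E → ∃ e' ∈ E, Covers X Y e' (c, e) := by
    rintro j hj he0 ⟨e', he', hm⟩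
    refine ⟨e', he', Or.inr ⟨he0, ?_⟩⟩
    rcases G.edge e' he' with ⟨i, j', j'', rfl⟩ | ⟨i, i', j', rfl⟩
    · have := (mem_segment_vertical.1 hm).1
      rw [pt_zero] at this
      have b1 := bx i
      rw [this] at b1
      simp only [lt_self_iff_false, false_iff] at b1
      omega
    · obtain ⟨m0, m1⟩ := mem_segment_horizontal.1 hm
      rw [pt_one] at m0
      obtain rfl := hY.injective m0
      exact ⟨i, i', _, rfl, hj, hX.between_of_mem_uIcc x1 x2 (by simpa using m1)⟩
  simp only [dirs, Finset.mem_insert, Finset.mem_singleton] at he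
  rcases he with rfl | rfl | rfl | rfl
  · refine vert (c.1 + 1) (by simp) (by simp) (G.mem_trace_of_closedCell ?_ ?_ hc hce) <;>
      simp [closedCell, l1.le, y1.le, y2.le, (hX (lt_add_one (c.1 + 1))).le]
  · refine vert c.1 (by simp) (by simp) (G.mem_trace_of_closedCell ?_ ?_ hc hce) <;>
      simp [closedCell, l1.le, y1.le, y2.le, hX.le_iff_le]
  · refine hor (c.2 + 1) (by simp) (by simp) (G.mem_trace_of_closedCell ?_ ?_ hc hce) <;>
      simp [closedCell, l2.le, x1.le, x2.le, (hY (lt_add_one (c.2 + 1))).le]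
  · refine hor c.2 (by simp) (by simp) (G.mem_trace_of_closedCell ?_ ?_ hc hce) <;>
      simp [closedCell, l2.le, x1.le, x2.le, hY.le_iff_le]

/-- Each exposed side is charged to a boundary edge that covers it. The sides charged to one edge
are different grid intervals of that edge: one interval cannot be exposed from both sides, since
either cell would then be both in `S` and outside. -/
lemma out_le_weight (G : IsGridRegion X Y R E) {S : Finset Cell}
    (hS : ∀ c, c ∈ S ↔ ctr X Y c ∈ R) : out (gridLength X Y) S S ≤ weight E := by
  have hX := G.strictMono_fst
  have hY := G.strictMono_snd
  unfold out weight
  refine sum_le_sum_cover _ _ (fun x _ => (isLength_grid hX hY).nonneg _ _) _ (Covers X Y) _ ?_ ?_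
  · rintro ⟨c, e⟩ hx
    simp only [Finset.mem_filter, Finset.mem_product, hS] at hx
    exact G.exists_covers hx.1.2 hx.1.1 hx.2
  · intro e' he' V hV hA
    have hV' : ∀ x ∈ V, x.1 ∈ S ∧ x.2 ∈ dirs ∧ x.1 + x.2 ∉ S := by
      intro x hx
      have := hV hx
      simp only [Finset.mem_filter, Finset.mem_product] at this
      exact ⟨this.1.1, this.1.2, this.2⟩
    have hinj : ∀ x ∈ V, ∀ x' ∈ V, x' = x ∨ x'.1 ≠ x.1 + x.2 := by
      intro x hx x' hx'
      right
      intro h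
      exact (hV' x hx).2.2 (h ▸ (hV' x' hx').1)
    rcases G.edge e' he' with ⟨i, j, j', rfl⟩ | ⟨i, i', j, rfl⟩
    · have hV2 : ∀ x ∈ V, x.2.1 ≠ 0 ∧ i = (if x.2.1 = 1 then x.1.1 + 1 else x.1.1) ∧
          (j ≤ x.1.2 ∧ x.1.2 < j' ∨ j' ≤ x.1.2 ∧ x.1.2 < j) := by
        intro x hx
        rcases hA x hx with ⟨h0, a, b, b', he, h1, h2⟩ | ⟨h0, a, a', b, he, h1, h2⟩
        · simp only [Prod.mk.injEq] at he
          have q1 := hX.injective (by simpa using congrArg (· 0) he.1)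
          have q2 := hY.injective (by simpa using congrArg (· 1) he.1)
          have q3 := hY.injective (by simpa using congrArg (· 1) he.2)
          subst q1 q2 q3
          exact ⟨h0, h1, h2⟩
        · exfalso
          simp only [Prod.mk.injEq] at he
          have q1 := hX.injective (by simpa using congrArg (· 0) he.1)
          have q2 := hX.injective (by simpa using congrArg (· 0) he.2)
          omega
      refine (sum_steps_le hY V (fun x => x.1.2) _ (j := j) (j' := j') ?_
        (fun x hx => (hV2 x hx).2.2) fun x hx => ?_).trans_eq ?_
      · rintro ⟨⟨a, b⟩, e⟩ hx ⟨⟨a', b'⟩, e'⟩ hx' hxx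
        obtain ⟨h1, h2, -⟩ := hV2 _ hx
        obtain ⟨h1', h2', -⟩ := hV2 _ hx'
        have d1 := (hV' _ hx).2.1
        have d2 := (hV' _ hx').2.1
        have q := hinj _ hx _ hx'
        simp only [dirs, Finset.mem_insert, Finset.mem_singleton] at d1 d2 hxx h1 h1' h2 h2'
        subst hxx
        rcases d1 with rfl | rfl | rfl | rfl <;> rcases d2 with rfl | rfl | rfl | rfl <;>
          simp at h1 h1' h2 h2' q ⊢ <;> omega
      · have := (hV2 x hx).1
        simp [gridLength, this]
      · simp [EuclideanSpace.dist_eq, Fin.sum_univ_two, Real.dist_eq, Real.sqrt_sq_eq_abs]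
    · have hV2 : ∀ x ∈ V, x.2.1 = 0 ∧ j = (if x.2.2 = 1 then x.1.2 + 1 else x.1.2) ∧
          (i ≤ x.1.1 ∧ x.1.1 < i' ∨ i' ≤ x.1.1 ∧ x.1.1 < i) := by
        intro x hx
        rcases hA x hx with ⟨h0, a, b, b', he, h1, h2⟩ | ⟨h0, a, a', b, he, h1, h2⟩
        · exfalso
          simp only [Prod.mk.injEq] at he
          have q1 := hY.injective (by simpa using congrArg (· 1) he.1)
          have q2 := hY.injective (by simpa using congrArg (· 1) he.2)
          omega
        · simp only [Prod.mk.injEq] at he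
          have q1 := hX.injective (by simpa using congrArg (· 0) he.1)
          have q2 := hX.injective (by simpa using congrArg (· 0) he.2)
          have q3 := hY.injective (by simpa using congrArg (· 1) he.1)
          subst q1 q2 q3
          exact ⟨h0, h1, h2⟩
      refine (sum_steps_le hX V (fun x => x.1.1) _ (j := i) (j' := i') ?_
        (fun x hx => (hV2 x hx).2.2) fun x hx => ?_).trans_eq ?_
      · rintro ⟨⟨a, b⟩, e⟩ hx ⟨⟨a', b'⟩, e'⟩ hx' hxx
        obtain ⟨h1, h2, -⟩ := hV2 _ hx
        obtain ⟨h1', h2', -⟩ := hV2 _ hx'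
        have d1 := (hV' _ hx).2.1
        have d2 := (hV' _ hx').2.1
        have q := hinj _ hx _ hx'
        simp only [dirs, Finset.mem_insert, Finset.mem_singleton] at d1 d2 hxx h1 h1' h2 h2'
        subst hxx
        rcases d1 with rfl | rfl | rfl | rfl <;> rcases d2 with rfl | rfl | rfl | rfl <;>
          simp at h1 h1' h2 h2' q ⊢ <;> omega
      · have := (hV2 x hx).1
        simp [gridLength, this]
      · simp [EuclideanSpace.dist_eq, Fin.sum_univ_two, Real.dist_eq, Real.sqrt_sq_eq_abs]

/-- The cells in a bounded region. -/
lemma exists_cells (G : IsGridRegion X Y R E) (hR : Bornology.IsBounded R) :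
    ∃ S : Finset Cell, ∀ c, c ∈ S ↔ ctr X Y c ∈ R := by
  obtain ⟨M, hM⟩ := hR.exists_norm_le
  have hM' : ∀ p ∈ R, ∀ k, -M ≤ p k ∧ p k ≤ M := fun p hp k =>
    abs_le.1 ((PiLp.norm_apply_le p k).trans (hM p hp))
  obtain ⟨i, i1, -⟩ := G.cover_fst (-M)
  obtain ⟨i', -, i2⟩ := G.cover_fst M
  obtain ⟨j, j1, -⟩ := G.cover_snd (-M)
  obtain ⟨j', -, j2⟩ := G.cover_snd M
  have hfin : {c : Cell | ctr X Y c ∈ R}.Finite := by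
    refine (Finset.Icc i i' ×ˢ Finset.Icc j j').finite_toSet.subset fun c hc => ?_
    have h := G.ctr_mem c
    obtain ⟨⟨h1, h2⟩, h3, h4⟩ := h
    have m0 := hM' _ hc 0
    have m1 := hM' _ hc 1
    have a1 := G.strictMono_fst.lt_iff_lt.1 ((i1.trans m0.1).trans_lt h2)
    have a2 := G.strictMono_fst.lt_iff_lt.1 ((h1.trans_le m0.2).trans i2)
    have a3 := G.strictMono_snd.lt_iff_lt.1 ((j1.trans m1.1).trans_lt h4)
    have a4 := G.strictMono_snd.lt_iff_lt.1 ((h3.trans_le m1.2).trans j2)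
    simp only [Finset.coe_product, Finset.coe_Icc, Set.mem_prod, Set.mem_Icc]
    omega
  exact ⟨hfin.toFinset, fun c => by simp⟩

lemma ae_exists_cell (G : IsGridRegion X Y R E) : ∀ᵐ p : Plane, ∃ c, (ctr X Y c ∈ R ↔ p ∈ R) ∧
    ∀ h : Finset Cell, ∑ c' ∈ h, cellCount X Y c' p = if c ∈ h then 1 else 0 := by
  filter_upwards [ae_off_grid X Y] with p hp
  obtain ⟨c, hc⟩ := G.exists_cellBox hp
  have h1 : ∀ c', cellCount X Y c' p = if c' = c then 1 else 0 := by
    intro c'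
    unfold cellCount
    refine if_congr ⟨fun h => ?_, ?_⟩ rfl rfl
    · refine G.eq_of_cellBox (p := p) ⟨⟨?_, h.1.2⟩, ?_, h.2.2⟩ hc
      · exact lt_of_le_of_ne h.1.1 (hp.1 _).symm
      · exact lt_of_le_of_ne h.2.1 (hp.2 _).symm
    · rintro rfl
      exact ⟨⟨hc.1.1.le, hc.1.2⟩, hc.2.1.le, hc.2.2⟩
  exact ⟨c, (G.mem_iff_ctr hc).symm, fun h => by simp [h1]⟩

end IsGridRegion

/-! ### The subdivision of a rectilinear polygon -/

lemma exists_gridRegion {P : SimplePolygon} (hP : P.IsRectilinear) :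
    ∃ X Y : ℤ → ℝ, IsGridRegion X Y P.region (cyclicEdges P.vertices) := by
  obtain ⟨X, hX, cX, mX⟩ := exists_grid (P.vertices.map fun p => p 0).toFinset
  obtain ⟨Y, hY, cY, mY⟩ := exists_grid (P.vertices.map fun p => p 1).toFinset
  refine ⟨X, Y, hX, hY, cX, cY, P.isCompact_region.isClosed, P.frontier_region, ?_⟩
  have hv : ∀ v ∈ P.vertices, ∃ i j, v = pt (X i) (Y j) := by
    intro v hv
    obtain ⟨i, hi⟩ := mX (v 0) (List.mem_toFinset.2 (List.mem_map.2 ⟨v, hv, rfl⟩))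
    obtain ⟨j, hj⟩ := mY (v 1) (List.mem_toFinset.2 (List.mem_map.2 ⟨v, hv, rfl⟩))
    exact ⟨i, j, by rw [← hi, ← hj, pt_eta]⟩
  rintro ⟨u, v⟩ he
  have hm := List.of_mem_zip he
  rw [List.mem_rotate] at hm
  obtain ⟨i, j, rfl⟩ := hv u hm.1
  obtain ⟨i', j', rfl⟩ := hv v hm.2
  rcases hP _ he with h | h
  · left
    have : X i = X i' := by simpa using h
    exact ⟨i, j, j', by rw [this]⟩
  · right
    have : Y j = Y j' := by simpa using h
    exact ⟨i, i', j, by rw [this]⟩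

lemma exists_tiles_hists {X Y : ℤ → ℝ} {s : ℝ} (hs : 8 ≤ s) (hX : StrictMono X)
    (hY : StrictMono Y) (L : List (Finset Cell)) (hL : ∀ h ∈ L, IsHist h) :
    ∃ F : List SimplePolygon, (∀ Q ∈ F, IsTile s Q) ∧
      (∀ᵐ p : Plane, cnt F p = (L.map fun h => ∑ c ∈ h, cellCount X Y c p).sum) ∧
      sumHper F ≤ 8 * (L.map fun h => out (gridLength X Y) h h).sum ∧
      sumPer F ≤ 8 * s * (L.map fun h => out (gridLength X Y) h h).sum := by
  induction L with
  | nil => exact ⟨[], by simp⟩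
  | cons h L ih =>
    obtain ⟨F, f1, f2, f3, f4⟩ := (hL h (by simp)).exists_tiles hs hX hY
    obtain ⟨F', g1, g2, g3, g4⟩ := ih fun h' hh' => hL h' (List.mem_cons_of_mem _ hh')
    refine ⟨F ++ F', ?_, ?_, ?_, ?_⟩
    · intro Q hQ
      exact (List.mem_append.1 hQ).elim (f1 Q) (g1 Q)
    · filter_upwards [f2, g2] with p hp hp'
      rw [cnt_append, hp, hp', List.map_cons, List.sum_cons]
    · rw [sumHper_append, List.map_cons, List.sum_cons]; linarith
    · rw [sumPer_append, List.map_cons, List.sum_cons, mul_add]; linarith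

lemma one_le_cnt_iff {F : List SimplePolygon} {p : Plane} :
    1 ≤ cnt F p ↔ ∃ Q ∈ F, p ∈ Q.region := by
  induction F with
  | nil => simp
  | cons Q F ih =>
    have h0 := cnt_nonneg F p
    rw [cnt_cons]
    by_cases h : p ∈ Q.region
    · simp [h, h0]
    · simp [h, ih]

/-- Overlapping interiors would meet in a nonempty open set on which the count is at least 2, and a
set of full measure is dense. -/
lemma pairwise_disjoint_of_cnt {F : List SimplePolygon} (h : ∀ᵐ p : Plane, cnt F p ≤ 1) :
    F.Pairwise fun Q Q' => Disjoint (interior Q.region) (interior Q'.region) := by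
  induction F with
  | nil => exact List.Pairwise.nil
  | cons Q F ih =>
    rw [List.pairwise_cons]
    refine ⟨fun Q' hQ' => ?_, ih ?_⟩
    · rw [Set.disjoint_iff_inter_eq_empty]
      by_contra hne
      obtain ⟨p, hp, hc⟩ := (Measure.dense_of_ae h).inter_open_nonempty _
        (isOpen_interior.inter isOpen_interior) (Set.nonempty_iff_ne_empty.2 hne)
      have h1 : 1 ≤ cnt F p := one_le_cnt_iff.2 ⟨Q', hQ', interior_subset hp.2⟩
      rw [Set.mem_setOf_eq, cnt_cons, Set.indicator_of_mem (interior_subset hp.1)] at hc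
      omega
    · filter_upwards [h] with p hp
      rw [cnt_cons] at hp
      have : 0 ≤ Q.region.indicator (fun _ => (1 : ℤ)) p :=
        Set.indicator_nonneg (fun _ _ => zero_le_one) p
      linarith

/-- Every region is the closure of its interior, and sets of full measure are dense; so an inclusion
of a region in a closed set need be checked only at points with the correct count. -/
lemma isSubdivision_of_cnt {P : SimplePolygon} {F : List SimplePolygon}
    (h : ∀ᵐ p : Plane, cnt F p = P.region.indicator (fun _ => 1) p) : P.IsSubdivision F := by
  have hd := Measure.dense_of_ae h
  have key : ∀ (Q : SimplePolygon) (K : Set Plane), IsClosed K →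
      (∀ p ∈ Q.region, cnt F p = P.region.indicator (fun _ => 1) p → p ∈ K) → Q.region ⊆ K := by
    intro Q K hK hQ
    rw [← Q.closure_interior_region]
    refine closure_minimal ((hd.open_subset_closure_inter isOpen_interior).trans
      (closure_minimal ?_ hK)) hK
    rintro p ⟨hp, hpc⟩
    exact hQ p (interior_subset hp) hpc
  refine ⟨subset_antisymm ?_ ?_, pairwise_disjoint_of_cnt ?_⟩
  · refine Set.iUnion₂_subset fun Q hQ => key Q _ P.isCompact_region.isClosed fun p hp hc => ?_
    by_contra hcon
    have := one_le_cnt_iff.2 ⟨Q, hQ, hp⟩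
    rw [hc, Set.indicator_of_notMem hcon] at this
    omega
  · refine key P _ ?_ fun p hp hc => ?_
    · exact (List.finite_toSet F).isClosed_biUnion fun Q _ => Q.isCompact_region.isClosed
    · rw [Set.indicator_of_mem hp] at hc
      simpa using one_le_cnt_iff.1 hc.ge
  · filter_upwards [h] with p hp
    rw [hp]
    by_cases hpP : p ∈ P.region <;> simp [hpP]

/-- A rectilinear polygon has a subdivision into tiles of controlled total perimeters. -/
theorem exists_subdivision {s : ℝ} (hs : 8 ≤ s) {P : SimplePolygon} (hP : P.IsRectilinear) :
    ∃ F : List SimplePolygon, P.IsSubdivision F ∧ (∀ Q ∈ F, IsTile s Q) ∧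
      sumHper F ≤ 24 * P.per ∧ sumPer F ≤ 24 * s * P.per := by
  obtain ⟨X, Y, G⟩ := exists_gridRegion hP
  obtain ⟨S, hS⟩ := G.exists_cells P.isCompact_region.isBounded
  have hsep := G.separated hS fun u hu w hw => reflTransGen_trace hP hu hw
  obtain ⟨L, hL, hcount, hout⟩ :=
    exists_histDecomp hsep (isLength_grid G.strictMono_fst G.strictMono_snd)
  obtain ⟨F, hF, hFc, hFh, hFp⟩ := exists_tiles_hists hs G.strictMono_fst G.strictMono_snd L hL
  have hper : out (gridLength X Y) S S ≤ P.per := G.out_le_weight hS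
  refine ⟨F, isSubdivision_of_cnt ?_, hF, by linarith, ?_⟩
  · filter_upwards [hFc, G.ae_exists_cell] with p hp ⟨c, hc, hsum⟩
    rw [hp]
    simp only [hsum]
    rw [hcount]
    by_cases h : p ∈ P.region <;> simp [hS, hc, h]
  · calc sumPer F ≤ 8 * s * (3 * P.per) :=
        hFp.trans (mul_le_mul_of_nonneg_left (by linarith) (by linarith))
      _ = _ := by ring

/-- Every simple rectilinear polygon can be subdivided into fuzzy staircases and tame histograms
of total perimeter `O(ε^(-1/2) per(P))` and total horizontal perimeter `O(per(P))`, where the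
constants depend only on the fixed constant `Λ ≥ 8` in the slope `Λ ε^(-1/2)`. -/
theorem mainTheorem3 (Λ : ℝ) (hΛ : 8 ≤ Λ) :
    ∃ C : ℝ, ∀ ε : ℝ, 0 < ε → ε < 1 →
      ∀ P : SimplePolygon, P.IsRectilinear →
        ∃ F : List SimplePolygon,
          P.IsSubdivision F ∧
          (∀ Q ∈ F, IsFuzzyStaircase (Λ * ε ^ (-(1 / 2) : ℝ)) Q ∨
            IsTameHistogram (Λ * ε ^ (-(1 / 2) : ℝ)) Q) ∧
          (F.map SimplePolygon.per).sum ≤ C * ε ^ (-(1 / 2) : ℝ) * P.per ∧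
          (F.map SimplePolygon.hper).sum ≤ C * P.per := by
  -- The factor 24 is 3 for the cut into histograms times 8 for tiling them. The perimeter carries
  -- the slope `Λ * ε ^ (-1/2)` as a further factor, and `Λ` is absorbed into the constant; for the
  -- horizontal perimeter 24 alone would do.
  refine ⟨24 * Λ, fun ε h0 h1 P hP => ?_⟩
  have hε : 1 ≤ ε ^ (-(1 / 2) : ℝ) :=
    Real.one_le_rpow_of_pos_of_le_one_of_nonpos h0 h1.le (by norm_num)
  have hs : 8 ≤ Λ * ε ^ (-(1 / 2) : ℝ) := by nlinarith
  obtain ⟨F, hsub, htile, hh, hp⟩ := exists_subdivision hs hP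
  have hper : 0 ≤ P.per := List.sum_nonneg fun x hx => by
    obtain ⟨e, -, rfl⟩ := List.mem_map.1 hx
    exact dist_nonneg
  refine ⟨F, hsub, htile, hp.trans_eq (by ring), hh.trans ?_⟩
  exact mul_le_mul_of_nonneg_right (by linarith) hper
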